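/- Let $n\ge 3$. All maps are holomorphic, $\mathbb C^m$ carries the bilinear product $x^Ty$, and $|x|^2=x^Tx$. Let $U\subset\mathbb C^n$ be open with coordinates $u=(u^1,\dots,u^n)$, and let $x_0:U\to\mathbb C^{n+1}$ parametrize a piece of a quadric (non-degenerate, i.e. projectively equivalent to the complex unit sphere), with non-degenerate linear element $|dx_0|^2=\sum g_{jk}\,du^jdu^k$, $\det(g_{jk})\ne0$, whose Christoffel symbols are $\Gamma^l_{jk}$, and such that $(u^j)$ is a conjugate system on $x_0$, i.e. its second fundamental form has no mixed terms. A \emph{deformation} of $x_0$ means here a map $x:U\to\mathbb C^{2n-1}$ with $|dx|^2=|dx_0|^2$ on which $(u^j)$ is again a conjugate system and such that the joined second fundamental forms are non-degenerate: if $N_0$ is a unit normal field of $x_0$, $h^0_j=N_0^T\partial_{u^j}^2x_0$, and $h_j^\alpha=N_\alpha^T\partial_{u^j}^2x$ for an orthonormal normal frame $(N_\alpha)_{n+1\le\alpha\le 2n-1}$ of $x$, then the vectors $h_j=[\,ih_j^0\ h_j^{n+1}\ \dots\ h_j^{2n-1}]^T\in\mathbb C^n$, $j=1,\dots,n$, are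 linearly independent at each point. (1) If $x_0$ has a deformation, then $\Gamma^l_{jk}=0$ for distinct $j,k,l$. (2) Let $U$ be convex. Then the deformations of $x_0$ on $U$, up to rigid motions $x\mapsto Ax+b$ ($A^TA=I$) of $\mathbb C^{2n-1}$, are in bijective correspondence with the solutions $\mathbf a_j:U\to\mathbb C^*$, $j=1,\dots,n$, up to the signs of the $\mathbf a_j$, of $$\partial_{u^k}\log\mathbf a_j=\Gamma^j_{jk}\quad(j\ne k),\qquad \sum_{j=1}^n\frac{(h_j^0)^2}{\mathbf a_j^2}+1=0 ;$$ the correspondence is given by $\mathbf a_j^2=|h_j|^2=-(h_j^0)^2+\sum_\alpha(h_j^\alpha)^2$. (3) Let $a_0,\dots,a_n\in\mathbb C^*$ be distinct, $\mathbf C_k=\prod_{j=k+1}^n\cos u^j$, and let $x_0=\mathcal X=\sqrt{a_0}\,\mathbf C_0e_0+\sum_{k=1}^n\sqrt{a_k}\,\mathbf C_k\sin(u^k)e_k$ be the quadric $\sum_{j=0}^n x_j^2/a_j=1$ in spherical coordinates, on a non-empty convex open set $U$ where its linear element is non-degenerate. For $\mathbf z=(z_1,\dots,z_{n-1})\in(\mathbb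 C^*)^{n-1}$ and $z_0=1$ let $$\mathcal X_{\mathbf z}=\sum_{k=1}^{n-1}\mathbf C_kf_k(u^k)\big(\cos g_k(u^k)\,e_{2k-2}+\sin g_k(u^k)\,e_{2k-1}\big)+h(u^n)e_{2n-2},$$ $$f_k^2=F_k:=(z_{k-1}-z_k)a_0+(a_k-z_{k-1}a_0)\sin^2u^k,\qquad (h')^2=a_n-(a_n-z_{n-1}a_0)\sin^2u^n,$$ $$(F_kg_k')^2=(z_{k-1}-z_k)a_0a_k+(a_k-z_{k-1}a_0)z_ka_0\sin^2u^k,$$ wherever holomorphic $f_k,g_k,h$ with $f_k$, $g_k'$, $h'$ without zeros exist. Then $(\mathcal X_{\mathbf z})$ is a maximal family of deformations, depending on $n-1$ parameters: (a) where it is defined on all of $U$, $\mathcal X_{\mathbf z}$ is a deformation of $\mathcal X$ on $U$; two such deformations $\mathcal X_{\mathbf z}$, $\mathcal X_{\mathbf z'}$ (with any choices of $f_k,g_k,h$) differ by a rigid motion if and only if $\mathbf z=\mathbf z'$; and for each $u\in U$ and each non-empty open $O\subset\mathbb C^{n-1}$ there are a convex neighbourhood $V\subset U$ of $u$ and a non-empty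 open $Z\subset O\cap(\mathbb C^*)^{n-1}$ such that $\mathcal X_{\mathbf z}$ exists on $V$ for all $\mathbf z\in Z$; (b) if $(Y_w)$, with $w$ in a non-empty open subset $W$ of $\mathbb C^m$, is a family of deformations of $\mathcal X$ on $U$, holomorphic in $(w,u)$, no two of which differ by a rigid motion, then $m\le n-1$; and if $m=n-1$, then for a dense set of $w\in W$ the deformation $Y_w$ is, on some non-empty open subset of $U$ and up to a rigid motion, one of the $\mathcal X_{\mathbf z}$; (c) if $(Y_w)_{w\in W}$ is any holomorphic family of deformations of $\mathcal X$ on $U$ such that $Y_{w_0}$ is, up to a rigid motion, one of the $\mathcal X_{\mathbf z}$, then each $u\in U$ has a neighbourhood on which, for all $w$ close to $w_0$, $Y_w$ is, up to a rigid motion, one of the $\mathcal X_{\mathbf z}$. -/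

import Mathlib

open scoped ContDiff Matrix

namespace QuadricDeformation

noncomputable section

/-! ### Local differential geometry in complex Euclidean space

The coordinates `u = (u^1, …, u^n)` are points of `Fin n → ℂ`, and `ℂ^m` carries the complex
bilinear product `x ⬝ᵥ y = xᵀ y`.  "Holomorphic on the open set `U`" is rendered by
`ContDiffOn ℂ ∞ · U`; between finite dimensional complex spaces this is the same as
complex differentiability on `U`. -/

/-- The partial derivative `∂_{u^j} f`. -/
def pd {n : ℕ} {E : Type} [NormedAddCommGroup E] [NormedSpace ℂ E] (j : Fin n)
    (f : (Fin n → ℂ) → E) : (Fin n → ℂ) → E :=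
  fun u => fderiv ℂ f u (Pi.single j 1)

/-- The coefficients `g_{jk} = (∂_j x)ᵀ (∂_k x)` of the linear element `|dx|²`. -/
def metric {n m : ℕ} (x : (Fin n → ℂ) → (Fin m → ℂ)) (u : Fin n → ℂ) :
    Matrix (Fin n) (Fin n) ℂ :=
  Matrix.of fun j k => pd j x u ⬝ᵥ pd k x u

/-- The Christoffel symbol `Γ_{jk}^l` of the linear element of `x`. -/
def christoffel {n m : ℕ} (x : (Fin n → ℂ) → (Fin m → ℂ)) (l j k : Fin n)
    (u : Fin n → ℂ) : ℂ :=
  ∑ p, ((metric x u)⁻¹ l p / 2) *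
    (pd k (fun v => metric x v j p) u + pd j (fun v => metric x v k p) u
      - pd p (fun v => metric x v j k) u)

/-- The vector valued second fundamental form: the component
`∂_k ∂_j x - Γ_{jk}^l ∂_l x = h_{jk}^α N_α` of `∂_k ∂_j x` normal to `x`. -/
def secondForm {n m : ℕ} (x : (Fin n → ℂ) → (Fin m → ℂ)) (j k : Fin n)
    (u : Fin n → ℂ) : Fin m → ℂ :=
  pd k (pd j x) u - ∑ l, christoffel x l j k u • pd l x u

/-- The tangent spaces of `x` are `n`-dimensional and not isotropic. -/
def IsRegular {n m : ℕ} (x : (Fin n → ℂ) → (Fin m → ℂ)) (U : Set (Fin n → ℂ)) : Prop :=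
  ∀ u ∈ U, (metric x u).det ≠ 0

/-- `(u^1, …, u^n)` is a conjugate system on `x`: the second fundamental form has no mixed
terms. -/
def IsConjugate {n m : ℕ} (x : (Fin n → ℂ) → (Fin m → ℂ)) (U : Set (Fin n → ℂ)) : Prop :=
  ∀ u ∈ U, ∀ j k, j ≠ k → secondForm x j k u = 0

/-- `x₀` takes its values in a non-degenerate quadric of `ℂ^{n+1}` (one which is projectively
equivalent to the complex unit sphere): in homogeneous coordinates `(1, x₀)` the quadric is
given by an invertible symmetric matrix. -/
def LiesOnQuadric {n : ℕ} (x₀ : (Fin n → ℂ) → (Fin (n + 1) → ℂ)) (U : Set (Fin n → ℂ)) :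
    Prop :=
  ∃ M : Matrix (Fin (n + 1 + 1)) (Fin (n + 1 + 1)) ℂ, M.IsSymm ∧ M.det ≠ 0 ∧
    ∀ u ∈ U, Matrix.vecCons 1 (x₀ u) ⬝ᵥ (M *ᵥ Matrix.vecCons 1 (x₀ u)) = 0

/-- `x₀` is a (piece of a) quadric in `ℂ^{n+1}`, parametrized by a conjugate system. -/
structure IsConjugateQuadric {n : ℕ} (x₀ : (Fin n → ℂ) → (Fin (n + 1) → ℂ))
    (U : Set (Fin n → ℂ)) : Prop where
  holo : ContDiffOn ℂ ∞ x₀ U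
  regular : IsRegular x₀ U
  quadric : LiesOnQuadric x₀ U
  conjugate : IsConjugate x₀ U

/-- `N₀` is a holomorphic unit normal field of `x₀`. -/
structure IsUnitNormal {n : ℕ} (x₀ N₀ : (Fin n → ℂ) → (Fin (n + 1) → ℂ))
    (U : Set (Fin n → ℂ)) : Prop where
  holo : ContDiffOn ℂ ∞ N₀ U
  unit : ∀ u ∈ U, N₀ u ⬝ᵥ N₀ u = 1
  normal : ∀ u ∈ U, ∀ j, N₀ u ⬝ᵥ pd j x₀ u = 0

/-- The coefficient `h_j^0` of the second fundamental form `N₀ᵀ d²x₀ = ∑ h_j^0 (du^j)²`. -/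
def h₀ {n : ℕ} (x₀ N₀ : (Fin n → ℂ) → (Fin (n + 1) → ℂ)) (j : Fin n) (u : Fin n → ℂ) : ℂ :=
  N₀ u ⬝ᵥ pd j (pd j x₀) u

/-- The joined second fundamental forms of `x₀` and `x` (in a common conjugate system) are
non-degenerate: the `n` vectors `h_j`, made of the normal components of `∂_j² x₀` and of
`∂_j² x`, are linearly independent. -/
def JoinedNondegenerate {n m p : ℕ} (x₀ : (Fin n → ℂ) → (Fin m → ℂ))
    (x : (Fin n → ℂ) → (Fin p → ℂ)) (U : Set (Fin n → ℂ)) : Prop :=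
  ∀ u ∈ U, LinearIndependent ℂ fun j : Fin n => (secondForm x₀ j j u, secondForm x j j u)

/-- `x ⊂ ℂ^{2n-1}` is a deformation of `x₀ ⊂ ℂ^{n+1}`, that is `|dx|² = |dx₀|²`, for which `(u^j)`
is a conjugate system as well, with non-degenerate joined second fundamental forms. -/
structure IsDeformation {n : ℕ} (x₀ : (Fin n → ℂ) → (Fin (n + 1) → ℂ)) (U : Set (Fin n → ℂ))
    (x : (Fin n → ℂ) → (Fin (2 * n - 1) → ℂ)) : Prop where
  holo : ContDiffOn ℂ ∞ x U
  isometric : ∀ u ∈ U, metric x u = metric x₀ u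
  conjugate : IsConjugate x U
  nondegenerate : JoinedNondegenerate x₀ x U

/-- `x` and `x'` differ on `U` by a rigid motion of `ℂ^m`. -/
def Congruent {n m : ℕ} (U : Set (Fin n → ℂ)) (x x' : (Fin n → ℂ) → (Fin m → ℂ)) : Prop :=
  ∃ (A : Matrix (Fin m) (Fin m) ℂ) (b : Fin m → ℂ), Aᵀ * A = 1 ∧
    ∀ u ∈ U, x' u = A *ᵥ x u + b

/-- The square `|h_j|²` of the joined vector `h_j = [i h_j^0, h_j^{n+1}, …, h_j^{2n-1}]ᵀ`. -/
def joinedSq {n : ℕ} (x₀ N₀ : (Fin n → ℂ) → (Fin (n + 1) → ℂ))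
    (x : (Fin n → ℂ) → (Fin (2 * n - 1) → ℂ)) (j : Fin n) (u : Fin n → ℂ) : ℂ :=
  -(h₀ x₀ N₀ j u) ^ 2 + secondForm x j j u ⬝ᵥ secondForm x j j u

/-- `(𝐚_j)` is a solution, with values in `ℂ^*`, of the system
`∂_k log 𝐚_j = Γ_{jk}^j` (`j ≠ k`), `∑_j (h_j^0)² / 𝐚_j² + 1 = 0`. -/
structure IsSolution {n : ℕ} (x₀ N₀ : (Fin n → ℂ) → (Fin (n + 1) → ℂ)) (U : Set (Fin n → ℂ))
    (a : Fin n → (Fin n → ℂ) → ℂ) : Prop where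
  holo : ∀ j, ContDiffOn ℂ ∞ (a j) U
  ne_zero : ∀ j, ∀ u ∈ U, a j u ≠ 0
  log_deriv : ∀ u ∈ U, ∀ j k, j ≠ k → pd k (a j) u / a j u = christoffel x₀ j j k u
  sum_eq : ∀ u ∈ U, ∑ j, (h₀ x₀ N₀ j u) ^ 2 / (a j u) ^ 2 + 1 = 0

/-- Two solutions agree on `U` up to the choice of the signs of the `𝐚_j`. -/
def SameUpToSigns {n : ℕ} (U : Set (Fin n → ℂ)) (a a' : Fin n → (Fin n → ℂ) → ℂ) : Prop :=
  ∃ ε : Fin n → ℂ, (∀ j, ε j = 1 ∨ ε j = -1) ∧ ∀ j, ∀ u ∈ U, a' j u = ε j * a j u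

/-- Deformations on `U`, two of them being identified if they are congruent on `U`. -/
def deformationSetoid {n : ℕ} (x₀ : (Fin n → ℂ) → (Fin (n + 1) → ℂ)) (U : Set (Fin n → ℂ)) :
    Setoid {x : (Fin n → ℂ) → (Fin (2 * n - 1) → ℂ) // IsDeformation x₀ U x} where
  r x x' := Congruent U x.1 x'.1
  iseqv :=
    { refl := fun x => ⟨1, 0, by simp, by simp⟩
      symm := by
        rintro x y ⟨A, b, hA, h⟩
        refine ⟨Aᵀ, -(Aᵀ *ᵥ b), ?_, fun u hu => ?_⟩
        · rw [Matrix.transpose_transpose]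
          exact mul_eq_one_comm.mp hA
        · rw [h u hu, Matrix.mulVec_add, Matrix.mulVec_mulVec, hA, Matrix.one_mulVec]
          simp
      trans := by
        rintro x y z ⟨A, b, hA, h⟩ ⟨B, c, hB, h'⟩
        refine ⟨B * A, B *ᵥ b + c, ?_, fun u hu => ?_⟩
        · rw [Matrix.transpose_mul, Matrix.mul_assoc, ← Matrix.mul_assoc Bᵀ, hB,
            Matrix.one_mul, hA]
        · rw [h' u hu, h u hu, Matrix.mulVec_add, Matrix.mulVec_mulVec, add_assoc] }

/-- Solutions on `U`, two of them being identified if they differ only by signs. -/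
def solutionSetoid {n : ℕ} (x₀ N₀ : (Fin n → ℂ) → (Fin (n + 1) → ℂ)) (U : Set (Fin n → ℂ)) :
    Setoid {a : Fin n → (Fin n → ℂ) → ℂ // IsSolution x₀ N₀ U a} where
  r a a' := SameUpToSigns U a.1 a'.1
  iseqv :=
    { refl := fun a => ⟨1, by simp, by simp⟩
      symm := by
        rintro a b ⟨ε, hε, h⟩
        refine ⟨ε, hε, fun j u hu => ?_⟩
        rw [h j u hu]
        rcases hε j with h1 | h1 <;> simp [h1]
      trans := by
        rintro a b c ⟨ε, hε, h⟩ ⟨δ, hδ, h'⟩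
        refine ⟨fun j => δ j * ε j, fun j => ?_, fun j u hu => ?_⟩
        · rcases hε j with h1 | h1 <;> rcases hδ j with h2 | h2 <;> simp [h1, h2]
        · rw [h' j u hu, h j u hu, mul_assoc] }

/-! ### Spherical coordinates and Peterson's deformations

The coordinate `u^k`, `k = 1, …, n`, is `u (k - 1)` with `k - 1 : Fin n`. -/

/-- `𝐂_k = ∏_{j=k+1}^n cos (u^j)`. -/
def bigC {n : ℕ} (k : ℕ) (u : Fin n → ℂ) : ℂ :=
  ∏ i ∈ Finset.univ.filter (fun i : Fin n => k ≤ i.val), Complex.cos (u i)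

/-- The quadric `∑_{j=0}^n x_j² / a_j = 1` in spherical coordinates,
`𝒳 = √a₀ 𝐂₀ e₀ + ∑_k √a_k 𝐂_k sin (u^k) e_k`, with the principal square roots. -/
def spherical {n : ℕ} (a : Fin (n + 1) → ℂ) (u : Fin n → ℂ) : Fin (n + 1) → ℂ :=
  Fin.cons (a 0 ^ (1 / 2 : ℂ) * bigC 0 u)
    fun i : Fin n => a i.succ ^ (1 / 2 : ℂ) * bigC (i.val + 1) u * Complex.sin (u i)

/-- `(z_0, z_1, …, z_{m})` with `z_0 = 1`. -/
def zExt {m : ℕ} (z : Fin m → ℂ) : Fin (m + 1) → ℂ := Fin.cons 1 z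

/-- `f_k² = (z_{k-1} - z_k) a₀ + (a_k - z_{k-1} a₀) sin² t`, where `k = i + 1`. -/
def radF {n : ℕ} (a : Fin (n + 1) → ℂ) (z : Fin (n - 1) → ℂ) (i : Fin (n - 1)) (t : ℂ) : ℂ :=
  (zExt z i.castSucc - zExt z i.succ) * a 0
    + (a ⟨i.val + 1, by omega⟩ - zExt z i.castSucc * a 0) * Complex.sin t ^ 2

/-- `(z_{k-1} - z_k) a₀ a_k + (a_k - z_{k-1} a₀) z_k a₀ sin² t`, where `k = i + 1`; its square root
is the numerator of the integrand of `g_k`. -/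
def radG {n : ℕ} (a : Fin (n + 1) → ℂ) (z : Fin (n - 1) → ℂ) (i : Fin (n - 1)) (t : ℂ) : ℂ :=
  (zExt z i.castSucc - zExt z i.succ) * a 0 * a ⟨i.val + 1, by omega⟩
    + (a ⟨i.val + 1, by omega⟩ - zExt z i.castSucc * a 0) * zExt z i.succ * a 0
      * Complex.sin t ^ 2

/-- `h'² = a_n - (a_n - z_{n-1} a₀) sin² t`. -/
def radH {n : ℕ} (a : Fin (n + 1) → ℂ) (z : Fin (n - 1) → ℂ) (t : ℂ) : ℂ :=
  a (Fin.last n) - (a (Fin.last n) - zExt z (Fin.last (n - 1)) * a 0) * Complex.sin t ^ 2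

/-- `∑_{k=1}^{n-1} 𝐂_k f_k(u^k) (cos g_k(u^k) e_{2k-2} + sin g_k(u^k) e_{2k-1})
+ h(u^n) e_{2n-2}`. -/
def petersonMap {n : ℕ} (f g : Fin (n - 1) → ℂ → ℂ) (h : ℂ → ℂ) (u : Fin n → ℂ) :
    Fin (2 * n - 1) → ℂ :=
  fun p =>
    if hp : p.val / 2 < n - 1 then
      bigC (p.val / 2 + 1) u * f ⟨p.val / 2, hp⟩ (u ⟨p.val / 2, by omega⟩) *
        (if p.val % 2 = 0 then Complex.cos (g ⟨p.val / 2, hp⟩ (u ⟨p.val / 2, by omega⟩))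
          else Complex.sin (g ⟨p.val / 2, hp⟩ (u ⟨p.val / 2, by omega⟩)))
    else h (u ⟨n - 1, by omega⟩)

/-- `X` is (on `U`) the Peterson deformation `𝒳_𝐳`: `f_k = √(radF)`, `g_k = ∫ √(radG) / radF`,
`h = ∫ √(radH)` for holomorphic branches of the roots and of the primitives on the ranges of the
coordinates (other branches change `X` only by rigid motions), where `f_k`, `g_k'`, `h'` have no
zeros. -/
def IsPeterson {n : ℕ} (a : Fin (n + 1) → ℂ) (z : Fin (n - 1) → ℂ) (U : Set (Fin n → ℂ))
    (X : (Fin n → ℂ) → (Fin (2 * n - 1) → ℂ)) : Prop :=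
  ∃ (f g : Fin (n - 1) → ℂ → ℂ) (h : ℂ → ℂ),
    (∀ i : Fin (n - 1), ∀ t ∈ (fun u : Fin n → ℂ => u ⟨i.val, by omega⟩) '' U,
      DifferentiableAt ℂ (f i) t ∧ DifferentiableAt ℂ (g i) t ∧
      f i t ≠ 0 ∧ f i t ^ 2 = radF a z i t ∧
      deriv (g i) t ≠ 0 ∧ (deriv (g i) t * radF a z i t) ^ 2 = radG a z i t) ∧
    (∀ i : Fin n, i.val + 1 = n → ∀ t ∈ (fun u : Fin n → ℂ => u i) '' U,
      DifferentiableAt ℂ h t ∧ deriv h t ≠ 0 ∧ deriv h t ^ 2 = radH a z t) ∧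
    ∀ u ∈ U, X u = petersonMap f g h u

/-- On `V` the map `x` is, up to a rigid motion, one of Peterson's deformations `𝒳_𝐳` with all
`z_k ≠ 0`. -/
def IsPetersonUpToMotion {n : ℕ} (a : Fin (n + 1) → ℂ) (V : Set (Fin n → ℂ))
    (x : (Fin n → ℂ) → (Fin (2 * n - 1) → ℂ)) : Prop :=
  ∃ z : Fin (n - 1) → ℂ, (∀ k, z k ≠ 0) ∧ ∃ X, IsPeterson a z V X ∧ Congruent V x X

/-- `(Y_w)_{w ∈ W}` is a holomorphic family, with `m` parameters, of deformations of `x₀` on `U`. -/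
structure IsFamily {n m : ℕ} (x₀ : (Fin n → ℂ) → (Fin (n + 1) → ℂ)) (U : Set (Fin n → ℂ))
    (W : Set (Fin m → ℂ)) (Y : (Fin m → ℂ) → (Fin n → ℂ) → (Fin (2 * n - 1) → ℂ)) : Prop where
  isOpen : IsOpen W
  holo : ContDiffOn ℂ ∞ (fun q : (Fin m → ℂ) × (Fin n → ℂ) => Y q.1 q.2) (W ×ˢ U)
  deformation : ∀ w ∈ W, IsDeformation x₀ U (Y w)

/-- The parameters of a family are essential: different parameter values give deformations which
are not congruent. -/
def IsEssential {n m : ℕ} (U : Set (Fin n → ℂ)) (W : Set (Fin m → ℂ))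
    (Y : (Fin m → ℂ) → (Fin n → ℂ) → (Fin (2 * n - 1) → ℂ)) : Prop :=
  ∀ w ∈ W, ∀ w' ∈ W, Congruent U (Y w) (Y w') → w = w'

/-- Peterson's `(n-1)`-parameter family is a maximal family of deformations of the quadric `x₀ = 𝒳`
in spherical coordinates on `U`. -/
structure PetersonFamilyIsMaximal {n : ℕ} (a : Fin (n + 1) → ℂ) (U : Set (Fin n → ℂ)) :
    Prop where
  /-- The `𝒳_𝐳` with `z_k ≠ 0` are deformations of the kind considered. -/
  deformation : ∀ z : Fin (n - 1) → ℂ, (∀ k, z k ≠ 0) → ∀ X, IsPeterson a z U X →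
    IsDeformation (spherical a) U X
  /-- Their congruence class is determined by `𝐳` and determines `𝐳`. -/
  congruent_iff : ∀ z z' : Fin (n - 1) → ℂ, (∀ k, z k ≠ 0) → (∀ k, z' k ≠ 0) →
    ∀ X X', IsPeterson a z U X → IsPeterson a z' U X' → (Congruent U X X' ↔ z = z')
  /-- Near every point they exist for all `𝐳` in open sets of parameters, which can be found in
  any given open set. -/
  exist : ∀ u ∈ U, ∀ O : Set (Fin (n - 1) → ℂ), IsOpen O → O.Nonempty →
    ∃ V, IsOpen V ∧ Convex ℝ V ∧ u ∈ V ∧ V ⊆ U ∧ ∃ Z, IsOpen Z ∧ Z.Nonempty ∧ Z ⊆ O ∧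
      ∀ z ∈ Z, (∀ k, z k ≠ 0) ∧ ∃ X, IsPeterson a z V X
  /-- No family of deformations has more than `n - 1` essential parameters. -/
  parameters_le : ∀ (m : ℕ) (W : Set (Fin m → ℂ)) (Y), W.Nonempty →
    IsFamily (spherical a) U W Y → IsEssential U W Y → m ≤ n - 1
  /-- In a family with `n - 1` essential parameters the general member is one of the `𝒳_𝐳`. -/
  generic : ∀ (W : Set (Fin (n - 1) → ℂ)) (Y),
    IsFamily (spherical a) U W Y → IsEssential U W Y →
    W ⊆ closure {w ∈ W | ∃ V, IsOpen V ∧ Convex ℝ V ∧ V.Nonempty ∧ V ⊆ U ∧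
      IsPetersonUpToMotion a V (Y w)}
  /-- Peterson's family cannot be enlarged near any of its members: in every family of
  deformations through a member, all nearby deformations are again members. -/
  isolated : ∀ (m : ℕ) (W : Set (Fin m → ℂ)) (Y), IsFamily (spherical a) U W Y →
    ∀ w₀ ∈ W, IsPetersonUpToMotion a U (Y w₀) →
    ∀ u ∈ U, ∃ V, IsOpen V ∧ Convex ℝ V ∧ u ∈ V ∧ V ⊆ U ∧
      ∀ᶠ w in nhds w₀, IsPetersonUpToMotion a V (Y w)

end

end QuadricDeformation

namespace QuadricDeformation

/-! ### Calculus of partial derivatives -/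

section Calculus

variable {n : ℕ} {U : Set (Fin n → ℂ)} {E F : Type} [NormedAddCommGroup E] [NormedSpace ℂ E]
  [NormedAddCommGroup F] [NormedSpace ℂ F]

/-! Vanishing symbols. In a conjugate system the Codazzi equations with distinct indices read
Γ^l_{jk} h_l = Γ^k_{jl} h_k, where the h are vector valued second forms. They hold for `x₀` and for
`x` with the same symbols, so linear independence of the joined vectors kills Γ^l_{jk}
(`codazzi_distinct`, `IsDeformation.christoffel_eq_zero`).

From deformations to solutions. By the Gauss equation the products of second forms with different
indices depend only on the linear element, so the joined vectors h_j are mutually orthogonal.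
Together with the tangent vectors they form a basis of ℂ ⊕ ℂ^{2n-1} with Gram matrix g ⊕
diag(|h_j|²). Hence |h_j|² ≠ 0; expanding the unit vector of the extra coordinate in this basis
gives the algebraic equation (`sum_sq_div_joinedSq`), and Codazzi with orthogonality gives the
differential one (`pd_joinedSq`). All products of frame vectors with their derivatives are
determined by g and the |h_j|², so two deformations with equal |h_j|² have frames related by a
constant orthogonal matrix (`IsDeformation.congruent`).

From solutions to deformations. In ℂ^{n+1} ⊕ ℂ^n, put ν = ∑ (h_j^0 / a_j) e_j, so that ν·ν = -1. The
skew connection `rollingConn` has N₀ and ν as parallel sections. The structure equations reduce its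
curvature to a multiple of e_k ∧ e_l, and this annihilates ν, all of whose components are nonzero;
so the connection is flat (`rollingConn_flat`). An orthonormal parallel frame containing N₀ and iν
has 2n - 1 further members y_b, and the primitives of ∑ (∂_j x₀ · y_b) du^j are the coordinates of
the deformation (`IsSolution.exists_isDeformation`). The conditions Γ^l_{jk} = 0 and h_j^0 ≠ 0 used
here follow from the equation of the quadric alone. Flat systems are solved on convex sets by a
Picard series along rays (`exists_solution_of_isFlat`).

Peterson's family. The quadric in spherical coordinates and Peterson's maps are both iterated cones
S_{m+1} = cos(u^m) S_m + φ_m(u^m). For a deformation of the quadric, J_j = |h_j|² makes 𝐂_{j+1}² /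
J_j a function of u^j alone, and the algebraic equation, arranged as a Horner scheme, becomes W_n =
0 for the quantities W_m of `ladder`. Descending from W_n = 0 shows that every W_m is constant
(`pd_ladder_eq_zero`). So W_1, …, W_{n-1} form a complete set of invariants
(`congruent_of_ladder_eq`), and for 𝒳_𝐳 they equal 1 / (a_0 z_m) (`IsPeterson.ladder_eq`).

Maximality is then a statement about the map w ↦ (W_1, …, W_{n-1}). For an essential family it is
holomorphic and injective, and such maps do not lower dimension (`le_of_injOn`). In equal dimension
they avoid finitely many prescribed values of the components on a dense set, and off these values
the member with z_m = 1 / (a_0 W_m) exists somewhere. Near a Peterson deformation it exists because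
admissibility of (𝐳, u) is an open condition. -/

theorem _root_.ContDiffOn.differentiableAt_of_isOpen {E F : Type*} [NormedAddCommGroup E]
    [NormedSpace ℂ E] [NormedAddCommGroup F] [NormedSpace ℂ F] {U : Set E} {f : E → F}
    (hf : ContDiffOn ℂ ∞ f U) (hU : IsOpen U) {u : E} (hu : u ∈ U) : DifferentiableAt ℂ f u :=
  (hf.contDiffAt (hU.mem_nhds hu)).differentiableAt (by simp)

theorem contDiffOn_fderiv_of_isOpen {E F : Type*} [NormedAddCommGroup E]
    [NormedSpace ℂ E] [NormedAddCommGroup F] [NormedSpace ℂ F] {U : Set E} {f : E → F}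
    (hf : ContDiffOn ℂ ∞ f U) (hU : IsOpen U) : ContDiffOn ℂ ∞ (fderiv ℂ f) U :=
  hf.fderiv_of_isOpen hU (by simp)

theorem contDiffOn_pd (hU : IsOpen U) {f : (Fin n → ℂ) → E} (hf : ContDiffOn ℂ ∞ f U)
    (j : Fin n) : ContDiffOn ℂ ∞ (pd j f) U :=
  (contDiffOn_fderiv_of_isOpen hf hU).clm_apply contDiffOn_const

theorem fderiv_apply_eq_sum_pd (f : (Fin n → ℂ) → E) (u v : Fin n → ℂ) :
    fderiv ℂ f u v = ∑ k, v k • pd k f u := by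
  conv_lhs => rw [← Finset.univ_sum_single v]
  rw [map_sum]
  refine Finset.sum_congr rfl fun k _ => ?_
  rw [pd, ← map_smul, ← Pi.single_smul', smul_eq_mul, mul_one]

theorem fderiv_eq_zero_of_pd {f : (Fin n → ℂ) → E} {u : Fin n → ℂ} (h : ∀ k, pd k f u = 0) :
    fderiv ℂ f u = 0 := by
  ext v
  simp [fderiv_apply_eq_sum_pd, h]

theorem pd_congr (hU : IsOpen U) {f g : (Fin n → ℂ) → E} (h : ∀ u ∈ U, f u = g u)
    {u : Fin n → ℂ} (hu : u ∈ U) (j : Fin n) : pd j f u = pd j g u := by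
  unfold pd
  rw [Filter.EventuallyEq.fderiv_eq (Filter.mem_of_superset (hU.mem_nhds hu) h)]

theorem pd_comm (hU : IsOpen U) {f : (Fin n → ℂ) → E} (hf : ContDiffOn ℂ ∞ f U)
    {u : Fin n → ℂ} (hu : u ∈ U) (j k : Fin n) : pd j (pd k f) u = pd k (pd j f) u := by
  have hd := (contDiffOn_fderiv_of_isOpen hf hU).differentiableAt_of_isOpen hU hu
  have key : ∀ i l : Fin n, pd i (pd l f) u
      = fderiv ℂ (fderiv ℂ f) u (Pi.single i 1) (Pi.single l 1) := by
    intro i l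
    unfold pd
    rw [fderiv_clm_apply hd (differentiableAt_const _)]
    simp
  rw [key, key]
  have hs : IsSymmSndFDerivAt ℂ f u :=
    (hf.contDiffAt (hU.mem_nhds hu)).isSymmSndFDerivAt (by simpa using WithTop.coe_le_coe.2 (le_top (a := (2 : ℕ∞))))
  exact hs _ _

@[simp] theorem pd_const (j : Fin n) (c : E) (u : Fin n → ℂ) : pd j (fun _ => c) u = 0 := by
  simp [pd]

theorem pd_clm (L : E →L[ℂ] F) {f : (Fin n → ℂ) → E} {u : Fin n → ℂ}
    (hf : DifferentiableAt ℂ f u) (j : Fin n) : pd j (fun v => L (f v)) u = L (pd j f u) := by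
  unfold pd
  have := (L.hasFDerivAt.comp u hf.hasFDerivAt).fderiv
  simp only [Function.comp_def] at this
  rw [this]; rfl

theorem pd_apply {ι : Type} [Fintype ι] {f : (Fin n → ℂ) → (ι → ℂ)} {u : Fin n → ℂ}
    (hf : DifferentiableAt ℂ f u) (j : Fin n) (i : ι) : pd j (fun v => f v i) u = pd j f u i :=
  pd_clm (ContinuousLinearMap.proj (R := ℂ) (φ := fun _ : ι => ℂ) i) hf j

theorem pd_add {f g : (Fin n → ℂ) → E} {u : Fin n → ℂ} (hf : DifferentiableAt ℂ f u)
    (hg : DifferentiableAt ℂ g u) (j : Fin n) :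
    pd j (fun v => f v + g v) u = pd j f u + pd j g u := by
  unfold pd; rw [fderiv_fun_add hf hg]; rfl

theorem pd_sub {f g : (Fin n → ℂ) → E} {u : Fin n → ℂ} (hf : DifferentiableAt ℂ f u)
    (hg : DifferentiableAt ℂ g u) (j : Fin n) :
    pd j (fun v => f v - g v) u = pd j f u - pd j g u := by
  unfold pd; rw [fderiv_fun_sub hf hg]; rfl

theorem pd_neg {f : (Fin n → ℂ) → E} {u : Fin n → ℂ} (j : Fin n) :
    pd j (fun v => -f v) u = -pd j f u := by
  unfold pd; rw [fderiv_fun_neg]; rfl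

theorem pd_sum {ι : Type*} (s : Finset ι) {f : ι → (Fin n → ℂ) → E} {u : Fin n → ℂ}
    (hf : ∀ i ∈ s, DifferentiableAt ℂ (f i) u) (j : Fin n) :
    pd j (fun v => ∑ i ∈ s, f i v) u = ∑ i ∈ s, pd j (f i) u := by
  unfold pd; rw [fderiv_fun_sum hf]; simp

theorem pd_smul {c : (Fin n → ℂ) → ℂ} {f : (Fin n → ℂ) → E} {u : Fin n → ℂ}
    (hc : DifferentiableAt ℂ c u) (hf : DifferentiableAt ℂ f u) (j : Fin n) :
    pd j (fun v => c v • f v) u = pd j c u • f u + c u • pd j f u := by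
  unfold pd; rw [fderiv_fun_smul hc hf]
  simp [add_comm]

theorem pd_mul {c f : (Fin n → ℂ) → ℂ} {u : Fin n → ℂ}
    (hc : DifferentiableAt ℂ c u) (hf : DifferentiableAt ℂ f u) (j : Fin n) :
    pd j (fun v => c v * f v) u = pd j c u * f u + c u * pd j f u :=
  pd_smul hc hf j

theorem pd_sq {c : (Fin n → ℂ) → ℂ} {u : Fin n → ℂ}
    (hc : DifferentiableAt ℂ c u) (j : Fin n) :
    pd j (fun v => c v ^ 2) u = 2 * c u * pd j c u := by
  have := pd_mul hc hc j
  simp only [← pow_two] at this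
  rw [this]; ring

theorem pd_inv {f : (Fin n → ℂ) → ℂ} {u : Fin n → ℂ}
    (hf : DifferentiableAt ℂ f u) (h0 : f u ≠ 0) (j : Fin n) :
    pd j (fun v => (f v)⁻¹) u = -pd j f u / f u ^ 2 := by
  unfold pd
  have := ((hasDerivAt_inv h0).comp_hasFDerivAt u hf.hasFDerivAt).fderiv
  simp only [Function.comp_def] at this
  rw [this]
  simp
  field_simp

theorem pd_div {c f : (Fin n → ℂ) → ℂ} {u : Fin n → ℂ}
    (hc : DifferentiableAt ℂ c u) (hf : DifferentiableAt ℂ f u) (h0 : f u ≠ 0) (j : Fin n) :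
    pd j (fun v => c v / f v) u = (pd j c u * f u - c u * pd j f u) / f u ^ 2 := by
  simp only [div_eq_mul_inv (c _)]
  rw [pd_mul hc (hf.fun_inv h0), pd_inv hf h0]
  field_simp
  ring

theorem pd_dot {ι : Type} [Fintype ι] {f g : (Fin n → ℂ) → (ι → ℂ)} {u : Fin n → ℂ}
    (hf : DifferentiableAt ℂ f u) (hg : DifferentiableAt ℂ g u) (j : Fin n) :
    pd j (fun v => f v ⬝ᵥ g v) u = pd j f u ⬝ᵥ g u + f u ⬝ᵥ pd j g u := by
  have hf' := fun i => differentiableAt_pi.mp hf i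
  have hg' := fun i => differentiableAt_pi.mp hg i
  simp only [dotProduct]
  rw [pd_sum _ (fun i _ => (hf' i).fun_mul (hg' i)), ← Finset.sum_add_distrib]
  refine Finset.sum_congr rfl fun i _ => ?_
  rw [pd_mul (hf' i) (hg' i), pd_apply hf, pd_apply hg]

theorem _root_.DifferentiableAt.dotProduct {E : Type*} [NormedAddCommGroup E] [NormedSpace ℂ E]
    {ι : Type} [Fintype ι] {f g : E → (ι → ℂ)} {u : E}
    (hf : DifferentiableAt ℂ f u) (hg : DifferentiableAt ℂ g u) :
    DifferentiableAt ℂ (fun v => f v ⬝ᵥ g v) u := by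
  have hf' := fun i => differentiableAt_pi.mp hf i
  have hg' := fun i => differentiableAt_pi.mp hg i
  simp only [_root_.dotProduct]
  exact DifferentiableAt.fun_sum fun i _ => (hf' i).mul (hg' i)

theorem _root_.ContDiffOn.dotProduct {E : Type*} [NormedAddCommGroup E] [NormedSpace ℂ E]
    {ι : Type} [Fintype ι] {f g : E → (ι → ℂ)} {U : Set E}
    (hf : ContDiffOn ℂ ∞ f U) (hg : ContDiffOn ℂ ∞ g U) :
    ContDiffOn ℂ ∞ (fun v => f v ⬝ᵥ g v) U := by
  have hf' := fun i => contDiffOn_pi.mp hf i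
  have hg' := fun i => contDiffOn_pi.mp hg i
  simp only [_root_.dotProduct]
  exact ContDiffOn.sum fun i _ => (hf' i).mul (hg' i)

theorem eq_of_pd_eq_zero (hU : IsOpen U) (hc : Convex ℝ U) {f : (Fin n → ℂ) → E}
    (hf : ContDiffOn ℂ ∞ f U) (h : ∀ u ∈ U, ∀ k, pd k f u = 0) {u v : Fin n → ℂ} (hu : u ∈ U)
    (hv : v ∈ U) : f u = f v := by
  refine hU.is_const_of_fderiv_eq_zero (𝕜 := ℂ) hc.isPreconnected (hf.differentiableOn (by simp))
    (fun w hw => fderiv_eq_zero_of_pd (h w hw)) hu hv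

theorem contDiffOn_det {E : Type*} [NormedAddCommGroup E] [NormedSpace ℂ E] {ι : Type} [Fintype ι]
    [DecidableEq ι] {U : Set E} {M : E → Matrix ι ι ℂ}
    (hM : ∀ i j, ContDiffOn ℂ ∞ (fun u => M u i j) U) :
    ContDiffOn ℂ ∞ (fun u => (M u).det) U := by
  simp only [Matrix.det_apply]
  refine ContDiffOn.sum fun σ _ => ?_
  have : ContDiffOn ℂ ∞ (fun u => ∏ i, M u (σ i) i) U := contDiffOn_prod fun i _ => hM _ _
  simp only [Units.smul_def, zsmul_eq_mul]
  exact contDiffOn_const.mul this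

theorem contDiffOn_matrix_inv {E : Type*} [NormedAddCommGroup E] [NormedSpace ℂ E] {ι : Type}
    [Fintype ι] [DecidableEq ι] {U : Set E} {M : E → Matrix ι ι ℂ}
    (hM : ∀ i j, ContDiffOn ℂ ∞ (fun u => M u i j) U) (h0 : ∀ u ∈ U, (M u).det ≠ 0) (i j : ι) :
    ContDiffOn ℂ ∞ (fun u => (M u)⁻¹ i j) U := by
  simp only [Matrix.inv_def, Ring.inverse_eq_inv', Matrix.smul_apply, smul_eq_mul,
    Matrix.adjugate_apply]
  refine ((contDiffOn_det hM).inv h0).mul (contDiffOn_det fun k l => ?_)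
  simp only [Matrix.updateRow_apply]
  split_ifs
  · exact contDiffOn_const
  · exact hM _ _

end Calculus

/-! ### Completely integrable linear systems on convex open sets -/

section Pfaff

set_option linter.unusedSectionVars false

open MeasureTheory Set Metric Filter Topology Interval

/-- Cauchy's estimate on the complex line through `v` in the direction `w`. -/
theorem norm_fderiv_le_of_forall_mem_ball {E V : Type} [NormedAddCommGroup E] [NormedSpace ℂ E]
    [NormedAddCommGroup V] [NormedSpace ℂ V] {g : E → V} {u v : E} {r b : ℝ}
    (hr : 0 < r) (hg : DifferentiableOn ℂ g (ball u r)) (hb : ∀ w ∈ ball u r, ‖g w‖ ≤ b)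
    (hv : v ∈ ball u (r / 2)) : ‖fderiv ℂ g v‖ ≤ b * (4 / r) := by
  have hb0 : 0 ≤ b := (norm_nonneg _).trans (hb u (mem_ball_self hr))
  refine ContinuousLinearMap.opNorm_le_bound _ (by positivity) fun w => ?_
  rcases eq_or_ne w 0 with rfl | hw
  · simp
  have hw' : 0 < ‖w‖ := norm_pos_iff.mpr hw
  -- A disc of this radius moves `v` by at most r/4, which together with the distance r/2 from the
  -- centre stays inside the ball; Cauchy's bound is then b / R = 4b‖w‖ / r.
  set R := r / (4 * ‖w‖) with hR
  have hR0 : 0 < R := by positivity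
  have hmem : ∀ z ∈ closedBall (0 : ℂ) R, v + z • w ∈ ball u r := by
    intro z hz
    rw [mem_ball, dist_eq_norm]
    rw [mem_closedBall, dist_zero_right] at hz
    rw [mem_ball, dist_eq_norm] at hv
    calc ‖v + z • w - u‖ = ‖(v - u) + z • w‖ := by congr 1; abel
      _ ≤ ‖v - u‖ + ‖z‖ * ‖w‖ := (norm_add_le _ _).trans (by rw [norm_smul])
      _ < r / 2 + R * ‖w‖ := add_lt_add_of_lt_of_le hv (by gcongr)
      _ < r := by rw [hR]; field_simp; nlinarith
  have hdiff : ∀ z ∈ closedBall (0 : ℂ) R,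
      HasDerivAt (fun z : ℂ => g (v + z • w)) (fderiv ℂ g (v + z • w) w) z := by
    intro z hz
    have h1 := (hg.differentiableAt (isOpen_ball.mem_nhds (hmem z hz))).hasFDerivAt
    have h2 : HasDerivAt (fun z : ℂ => v + z • w) w z := by
      simpa using ((hasDerivAt_id z).smul_const w).const_add v
    exact h1.comp_hasDerivAt z h2
  have hd : DiffContOnCl ℂ (fun z : ℂ => g (v + z • w)) (ball 0 R) := by
    refine DifferentiableOn.diffContOnCl ?_
    rw [closure_ball _ hR0.ne']
    exact fun z hz => (hdiff z hz).differentiableAt.differentiableWithinAt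
  have := Complex.norm_deriv_le_of_forall_mem_sphere_norm_le hR0 hd
    (fun z hz => hb _ (hmem z (sphere_subset_closedBall hz)))
  rw [(hdiff 0 (mem_closedBall_self hR0.le)).deriv] at this
  simp only [zero_smul, add_zero] at this
  refine this.trans (le_of_eq ?_)
  rw [hR]; field_simp

/-- The terms of a series of functions have, locally on `U`, summable uniform bounds. -/
def LocallySummable {E V : Type} [NormedAddCommGroup E] [NormedAddCommGroup V] (U : Set E)
    (f : ℕ → E → V) : Prop :=
  ∀ u ∈ U, ∃ r > 0, ∃ b : ℕ → ℝ, Summable b ∧ ball u r ⊆ U ∧ ∀ m, ∀ v ∈ ball u r, ‖f m v‖ ≤ b m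

/-- Halving the radius costs only a constant factor in Cauchy's estimate, so summable bounds pass to
derivatives of every order. -/
theorem LocallySummable.fderiv {E V : Type} [NormedAddCommGroup E] [NormedSpace ℂ E]
    [NormedAddCommGroup V] [NormedSpace ℂ V] {U : Set E} {f : ℕ → E → V}
    (h : LocallySummable U f) (hf : ∀ m, DifferentiableOn ℂ (f m) U) :
    LocallySummable U fun m => fderiv ℂ (f m) := by
  intro u hu
  obtain ⟨r, hr, b, hb, hrU, hfb⟩ := h u hu
  refine ⟨r / 2, by positivity, fun m => b m * (4 / r), hb.mul_right _,
    (ball_subset_ball (by linarith)).trans hrU, fun m v hv => ?_⟩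
  exact norm_fderiv_le_of_forall_mem_ball hr ((hf m).mono hrU) (hfb m) hv

theorem LocallySummable.hasFDerivAt_tsum {E V : Type} [NormedAddCommGroup E] [NormedSpace ℂ E]
    [NormedAddCommGroup V] [NormedSpace ℂ V] [CompleteSpace V] {U : Set E} {f : ℕ → E → V}
    (h : LocallySummable U f) (hU : IsOpen U) (hf : ∀ m, DifferentiableOn ℂ (f m) U) {u : E}
    (hu : u ∈ U) :
    HasFDerivAt (fun v => ∑' m, f m v) (∑' m, _root_.fderiv ℂ (f m) u) u := by
  obtain ⟨r, hr, b, hb, hrU, hfb⟩ := h.fderiv hf u hu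
  obtain ⟨r', hr', b', hb', -, hfb'⟩ := h u hu
  let : NormedSpace ℝ E := NormedSpace.restrictScalars ℝ ℂ E
  refine hasFDerivAt_tsum_of_isPreconnected hb isOpen_ball (convex_ball u r).isPreconnected
    (fun m v hv => ((hf m).differentiableAt (hU.mem_nhds (hrU hv))).hasFDerivAt) hfb
    (mem_ball_self hr) ?_ (mem_ball_self hr)
  exact Summable.of_norm_bounded hb' fun m => hfb' m u (mem_ball_self hr')

/-- The derivative of the sum is again the sum of a locally summable series, with values in a space
of linear maps; the induction on the order therefore runs over all target spaces. -/
theorem LocallySummable.contDiffOn_tsum {E V : Type} [NormedAddCommGroup E] [NormedSpace ℂ E]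
    [NormedAddCommGroup V] [NormedSpace ℂ V] [CompleteSpace V] {U : Set E} {f : ℕ → E → V}
    (h : LocallySummable U f) (hU : IsOpen U) (hf : ∀ m, ContDiffOn ℂ ∞ (f m) U) :
    ContDiffOn ℂ ∞ (fun v => ∑' m, f m v) U := by
  rw [contDiffOn_infty]
  intro N
  induction N generalizing V with
  | zero =>
    rw [Nat.cast_zero, contDiffOn_zero]
    exact fun u hu => (h.hasFDerivAt_tsum hU (fun m => (hf m).differentiableOn (by simp))
      hu).continuousAt.continuousWithinAt
  | succ N ih =>
    have hd := fun u (hu : u ∈ U) =>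
      h.hasFDerivAt_tsum hU (fun m => (hf m).differentiableOn (by simp)) hu
    rw [Nat.cast_succ, contDiffOn_succ_iff_fderiv_of_isOpen hU]
    refine ⟨fun u hu => (hd u hu).differentiableAt.differentiableWithinAt, by simp, ?_⟩
    exact (ih (h.fderiv fun m => (hf m).differentiableOn (by simp))
      fun m => contDiffOn_fderiv_of_isOpen (hf m) hU).congr fun u hu => (hd u hu).fderiv

/-- The integral of `t ^ k • g (t • u)` over `t ∈ [0, 1]`. -/
noncomputable def radialIntegral {E V : Type} [NormedAddCommGroup E] [NormedSpace ℂ E]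
    [NormedAddCommGroup V] [NormedSpace ℂ V] (k : ℕ) (g : E → V) (u : E) : V :=
  ∫ t in (0 : ℝ)..1, (t : ℂ) ^ k • g ((t : ℂ) • u)

variable {E V : Type} [NormedAddCommGroup E] [NormedSpace ℂ E]
    [NormedAddCommGroup V] [NormedSpace ℂ V] [CompleteSpace V] {U : Set E}

/-- `U` is star-shaped about the origin. -/
def IsStar (U : Set E) : Prop := ∀ u ∈ U, ∀ t ∈ Icc (0 : ℝ) 1, (t : ℂ) • u ∈ U

theorem continuousOn_radial (hs : IsStar U) {g : E → V} (hg : ContinuousOn g U)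
    {u : E} (hu : u ∈ U) (k : ℕ) :
    ContinuousOn (fun t : ℝ => (t : ℂ) ^ k • g ((t : ℂ) • u)) (Icc 0 1) := by
  refine ContinuousOn.smul (by fun_prop) (hg.comp (by fun_prop) fun t ht => hs u hu t ht)

/-- Differentiation under the integral sign; the chain rule contributes one more factor t. The
weight t^k is there to make this class of integrals closed under differentiation. -/
theorem hasFDerivAt_radialIntegral [ProperSpace E] (hU : IsOpen U) (hs : IsStar U) {g : E → V}
    (hg : ContDiffOn ℂ ∞ g U) {u : E} (hu : u ∈ U) (k : ℕ) :
    HasFDerivAt (radialIntegral k g) (radialIntegral (k + 1) (fderiv ℂ g) u) u := by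
  obtain ⟨r, hr, hrU⟩ := nhds_basis_closedBall.mem_iff.mp (hU.mem_nhds hu)
  have hg' := (contDiffOn_fderiv_of_isOpen hg hU).continuousOn
  have hcomp : IsCompact (Icc (0 : ℝ) 1 ×ˢ closedBall u r) :=
    isCompact_Icc.prod (isCompact_closedBall u r)
  have hcont : ContinuousOn (fun p : ℝ × E => (p.1 : ℂ) ^ (k + 1) • fderiv ℂ g ((p.1 : ℂ) • p.2))
      (Icc (0 : ℝ) 1 ×ˢ closedBall u r) := by
    have e : ContinuousOn (fun p : ℝ × E => (p.1 : ℂ) • p.2)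
      (Icc (0 : ℝ) 1 ×ˢ closedBall u r) := by fun_prop
    refine ContinuousOn.smul (f := fun p : ℝ × E => (p.1 : ℂ) ^ (k + 1)) (by fun_prop)
      (hg'.comp e fun p hp => ?_)
    exact hs _ (hrU hp.2) _ hp.1
  obtain ⟨C, hC⟩ := hcomp.exists_bound_of_continuousOn hcont
  have hIoc : Ι (0 : ℝ) 1 ⊆ Icc 0 1 := by
    rw [uIoc_of_le zero_le_one]; exact Ioc_subset_Icc_self
  refine intervalIntegral.hasFDerivAt_integral_of_dominated_of_fderiv_le
    (F := fun x t => (t : ℂ) ^ k • g ((t : ℂ) • x))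
    (F' := fun x t => (t : ℂ) ^ (k + 1) • fderiv ℂ g ((t : ℂ) • x)) (bound := fun _ => C)
    (closedBall_mem_nhds u hr) ?_ ?_ ?_ ?_ (by simp) ?_
  · filter_upwards [closedBall_mem_nhds u hr] with x hx
    exact ((continuousOn_radial hs hg.continuousOn (hrU hx) k).mono hIoc).aestronglyMeasurable
      measurableSet_uIoc
  · refine ContinuousOn.intervalIntegrable ?_
    rw [uIcc_of_le zero_le_one]
    exact continuousOn_radial hs hg.continuousOn hu k
  · exact ((continuousOn_radial hs hg' hu (k + 1)).mono hIoc).aestronglyMeasurable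
      measurableSet_uIoc
  · exact ae_of_all _ fun t ht x hx => hC (t, x) ⟨hIoc ht, hx⟩
  · refine ae_of_all _ fun t ht x hx => ?_
    have h1 := (hg.differentiableAt_of_isOpen hU (hs _ (hrU hx) t (hIoc ht))).hasFDerivAt
    have h2 : HasFDerivAt (fun x : E => (t : ℂ) • x) ((t : ℂ) • ContinuousLinearMap.id ℂ E) x :=
      (hasFDerivAt_id x).const_smul _
    have h3 := (h1.comp x h2).const_smul ((t : ℂ) ^ k)
    refine h3.congr_fderiv ?_
    ext w
    simp [pow_succ, mul_smul]

theorem contDiffOn_radialIntegral [ProperSpace E] (hU : IsOpen U) (hs : IsStar U) {g : E → V}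
    (hg : ContDiffOn ℂ ∞ g U) (k : ℕ) : ContDiffOn ℂ ∞ (radialIntegral k g) U := by
  rw [contDiffOn_infty]
  intro N
  induction N generalizing V k with
  | zero =>
    rw [Nat.cast_zero, contDiffOn_zero]
    exact fun u hu => (hasFDerivAt_radialIntegral hU hs hg hu k).continuousAt.continuousWithinAt
  | succ N ih =>
    have hd := fun u (hu : u ∈ U) => hasFDerivAt_radialIntegral hU hs hg hu k
    rw [Nat.cast_succ, contDiffOn_succ_iff_fderiv_of_isOpen hU]
    refine ⟨fun u hu => (hd u hu).differentiableAt.differentiableWithinAt, by simp, ?_⟩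
    exact (ih (contDiffOn_fderiv_of_isOpen hg hU) (k + 1)).congr fun u hu => (hd u hu).fderiv

/-- The terms of the Picard series of the system `dy = Ω y` with `y 0 = y₀`. -/
noncomputable def picardTerm (Ω : E → E →L[ℂ] V →L[ℂ] V) (y₀ : V) : ℕ → E → V
  | 0 => fun _ => y₀
  | m + 1 => fun u => radialIntegral 0 (fun v => ContinuousLinearMap.apply ℂ V (picardTerm Ω y₀ m v) ∘L Ω v) u u

variable {Ω : E → E →L[ℂ] V →L[ℂ] V} {y₀ : V}

theorem contDiffOn_apply_comp (hΩ : ContDiffOn ℂ ∞ Ω U) {y : E → V} (hy : ContDiffOn ℂ ∞ y U) :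
    ContDiffOn ℂ ∞ (fun v => ContinuousLinearMap.apply ℂ V (y v) ∘L Ω v) U :=
  ((contDiffOn_const (c := ContinuousLinearMap.apply ℂ V)).clm_apply hy).clm_comp hΩ

theorem contDiffOn_picardTerm [ProperSpace E] (hU : IsOpen U) (hs : IsStar U)
    (hΩ : ContDiffOn ℂ ∞ Ω U) (m : ℕ) : ContDiffOn ℂ ∞ (picardTerm Ω y₀ m) U := by
  induction m with
  | zero => exact contDiffOn_const
  | succ m ih =>
    exact (contDiffOn_radialIntegral hU hs (contDiffOn_apply_comp hΩ ih) 0).clm_apply contDiffOn_id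

theorem radialIntegral_apply {g : E → E →L[ℂ] V} (hs : IsStar U) (hg : ContinuousOn g U)
    (k : ℕ) {u : E} (hu : u ∈ U) (w : E) :
    radialIntegral k g u w = ∫ t in (0 : ℝ)..1, (t : ℂ) ^ k • g ((t : ℂ) • u) w := by
  unfold radialIntegral
  have : IntervalIntegrable (fun t : ℝ => (t : ℂ) ^ k • g ((t : ℂ) • u)) volume 0 1 := by
    refine ContinuousOn.intervalIntegrable ?_
    rw [uIcc_of_le zero_le_one]
    exact continuousOn_radial hs hg hu k
  rw [ContinuousLinearMap.intervalIntegral_apply this]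
  rfl

/-- After the substitution τ = ts the recursion is ordinary Picard iteration for the linear equation
that the system induces on the ray through `u`. -/
theorem picardTerm_succ_smul [ProperSpace E] (hU : IsOpen U) (hs : IsStar U)
    (hΩ : ContDiffOn ℂ ∞ Ω U) (m : ℕ) {u : E} (hu : u ∈ U) {s : ℝ} (h : s ∈ Icc (0 : ℝ) 1) :
    picardTerm Ω y₀ (m + 1) ((s : ℂ) • u)
      = ∫ τ in (0 : ℝ)..s, Ω ((τ : ℂ) • u) u (picardTerm Ω y₀ m ((τ : ℂ) • u)) := by
  have hc := (contDiffOn_apply_comp hΩ (contDiffOn_picardTerm (y₀ := y₀) hU hs hΩ m)).continuousOn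
  simp only [picardTerm]
  rw [radialIntegral_apply hs hc 0 (hs u hu s h)]
  simp only [pow_zero, one_smul, ContinuousLinearMap.comp_apply, map_smul,
    ContinuousLinearMap.apply_apply]
  rw [intervalIntegral.integral_smul]
  have := intervalIntegral.smul_integral_comp_mul_right (a := 0) (b := 1)
    (fun τ : ℝ => Ω ((τ : ℂ) • u) u (picardTerm Ω y₀ m ((τ : ℂ) • u))) s
  simp only [zero_mul, one_mul, Complex.ofReal_mul] at this
  rw [← this]
  simp only [smul_smul]
  rfl

/-- The factorial in the usual bound for iterated integrals makes the series converge on all of the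
star-shaped set and not only near its centre. -/
theorem norm_picardTerm_le [ProperSpace E] (hU : IsOpen U) (hs : IsStar U)
    (hΩ : ContDiffOn ℂ ∞ Ω U) {u : E} (hu : u ∈ U) {M : ℝ} (hM : 0 ≤ M)
    (hb : ∀ t ∈ Icc (0 : ℝ) 1, ‖Ω ((t : ℂ) • u) u‖ ≤ M) (m : ℕ) {s : ℝ} (h : s ∈ Icc (0 : ℝ) 1) :
    ‖picardTerm Ω y₀ m ((s : ℂ) • u)‖ ≤ ‖y₀‖ * (M ^ m / m.factorial) * s ^ m := by
  induction m generalizing s with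
  | zero => simp [picardTerm]
  | succ m ih =>
    rw [picardTerm_succ_smul hU hs hΩ m hu h]
    have hint : ∫ τ in (0 : ℝ)..s, M * (‖y₀‖ * (M ^ m / m.factorial) * τ ^ m)
        = ‖y₀‖ * (M ^ (m + 1) / (m + 1).factorial) * s ^ (m + 1) := by
      rw [intervalIntegral.integral_const_mul, intervalIntegral.integral_const_mul, integral_pow]
      have : ((m : ℝ) + 1) ≠ 0 := by positivity
      have h2 : (m.factorial : ℝ) ≠ 0 := by positivity
      rw [Nat.factorial_succ]
      push_cast
      field_simp
      simp only [ne_eq, Nat.add_eq_zero_iff, one_ne_zero, and_false, not_false_eq_true, zero_pow,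
        sub_zero]
      ring
    rw [← hint]
    refine intervalIntegral.norm_integral_le_of_norm_le h.1 (ae_of_all _ fun τ hτ => ?_)
      (Continuous.intervalIntegrable (by fun_prop) _ _)
    have hτ' : τ ∈ Icc (0 : ℝ) 1 := ⟨hτ.1.le, hτ.2.trans h.2⟩
    exact (ContinuousLinearMap.le_opNorm _ _).trans
      (mul_le_mul (hb τ hτ') (ih hτ') (norm_nonneg _) hM)

theorem locallySummable_picardTerm [ProperSpace E] (hU : IsOpen U) (hs : IsStar U)
    (hΩ : ContDiffOn ℂ ∞ Ω U) : LocallySummable U (picardTerm Ω y₀) := by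
  intro u hu
  obtain ⟨r, hr, hrU⟩ := nhds_basis_closedBall.mem_iff.mp (hU.mem_nhds hu)
  have hcomp : IsCompact (Icc (0 : ℝ) 1 ×ˢ closedBall u r) :=
    isCompact_Icc.prod (isCompact_closedBall u r)
  have hcont : ContinuousOn (fun p : ℝ × E => Ω ((p.1 : ℂ) • p.2) p.2)
      (Icc (0 : ℝ) 1 ×ˢ closedBall u r) := by
    refine ContinuousOn.clm_apply (hΩ.continuousOn.comp (by fun_prop) fun p hp => ?_) (by fun_prop)
    exact hs _ (hrU hp.2) _ hp.1
  obtain ⟨C, hC⟩ := hcomp.exists_bound_of_continuousOn hcont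
  refine ⟨r, hr, fun m => ‖y₀‖ * (|C| ^ m / m.factorial), ?_, ball_subset_closedBall.trans hrU,
    fun m v hv => ?_⟩
  · exact (Real.summable_pow_div_factorial _).mul_left _
  · have hv' := ball_subset_closedBall hv
    have := norm_picardTerm_le (y₀ := y₀) hU hs hΩ (hrU hv') (abs_nonneg C)
      (fun t ht => (hC (t, v) ⟨ht, hv'⟩).trans (le_abs_self C)) m (s := 1) (by simp)
    simpa using this

/-- With g the integrand of the recursion, the radial derivative is the integral over [0, 1] of d/dt
(t g(tu) u), so the fundamental theorem of calculus leaves g(u) u. -/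
theorem fderiv_picardTerm_succ_self [ProperSpace E] (hU : IsOpen U) (hs : IsStar U)
    (hΩ : ContDiffOn ℂ ∞ Ω U) (m : ℕ) {u : E} (hu : u ∈ U) :
    fderiv ℂ (picardTerm Ω y₀ (m + 1)) u u = Ω u u (picardTerm Ω y₀ m u) := by
  set g : E → E →L[ℂ] V := fun v => ContinuousLinearMap.apply ℂ V (picardTerm Ω y₀ m v) ∘L Ω v with hg
  have hgs : ContDiffOn ℂ ∞ g U :=
    contDiffOn_apply_comp hΩ (contDiffOn_picardTerm (y₀ := y₀) hU hs hΩ m)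
  have hg' := contDiffOn_fderiv_of_isOpen hgs hU
  have h1 := (hasFDerivAt_radialIntegral hU hs hgs hu 0).clm_apply (hasFDerivAt_id u)
  have h2 : fderiv ℂ (picardTerm Ω y₀ (m + 1)) u u
      = radialIntegral 0 g u u + radialIntegral 1 (fderiv ℂ g) u u u := by
    rw [show picardTerm Ω y₀ (m + 1) = fun u => radialIntegral 0 g u (id u) from rfl, h1.fderiv]
    simp
  have hd : ∀ t ∈ uIcc (0 : ℝ) 1, HasDerivAt (fun t : ℝ => (t : ℂ) • g ((t : ℂ) • u) u)
      (g ((t : ℂ) • u) u + (t : ℂ) • fderiv ℂ g ((t : ℂ) • u) u u) t := by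
    intro t ht
    rw [uIcc_of_le zero_le_one] at ht
    have e1 : HasDerivAt (fun t : ℝ => (t : ℂ)) 1 t := Complex.ofRealCLM.hasDerivAt
    have e2 : HasDerivAt (fun t : ℝ => (t : ℂ) • u) u t := by
      simpa using e1.smul_const u
    have e3 := (((hgs.differentiableAt_of_isOpen hU (hs u hu t ht)).hasFDerivAt.restrictScalars
      ℝ).comp_hasDerivAt t e2)
    have e4 := ((ContinuousLinearMap.apply ℂ V u).restrictScalars ℝ).hasFDerivAt.comp_hasDerivAt t e3
    have e5 := e1.smul e4
    refine e5.congr_deriv ?_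
    simp [add_comm]
  have c1 := continuousOn_radial hs hgs.continuousOn hu 0
  have c2 := continuousOn_radial hs hg'.continuousOn hu 1
  have i1 : IntervalIntegrable (fun t : ℝ => g ((t : ℂ) • u) u) volume 0 1 := by
    refine ContinuousOn.intervalIntegrable ?_
    rw [uIcc_of_le zero_le_one]
    simp only [pow_zero, one_smul] at c1
    exact c1.clm_apply continuousOn_const
  have i2 : IntervalIntegrable (fun t : ℝ => (t : ℂ) • fderiv ℂ g ((t : ℂ) • u) u u) volume 0 1 := by
    refine ContinuousOn.intervalIntegrable ?_
    rw [uIcc_of_le zero_le_one]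
    simp only [pow_one] at c2
    exact (c2.clm_apply continuousOn_const).clm_apply continuousOn_const
  have ftc := intervalIntegral.integral_eq_sub_of_hasDerivAt hd (i1.add i2)
  rw [h2, radialIntegral_apply hs hgs.continuousOn 0 hu,
    radialIntegral_apply hs hg'.continuousOn 1 hu]
  have i3 : IntervalIntegrable (fun t : ℝ => (t : ℂ) ^ 1 • fderiv ℂ g ((t : ℂ) • u) u) volume 0 1 := by
    refine ContinuousOn.intervalIntegrable ?_
    rw [uIcc_of_le zero_le_one]
    exact c2.clm_apply continuousOn_const
  rw [ContinuousLinearMap.intervalIntegral_apply i3]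
  simp only [pow_zero, one_smul, pow_one, _root_.smul_apply]
  rw [← intervalIntegral.integral_add i1 i2, ftc]
  simp [hg]

/-- The system `dy = Ω y` is completely integrable on `U`. -/
def IsFlat (U : Set E) (Ω : E → E →L[ℂ] V →L[ℂ] V) : Prop :=
  ∀ u ∈ U, ∀ v w, fderiv ℂ Ω u v w - fderiv ℂ Ω u w v
    + (Ω u w ∘L Ω u v - Ω u v ∘L Ω u w) = 0

/-- Frobenius' theorem for linear systems. The Picard series satisfies the equation in the radial
direction without any condition; flatness enters only to propagate it to the other directions. -/
theorem exists_solution_of_isFlat_of_isStar [ProperSpace E] (hU : IsOpen U) (hs : IsStar U)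
    (hΩ : ContDiffOn ℂ ∞ Ω U) (hflat : IsFlat U Ω) (y₀ : V) :
    ∃ y : E → V, ContDiffOn ℂ ∞ y U ∧ y 0 = y₀ ∧ ∀ u ∈ U, ∀ v, fderiv ℂ y u v = Ω u v (y u) := by
  have hD : ∀ m, ContDiffOn ℂ ∞ (picardTerm Ω y₀ m) U := contDiffOn_picardTerm hU hs hΩ
  have hS : LocallySummable U (picardTerm Ω y₀) := locallySummable_picardTerm hU hs hΩ
  have hDd := fun m => (hD m).differentiableOn (by simp)
  set y : E → V := fun u => ∑' m, picardTerm Ω y₀ m u with hy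
  have hys : ContDiffOn ℂ ∞ y U := hS.contDiffOn_tsum hU hD
  have summ : ∀ u ∈ U, Summable fun m => picardTerm Ω y₀ m u := by
    intro u hu
    obtain ⟨r, hr, b, hb, -, h⟩ := hS u hu
    exact Summable.of_norm_bounded hb fun m => h m u (mem_ball_self hr)
  have summ' : ∀ u ∈ U, Summable fun m => fderiv ℂ (picardTerm Ω y₀ m) u := by
    intro u hu
    obtain ⟨r, hr, b, hb, -, h⟩ := hS.fderiv hDd u hu
    exact Summable.of_norm_bounded hb fun m => h m u (mem_ball_self hr)
  have radial : ∀ u ∈ U, fderiv ℂ y u u = Ω u u (y u) := by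
    intro u hu
    rw [(hS.hasFDerivAt_tsum hU hDd hu).fderiv]
    have e1 := (ContinuousLinearMap.apply ℂ V u).map_tsum (summ' u hu)
    simp only [ContinuousLinearMap.apply_apply] at e1
    have sm : Summable fun m => fderiv ℂ (picardTerm Ω y₀ m) u u :=
      (ContinuousLinearMap.apply ℂ V u).summable (summ' u hu)
    rw [e1, sm.tsum_eq_zero_add, hy, (Ω u u).map_tsum (summ u hu)]
    simp only [fderiv_picardTerm_succ_self hU hs hΩ _ hu]
    simp [picardTerm]
  refine ⟨y, hys, ?_, fun u hu v => ?_⟩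
  · rw [hy]
    simp only
    rw [tsum_eq_single 0]
    · rfl
    · intro m hm
      obtain ⟨m, rfl⟩ := Nat.exists_eq_succ_of_ne_zero hm
      simp [picardTerm]
  have hy' := contDiffOn_fderiv_of_isOpen hys hU
  -- the defect of the equation in the direction `v` solves a linear equation along rays
  set e : E → V := fun u => fderiv ℂ y u v - Ω u v (y u) with he
  have hes : ContDiffOn ℂ ∞ e U :=
    (hy'.clm_apply contDiffOn_const).sub ((hΩ.clm_apply contDiffOn_const).clm_apply hys)
  have hrad : ∀ u ∈ U, fderiv ℂ e u u = Ω u u (e u) - e u := by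
    intro u hu
    have dy := (hys.differentiableAt_of_isOpen hU hu).hasFDerivAt
    have dy' := (hy'.differentiableAt_of_isOpen hU hu).hasFDerivAt
    have dΩ := (hΩ.differentiableAt_of_isOpen hU hu).hasFDerivAt
    have a1 := (dy'.clm_apply (hasFDerivAt_id u))
    have a2 := ((dΩ.clm_apply (hasFDerivAt_id u)).clm_apply dy)
    have a3 : fderiv ℂ (fun u => fderiv ℂ y u (id u)) u
        = fderiv ℂ (fun u => Ω u (id u) (y u)) u :=
      Filter.EventuallyEq.fderiv_eq (Filter.mem_of_superset (hU.mem_nhds hu) radial)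
    rw [a1.fderiv, a2.fderiv] at a3
    have a4 := DFunLike.congr_fun a3 v
    have a5 := ((dy'.clm_apply (hasFDerivAt_const v u)).sub
      ((dΩ.clm_apply (hasFDerivAt_const v u)).clm_apply dy)).fderiv
    have a6 : fderiv ℂ e u u = _ := DFunLike.congr_fun a5 u
    rw [a6]
    have sym : fderiv ℂ (fderiv ℂ y) u u v = fderiv ℂ (fderiv ℂ y) u v u :=
      ((hys.contDiffAt (hU.mem_nhds hu)).isSymmSndFDerivAt
        (by simpa using WithTop.coe_le_coe.2 (le_top (a := (2 : ℕ∞))))) _ _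
    have fl := DFunLike.congr_fun (hflat u hu u v) (y u)
    simp at a4 fl ⊢
    rw [sym, radial u hu, he]
    simp only [map_sub]
    linear_combination (norm := module) a4 - fl
  -- The factor t absorbs the term -e of `hrad`: t e(tu) solves a homogeneous linear equation and
  -- vanishes at t = 0, so Grönwall's inequality makes it vanish at t = 1.
  have hode : ∀ t ∈ Icc (0 : ℝ) 1, HasDerivAt (fun t : ℝ => (t : ℂ) • e ((t : ℂ) • u))
      (Ω ((t : ℂ) • u) u ((t : ℂ) • e ((t : ℂ) • u))) t := by
    intro t ht
    have e1 : HasDerivAt (fun t : ℝ => (t : ℂ)) 1 t := Complex.ofRealCLM.hasDerivAt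
    have e2 : HasDerivAt (fun t : ℝ => (t : ℂ) • u) u t := by
      simpa using e1.smul_const u
    have hm := hs u hu t ht
    have e3 := ((hes.differentiableAt_of_isOpen hU hm).hasFDerivAt.restrictScalars
      ℝ).comp_hasDerivAt t e2
    have := hrad _ hm
    rw [map_smul] at this
    refine (e1.smul e3).congr_deriv ?_
    change (t : ℂ) • fderiv ℂ e ((t : ℂ) • u) u + (1 : ℂ) • e ((t : ℂ) • u) = _
    rw [this, one_smul, sub_add_cancel, map_smul, map_smul]
    rfl
  have hcΩ : ContinuousOn (fun t : ℝ => Ω ((t : ℂ) • u) u) (Icc 0 1) :=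
    (hΩ.continuousOn.comp (by fun_prop) fun t ht => hs u hu t ht).clm_apply continuousOn_const
  obtain ⟨K, hK⟩ := isCompact_Icc.exists_bound_of_continuousOn hcΩ
  have := norm_le_gronwallBound_of_norm_deriv_right_le (δ := 0) (K := K) (ε := 0)
    (fun t ht => (hode t ht).continuousAt.continuousWithinAt)
    (fun t ht => (hode t (Ico_subset_Icc_self ht)).hasDerivWithinAt) (by simp)
    (fun t ht => by
      rw [add_zero]
      exact (ContinuousLinearMap.le_opNorm _ _).trans
        (mul_le_mul_of_nonneg_right (hK t (Ico_subset_Icc_self ht)) (norm_nonneg _)))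
    1 (by simp)
  simp only [gronwallBound_ε0_δ0, Complex.ofReal_one, one_smul, norm_le_zero_iff] at this
  exact sub_eq_zero.mp this

theorem exists_solution_of_isFlat {n : ℕ} {U : Set (Fin n → ℂ)} (hU : IsOpen U)
    (hc : Convex ℝ U) {u₀ : Fin n → ℂ} (hu₀ : u₀ ∈ U)
    {Ω : (Fin n → ℂ) → (Fin n → ℂ) →L[ℂ] V →L[ℂ] V}
    (hΩ : ContDiffOn ℂ ∞ Ω U) (hflat : IsFlat U Ω) (y₀ : V) :
    ∃ y : (Fin n → ℂ) → V, ContDiffOn ℂ ∞ y U ∧ y u₀ = y₀ ∧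
      ∀ u ∈ U, ∀ v, fderiv ℂ y u v = Ω u v (y u) := by
  have hcont : Continuous fun v : Fin n → ℂ => v + u₀ := by fun_prop
  have hst : IsStar ((fun v : Fin n → ℂ => v + u₀) ⁻¹' U) := by
    intro v hv t ht
    have := hc hu₀ hv (sub_nonneg.mpr ht.2) ht.1 (by ring)
    simp only [mem_preimage] at hv ⊢
    convert this using 1
    ext i
    simp
    ring
  have hsm : ContDiffOn ℂ ∞ (fun v => Ω (v + u₀)) ((fun v : Fin n → ℂ => v + u₀) ⁻¹' U) :=
    hΩ.comp (by fun_prop) fun v hv => hv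
  obtain ⟨y, hy, hy0, h⟩ := exists_solution_of_isFlat_of_isStar (hU.preimage hcont) hst
    hsm (fun v hv a b => by
      have e : fderiv ℂ (fun v => Ω (v + u₀)) v = fderiv ℂ Ω (v + u₀) :=
        (((hΩ.differentiableAt_of_isOpen hU hv).hasFDerivAt).comp v
          ((hasFDerivAt_id v).add_const u₀)).fderiv
      rw [e]
      exact hflat _ hv a b) y₀
  refine ⟨fun u => y (u - u₀), hy.comp (by fun_prop) fun u hu => by simpa using hu, by simpa, ?_⟩
  intro u hu v
  rw [show fderiv ℂ (fun u => y (u - u₀)) u = fderiv ℂ y (u - u₀) from fderiv_comp_sub (f := y) u₀,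
    h (u - u₀) (by simpa using hu)]
  simp

/-- A holomorphic function without zeros on a convex open set has a holomorphic square root. -/
theorem exists_sqrt {n : ℕ} {U : Set (Fin n → ℂ)} (hU : IsOpen U) (hc : Convex ℝ U)
    {f : (Fin n → ℂ) → ℂ} (hf : ContDiffOn ℂ ∞ f U) (h0 : ∀ u ∈ U, f u ≠ 0) :
    ∃ r : (Fin n → ℂ) → ℂ, ContDiffOn ℂ ∞ r U ∧ ∀ u ∈ U, r u ^ 2 = f u := by
  rcases U.eq_empty_or_nonempty with rfl | ⟨u₀, hu₀⟩
  · exact ⟨0, contDiffOn_const, by simp⟩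
  have hf' := contDiffOn_fderiv_of_isOpen hf hU
  obtain ⟨c, hcf⟩ : ∃ c : ℂ, c ^ 2 = f u₀ := ⟨_, Complex.cpow_nat_inv_pow _ two_ne_zero⟩
  set L : ℂ →L[ℂ] ℂ →L[ℂ] ℂ := ContinuousLinearMap.mul ℂ ℂ with hL
  -- A root satisfies dy = (df / 2f) y. The form df / 2f is closed and multiplications commute, so
  -- the system is flat; then y² / f is constant.
  set Ω : (Fin n → ℂ) → (Fin n → ℂ) →L[ℂ] ℂ →L[ℂ] ℂ :=
    fun u => L ∘L ((2 * f u)⁻¹ • fderiv ℂ f u) with hΩ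
  have hg : ContDiffOn ℂ ∞ (fun u => (2 * f u)⁻¹) U :=
    (contDiffOn_const.mul hf).inv fun u hu => mul_ne_zero two_ne_zero (h0 u hu)
  have hΩs : ContDiffOn ℂ ∞ Ω U := contDiffOn_const.clm_comp (hg.smul hf')
  obtain ⟨y, hy, hy0, hyd⟩ := exists_solution_of_isFlat hU hc hu₀ hΩs (by
    intro u hu v w
    have d1 := (hf'.differentiableAt_of_isOpen hU hu).hasFDerivAt
    have d0 := (hf.differentiableAt_of_isOpen hU hu).hasFDerivAt
    have d3 := (hasDerivAt_inv (mul_ne_zero two_ne_zero (h0 u hu))).comp_hasFDerivAt u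
      (d0.const_mul 2)
    have d4 := ((hasFDerivAt_const L u).clm_comp (d3.smul d1)).fderiv
    have sym : fderiv ℂ (fderiv ℂ f) u v w = fderiv ℂ (fderiv ℂ f) u w v :=
      ((hf.contDiffAt (hU.mem_nhds hu)).isSymmSndFDerivAt
        (by simpa using WithTop.coe_le_coe.2 (le_top (a := (2 : ℕ∞))))) _ _
    have d5 : fderiv ℂ Ω u = _ := d4
    rw [d5, hΩ]
    ext
    simp [hL, sym]
    ring) c
  refine ⟨y, hy, fun u hu => ?_⟩
  have hconst : ∀ u ∈ U, y u ^ 2 / f u = y u₀ ^ 2 / f u₀ := fun u hu =>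
    eq_of_pd_eq_zero hU hc (f := fun u => y u ^ 2 / f u) ((hy.pow 2).div hf h0) (fun v hv k => by
      have dy := hy.differentiableAt_of_isOpen hU hv
      have df := hf.differentiableAt_of_isOpen hU hv
      have e : pd k y v = (2 * f v)⁻¹ * pd k f v * y v := by
        simp [pd, hyd v hv, hΩ, hL, mul_assoc]
      have := h0 v hv
      rw [pd_div (dy.fun_pow 2) df this, pd_sq dy, e]
      field_simp
      ring) hu hu₀
  have := hconst u hu
  rw [hy0, hcf, div_self (h0 u₀ hu₀), div_eq_one_iff_eq (h0 u hu)] at this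
  exact this

end Pfaff

/-! ### Tangential and normal components -/

section Surface

variable {n m : ℕ} {U : Set (Fin n → ℂ)} {x : (Fin n → ℂ) → (Fin m → ℂ)}

theorem metric_apply (x : (Fin n → ℂ) → (Fin m → ℂ)) (u : Fin n → ℂ) (j k : Fin n) :
    metric x u j k = pd j x u ⬝ᵥ pd k x u := rfl

theorem metric_symm (x : (Fin n → ℂ) → (Fin m → ℂ)) (u : Fin n → ℂ) (j k : Fin n) :
    metric x u j k = metric x u k j := dotProduct_comm (pd j x u) (pd k x u)

theorem contDiffOn_metric (hU : IsOpen U) (hx : ContDiffOn ℂ ∞ x U) (j k : Fin n) :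
    ContDiffOn ℂ ∞ (fun u => metric x u j k) U :=
  (contDiffOn_pd hU hx j).dotProduct (contDiffOn_pd hU hx k)

theorem contDiffOn_metric_inv (hU : IsOpen U) (hx : ContDiffOn ℂ ∞ x U) (hr : IsRegular x U)
    (j k : Fin n) : ContDiffOn ℂ ∞ (fun u => (metric x u)⁻¹ j k) U :=
  contDiffOn_matrix_inv (contDiffOn_metric hU hx) hr j k

theorem contDiffOn_christoffel (hU : IsOpen U) (hx : ContDiffOn ℂ ∞ x U) (hr : IsRegular x U)
    (l j k : Fin n) : ContDiffOn ℂ ∞ (christoffel x l j k) U := by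
  have h : ∀ i p q : Fin n, ContDiffOn ℂ ∞ (pd i fun v => metric x v p q) U := fun i p q =>
    contDiffOn_pd hU (contDiffOn_metric hU hx p q) i
  unfold christoffel
  exact ContDiffOn.sum fun p _ => ((contDiffOn_metric_inv hU hx hr l p).div_const 2).mul
    (((h _ _ _).add (h _ _ _)).sub (h _ _ _))

theorem contDiffOn_secondForm (hU : IsOpen U) (hx : ContDiffOn ℂ ∞ x U) (hr : IsRegular x U)
    (j k : Fin n) : ContDiffOn ℂ ∞ (secondForm x j k) U :=
  (contDiffOn_pd hU (contDiffOn_pd hU hx j) k).sub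
    (ContDiffOn.sum fun l _ => (contDiffOn_christoffel hU hx hr l j k).smul (contDiffOn_pd hU hx l))

/-- Each derivative of the metric is a sum of two products of a second with a first derivative; in
Christoffel's combination only 2 ∂_k∂_j x · ∂_p x survives. -/
theorem christoffel_eq_sum (hU : IsOpen U) (hx : ContDiffOn ℂ ∞ x U) {u : Fin n → ℂ} (hu : u ∈ U)
    (l j k : Fin n) :
    christoffel x l j k u = ∑ p, (metric x u)⁻¹ l p * (pd k (pd j x) u ⬝ᵥ pd p x u) := by
  unfold christoffel
  refine Finset.sum_congr rfl fun p _ => ?_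
  have hd := fun i => (contDiffOn_pd hU hx i).differentiableAt_of_isOpen hU hu
  have h : ∀ i p q : Fin n, pd i (fun v => metric x v p q) u
      = pd i (pd p x) u ⬝ᵥ pd q x u + pd p x u ⬝ᵥ pd i (pd q x) u := fun i p q =>
    pd_dot (hd p) (hd q) i
  rw [h, h, h, pd_comm hU hx hu j k, pd_comm hU hx hu k p, pd_comm hU hx hu j p,
    dotProduct_comm (pd k x u), dotProduct_comm (pd j x u)]
  rw [dotProduct_comm (pd p (pd k x) u) (pd j x u)]
  rw [dotProduct_comm (pd j x u) (pd p (pd k x) u)]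
  ring

theorem sum_christoffel_mul_metric (hU : IsOpen U) (hx : ContDiffOn ℂ ∞ x U) (hr : IsRegular x U)
    {u : Fin n → ℂ} (hu : u ∈ U) (j k p : Fin n) :
    ∑ l, christoffel x l j k u * metric x u l p = pd k (pd j x) u ⬝ᵥ pd p x u := by
  have h1 : (fun l => christoffel x l j k u)
      = (metric x u)⁻¹ *ᵥ fun p => pd k (pd j x) u ⬝ᵥ pd p x u := by
    ext l
    rw [christoffel_eq_sum hU hx hu]
    rfl
  have h2 : metric x u *ᵥ (fun l => christoffel x l j k u)
      = fun p => pd k (pd j x) u ⬝ᵥ pd p x u := by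
    rw [h1, Matrix.mulVec_mulVec, Matrix.mul_nonsing_inv _ (isUnit_iff_ne_zero.mpr (hr u hu)),
      Matrix.one_mulVec]
  have h3 := congrFun h2 p
  rw [← h3, Matrix.mulVec, dotProduct]
  exact Finset.sum_congr rfl fun l _ => by rw [metric_symm, mul_comm]

theorem pd_pd_eq (x : (Fin n → ℂ) → (Fin m → ℂ)) (j k : Fin n) (u : Fin n → ℂ) :
    pd k (pd j x) u = ∑ l, christoffel x l j k u • pd l x u + secondForm x j k u := by
  rw [secondForm]; abel

theorem secondForm_dot_pd (hU : IsOpen U) (hx : ContDiffOn ℂ ∞ x U) (hr : IsRegular x U)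
    {u : Fin n → ℂ} (hu : u ∈ U) (j k p : Fin n) : secondForm x j k u ⬝ᵥ pd p x u = 0 := by
  rw [secondForm, sub_dotProduct, sum_dotProduct, ← sum_christoffel_mul_metric hU hx hr hu]
  simp [metric_apply]

theorem eq_zero_of_tangent {u : Fin n → ℂ} (hr : (metric x u).det ≠ 0) {c : Fin n → ℂ}
    (h : ∀ q, (∑ p, c p • pd p x u) ⬝ᵥ pd q x u = 0) : c = 0 := by
  have h1 : c ᵥ* metric x u = 0 := by
    ext q
    rw [Pi.zero_apply, ← h q, sum_dotProduct]
    simp only [Matrix.vecMul, dotProduct, metric_apply, Pi.smul_apply, smul_eq_mul,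
      Finset.mul_sum, mul_assoc]
  exact Matrix.eq_zero_of_vecMul_eq_zero hr h1

/-- A non-degenerate metric makes tangential and normal parts unique, so both can be read off any
explicit decomposition. This is how they are computed for concrete maps. -/
theorem christoffel_secondForm_unique (hU : IsOpen U) (hx : ContDiffOn ℂ ∞ x U)
    (hr : IsRegular x U) {u : Fin n → ℂ} (hu : u ∈ U) {j k : Fin n} {c : Fin n → ℂ}
    {ν : Fin m → ℂ} (h : pd k (pd j x) u = ∑ l, c l • pd l x u + ν)
    (hν : ∀ p, ν ⬝ᵥ pd p x u = 0) :
    (∀ l, christoffel x l j k u = c l) ∧ secondForm x j k u = ν := by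
  have h1 := pd_pd_eq x j k u
  have h2 : (fun l => christoffel x l j k u) - c = 0 := by
    refine eq_zero_of_tangent (hr u hu) fun q => ?_
    have h3 : ∑ p, ((fun l => christoffel x l j k u) - c) p • pd p x u
        = ν - secondForm x j k u := by
      simp only [Pi.sub_apply, sub_smul, Finset.sum_sub_distrib]
      rw [h1] at h
      linear_combination (norm := module) h
    rw [h3, sub_dotProduct, hν, secondForm_dot_pd hU hx hr hu, sub_zero]
  have h4 : ∀ l, christoffel x l j k u = c l := fun l => sub_eq_zero.mp (congrFun h2 l)
  refine ⟨h4, ?_⟩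
  rw [secondForm, h]
  simp [h4]

theorem christoffel_comm (hU : IsOpen U) (hx : ContDiffOn ℂ ∞ x U)
    {u : Fin n → ℂ} (hu : u ∈ U) (l j k : Fin n) :
    christoffel x l j k u = christoffel x l k j u := by
  rw [christoffel_eq_sum hU hx hu, christoffel_eq_sum hU hx hu, pd_comm hU hx hu]

theorem secondForm_comm (hU : IsOpen U) (hx : ContDiffOn ℂ ∞ x U)
    {u : Fin n → ℂ} (hu : u ∈ U) (j k : Fin n) :
    secondForm x j k u = secondForm x k j u := by
  simp only [secondForm, pd_comm hU hx hu j k, christoffel_comm hU hx hu _ j k]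

theorem christoffel_congr (hU : IsOpen U) {m' : ℕ} {x' : (Fin n → ℂ) → (Fin m' → ℂ)}
    (h : ∀ u ∈ U, metric x u = metric x' u) {u : Fin n → ℂ} (hu : u ∈ U) (l j k : Fin n) :
    christoffel x l j k u = christoffel x' l j k u := by
  have h' : ∀ i p q : Fin n, pd i (fun v => metric x v p q) u = pd i (fun v => metric x' v p q) u :=
    fun i p q => pd_congr hU (fun v hv => by rw [h v hv]) hu i
  simp only [christoffel, h u hu, h']

theorem pd_pd_dot_normal {u : Fin n → ℂ} {ν : Fin m → ℂ}
    (hν : ∀ p, ν ⬝ᵥ pd p x u = 0) (j k : Fin n) :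
    pd k (pd j x) u ⬝ᵥ ν = secondForm x j k u ⬝ᵥ ν := by
  rw [pd_pd_eq, add_dotProduct, sum_dotProduct]
  simp [dotProduct_comm _ ν, hν]

theorem pd_pd_dot_pd_pd (hU : IsOpen U) (hx : ContDiffOn ℂ ∞ x U) (hr : IsRegular x U)
    {u : Fin n → ℂ} (hu : u ∈ U) (j k p q : Fin n) :
    pd k (pd j x) u ⬝ᵥ pd q (pd p x) u
      = ∑ a, christoffel x a p q u * ∑ l, christoffel x l j k u * metric x u l a
        + secondForm x j k u ⬝ᵥ secondForm x p q u := by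
  conv_lhs => rw [pd_pd_eq x p q u]
  rw [dotProduct_add, dotProduct_sum]
  congr 1
  · refine Finset.sum_congr rfl fun a _ => ?_
    rw [sum_christoffel_mul_metric hU hx hr hu, dotProduct_smul, smul_eq_mul]
  · rw [pd_pd_dot_normal fun l => secondForm_dot_pd hU hx hr hu p q l]

section Conjugate

variable (hU : IsOpen U) (hx : ContDiffOn ℂ ∞ x U) (hr : IsRegular x U) (hc : IsConjugate x U)
include hU hx hr hc

omit hU hx hr in
theorem pd_pd_dot_normal_of_isConjugate {u : Fin n → ℂ} (hu : u ∈ U) {ν : Fin m → ℂ}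
    (hν : ∀ p, ν ⬝ᵥ pd p x u = 0) (j k : Fin n) :
    pd k (pd j x) u ⬝ᵥ ν = if j = k then secondForm x k k u ⬝ᵥ ν else 0 := by
  rw [pd_pd_dot_normal hν]
  split_ifs with h
  · rw [h]
  · rw [hc u hu j k h, zero_dotProduct]

omit hc in
theorem pd_pd_pd_eq (p j k : Fin n) {u : Fin n → ℂ} (hu : u ∈ U) :
    pd p (pd k (pd j x)) u = ∑ l, (pd p (christoffel x l j k) u • pd l x u
      + christoffel x l j k u • pd p (pd l x) u) + pd p (secondForm x j k) u := by
  have hd := fun i => (contDiffOn_pd hU hx i).differentiableAt_of_isOpen hU hu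
  have hΓ := fun l => (contDiffOn_christoffel hU hx hr l j k).differentiableAt_of_isOpen hU hu
  have hs := (contDiffOn_secondForm hU hx hr j k).differentiableAt_of_isOpen hU hu
  rw [pd_congr hU (fun v _ => pd_pd_eq x j k v) hu,
    pd_add (DifferentiableAt.fun_sum fun l _ => (hΓ l).fun_smul (hd l)) hs,
    pd_sum _ fun l _ => (hΓ l).fun_smul (hd l)]
  simp only [pd_smul (hΓ _) (hd _)]

/-- In a conjugate system ∂_p∂_l x has a normal component only for l = p, so the Christoffel sum
contributes a single term. -/
theorem pd_pd_pd_dot_normal (p j k : Fin n) {u : Fin n → ℂ} (hu : u ∈ U) {ν : Fin m → ℂ}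
    (hν : ∀ p, ν ⬝ᵥ pd p x u = 0) :
    pd p (pd k (pd j x)) u ⬝ᵥ ν
      = christoffel x p j k u * (secondForm x p p u ⬝ᵥ ν) + pd p (secondForm x j k) u ⬝ᵥ ν := by
  rw [pd_pd_pd_eq hU hx hr p j k hu, add_dotProduct, sum_dotProduct]
  congr 1
  have : ∀ l, pd l x u ⬝ᵥ ν = 0 := fun l => by rw [dotProduct_comm, hν]
  simp [add_dotProduct, this, pd_pd_dot_normal_of_isConjugate hc hu hν]

omit hx hr in
theorem pd_secondForm_eq_zero {j k : Fin n} (hjk : j ≠ k) (p : Fin n) {u : Fin n → ℂ}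
    (hu : u ∈ U) : pd p (secondForm x j k) u = 0 := by
  rw [pd_congr hU (g := fun _ => 0) (fun v hv => hc v hv j k hjk) hu]
  simp

/-- The Codazzi equations in a conjugate system. -/
theorem codazzi {j k : Fin n} (hjk : j ≠ k) {u : Fin n → ℂ} (hu : u ∈ U) {ν : Fin m → ℂ}
    (hν : ∀ p, ν ⬝ᵥ pd p x u = 0) :
    pd k (secondForm x j j) u ⬝ᵥ ν = christoffel x j j k u * (secondForm x j j u ⬝ᵥ ν)
      - christoffel x k j j u * (secondForm x k k u ⬝ᵥ ν) := by
  have h1 := pd_pd_pd_dot_normal hU hx hr hc k j j hu hν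
  have h2 := pd_pd_pd_dot_normal hU hx hr hc j j k hu hν
  rw [pd_secondForm_eq_zero hU hc hjk j hu, zero_dotProduct, add_zero] at h2
  rw [pd_comm hU (contDiffOn_pd hU hx j) hu, h2] at h1
  linear_combination -h1

/-- The mixed second forms vanish together with their derivatives, so in ∂_l∂_k∂_j x = ∂_k∂_l∂_j x
the normal part of each side is one term. The difference of the two terms is both tangent and
normal, hence zero. -/
theorem codazzi_distinct {j k l : Fin n} (hjk : j ≠ k) (hjl : j ≠ l)
    {u : Fin n → ℂ} (hu : u ∈ U) :
    christoffel x l j k u • secondForm x l l u = christoffel x k j l u • secondForm x k k u := by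
  have h1 := pd_pd_pd_eq hU hx hr l j k hu
  have h2 := pd_pd_pd_eq hU hx hr k j l hu
  rw [pd_secondForm_eq_zero hU hc hjk l hu] at h1
  rw [pd_secondForm_eq_zero hU hc hjl k hu, pd_comm hU (contDiffOn_pd hU hx j) hu, h1] at h2
  have hII : ∀ (c : Fin n → ℂ) (p : Fin n), ∑ q, c q • pd p (pd q x) u
      = ∑ a, (∑ q, c q * christoffel x a q p u) • pd a x u + c p • secondForm x p p u := by
    intro c p
    simp only [pd_pd_eq x _ p u, smul_add, Finset.sum_add_distrib, Finset.smul_sum, smul_smul,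
      Finset.sum_smul]
    congr 1
    · rw [Finset.sum_comm]
    · rw [Finset.sum_eq_single p]
      · intro q _ hq; rw [hc u hu q p hq, smul_zero]
      · simp
  simp only [Finset.sum_add_distrib, hII] at h2
  set w := christoffel x l j k u • secondForm x l l u - christoffel x k j l u • secondForm x k k u
    with hw
  have h3 : w = ∑ a, ((pd k (christoffel x a j l) u + ∑ q, christoffel x q j l u *
      christoffel x a q k u) - (pd l (christoffel x a j k) u + ∑ q, christoffel x q j k u *
      christoffel x a q l u)) • pd a x u := by
    simp only [sub_smul, add_smul, Finset.sum_sub_distrib, Finset.sum_add_distrib, hw]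
    linear_combination (norm := module) h2
  have h4 := eq_zero_of_tangent (hr u hu) (fun q => by
    rw [← h3, hw, sub_dotProduct, smul_dotProduct, smul_dotProduct,
      secondForm_dot_pd hU hx hr hu, secondForm_dot_pd hU hx hr hu]
    simp)
  have h5 : w = 0 := by
    rw [h3]
    exact Finset.sum_eq_zero fun a _ => by rw [congrFun h4 a, Pi.zero_apply, zero_smul]
  exact sub_eq_zero.mp h5

omit hc in
/-- Gauss: the curvature is determined by the linear element. -/
theorem pd_pd_dot_sub (j k : Fin n) {u : Fin n → ℂ} (hu : u ∈ U) :
    pd j (pd j x) u ⬝ᵥ pd k (pd k x) u - pd k (pd j x) u ⬝ᵥ pd k (pd j x) u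
      = pd j (fun v => ∑ l, christoffel x l k k v * metric x v l j) u
        - pd k (fun v => ∑ l, christoffel x l j k v * metric x v l j) u := by
  have hd := fun i => (contDiffOn_pd hU hx i).differentiableAt_of_isOpen hU hu
  have hd2 := fun i l => (contDiffOn_pd hU (contDiffOn_pd hU hx i) l).differentiableAt_of_isOpen hU hu
  rw [pd_congr hU (fun v hv => sum_christoffel_mul_metric hU hx hr hv k k j) hu,
    pd_congr hU (fun v hv => sum_christoffel_mul_metric hU hx hr hv j k j) hu,
    pd_dot (hd2 k k) (hd j), pd_dot (hd2 j k) (hd j),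
    pd_comm hU (contDiffOn_pd hU hx k) hu j k, pd_congr hU (fun v hv => pd_comm hU hx hv j k) hu]
  rw [dotProduct_comm (pd j (pd j x) u)]
  ring

end Conjugate

/-- The Gauss equation for a pair of isometric maps with a common conjugate system. -/
theorem secondForm_dot_eq {m' : ℕ} {x' : (Fin n → ℂ) → (Fin m' → ℂ)} (hU : IsOpen U)
    (hx : ContDiffOn ℂ ∞ x U) (hr : IsRegular x U) (hc : IsConjugate x U)
    (hx' : ContDiffOn ℂ ∞ x' U) (hc' : IsConjugate x' U)
    (h : ∀ u ∈ U, metric x' u = metric x u) {j k : Fin n} (hjk : j ≠ k) {u : Fin n → ℂ}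
    (hu : u ∈ U) :
    secondForm x' j j u ⬝ᵥ secondForm x' k k u = secondForm x j j u ⬝ᵥ secondForm x k k u := by
  have hr' : IsRegular x' U := fun v hv => by rw [h v hv]; exact hr v hv
  have hΓ := fun v (hv : v ∈ U) l j k => christoffel_congr hU h hv l j k
  have g1 := pd_pd_dot_sub hU hx hr j k hu
  have g2 := pd_pd_dot_sub hU hx' hr' j k hu
  rw [pd_congr hU (f := fun v => ∑ l, christoffel x' l k k v * metric x' v l j)
      (g := fun v => ∑ l, christoffel x l k k v * metric x v l j)
      (fun v hv => by simp only [hΓ v hv, h v hv]) hu,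
    pd_congr hU (f := fun v => ∑ l, christoffel x' l j k v * metric x' v l j)
      (g := fun v => ∑ l, christoffel x l j k v * metric x v l j)
      (fun v hv => by simp only [hΓ v hv, h v hv]) hu, ← g1,
    pd_pd_dot_pd_pd hU hx' hr' hu, pd_pd_dot_pd_pd hU hx' hr' hu, pd_pd_dot_pd_pd hU hx hr hu,
    pd_pd_dot_pd_pd hU hx hr hu, hc u hu j k hjk, hc' u hu j k hjk] at g2
  simp only [hΓ u hu, h u hu, zero_dotProduct] at g2
  linear_combination g2

end Surface

/-! ### Frames with invertible Gram matrix -/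

section Gram

variable {κ ι : Type} [Fintype κ] [Fintype ι] [DecidableEq κ] [DecidableEq ι]

/-- Mᵀ(MMᵀ)⁻¹ is a right inverse, hence a left inverse by equality of dimensions. The index types
differ because frames indexed by `Fin n ⊕ Fin n` take values in `Unit ⊕ Fin (2 * n - 1) → ℂ`. -/
theorem gram_inv_mul (M : Matrix κ ι ℂ) (hcard : Fintype.card κ = Fintype.card ι)
    (hG : (M * Mᵀ).det ≠ 0) : Mᵀ * (M * Mᵀ)⁻¹ * M = 1 := by
  have h1 : M * (Mᵀ * (M * Mᵀ)⁻¹) = 1 := by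
    rw [← Matrix.mul_assoc, Matrix.mul_nonsing_inv _ (isUnit_iff_ne_zero.mpr hG)]
  exact (Matrix.mul_eq_one_comm_of_card_eq _ _ _ hcard).mp h1

theorem eq_zero_of_forall_dot {v : κ → ι → ℂ} (hcard : Fintype.card κ = Fintype.card ι)
    (hG : (Matrix.of v * (Matrix.of v)ᵀ).det ≠ 0) {w : ι → ℂ} (h : ∀ k, w ⬝ᵥ v k = 0) :
    w = 0 := by
  have h1 : Matrix.of v *ᵥ w = 0 := by
    ext k
    simpa [Matrix.mulVec, dotProduct_comm] using h k
  rw [← Matrix.one_mulVec w, ← gram_inv_mul _ hcard hG, ← Matrix.mulVec_mulVec, h1,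
    Matrix.mulVec_zero]

end Gram

/-- A holomorphic immersion with non-degenerate linear element, parametrized by a conjugate
system. -/
structure IsConjugateNet {n m : ℕ} (x : (Fin n → ℂ) → (Fin m → ℂ)) (U : Set (Fin n → ℂ)) :
    Prop where
  holo : ContDiffOn ℂ ∞ x U
  regular : IsRegular x U
  conjugate : IsConjugate x U

/-! ### Deformations, unit normals and the joined frame -/

section Deformation

variable {n : ℕ} {U : Set (Fin n → ℂ)} {x₀ N₀ : (Fin n → ℂ) → (Fin (n + 1) → ℂ)}
  {x : (Fin n → ℂ) → (Fin (2 * n - 1) → ℂ)}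

theorem IsConjugateQuadric.isConjugateNet (h : IsConjugateQuadric x₀ U) : IsConjugateNet x₀ U :=
  ⟨h.holo, h.regular, h.conjugate⟩

theorem IsDeformation.isConjugateNet (h : IsDeformation x₀ U x) (hx₀ : IsConjugateNet x₀ U) :
    IsConjugateNet x U :=
  ⟨h.holo, fun u hu => by rw [h.isometric u hu]; exact hx₀.regular u hu, h.conjugate⟩

theorem IsDeformation.christoffel_eq (h : IsDeformation x₀ U x) (hU : IsOpen U)
    {u : Fin n → ℂ} (hu : u ∈ U) (l j k : Fin n) :
    christoffel x l j k u = christoffel x₀ l j k u := christoffel_congr hU h.isometric hu l j k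

/-- The three-index Codazzi equations of `x₀` and `x` have the same coefficients, so together they
are one linear relation between the joined pairs of index k and l. -/
theorem IsDeformation.christoffel_eq_zero (h : IsDeformation x₀ U x) (hx₀ : IsConjugateNet x₀ U)
    (hU : IsOpen U) {u : Fin n → ℂ} (hu : u ∈ U) {j k l : Fin n} (hjk : j ≠ k) (hjl : j ≠ l)
    (hkl : k ≠ l) : christoffel x₀ l j k u = 0 := by
  have hx := h.isConjugateNet hx₀
  have e1 := codazzi_distinct hU hx₀.holo hx₀.regular hx₀.conjugate hjk hjl hu
  have e2 := codazzi_distinct hU hx.holo hx.regular hx.conjugate hjk hjl hu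
  rw [h.christoffel_eq hU hu, h.christoffel_eq hU hu] at e2
  have hli := Fintype.linearIndependent_iff.mp (h.nondegenerate u hu)
    (Pi.single l (christoffel x₀ l j k u) - Pi.single k (christoffel x₀ k j l u)) (by
      simp only [Pi.sub_apply, sub_smul, Finset.sum_sub_distrib, Pi.single_apply, ite_smul,
        zero_smul, Finset.sum_ite_eq', Finset.mem_univ, if_true]
      rw [sub_eq_zero]
      exact Prod.ext e1 e2) l
  simpa [hkl.symm] using hli

/-! ### Hypersurfaces -/

/-- The unit normal and the tangent vectors have Gram matrix 1 ⊕ g, so no nonzero vector is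
orthogonal to all of them. -/
theorem eq_smul_unitNormal (hr : IsRegular x₀ U) (hN : IsUnitNormal x₀ N₀ U) {u : Fin n → ℂ}
    (hu : u ∈ U) {ν : Fin (n + 1) → ℂ} (hν : ∀ p, ν ⬝ᵥ pd p x₀ u = 0) :
    ν = (N₀ u ⬝ᵥ ν) • N₀ u := by
  set v : Unit ⊕ Fin n → Fin (n + 1) → ℂ := Sum.elim (fun _ => N₀ u) fun j => pd j x₀ u with hv
  have hG : Matrix.of v * (Matrix.of v)ᵀ = Matrix.fromBlocks 1 0 0 (metric x₀ u) := by
    ext a b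
    have : (Matrix.of v * (Matrix.of v)ᵀ) a b = v a ⬝ᵥ v b := rfl
    rw [this]
    rcases a with a | a <;> rcases b with b | b
    · simp [hv, hN.unit u hu]
    · simp [hv, hN.normal u hu]
    · simp [hv, hN.normal u hu, dotProduct_comm]
    · simp [hv, metric_apply]
  rw [← sub_eq_zero]
  refine eq_zero_of_forall_dot (v := v) (by simp [add_comm]) ?_ fun k => ?_
  · rw [hG, Matrix.det_fromBlocks_zero₂₁]
    simpa using hr u hu
  · rcases k with k | k
    · simp [hv, hN.unit u hu, dotProduct_comm]
    · simp [hv, hν, hN.normal u hu]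

section Normal

variable (hU : IsOpen U) (hx₀ : IsConjugateNet x₀ U) (hN : IsUnitNormal x₀ N₀ U)
include hU hx₀ hN

omit hU hx₀ in
theorem h₀_eq_secondForm_dot {u : Fin n → ℂ} (hu : u ∈ U) (j : Fin n) :
    h₀ x₀ N₀ j u = secondForm x₀ j j u ⬝ᵥ N₀ u := by
  rw [h₀, dotProduct_comm, pd_pd_dot_normal (hN.normal u hu)]

theorem secondForm_eq_h₀_smul {u : Fin n → ℂ} (hu : u ∈ U) (j : Fin n) :
    secondForm x₀ j j u = h₀ x₀ N₀ j u • N₀ u := by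
  conv_lhs => rw [eq_smul_unitNormal hx₀.regular hN hu
    (fun p => secondForm_dot_pd hU hx₀.holo hx₀.regular hu j j p)]
  rw [h₀_eq_secondForm_dot hN hu, dotProduct_comm]

theorem secondForm_dot_secondForm {u : Fin n → ℂ} (hu : u ∈ U) (j k : Fin n) :
    secondForm x₀ j j u ⬝ᵥ secondForm x₀ k k u = h₀ x₀ N₀ j u * h₀ x₀ N₀ k u := by
  rw [secondForm_eq_h₀_smul hU hx₀ hN hu, secondForm_eq_h₀_smul hU hx₀ hN hu, smul_dotProduct,
    dotProduct_smul, hN.unit u hu]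
  simp

theorem contDiffOn_h₀ (j : Fin n) : ContDiffOn ℂ ∞ (h₀ x₀ N₀ j) U :=
  hN.holo.dotProduct (contDiffOn_pd hU (contDiffOn_pd hU hx₀.holo j) j)

omit hx₀ in
theorem unitNormal_dot_pd {u : Fin n → ℂ} (hu : u ∈ U) (k : Fin n) :
    N₀ u ⬝ᵥ pd k N₀ u = 0 := by
  have hd := hN.holo.differentiableAt_of_isOpen hU hu
  have h1 := pd_dot hd hd k
  rw [pd_congr hU hN.unit hu, pd_const, dotProduct_comm (pd k N₀ u)] at h1
  linear_combination -h1 / 2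

/-- Codazzi paired with the unit normal. The derivative of the normal does not contribute, since the
second form is a multiple of N₀ and N₀ · ∂_k N₀ = 0. -/
theorem pd_h₀ {j k : Fin n} (hjk : j ≠ k) {u : Fin n → ℂ} (hu : u ∈ U) :
    pd k (h₀ x₀ N₀ j) u
      = christoffel x₀ j j k u * h₀ x₀ N₀ j u - christoffel x₀ k j j u * h₀ x₀ N₀ k u := by
  have hs := (contDiffOn_secondForm hU hx₀.holo hx₀.regular j j).differentiableAt_of_isOpen hU hu
  have hd := hN.holo.differentiableAt_of_isOpen hU hu
  rw [pd_congr hU (fun v hv => h₀_eq_secondForm_dot hN hv j) hu, pd_dot hs hd,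
    codazzi hU hx₀.holo hx₀.regular hx₀.conjugate hjk hu (hN.normal u hu),
    ← h₀_eq_secondForm_dot hN hu, ← h₀_eq_secondForm_dot hN hu,
    secondForm_eq_h₀_smul hU hx₀ hN hu, smul_dotProduct, unitNormal_dot_pd hU hN hu]
  simp

/-! ### The joined second fundamental form -/

theorem contDiffOn_joinedSq (h : IsDeformation x₀ U x) (j : Fin n) :
    ContDiffOn ℂ ∞ (joinedSq x₀ N₀ x j) U := by
  have hs := contDiffOn_secondForm hU h.holo (h.isConjugateNet hx₀).regular j j
  exact ((contDiffOn_h₀ hU hx₀ hN j).pow 2).neg.add (hs.dotProduct hs)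

/-- For different indices this is the Gauss equation. It says that the joined vectors h_j and h_k
are orthogonal, on which the whole correspondence rests. -/
theorem secondForm_dot_eq_h₀ (h : IsDeformation x₀ U x) {u : Fin n → ℂ} (hu : u ∈ U)
    (j k : Fin n) : secondForm x j j u ⬝ᵥ secondForm x k k u
      = (if j = k then joinedSq x₀ N₀ x j u else 0) + h₀ x₀ N₀ j u * h₀ x₀ N₀ k u := by
  split_ifs with hjk
  · rw [joinedSq, ← hjk]; ring
  · rw [secondForm_dot_eq hU hx₀.holo hx₀.regular hx₀.conjugate h.holo h.conjugate h.isometric hjk hu,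
      secondForm_dot_secondForm hU hx₀ hN hu, zero_add]

/-- Codazzi for `x` and for `x₀` both contain a term with Γ^k_{jj}. After pairing with h_j these
terms combine into a multiple of h_j · h_k and vanish. -/
theorem pd_joinedSq (h : IsDeformation x₀ U x) {j k : Fin n} (hjk : j ≠ k) {u : Fin n → ℂ}
    (hu : u ∈ U) :
    pd k (joinedSq x₀ N₀ x j) u = 2 * christoffel x₀ j j k u * joinedSq x₀ N₀ x j u := by
  have hx := h.isConjugateNet hx₀
  have hs := (contDiffOn_secondForm hU hx.holo hx.regular j j).differentiableAt_of_isOpen hU hu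
  have hh := (contDiffOn_h₀ hU hx₀ hN j).differentiableAt_of_isOpen hU hu
  have e := codazzi hU hx.holo hx.regular hx.conjugate hjk hu
    (fun p => secondForm_dot_pd hU hx.holo hx.regular hu j j p)
  rw [h.christoffel_eq hU hu, h.christoffel_eq hU hu, secondForm_dot_eq_h₀ hU hx₀ hN h hu k j,
    secondForm_dot_eq_h₀ hU hx₀ hN h hu j j, if_neg hjk.symm, if_pos rfl] at e
  unfold joinedSq
  rw [pd_add (hh.fun_pow 2).fun_neg (hs.dotProduct hs), pd_neg, pd_sq hh, pd_dot hs hs,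
    dotProduct_comm (secondForm x j j u), e, pd_h₀ hU hx₀ hN hjk hu]
  rw [secondForm_dot_eq_h₀ hU hx₀ hN h hu j j, if_pos rfl]
  ring

/-- The tangent vectors of `x` and the joined normal vectors. -/
noncomputable def joinedFrame (x₀ N₀ : (Fin n → ℂ) → (Fin (n + 1) → ℂ))
    (x : (Fin n → ℂ) → (Fin (2 * n - 1) → ℂ)) : Fin n ⊕ Fin n → (Fin n → ℂ) →
    (Unit ⊕ Fin (2 * n - 1) → ℂ)
  | Sum.inl j => fun u => Sum.elim 0 (pd j x u)
  | Sum.inr j => fun u => Sum.elim (fun _ => Complex.I * h₀ x₀ N₀ j u) (secondForm x j j u)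

/-- The imaginary extra coordinate subtracts exactly the product h_j^0 h_k^0 that the Gauss equation
leaves over. -/
theorem joinedFrame_dot (h : IsDeformation x₀ U x) {u : Fin n → ℂ} (hu : u ∈ U)
    (b c : Fin n ⊕ Fin n) : joinedFrame x₀ N₀ x b u ⬝ᵥ joinedFrame x₀ N₀ x c u
      = Matrix.fromBlocks (metric x₀ u) 0 0 (Matrix.diagonal fun j => joinedSq x₀ N₀ x j u) b c := by
  have hx := h.isConjugateNet hx₀
  have ht := fun j k => secondForm_dot_pd hU hx.holo hx.regular hu j j k
  rcases b with j | j <;> rcases c with k | k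
  · simp [joinedFrame, ← h.isometric u hu, metric_apply]
  · simp [joinedFrame, dotProduct_comm, ht]
  · simp [joinedFrame, ht]
  · simp only [joinedFrame, sumElim_dotProduct_sumElim, Matrix.fromBlocks_apply₂₂,
      Matrix.diagonal_apply, secondForm_dot_eq_h₀ hU hx₀ hN h hu]
    simp only [dotProduct, Finset.univ_unique, Finset.sum_singleton]
    linear_combination (h₀ x₀ N₀ j u * h₀ x₀ N₀ k u) * Complex.I_mul_I

end Normal

end Deformation

/-! ### Deformations give solutions, and are determined by them up to rigid motions -/

section Uniqueness

variable {n : ℕ} {U : Set (Fin n → ℂ)} {x₀ N₀ : (Fin n → ℂ) → (Fin (n + 1) → ℂ)}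
  {x x' : (Fin n → ℂ) → (Fin (2 * n - 1) → ℂ)} (hU : IsOpen U) (hx₀ : IsConjugateNet x₀ U)
  (hN : IsUnitNormal x₀ N₀ U)

theorem card_joinedFrame (j : Fin n) :
    Fintype.card (Fin n ⊕ Fin n) = Fintype.card (Unit ⊕ Fin (2 * n - 1)) := by
  have := j.pos
  simp
  omega

include hU hx₀ hN

/-- Tangential and normal parts of a relation separate. Since the second form of `x₀` is h_j^0 N₀,
the extra coordinate carries the same information as the first member of the joined pairs. -/
theorem linearIndependent_joinedFrame (h : IsDeformation x₀ U x) {u : Fin n → ℂ} (hu : u ∈ U) :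
    LinearIndependent ℂ fun b => joinedFrame x₀ N₀ x b u := by
  have hx := h.isConjugateNet hx₀
  rw [Fintype.linearIndependent_iff]
  intro g hg
  have h2 : (∑ j, g (Sum.inl j) • pd j x u) + ∑ j, g (Sum.inr j) • secondForm x j j u = 0 := by
    ext p
    have := congrFun hg (Sum.inr p)
    simpa [joinedFrame, Finset.sum_apply] using this
  have h1 : ∑ j, g (Sum.inr j) * h₀ x₀ N₀ j u = 0 := by
    have := congrFun hg (Sum.inl ())
    simp only [joinedFrame, Finset.sum_apply, Fintype.sum_sum_type, Pi.smul_apply, Sum.elim_inl,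
      smul_eq_mul, Pi.zero_apply, mul_zero, Finset.sum_const_zero, zero_add] at this
    rw [← mul_right_inj' Complex.I_ne_zero, mul_zero, ← this, Finset.mul_sum]
    exact Finset.sum_congr rfl fun j _ => by ring
  have h3 : (fun j => g (Sum.inl j)) = 0 := by
    refine eq_zero_of_tangent (hx.regular u hu) fun q => ?_
    have := congrArg (fun v => v ⬝ᵥ pd q x u) h2
    simpa [add_dotProduct, sum_dotProduct, secondForm_dot_pd hU hx.holo hx.regular hu] using this
  have h4 : ∑ j, g (Sum.inr j) • secondForm x j j u = 0 := by
    have h5 : ∀ j, g (Sum.inl j) = 0 := congrFun h3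
    simpa [h5] using h2
  have h5 := Fintype.linearIndependent_iff.mp (h.nondegenerate u hu) (fun j => g (Sum.inr j)) (by
    refine Prod.ext ?_ ?_
    · rw [Prod.fst_sum]
      simp only [Prod.smul_fst, secondForm_eq_h₀_smul hU hx₀ hN hu, smul_smul, ← Finset.sum_smul,
        h1, zero_smul, Prod.fst_zero]
    · rw [Prod.snd_sum]
      simpa using h4)
  rintro (j | j)
  · exact congrFun h3 j
  · exact h5 j

/-- The frame consists of 2n independent vectors in dimension 2n. An isotropic h_j would be
orthogonal to all of them, itself included. -/
theorem joinedSq_ne_zero (h : IsDeformation x₀ U x) {u : Fin n → ℂ} (hu : u ∈ U) (j : Fin n) :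
    joinedSq x₀ N₀ x j u ≠ 0 := by
  intro h0
  have hli := linearIndependent_joinedFrame hU hx₀ hN h hu
  have hspan := hli.span_eq_top_of_card_eq_finrank' (by
    rw [Module.finrank_fintype_fun_eq_card, card_joinedFrame j])
  have hz : ∀ w, joinedFrame x₀ N₀ x (Sum.inr j) u ⬝ᵥ w = 0 := by
    intro w
    have hw : w ∈ Submodule.span ℂ (Set.range fun b => joinedFrame x₀ N₀ x b u) := by
      rw [hspan]; trivial
    induction hw using Submodule.span_induction with
    | mem w hw =>
      obtain ⟨b, rfl⟩ := hw
      rw [joinedFrame_dot hU hx₀ hN h hu]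
      rcases b with b | b
      · simp
      · simp [Matrix.diagonal_apply, h0]
    | zero => simp
    | add a b _ _ ha hb => rw [dotProduct_add, ha, hb, add_zero]
    | smul c a _ ha => rw [dotProduct_smul, ha, smul_zero]
  exact hli.ne_zero (Sum.inr j) (dotProduct_eq_zero _ hz)

theorem det_joinedGram_ne_zero (h : IsDeformation x₀ U x) {u : Fin n → ℂ} (hu : u ∈ U) :
    (Matrix.fromBlocks (metric x₀ u) 0 0
      (Matrix.diagonal fun j => joinedSq x₀ N₀ x j u)).det ≠ 0 := by
  rw [Matrix.det_fromBlocks_zero₂₁, Matrix.det_diagonal]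
  exact mul_ne_zero (hx₀.regular u hu)
    (Finset.prod_ne_zero_iff.mpr fun j _ => joinedSq_ne_zero hU hx₀ hN h hu j)

theorem joinedFrame_mul_transpose (h : IsDeformation x₀ U x) {u : Fin n → ℂ} (hu : u ∈ U) :
    (Matrix.of fun b => joinedFrame x₀ N₀ x b u) * (Matrix.of fun b => joinedFrame x₀ N₀ x b u)ᵀ
      = Matrix.fromBlocks (metric x₀ u) 0 0 (Matrix.diagonal fun j => joinedSq x₀ N₀ x j u) := by
  ext b c
  rw [← joinedFrame_dot hU hx₀ hN h hu]
  rfl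

theorem eq_zero_of_forall_dot_joinedFrame (h : IsDeformation x₀ U x) {u : Fin n → ℂ} (hu : u ∈ U)
    (j : Fin n) {w : Unit ⊕ Fin (2 * n - 1) → ℂ} (hw : ∀ b, w ⬝ᵥ joinedFrame x₀ N₀ x b u = 0) :
    w = 0 :=
  eq_zero_of_forall_dot (v := fun b => joinedFrame x₀ N₀ x b u) (card_joinedFrame j)
    (by rw [joinedFrame_mul_transpose hU hx₀ hN h hu]; exact det_joinedGram_ne_zero hU hx₀ hN h hu)
    hw

/-- The unit vector e of the extra coordinate is orthogonal to the tangent vectors, so e = ∑ (i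
h_j^0 / |h_j|²) h_j. The equation is e · e = 1 in this expansion. -/
theorem sum_sq_div_joinedSq (hn : 0 < n) (h : IsDeformation x₀ U x) {u : Fin n → ℂ} (hu : u ∈ U) :
    ∑ j, h₀ x₀ N₀ j u ^ 2 / joinedSq x₀ N₀ x j u + 1 = 0 := by
  set e : Unit ⊕ Fin (2 * n - 1) → ℂ := Pi.single (Sum.inl ()) 1 with he
  have hd : ∀ j, e ⬝ᵥ joinedFrame x₀ N₀ x (Sum.inr j) u = Complex.I * h₀ x₀ N₀ j u := fun j => by
    simp [he, joinedFrame]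
  have hJ := fun j => joinedSq_ne_zero hU hx₀ hN h hu j
  have h1 : e - ∑ j, (Complex.I * h₀ x₀ N₀ j u / joinedSq x₀ N₀ x j u) •
      joinedFrame x₀ N₀ x (Sum.inr j) u = 0 := by
    refine eq_zero_of_forall_dot_joinedFrame hU hx₀ hN h hu ⟨0, hn⟩ fun b => ?_
    simp only [sub_dotProduct, sum_dotProduct, smul_dotProduct, joinedFrame_dot hU hx₀ hN h hu]
    rcases b with b | b
    · simp [he, joinedFrame]
    · rw [hd]
      simp [Matrix.diagonal_apply, div_mul_cancel₀ _ (hJ b)]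
  have h2 := congrArg (fun v => e ⬝ᵥ v) (sub_eq_zero.mp h1)
  simp only [dotProduct_sum, dotProduct_smul, hd, smul_eq_mul] at h2
  have h3 : e ⬝ᵥ e = 1 := by simp [he]
  rw [h3] at h2
  rw [h2, ← Finset.sum_add_distrib]
  refine Finset.sum_eq_zero fun j _ => ?_
  field_simp [hJ j]
  rw [Complex.I_sq]
  ring

/-- The solution attached to a deformation. -/
theorem IsDeformation.exists_isSolution (hc : Convex ℝ U) (hn : 0 < n) (h : IsDeformation x₀ U x) :
    ∃ a, IsSolution x₀ N₀ U a ∧ ∀ u ∈ U, ∀ j, a j u ^ 2 = joinedSq x₀ N₀ x j u := by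
  choose a ha ha2 using fun j => exists_sqrt hU hc (contDiffOn_joinedSq hU hx₀ hN h j)
    fun u hu => joinedSq_ne_zero hU hx₀ hN h hu j
  have hne : ∀ j, ∀ u ∈ U, a j u ≠ 0 := fun j u hu h0 =>
    joinedSq_ne_zero hU hx₀ hN h hu j (by rw [← ha2 j u hu, h0]; simp)
  refine ⟨a, ⟨ha, hne, fun u hu j k hjk => ?_, fun u hu => ?_⟩, fun u hu j => ha2 j u hu⟩
  · have e := pd_joinedSq hU hx₀ hN h hjk hu
    rw [← ha2 j u hu, ← pd_congr hU (ha2 j) hu,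
      pd_sq ((ha j).differentiableAt_of_isOpen hU hu)] at e
    have := hne j u hu
    field_simp
    have h2 : 2 * a j u ≠ 0 := by simpa using this
    exact mul_left_cancel₀ h2 (by rw [e]; ring)
  · rw [← sum_sq_div_joinedSq hU hx₀ hN hn h hu]
    simp only [ha2 _ u hu]

theorem contDiffOn_joinedFrame (h : IsDeformation x₀ U x) (b : Fin n ⊕ Fin n) : ContDiffOn ℂ ∞ (joinedFrame x₀ N₀ x b) U := by
  have hx := h.isConjugateNet hx₀
  rw [contDiffOn_pi]
  rcases b with j | j <;> rintro (i | i)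
  · exact contDiffOn_const
  · exact contDiffOn_pi.mp (contDiffOn_pd hU hx.holo j) i
  · exact contDiffOn_const.mul (contDiffOn_h₀ hU hx₀ hN j)
  · exact contDiffOn_pi.mp (contDiffOn_secondForm hU hx.holo hx.regular j j) i

omit hU hx₀ hN in
theorem pd_sumElim {ι κ : Type} [Fintype ι] [Fintype κ] {f : (Fin n → ℂ) → ι → ℂ}
    {g : (Fin n → ℂ) → κ → ℂ} {u : Fin n → ℂ} (hf : DifferentiableAt ℂ f u)
    (hg : DifferentiableAt ℂ g u) (k : Fin n) :
    pd k (fun v => Sum.elim (f v) (g v)) u = Sum.elim (pd k f u) (pd k g u) := by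
  have hd : DifferentiableAt ℂ (fun v => Sum.elim (f v) (g v)) u := by
    rw [differentiableAt_pi]
    rintro (i | i)
    · exact differentiableAt_pi.mp hf i
    · exact differentiableAt_pi.mp hg i
  ext (i | i)
  · rw [← pd_apply hd]; exact pd_apply hf k i
  · rw [← pd_apply hd]; exact pd_apply hg k i

omit hN in
theorem pd_joinedFrame_inl (h : IsDeformation x₀ U x) {u : Fin n → ℂ} (hu : u ∈ U) (j k : Fin n) :
    pd k (joinedFrame x₀ N₀ x (Sum.inl j)) u
      = Sum.elim (0 : Unit → ℂ) (pd k (pd j x) u) := by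
  have hx := h.isConjugateNet hx₀
  have := pd_sumElim (f := fun _ : Fin n → ℂ => (0 : Unit → ℂ)) (differentiableAt_const _)
    ((contDiffOn_pd hU hx.holo j).differentiableAt_of_isOpen hU hu) k
  rw [pd_const] at this
  exact this

theorem pd_joinedFrame_inr (h : IsDeformation x₀ U x) {u : Fin n → ℂ} (hu : u ∈ U) (j k : Fin n) :
    pd k (joinedFrame x₀ N₀ x (Sum.inr j)) u
      = Sum.elim (fun _ => Complex.I * pd k (h₀ x₀ N₀ j) u) (pd k (secondForm x j j) u) := by
  have hx := h.isConjugateNet hx₀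
  have hh := (contDiffOn_h₀ hU hx₀ hN j).differentiableAt_of_isOpen hU hu
  have hd : DifferentiableAt ℂ (fun v (_ : Unit) => Complex.I * h₀ x₀ N₀ j v) u := by
    rw [differentiableAt_pi]
    exact fun _ => hh.const_mul _
  have e : pd k (fun v (_ : Unit) => Complex.I * h₀ x₀ N₀ j v) u
      = fun _ => Complex.I * pd k (h₀ x₀ N₀ j) u := by
    ext i
    rw [← pd_apply hd, pd_mul (differentiableAt_const _) hh]
    simp
  rw [← e]
  exact pd_sumElim hd
    ((contDiffOn_secondForm hU hx.holo hx.regular j j).differentiableAt_of_isOpen hU hu) k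

theorem joinedFrame_inr_dot_pd (h : IsDeformation x₀ U x) {u : Fin n → ℂ} (hu : u ∈ U)
    {j k : Fin n} (hjk : j ≠ k) (i : Fin n) :
    joinedFrame x₀ N₀ x (Sum.inr i) u ⬝ᵥ pd k (joinedFrame x₀ N₀ x (Sum.inr j)) u
      = christoffel x₀ j j k u * (if i = j then joinedSq x₀ N₀ x i u else 0)
        - christoffel x₀ k j j u * (if i = k then joinedSq x₀ N₀ x i u else 0) := by
  have hx := h.isConjugateNet hx₀
  rw [pd_joinedFrame_inr hU hx₀ hN h hu, joinedFrame, sumElim_dotProduct_sumElim,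
    dotProduct_comm (secondForm x i i u),
    codazzi hU hx.holo hx.regular hx.conjugate hjk hu
      (fun p => secondForm_dot_pd hU hx.holo hx.regular hu i i p),
    h.christoffel_eq hU hu, h.christoffel_eq hU hu, dotProduct_comm _ (secondForm x i i u),
    dotProduct_comm _ (secondForm x i i u), secondForm_dot_eq_h₀ hU hx₀ hN h hu,
    secondForm_dot_eq_h₀ hU hx₀ hN h hu, pd_h₀ hU hx₀ hN hjk hu]
  simp only [dotProduct, Finset.univ_unique, Finset.sum_singleton]
  linear_combination (h₀ x₀ N₀ i u * (christoffel x₀ j j k u * h₀ x₀ N₀ j u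
    - christoffel x₀ k j j u * h₀ x₀ N₀ k u)) * Complex.I_mul_I

/-- The products of the frame vectors with the derivatives of frame vectors depend only on the
linear element and on the squares `|h_j|²`. -/
theorem joinedFrame_dot_pd_congr (h : IsDeformation x₀ U x) (h' : IsDeformation x₀ U x')
    (hJ : ∀ u ∈ U, ∀ j, joinedSq x₀ N₀ x j u = joinedSq x₀ N₀ x' j u) {u : Fin n → ℂ} (hu : u ∈ U)
    (k : Fin n) (b c : Fin n ⊕ Fin n) :
    joinedFrame x₀ N₀ x b u ⬝ᵥ pd k (joinedFrame x₀ N₀ x c) u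
      = joinedFrame x₀ N₀ x' b u ⬝ᵥ pd k (joinedFrame x₀ N₀ x' c) u := by
  have hx := h.isConjugateNet hx₀
  have hx' := h'.isConjugateNet hx₀
  have hd : ∀ b, DifferentiableAt ℂ (joinedFrame x₀ N₀ x b) u := fun b =>
    (contDiffOn_joinedFrame hU hx₀ hN h b).differentiableAt_of_isOpen hU hu
  have hd' : ∀ b, DifferentiableAt ℂ (joinedFrame x₀ N₀ x' b) u := fun b =>
    (contDiffOn_joinedFrame hU hx₀ hN h' b).differentiableAt_of_isOpen hU hu
  -- the product rule for the Gram matrix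
  have gram : ∀ b c, pd k (joinedFrame x₀ N₀ x b) u ⬝ᵥ joinedFrame x₀ N₀ x c u
        + joinedFrame x₀ N₀ x b u ⬝ᵥ pd k (joinedFrame x₀ N₀ x c) u
      = pd k (joinedFrame x₀ N₀ x' b) u ⬝ᵥ joinedFrame x₀ N₀ x' c u
        + joinedFrame x₀ N₀ x' b u ⬝ᵥ pd k (joinedFrame x₀ N₀ x' c) u := fun b c => by
    rw [← pd_dot (hd b) (hd c), ← pd_dot (hd' b) (hd' c)]
    refine pd_congr hU (fun v hv => ?_) hu k
    rw [joinedFrame_dot hU hx₀ hN h hv, joinedFrame_dot hU hx₀ hN h' hv]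
    simp only [hJ v hv]
  have key : ∀ i j, joinedFrame x₀ N₀ x (Sum.inr i) u ⬝ᵥ pd k (joinedFrame x₀ N₀ x (Sum.inl j)) u
      = joinedFrame x₀ N₀ x' (Sum.inr i) u ⬝ᵥ pd k (joinedFrame x₀ N₀ x' (Sum.inl j)) u := by
    intro i j
    rw [pd_joinedFrame_inl hU hx₀ h hu, pd_joinedFrame_inl hU hx₀ h' hu]
    simp only [joinedFrame, sumElim_dotProduct_sumElim, dotProduct_zero, zero_add]
    rw [dotProduct_comm (secondForm x i i u), dotProduct_comm (secondForm x' i i u),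
      pd_pd_dot_normal_of_isConjugate hx.conjugate hu
        (fun p => secondForm_dot_pd hU hx.holo hx.regular hu i i p),
      pd_pd_dot_normal_of_isConjugate hx'.conjugate hu
        (fun p => secondForm_dot_pd hU hx'.holo hx'.regular hu i i p)]
    simp only [secondForm_dot_eq_h₀ hU hx₀ hN h hu, secondForm_dot_eq_h₀ hU hx₀ hN h' hu, hJ u hu]
  have key2 : ∀ i j, j ≠ k →
      joinedFrame x₀ N₀ x (Sum.inr i) u ⬝ᵥ pd k (joinedFrame x₀ N₀ x (Sum.inr j)) u
      = joinedFrame x₀ N₀ x' (Sum.inr i) u ⬝ᵥ pd k (joinedFrame x₀ N₀ x' (Sum.inr j)) u :=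
    fun i j hjk => by
      rw [joinedFrame_inr_dot_pd hU hx₀ hN h hu hjk, joinedFrame_inr_dot_pd hU hx₀ hN h' hu hjk,
        hJ u hu]
  rcases b with i | i <;> rcases c with j | j
  · rw [pd_joinedFrame_inl hU hx₀ h hu, pd_joinedFrame_inl hU hx₀ h' hu]
    simp only [joinedFrame, sumElim_dotProduct_sumElim, dotProduct_zero, zero_add]
    rw [dotProduct_comm (pd i x u), dotProduct_comm (pd i x' u), ← sum_christoffel_mul_metric hU hx.holo
      hx.regular hu, ← sum_christoffel_mul_metric hU hx'.holo hx'.regular hu]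
    simp only [h.christoffel_eq hU hu, h'.christoffel_eq hU hu, h.isometric u hu, h'.isometric u hu]
  · have g := gram (Sum.inl i) (Sum.inr j)
    rw [dotProduct_comm, key, dotProduct_comm _ (joinedFrame x₀ N₀ x' (Sum.inr j) u)] at g
    exact add_left_cancel g
  · exact key i j
  -- Codazzi gives no information on ∂_k h_k. Its products come from differentiating the Gram
  -- matrix: with h_k by halving, with the other h_i by moving the derivative to h_i.
  · by_cases hjk : j = k
    · by_cases hik : i = k
      · have g := gram (Sum.inr i) (Sum.inr j)
        rw [hik, hjk] at g ⊢
        rw [dotProduct_comm, dotProduct_comm (pd k (joinedFrame x₀ N₀ x' (Sum.inr k)) u)] at g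
        linear_combination g / 2
      · have g := gram (Sum.inr i) (Sum.inr j)
        rw [dotProduct_comm, key2 j i hik, dotProduct_comm _ (joinedFrame x₀ N₀ x' (Sum.inr j) u)]
          at g
        exact add_left_cancel g
    · exact key2 i j hjk

/-- Two deformations with the same squares `|h_j|²` differ by a rigid motion. -/
theorem IsDeformation.congruent (hc : Convex ℝ U) (hn : 0 < n) (h : IsDeformation x₀ U x)
    (h' : IsDeformation x₀ U x')
    (hJ : ∀ u ∈ U, ∀ j, joinedSq x₀ N₀ x j u = joinedSq x₀ N₀ x' j u) : Congruent U x x' := by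
  rcases U.eq_empty_or_nonempty with rfl | ⟨u₀, hu₀⟩
  · exact ⟨1, 0, by simp, by simp⟩
  have hcard := card_joinedFrame ⟨0, hn⟩
  set F : (Fin n → ℂ) → Matrix (Fin n ⊕ Fin n) (Unit ⊕ Fin (2 * n - 1)) ℂ :=
    fun u => Matrix.of fun b => joinedFrame x₀ N₀ x b u with hF
  set F' : (Fin n → ℂ) → Matrix (Fin n ⊕ Fin n) (Unit ⊕ Fin (2 * n - 1)) ℂ :=
    fun u => Matrix.of fun b => joinedFrame x₀ N₀ x' b u with hF'
  set G : (Fin n → ℂ) → Matrix (Fin n ⊕ Fin n) (Fin n ⊕ Fin n) ℂ :=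
    fun u => Matrix.fromBlocks (metric x₀ u) 0 0 (Matrix.diagonal fun j => joinedSq x₀ N₀ x j u)
    with hG
  have hFG : ∀ u ∈ U, F u * (F u)ᵀ = G u := fun u hu => joinedFrame_mul_transpose hU hx₀ hN h hu
  have hFG' : ∀ u ∈ U, F' u * (F' u)ᵀ = G u := fun u hu => by
    rw [hF', joinedFrame_mul_transpose hU hx₀ hN h' hu, hG]
    simp only [hJ u hu]
  have hG0 : ∀ u ∈ U, (G u).det ≠ 0 := fun u hu => det_joinedGram_ne_zero hU hx₀ hN h hu
  have hGs : ∀ b c, ContDiffOn ℂ ∞ (fun u => G u b c) U := by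
    rintro (b | b) (c | c)
    · exact contDiffOn_metric hU hx₀.holo b c
    · exact contDiffOn_const
    · exact contDiffOn_const
    · simp only [hG, Matrix.fromBlocks_apply₂₂, Matrix.diagonal_apply]
      split_ifs
      · exact contDiffOn_joinedSq hU hx₀ hN h b
      · exact contDiffOn_const
  -- The matrix that carries the first frame to the second; F Fᵀ = G forces this formula. It is
  -- orthogonal because both frames have Gram matrix G.
  set A : (Fin n → ℂ) → Matrix (Unit ⊕ Fin (2 * n - 1)) (Unit ⊕ Fin (2 * n - 1)) ℂ :=
    fun u => (F' u)ᵀ * (G u)⁻¹ * F u with hA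
  have hFs := fun b c => contDiffOn_pi.mp (contDiffOn_joinedFrame hU hx₀ hN h b) c
  have hFs' := fun b c => contDiffOn_pi.mp (contDiffOn_joinedFrame hU hx₀ hN h' b) c
  have hAs : ∀ i, ContDiffOn ℂ ∞ (fun u => A u i) U := by
    intro i
    rw [contDiffOn_pi]
    intro j
    simp only [hA, Matrix.mul_apply, Finset.sum_mul]
    exact ContDiffOn.sum fun b _ => ContDiffOn.sum fun c _ =>
      ((hFs' c i).mul (contDiffOn_matrix_inv hGs hG0 c b)).mul (hFs b j)
  have hAF : ∀ u ∈ U, ∀ b, A u *ᵥ joinedFrame x₀ N₀ x b u = joinedFrame x₀ N₀ x' b u := by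
    intro u hu b
    have e1 : A u * (F u)ᵀ = (F' u)ᵀ := by
      rw [hA]
      simp only
      rw [Matrix.mul_assoc, hFG u hu, Matrix.mul_assoc,
        Matrix.nonsing_inv_mul _ (isUnit_iff_ne_zero.mpr (hG0 u hu)), Matrix.mul_one]
    ext i
    exact congrFun (congrFun e1 i) b
  have hAA : ∀ u ∈ U, (A u)ᵀ * A u = 1 := by
    intro u hu
    have e2 : (F u)ᵀ * (G u)⁻¹ * F u = 1 := by
      have := gram_inv_mul (F u) hcard (by rw [hFG u hu]; exact hG0 u hu)
      rwa [hFG u hu] at this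
    have e3 : (G u)⁻¹ᵀ = (G u)⁻¹ := by
      rw [Matrix.transpose_nonsing_inv, ← hFG u hu, Matrix.transpose_mul, Matrix.transpose_transpose]
    calc (A u)ᵀ * A u = (F u)ᵀ * (G u)⁻¹ * (F' u * (F' u)ᵀ) * (G u)⁻¹ * F u := by
          simp only [hA, Matrix.transpose_mul, Matrix.transpose_transpose, e3, Matrix.mul_assoc]
      _ = (F u)ᵀ * (G u)⁻¹ * F u := by
          rw [hFG' u hu, Matrix.mul_assoc ((F u)ᵀ),
            Matrix.nonsing_inv_mul _ (isUnit_iff_ne_zero.mpr (hG0 u hu)), Matrix.mul_one]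
      _ = 1 := e2
  -- Since the frames have equal products with their own derivatives, A also carries the derivatives
  -- of one frame to those of the other. Thus ∂_k A annihilates a basis.
  have hdA : ∀ i, ∀ u ∈ U, ∀ k, pd k (fun v => A v i) u = 0 := by
    intro i u hu k
    refine eq_zero_of_forall_dot_joinedFrame hU hx₀ hN h hu ⟨0, hn⟩ fun b => ?_
    have db := (contDiffOn_joinedFrame hU hx₀ hN h b).differentiableAt_of_isOpen hU hu
    have db' := (contDiffOn_joinedFrame hU hx₀ hN h' b).differentiableAt_of_isOpen hU hu
    have e1 := pd_dot ((hAs i).differentiableAt_of_isOpen hU hu) db k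
    rw [pd_congr hU (f := fun v => A v i ⬝ᵥ joinedFrame x₀ N₀ x b v)
      (g := fun v => joinedFrame x₀ N₀ x' b v i) (fun v hv => congrFun (hAF v hv b) i) hu,
      pd_apply db'] at e1
    have e2 : A u *ᵥ pd k (joinedFrame x₀ N₀ x b) u - pd k (joinedFrame x₀ N₀ x' b) u = 0 := by
      refine eq_zero_of_forall_dot_joinedFrame hU hx₀ hN h' hu ⟨0, hn⟩ fun c => ?_
      rw [sub_dotProduct, dotProduct_comm (pd k (joinedFrame x₀ N₀ x' b) u),
        ← joinedFrame_dot_pd_congr hU hx₀ hN h h' hJ hu, ← hAF u hu c, Matrix.dotProduct_mulVec,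
        Matrix.vecMul_mulVec, ← Matrix.mulVec_transpose, Matrix.transpose_mul,
        Matrix.transpose_transpose, hAA u hu, Matrix.one_mulVec, dotProduct_comm, sub_self]
    have e3 := congrFun (sub_eq_zero.mp e2) i
    rw [← e3] at e1
    have e4 : (A u *ᵥ pd k (joinedFrame x₀ N₀ x b) u) i
      = A u i ⬝ᵥ pd k (joinedFrame x₀ N₀ x b) u := rfl
    rw [e4] at e1
    linear_combination -e1
  have hconst : ∀ u ∈ U, A u = A u₀ := fun u hu => funext fun i =>
    eq_of_pd_eq_zero hU hc (hAs i) (hdA i) hu hu₀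
  set B := (A u₀).toBlocks₂₂ with hB
  -- Corresponding vectors of the two frames have the same extra coordinate, which involves only
  -- `x₀`. So A preserves this coordinate, and its remaining diagonal block is orthogonal and acts
  -- on ℂ^{2n-1}.
  have hrow : ∀ p, A u₀ (Sum.inl ()) (Sum.inr p) = 0 := by
    have e1 : A u₀ (Sum.inl ()) - Pi.single (Sum.inl ()) 1 = 0 := by
      refine eq_zero_of_forall_dot_joinedFrame hU hx₀ hN h hu₀ ⟨0, hn⟩ fun b => ?_
      have := congrFun (hAF u₀ hu₀ b) (Sum.inl ())
      rw [sub_dotProduct]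
      have e4 : (A u₀ *ᵥ joinedFrame x₀ N₀ x b u₀) (Sum.inl ())
        = A u₀ (Sum.inl ()) ⬝ᵥ joinedFrame x₀ N₀ x b u₀ := rfl
      rw [← e4, this]
      rcases b with b | b <;> simp [joinedFrame]
    intro p
    have := congrFun (sub_eq_zero.mp e1) (Sum.inr p)
    simpa using this
  have hBB : Bᵀ * B = 1 := by
    ext p q
    have := congrFun (congrFun (hAA u₀ hu₀) (Sum.inr p)) (Sum.inr q)
    rw [Matrix.mul_apply, Fintype.sum_sum_type] at this
    simp only [Matrix.transpose_apply, Finset.univ_unique, Finset.sum_singleton] at this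
    rw [show (default : Unit) = () from rfl, hrow p, zero_mul, zero_add] at this
    rw [Matrix.mul_apply]
    simpa [hB, Matrix.toBlocks₂₂, Matrix.one_apply] using this
  have hd : ∀ j, ∀ u ∈ U, pd j x' u = B *ᵥ pd j x u := by
    intro j u hu
    ext p
    have := congrFun (hAF u hu (Sum.inl j)) (Sum.inr p)
    rw [hconst u hu] at this
    simpa [joinedFrame, Matrix.mulVec, dotProduct, hB, Matrix.toBlocks₂₂] using this.symm
  have hL : ∀ u ∈ U, ∀ k, pd k (fun v => x' v - B *ᵥ x v) u = 0 := by
    intro u hu k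
    have dx := h.holo.differentiableAt_of_isOpen hU hu
    have dx' := h'.holo.differentiableAt_of_isOpen hU hu
    have e := pd_clm (LinearMap.toContinuousLinearMap (Matrix.mulVecLin B)) dx k
    simp only [LinearMap.coe_toContinuousLinearMap', Matrix.mulVecLin_apply] at e
    have dB : DifferentiableAt ℂ (fun v => B *ᵥ x v) u :=
      (LinearMap.toContinuousLinearMap (Matrix.mulVecLin B)).differentiableAt.comp u dx
    rw [pd_sub dx' dB, e, hd k u hu, sub_self]
  have hs : ContDiffOn ℂ ∞ (fun v => x' v - B *ᵥ x v) U :=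
    h'.holo.sub ((LinearMap.toContinuousLinearMap (Matrix.mulVecLin B)).contDiff.comp_contDiffOn
      h.holo)
  refine ⟨B, x' u₀ - B *ᵥ x u₀, hBB, fun u hu => ?_⟩
  rw [← eq_of_pd_eq_zero hU hc hs hL hu hu₀]
  abel

end Uniqueness

/-! ### Invariance under rigid motions -/

section Congruence

variable {n m : ℕ} {U : Set (Fin n → ℂ)} {x x' : (Fin n → ℂ) → (Fin m → ℂ)}

theorem pd_mulVec {f : (Fin n → ℂ) → (Fin m → ℂ)} {u : Fin n → ℂ} (hf : DifferentiableAt ℂ f u)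
    (A : Matrix (Fin m) (Fin m) ℂ) (k : Fin n) :
    pd k (fun v => A *ᵥ f v) u = A *ᵥ pd k f u :=
  pd_clm (LinearMap.toContinuousLinearMap (Matrix.mulVecLin A)) hf k

theorem mulVec_dotProduct_mulVec {A : Matrix (Fin m) (Fin m) ℂ} (hA : Aᵀ * A = 1)
    (v w : Fin m → ℂ) : (A *ᵥ v) ⬝ᵥ (A *ᵥ w) = v ⬝ᵥ w := by
  rw [Matrix.dotProduct_mulVec, Matrix.vecMul_mulVec, ← Matrix.mulVec_transpose,
    Matrix.transpose_mul, Matrix.transpose_transpose, hA, Matrix.one_mulVec]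

theorem Congruent.secondForm_dot (hU : IsOpen U) (hx : ContDiffOn ℂ ∞ x U)
    (h : Congruent U x x') {u : Fin n → ℂ} (hu : u ∈ U) (j k p q : Fin n) :
    secondForm x' j k u ⬝ᵥ secondForm x' p q u = secondForm x j k u ⬝ᵥ secondForm x p q u := by
  obtain ⟨A, b, hA, h⟩ := h
  have h1 : ∀ u ∈ U, ∀ j, pd j x' u = A *ᵥ pd j x u := fun u hu j => by
    have dx := hx.differentiableAt_of_isOpen hU hu
    have dA : DifferentiableAt ℂ (fun v => A *ᵥ x v) u :=
      (LinearMap.toContinuousLinearMap (Matrix.mulVecLin A)).differentiableAt.comp u dx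
    rw [pd_congr hU h hu, pd_add dA (differentiableAt_const _), pd_mulVec dx, pd_const, add_zero]
  have hg : ∀ u ∈ U, metric x' u = metric x u := fun u hu => by
    ext j k
    rw [metric_apply, metric_apply, h1 u hu, h1 u hu, mulVec_dotProduct_mulVec hA]
  have hII : ∀ j k, secondForm x' j k u = A *ᵥ secondForm x j k u := fun j k => by
    rw [secondForm, secondForm, pd_congr hU (fun v hv => h1 v hv j) hu,
      pd_mulVec ((contDiffOn_pd hU hx j).differentiableAt_of_isOpen hU hu), Matrix.mulVec_sub,
      Matrix.mulVec_sum]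
    simp only [Matrix.mulVec_smul, h1 u hu, christoffel_congr hU hg hu]
  rw [hII, hII, mulVec_dotProduct_mulVec hA]

theorem Congruent.joinedSq_eq {x₀ N₀ : (Fin n → ℂ) → (Fin (n + 1) → ℂ)}
    {x x' : (Fin n → ℂ) → (Fin (2 * n - 1) → ℂ)} (hU : IsOpen U) (hx : ContDiffOn ℂ ∞ x U)
    (h : Congruent U x x') {u : Fin n → ℂ} (hu : u ∈ U) (j : Fin n) :
    joinedSq x₀ N₀ x' j u = joinedSq x₀ N₀ x j u := by
  rw [joinedSq, joinedSq, h.secondForm_dot hU hx hu]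

end Congruence

/-! ### Parallel sections -/

section Parallel

variable {n : ℕ} {U : Set (Fin n → ℂ)} {V : Type} [NormedAddCommGroup V] [NormedSpace ℂ V]

theorem pd_clm_apply {L : (Fin n → ℂ) → V →L[ℂ] V} {f : (Fin n → ℂ) → V} {u : Fin n → ℂ}
    (hL : DifferentiableAt ℂ L u) (hf : DifferentiableAt ℂ f u) (l : Fin n) :
    pd l (fun v => L v (f v)) u = pd l (fun v => L v (f u)) u + L u (pd l f u) := by
  unfold pd
  rw [(hL.hasFDerivAt.clm_apply hf.hasFDerivAt).fderiv,
    (hL.hasFDerivAt.clm_apply (hasFDerivAt_const (f u) u)).fderiv]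
  simp [add_comm]

/-- The system `∂_k y = L_k y` is solvable with any initial value if its integrability conditions
hold. -/
theorem exists_parallel [CompleteSpace V] (hU : IsOpen U) (hc : Convex ℝ U) {u₀ : Fin n → ℂ}
    (hu₀ : u₀ ∈ U) {L : Fin n → (Fin n → ℂ) → V →L[ℂ] V} (hL : ∀ k, ContDiffOn ℂ ∞ (L k) U)
    (hflat : ∀ u ∈ U, ∀ k l s, pd l (fun v => L k v s) u + L k u (L l u s)
      = pd k (fun v => L l v s) u + L l u (L k u s)) (y₀ : V) :
    ∃ y : (Fin n → ℂ) → V, ContDiffOn ℂ ∞ y U ∧ y u₀ = y₀ ∧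
      ∀ u ∈ U, ∀ k, pd k y u = L k u (y u) := by
  set Ω : (Fin n → ℂ) → (Fin n → ℂ) →L[ℂ] V →L[ℂ] V := fun u =>
    ∑ k, (ContinuousLinearMap.proj (R := ℂ) (φ := fun _ : Fin n => ℂ) k).smulRight (L k u) with hΩd
  have hΩa : ∀ u w s, Ω u w s = ∑ k, w k • L k u s := by
    intro u w s
    simp [hΩd]
  have hΩ : ContDiffOn ℂ ∞ Ω U := by
    refine ContDiffOn.sum fun k _ => ?_
    exact contDiffOn_const.smulRight (hL k)
  have hd : ∀ u ∈ U, ∀ v w s, fderiv ℂ Ω u v w s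
      = ∑ l, v l • ∑ k, w k • pd l (fun v => L k v s) u := by
    intro u hu v w s
    have hdΩ := hΩ.differentiableAt_of_isOpen hU hu
    have h1 : fderiv ℂ (fun v => Ω v w s) u v = fderiv ℂ Ω u v w s := by
      have h2 := (hdΩ.hasFDerivAt.clm_apply (hasFDerivAt_const w u)).clm_apply
        (hasFDerivAt_const s u)
      rw [h2.fderiv]
      simp
    rw [← h1, fderiv_apply_eq_sum_pd]
    refine Finset.sum_congr rfl fun l _ => ?_
    congr 1
    simp only [hΩa]
    have hdk : ∀ k, DifferentiableAt ℂ (fun v => L k v s) u := fun k =>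
      ((hL k).differentiableAt_of_isOpen hU hu).clm_apply (differentiableAt_const s)
    rw [pd_sum _ (fun k _ => (hdk k).fun_const_smul (w k))]
    refine Finset.sum_congr rfl fun k _ => ?_
    rw [pd_smul (differentiableAt_const _) (hdk k), pd_const, zero_smul, zero_add]
  have hflat' : IsFlat U Ω := by
    intro u hu v w
    ext s
    simp only [_root_.add_apply, _root_.sub_apply,
      ContinuousLinearMap.comp_apply, _root_.zero_apply, hd u hu, hΩa, map_sum,
      map_smul, Finset.smul_sum]
    rw [Finset.sum_comm (f := fun l k => v l • w k • pd l (fun v => L k v s) u)]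
    rw [← Finset.sum_sub_distrib]
    rw [Finset.sum_comm (f := fun k l => v k • w l • (L k u) ((L l u) s)), ← Finset.sum_sub_distrib,
      ← Finset.sum_add_distrib]
    refine Finset.sum_eq_zero fun k _ => ?_
    rw [← Finset.sum_sub_distrib, ← Finset.sum_sub_distrib, ← Finset.sum_add_distrib]
    refine Finset.sum_eq_zero fun l _ => ?_
    have := hflat u hu k l s
    rw [smul_comm (v l) (w k), smul_comm (v l) (w k), ← smul_sub, ← smul_sub, ← smul_sub,
      ← smul_sub, ← smul_add, ← smul_add]
    rw [sub_add_sub_comm, this, sub_self, smul_zero, smul_zero]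
  obtain ⟨y, hy, hy0, hyd⟩ := exists_solution_of_isFlat hU hc hu₀ hΩ hflat' y₀
  refine ⟨y, hy, hy0, fun u hu k => ?_⟩
  have : pd k y u = Ω u (Pi.single k 1) (y u) := hyd u hu _
  rw [this, hΩa]
  simp [Pi.single_apply]

end Parallel

/-! ### Complex orthogonal matrices -/

section Orthogonal

variable {ι : Type} [Fintype ι]

/-- The skew operator `a ∧ b : s ↦ (b ⬝ s) a - (a ⬝ s) b`. -/
noncomputable def wedge (a b : ι → ℂ) : (ι → ℂ) →L[ℂ] (ι → ℂ) :=
  LinearMap.toContinuousLinearMap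
    { toFun := fun s => (b ⬝ᵥ s) • a - (a ⬝ᵥ s) • b
      map_add' := fun s t => by simp only [dotProduct_add, add_smul]; abel
      map_smul' := fun c s => by
        simp only [dotProduct_smul, smul_eq_mul, mul_smul, RingHom.id_apply, smul_sub] }

theorem wedge_apply (a b s : ι → ℂ) : wedge a b s = (b ⬝ᵥ s) • a - (a ⬝ᵥ s) • b := rfl

theorem wedge_dot (a b s t : ι → ℂ) : wedge a b s ⬝ᵥ t = -(s ⬝ᵥ wedge a b t) := by
  rw [dotProduct_comm s]
  simp only [wedge_apply, sub_dotProduct, smul_dotProduct, smul_eq_mul]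
  ring

theorem _root_.ContDiffOn.wedge {n : ℕ} {U : Set (Fin n → ℂ)} {f g : (Fin n → ℂ) → (ι → ℂ)}
    (hf : ContDiffOn ℂ ∞ f U) (hg : ContDiffOn ℂ ∞ g U) :
    ContDiffOn ℂ ∞ (fun u => wedge (f u) (g u)) U := by
  rw [contDiffOn_clm_apply]
  intro s
  simp only [wedge_apply]
  exact ((hg.dotProduct contDiffOn_const).smul hf).sub ((hf.dotProduct contDiffOn_const).smul hg)

/-- A unit vector is a row of an orthogonal matrix. -/
theorem exists_orthogonal_row [DecidableEq ι] (p : ι) {v : ι → ℂ} (hv : v ⬝ᵥ v = 1) :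
    ∃ Q : Matrix ι ι ℂ, Q * Qᵀ = 1 ∧ Q p = v := by
  -- Householder reflections; over ℂ they exist for non-isotropic vectors only.
  have house : ∀ w : ι → ℂ, w ⬝ᵥ w ≠ 0 →
      (1 - (2 / (w ⬝ᵥ w)) • Matrix.vecMulVec w w) * (1 - (2 / (w ⬝ᵥ w)) • Matrix.vecMulVec w w)ᵀ
        = 1 := by
    intro w hw
    ext i j
    have e : ∀ i j, ((1 - (2 / (w ⬝ᵥ w)) • Matrix.vecMulVec w w) : Matrix ι ι ℂ) i j
        = (1 : Matrix ι ι ℂ) i j - 2 / (w ⬝ᵥ w) * (w i * w j) := fun i j => by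
      simp [Matrix.vecMulVec_apply]
    rw [Matrix.mul_apply]
    simp only [Matrix.transpose_apply, e, sub_mul, mul_sub, Finset.sum_sub_distrib]
    have e1 : ∑ q, (1 : Matrix ι ι ℂ) i q * (1 : Matrix ι ι ℂ) j q = (1 : Matrix ι ι ℂ) i j := by
      simp [Matrix.one_apply]
    have e2 : ∀ i j, ∑ q, (1 : Matrix ι ι ℂ) i q * (2 / (w ⬝ᵥ w) * (w j * w q))
        = 2 / (w ⬝ᵥ w) * (w j * w i) := fun i j => by simp [Matrix.one_apply]
    have e3 : ∑ q, 2 / (w ⬝ᵥ w) * (w i * w q) * (2 / (w ⬝ᵥ w) * (w j * w q))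
        = (2 / (w ⬝ᵥ w)) ^ 2 * (w i * w j) * (w ⬝ᵥ w) := by
      rw [dotProduct, Finset.mul_sum]
      exact Finset.sum_congr rfl fun q _ => by ring
    have e4 : ∑ q, 2 / (w ⬝ᵥ w) * (w i * w q) * (1 : Matrix ι ι ℂ) j q
        = 2 / (w ⬝ᵥ w) * (w i * w j) := by simp [Matrix.one_apply]
    rw [e1, e2, e3, e4]
    field_simp
    ring
  -- The reflection exchanging v and e_p is along v - e_p, whose square 2(1 - v_p) may vanish. In
  -- that case v + e_p has square 4, and the negative of its reflection serves.
  by_cases h : v p = 1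
  · obtain ⟨w, hw⟩ : ∃ w : ι → ℂ, w = v + Pi.single p 1 := ⟨_, rfl⟩
    have hwi : ∀ i, w i = v i + if i = p then 1 else 0 := fun i => by simp [hw, Pi.single_apply]
    have hww : w ⬝ᵥ w = 4 := by
      simp [hw, hv, h]; norm_num
    refine ⟨-(1 - (2 / (w ⬝ᵥ w)) • Matrix.vecMulVec w w), ?_, ?_⟩
    · rw [Matrix.transpose_neg, neg_mul_neg, house w (by rw [hww]; norm_num)]
    · ext i
      simp only [hww, Matrix.neg_apply, Matrix.sub_apply, Matrix.smul_apply, Matrix.vecMulVec_apply,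
        Matrix.one_apply, hwi, h, smul_eq_mul, eq_comm (a := p), if_true]
      ring
  · obtain ⟨w, hw⟩ : ∃ w : ι → ℂ, w = v - Pi.single p 1 := ⟨_, rfl⟩
    have hwi : ∀ i, w i = v i - if i = p then 1 else 0 := fun i => by simp [hw, Pi.single_apply]
    have hww : w ⬝ᵥ w = 2 * (1 - v p) := by
      simp [hw, hv]; ring
    have h0 : 1 - v p ≠ 0 := sub_ne_zero.mpr (Ne.symm h)
    refine ⟨1 - (2 / (w ⬝ᵥ w)) • Matrix.vecMulVec w w, house w (by rw [hww]; simpa using h0), ?_⟩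
    ext i
    simp only [hww, Matrix.sub_apply, Matrix.smul_apply, Matrix.vecMulVec_apply,
      Matrix.one_apply, hwi, smul_eq_mul, eq_comm (a := p), if_true]
    field_simp
    ring

end Orthogonal

/-! ### Structure equations of a hypersurface in a conjugate system -/

/-- The tangent vectors `∑ g^{kl} ∂_l x` dual to the coordinate vectors. -/
noncomputable def dualFrame {n m : ℕ} (x : (Fin n → ℂ) → (Fin m → ℂ)) (k : Fin n)
    (u : Fin n → ℂ) : Fin m → ℂ :=
  ∑ l, (metric x u)⁻¹ k l • pd l x u

section DualFrame

variable {n m : ℕ} {U : Set (Fin n → ℂ)} {x : (Fin n → ℂ) → (Fin m → ℂ)}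

theorem contDiffOn_dualFrame (hU : IsOpen U) (hx : IsConjugateNet x U) (k : Fin n) :
    ContDiffOn ℂ ∞ (dualFrame x k) U :=
  ContDiffOn.sum fun l _ => (contDiffOn_metric_inv hU hx.holo hx.regular k l).smul
    (contDiffOn_pd hU hx.holo l)

theorem dualFrame_dot_pd (hr : IsRegular x U) {u : Fin n → ℂ} (hu : u ∈ U) (k j : Fin n) :
    dualFrame x k u ⬝ᵥ pd j x u = if k = j then 1 else 0 := by
  rw [dualFrame, sum_dotProduct]
  simp only [smul_dotProduct, ← metric_apply, smul_eq_mul]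
  rw [← Matrix.mul_apply, Matrix.nonsing_inv_mul _ (isUnit_iff_ne_zero.mpr (hr u hu)),
    Matrix.one_apply]

theorem dualFrame_dot_eq_zero {u : Fin n → ℂ} {ν : Fin m → ℂ} (hν : ∀ p, ν ⬝ᵥ pd p x u = 0)
    (k : Fin n) : ν ⬝ᵥ dualFrame x k u = 0 := by
  rw [dualFrame, dotProduct_sum]
  simp [hν]

theorem dualFrame_dot_dualFrame (hr : IsRegular x U) {u : Fin n → ℂ} (hu : u ∈ U) (k l : Fin n) :
    dualFrame x k u ⬝ᵥ dualFrame x l u = (metric x u)⁻¹ l k := by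
  conv_lhs => rw [dualFrame.eq_1 x l, dotProduct_sum]
  simp [dualFrame_dot_pd hr hu]

theorem metric_inv_symm (u : Fin n → ℂ) (k l : Fin n) :
    (metric x u)⁻¹ k l = (metric x u)⁻¹ l k := by
  have h : (metric x u)ᵀ = metric x u := by ext j k; exact metric_symm x u k j
  conv_lhs => rw [← h, ← Matrix.transpose_nonsing_inv]
  rfl

end DualFrame

section Hypersurface

variable {n : ℕ} {U : Set (Fin n → ℂ)} {x₀ N₀ : (Fin n → ℂ) → (Fin (n + 1) → ℂ)}
variable (hU : IsOpen U) (hx₀ : IsConjugateNet x₀ U) (hN : IsUnitNormal x₀ N₀ U)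
include hU hx₀ hN

omit hU in
theorem eq_of_dot_eq {u : Fin n → ℂ} (hu : u ∈ U) {v w : Fin (n + 1) → ℂ}
    (h : ∀ p, v ⬝ᵥ pd p x₀ u = w ⬝ᵥ pd p x₀ u) (h' : v ⬝ᵥ N₀ u = w ⬝ᵥ N₀ u) : v = w := by
  have h1 := eq_smul_unitNormal hx₀.regular hN hu (ν := v - w)
    (fun p => by rw [sub_dotProduct, h, sub_self])
  rw [dotProduct_comm, sub_dotProduct, h', sub_self, zero_smul] at h1
  exact sub_eq_zero.mp h1

theorem pd_pd_hypersurface {u : Fin n → ℂ} (hu : u ∈ U) (j k : Fin n) :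
    pd k (pd j x₀) u = ∑ l, christoffel x₀ l j k u • pd l x₀ u
      + (if j = k then h₀ x₀ N₀ k u else 0) • N₀ u := by
  rw [pd_pd_eq]
  congr 1
  split_ifs with h
  · rw [h, secondForm_eq_h₀_smul hU hx₀ hN hu]
  · rw [hx₀.conjugate u hu j k h, zero_smul]

theorem pd_unitNormal {u : Fin n → ℂ} (hu : u ∈ U) (k : Fin n) :
    pd k N₀ u = -(h₀ x₀ N₀ k u • dualFrame x₀ k u) := by
  refine eq_of_dot_eq hx₀ hN hu (fun p => ?_) ?_
  · have hd := hN.holo.differentiableAt_of_isOpen hU hu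
    have hdp := (contDiffOn_pd hU hx₀.holo p).differentiableAt_of_isOpen hU hu
    have h1 := pd_dot hd hdp k
    rw [pd_congr hU (fun v hv => hN.normal v hv p) hu, pd_const,
      pd_pd_hypersurface hU hx₀ hN hu, dotProduct_add, dotProduct_sum, dotProduct_smul,
      hN.unit u hu] at h1
    simp only [dotProduct_smul, hN.normal u hu, smul_zero, Finset.sum_const_zero] at h1
    rw [neg_dotProduct, smul_dotProduct, dualFrame_dot_pd hx₀.regular hu]
    by_cases hkp : k = p
    · subst hkp; simp at h1 ⊢; linear_combination -h1
    · simp [hkp, Ne.symm hkp] at h1 ⊢; exact h1.symm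
  · rw [dotProduct_comm, unitNormal_dot_pd hU hN hu, dotProduct_comm, dotProduct_neg,
      dotProduct_smul, dualFrame_dot_eq_zero (hN.normal u hu)]
    simp

theorem sum_christoffel_smul_of_ne (hΓ : ∀ u ∈ U, ∀ j k l : Fin n, j ≠ k → j ≠ l → k ≠ l →
    christoffel x₀ l j k u = 0) {u : Fin n → ℂ} (hu : u ∈ U) {j k : Fin n} (hjk : j ≠ k) :
    pd k (pd j x₀) u = christoffel x₀ j j k u • pd j x₀ u + christoffel x₀ k j k u • pd k x₀ u := by
  rw [pd_pd_hypersurface hU hx₀ hN hu, if_neg hjk, zero_smul, add_zero, ← Finset.sum_pair hjk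
    (f := fun l => christoffel x₀ l j k u • pd l x₀ u)]
  refine (Finset.sum_subset (Finset.subset_univ _) fun l _ hl => ?_).symm
  simp only [Finset.mem_insert, Finset.mem_singleton, not_or] at hl
  rw [hΓ u hu j k l hjk (Ne.symm hl.1) (Ne.symm hl.2), zero_smul]

/-- Obtained by differentiating the relations X^l · ∂_p x₀ = δ and X^l · N₀ = 0, which determine the
dual frame; the vanishing of three-index symbols leaves two tangential terms. -/
theorem pd_dualFrame (hΓ : ∀ u ∈ U, ∀ j k l : Fin n, j ≠ k → j ≠ l → k ≠ l →
    christoffel x₀ l j k u = 0) {u : Fin n → ℂ} (hu : u ∈ U) {k l : Fin n} (hkl : k ≠ l) :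
    pd k (dualFrame x₀ l) u = -(christoffel x₀ l l k u • dualFrame x₀ l u)
      - christoffel x₀ l k k u • dualFrame x₀ k u
      + (h₀ x₀ N₀ k u * (metric x₀ u)⁻¹ k l) • N₀ u := by
  have hX := (contDiffOn_dualFrame hU hx₀ l).differentiableAt_of_isOpen hU hu
  refine eq_of_dot_eq hx₀ hN hu (fun p => ?_) ?_
  · have hdp := (contDiffOn_pd hU hx₀.holo p).differentiableAt_of_isOpen hU hu
    have h1 := pd_dot hX hdp k
    rw [pd_congr hU (fun v hv => dualFrame_dot_pd hx₀.regular hv l p) hu, pd_const,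
      pd_pd_hypersurface hU hx₀ hN hu, dotProduct_add, dotProduct_sum, dotProduct_smul,
      dotProduct_comm _ (N₀ u), dualFrame_dot_eq_zero (hN.normal u hu)] at h1
    simp only [dotProduct_smul, dualFrame_dot_pd hx₀.regular hu, smul_eq_mul, mul_ite, mul_one,
      mul_zero, Finset.sum_ite_eq, Finset.mem_univ, if_true, add_zero] at h1
    simp only [add_dotProduct, sub_dotProduct, neg_dotProduct, smul_dotProduct,
      dualFrame_dot_pd hx₀.regular hu, hN.normal u hu, smul_eq_mul, mul_ite, mul_one,
      mul_zero, add_zero]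
    rw [eq_neg_of_add_eq_zero_left h1.symm]
    by_cases hlp : l = p
    · subst hlp; simp [hkl]
    · by_cases hkp : k = p
      · subst hkp; simp [hlp]
      · simp [hlp, hkp, hΓ u hu p k l (Ne.symm hkp) (Ne.symm hlp) hkl]
  · have h1 := pd_dot hX (hN.holo.differentiableAt_of_isOpen hU hu) k
    rw [pd_congr hU (fun v hv => (dotProduct_comm _ _).trans
      (dualFrame_dot_eq_zero (hN.normal v hv) l)) hu, pd_const, pd_unitNormal hU hx₀ hN hu,
      dotProduct_neg, dotProduct_smul, dualFrame_dot_dualFrame hx₀.regular hu] at h1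
    have hz : ∀ i, dualFrame x₀ i u ⬝ᵥ N₀ u = 0 := fun i => by
      rw [dotProduct_comm, dualFrame_dot_eq_zero (hN.normal u hu)]
    simp only [add_dotProduct, sub_dotProduct, neg_dotProduct, smul_dotProduct, hz, hN.unit u hu,
      smul_eq_mul] at h1 ⊢
    linear_combination -h1

/-- The Gauss equations which involve three distinct indices. -/
theorem pd_christoffel (hΓ : ∀ u ∈ U, ∀ j k l : Fin n, j ≠ k → j ≠ l → k ≠ l →
    christoffel x₀ l j k u = 0) {u : Fin n → ℂ} (hu : u ∈ U) {j k l : Fin n} (hjk : j ≠ k)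
    (hjl : j ≠ l) (hkl : k ≠ l) :
    pd k (christoffel x₀ l j j) u = christoffel x₀ l j j u * (christoffel x₀ j j k u
        - christoffel x₀ l l k u) - christoffel x₀ l k k u * christoffel x₀ k j j u
      + (metric x₀ u)⁻¹ k l * h₀ x₀ N₀ k u * h₀ x₀ N₀ j u := by
  have hX := (contDiffOn_dualFrame hU hx₀ l).differentiableAt_of_isOpen hU hu
  have hdd := (contDiffOn_pd hU (contDiffOn_pd hU hx₀.holo j) j).differentiableAt_of_isOpen hU hu
  -- The symbol is the product of X^l with ∂_j² x₀. In its derivative, ∂_k∂_j² x₀ is evaluated as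
  -- ∂_j of the two-term formula for ∂_k∂_j x₀.
  have hdot : ∀ v ∈ U, ∀ l j, dualFrame x₀ l v ⬝ᵥ pd j (pd j x₀) v = christoffel x₀ l j j v := by
    intro v hv l j
    rw [pd_pd_hypersurface hU hx₀ hN hv, dotProduct_add, dotProduct_sum, dotProduct_smul,
      dotProduct_comm _ (N₀ v), dualFrame_dot_eq_zero (hN.normal v hv)]
    simp [dualFrame_dot_pd hx₀.regular hv]
  rw [← pd_congr hU (fun v hv => hdot v hv l j) hu, pd_dot hX hdd,
    pd_comm hU (contDiffOn_pd hU hx₀.holo j) hu,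
    pd_congr hU (fun v hv => sum_christoffel_smul_of_ne hU hx₀ hN hΓ hv hjk) hu]
  have hd := fun i => (contDiffOn_pd hU hx₀.holo i).differentiableAt_of_isOpen hU hu
  have hΓd := fun i => (contDiffOn_christoffel hU hx₀.holo hx₀.regular i j k).differentiableAt_of_isOpen
    hU hu
  rw [pd_add ((hΓd j).fun_smul (hd j)) ((hΓd k).fun_smul (hd k)), pd_smul (hΓd j) (hd j),
    pd_smul (hΓd k) (hd k), pd_dualFrame hU hx₀ hN hΓ hu hkl,
    sum_christoffel_smul_of_ne hU hx₀ hN hΓ hu hjk.symm]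
  simp only [add_dotProduct, sub_dotProduct, neg_dotProduct, smul_dotProduct, dotProduct_add,
    dotProduct_smul, hdot u hu, dualFrame_dot_pd hx₀.regular hu, if_neg hjl.symm, if_neg hkl.symm,
    smul_eq_mul, h₀]
  ring

end Hypersurface

/-! ### The algebra of the curvature -/

section Curvature

variable {ι : Type} [Fintype ι]

/-- The curvature of the connection `∂_k - X_k ∧ P_k - e_k ∧ β_k`, in terms of its structure
equations. -/
theorem exists_curvature_eq {X Y N e f b c ν P Q dX dY dP dQ db dc : ι → ℂ}
    {α β h l g G₁ G₂ G₃ G₄ p q r t : ℂ}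
    (hP : P = α • e + h • ν - h • N) (hQ : Q = β • f + l • ν - l • N)
    (hdX : dX = -(G₁ • X) - G₃ • Y + (l * g) • N)
    (hdY : dY = -(G₂ • Y) - G₄ • X + (h * g) • N)
    (hdP : dP = G₁ • (P + h • N) - G₄ • (Q + l • N) + wedge f c (P + h • N)
      - (G₁ * h - G₄ * l) • N + (h * l) • Y)
    (hdQ : dQ = G₂ • (Q + l • N) - G₃ • (P + h • N) + wedge e b (Q + l • N)
      - (G₂ * l - G₃ * h) • N + (h * l) • X)
    (hdb : db = p • f + q • e + (g * α * l) • ν - (b ⬝ᵥ f) • c)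
    (hdc : dc = r • e + t • f + (g * β * h) • ν - (c ⬝ᵥ e) • b)
    (hXX : X ⬝ᵥ Y = g) (hXN : X ⬝ᵥ N = 0) (hYN : Y ⬝ᵥ N = 0)
    (hXf : X ⬝ᵥ f = 0) (hYe : Y ⬝ᵥ e = 0)
    (hXc : X ⬝ᵥ c = 0) (hYb : Y ⬝ᵥ b = 0) (hXν : X ⬝ᵥ ν = 0)
    (hYν : Y ⬝ᵥ ν = 0) (hNN : N ⬝ᵥ N = 1) (hNe : N ⬝ᵥ e = 0) (hNf : N ⬝ᵥ f = 0)
    (hNb : N ⬝ᵥ b = 0) (hNc : N ⬝ᵥ c = 0) (hNν : N ⬝ᵥ ν = 0) (hef : e ⬝ᵥ f = 0)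
    (hνν : ν ⬝ᵥ ν = -1) (hνe : α * (ν ⬝ᵥ e) = h) (hνf : β * (ν ⬝ᵥ f) = l) :
    ∃ C : ℂ, ∀ s, (wedge dX P s + wedge X dP s + wedge e db s
        + (wedge X P + wedge e b) ((wedge Y Q + wedge f c) s))
      - (wedge dY Q s + wedge Y dQ s + wedge f dc s
        + (wedge Y Q + wedge f c) ((wedge X P + wedge e b) s))
      = C • wedge e f s := by
  -- The structure equations cancel every component except e ∧ f. This one contains p and r, the
  -- components of ∂_l β_k along e_l and of ∂_k β_l along e_k, about which nothing is known at this
  -- stage.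
  refine ⟨p + r - b ⬝ᵥ c - g * α * β, fun s => ?_⟩
  subst hνe hνf
  have c1 := dotProduct_comm Y X
  have c2 := dotProduct_comm N X
  have c3 := dotProduct_comm N Y
  have c5 := dotProduct_comm f X
  have c6 := dotProduct_comm e Y
  have c9 := dotProduct_comm c X
  have c10 := dotProduct_comm b Y
  have c12 := dotProduct_comm ν X
  have c13 := dotProduct_comm ν Y
  have c14 := dotProduct_comm e N
  have c15 := dotProduct_comm f N
  have c16 := dotProduct_comm b N
  have c17 := dotProduct_comm c N
  have c18 := dotProduct_comm ν N
  have c19 := dotProduct_comm f e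
  have c22 := dotProduct_comm e ν
  have c23 := dotProduct_comm f ν
  have c24 := dotProduct_comm f b
  have c25 := dotProduct_comm e c
  have c26 := dotProduct_comm c b
  have c27 := dotProduct_comm ν b
  have c28 := dotProduct_comm ν c
  subst hdX hdY hdP hdQ hdb hdc hP hQ
  ext i
  simp only [_root_.add_apply, wedge_apply, add_dotProduct, sub_dotProduct, neg_dotProduct, smul_dotProduct,
    dotProduct_add, dotProduct_sub, dotProduct_smul, smul_eq_mul, Pi.add_apply,
    Pi.sub_apply, Pi.neg_apply, Pi.smul_apply, c1, c2, c3, c5, c6, c9, c10, c12,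
    c13, c14, c15, c16, c17, c18, c19, c22, c23, c24, c25, c26, c27, c28,
    hXX, hXN, hYN, hXf, hYe, hXc, hYb, hXν, hYν, hNN, hNe, hNf, hNb, hNc, hNν,
    hef, hνν]
  ring

end Curvature

/-! ### The flat connection attached to a solution -/

section Realization

variable {n : ℕ} {U : Set (Fin n → ℂ)} {x₀ N₀ : (Fin n → ℂ) → (Fin (n + 1) → ℂ)}
  {a : Fin n → (Fin n → ℂ) → ℂ}

/-- The covectors `X^k` of a hypersurface in `ℂ^{n+1} ⊕ ℂ^n`. -/
noncomputable def tangentLift (x₀ : (Fin n → ℂ) → (Fin (n + 1) → ℂ)) (k : Fin n)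
    (u : Fin n → ℂ) : Fin (n + 1) ⊕ Fin n → ℂ := Sum.elim (dualFrame x₀ k u) 0

/-- The normal of a hypersurface in `ℂ^{n+1} ⊕ ℂ^n`. -/
def normalLift (N₀ : (Fin n → ℂ) → (Fin (n + 1) → ℂ)) (u : Fin n → ℂ) :
    Fin (n + 1) ⊕ Fin n → ℂ := Sum.elim (N₀ u) 0

/-- The standard basis of the second summand of `ℂ^{n+1} ⊕ ℂ^n`. -/
noncomputable def basisLift (k : Fin n) : Fin (n + 1) ⊕ Fin n → ℂ := Sum.elim 0 (Pi.single k 1)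

/-- The vector `ν = ∑ (h_j / a_j) e_j`, with `ν ⬝ ν = -1`. -/
noncomputable def ratioVec (x₀ N₀ : (Fin n → ℂ) → (Fin (n + 1) → ℂ)) (a : Fin n → (Fin n → ℂ) → ℂ)
    (u : Fin n → ℂ) : Fin (n + 1) ⊕ Fin n → ℂ := Sum.elim 0 fun j => h₀ x₀ N₀ j u / a j u

/-- The rotation coefficients of the frame `e_j`. -/
noncomputable def rotVec (x₀ : (Fin n → ℂ) → (Fin (n + 1) → ℂ)) (a : Fin n → (Fin n → ℂ) → ℂ)
    (k : Fin n) (u : Fin n → ℂ) : Fin (n + 1) ⊕ Fin n → ℂ :=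
  Sum.elim 0 fun j => if j = k then 0 else christoffel x₀ k j j u * a k u / a j u

/-- The vectors `a_k e_k + h_k ν`, which will represent the second fundamental form. -/
noncomputable def curvVec (x₀ N₀ : (Fin n → ℂ) → (Fin (n + 1) → ℂ)) (a : Fin n → (Fin n → ℂ) → ℂ)
    (k : Fin n) (u : Fin n → ℂ) : Fin (n + 1) ⊕ Fin n → ℂ :=
  a k u • basisLift k + h₀ x₀ N₀ k u • ratioVec x₀ N₀ a u

/-- `a_k e_k + h_k (ν - N)`. -/
noncomputable def shiftVec (x₀ N₀ : (Fin n → ℂ) → (Fin (n + 1) → ℂ)) (a : Fin n → (Fin n → ℂ) → ℂ)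
    (k : Fin n) (u : Fin n → ℂ) : Fin (n + 1) ⊕ Fin n → ℂ :=
  a k u • basisLift k + h₀ x₀ N₀ k u • ratioVec x₀ N₀ a u - h₀ x₀ N₀ k u • normalLift N₀ u

/-- The flat connection whose parallel sections are the unit normals of the deformation. -/
noncomputable def rollingConn (x₀ N₀ : (Fin n → ℂ) → (Fin (n + 1) → ℂ))
    (a : Fin n → (Fin n → ℂ) → ℂ) (k : Fin n) (u : Fin n → ℂ) :
    (Fin (n + 1) ⊕ Fin n → ℂ) →L[ℂ] (Fin (n + 1) ⊕ Fin n → ℂ) :=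
  wedge (tangentLift x₀ k u) (shiftVec x₀ N₀ a k u) + wedge (basisLift k) (rotVec x₀ a k u)

theorem contDiffOn_sumElim {ι κ : Type} [Fintype ι] [Fintype κ] {f : (Fin n → ℂ) → ι → ℂ}
    {g : (Fin n → ℂ) → κ → ℂ} (hf : ContDiffOn ℂ ∞ f U) (hg : ContDiffOn ℂ ∞ g U) :
    ContDiffOn ℂ ∞ (fun v => Sum.elim (f v) (g v)) U := by
  rw [contDiffOn_pi]
  rintro (i | i)
  · exact contDiffOn_pi.mp hf i
  · exact contDiffOn_pi.mp hg i

theorem pd_wedge {ι : Type} [Fintype ι] {f g : (Fin n → ℂ) → (ι → ℂ)} {u : Fin n → ℂ}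
    (hf : DifferentiableAt ℂ f u) (hg : DifferentiableAt ℂ g u) (k : Fin n) (s : ι → ℂ) :
    pd k (fun v => wedge (f v) (g v) s) u = wedge (pd k f u) (g u) s + wedge (f u) (pd k g u) s := by
  have hs : DifferentiableAt ℂ (fun _ : Fin n → ℂ => s) u := differentiableAt_const s
  simp only [wedge_apply]
  rw [pd_sub ((hg.dotProduct hs).fun_smul hf) ((hf.dotProduct hs).fun_smul hg),
    pd_smul (hg.dotProduct hs) hf, pd_smul (hf.dotProduct hs) hg, pd_dot hg hs, pd_dot hf hs,
    pd_const, dotProduct_zero, dotProduct_zero]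
  module

section Dot

variable (hx₀ : IsConjugateNet x₀ U) (hN : IsUnitNormal x₀ N₀ U) {u : Fin n → ℂ} (hu : u ∈ U)

theorem tangentLift_dot_sumElim_zero (k : Fin n) (w : Fin n → ℂ) :
    tangentLift x₀ k u ⬝ᵥ Sum.elim 0 w = 0 := by
  simp [tangentLift, sumElim_dotProduct_sumElim]

theorem normalLift_dot_sumElim_zero (w : Fin n → ℂ) :
    normalLift N₀ u ⬝ᵥ Sum.elim 0 w = 0 := by
  simp [normalLift, sumElim_dotProduct_sumElim]

include hx₀ hu in
theorem tangentLift_dot_tangentLift (k l : Fin n) :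
    tangentLift x₀ k u ⬝ᵥ tangentLift x₀ l u = (metric x₀ u)⁻¹ l k := by
  simp [tangentLift, sumElim_dotProduct_sumElim, dualFrame_dot_dualFrame hx₀.regular hu]

include hN hu in
theorem tangentLift_dot_normalLift (k : Fin n) : tangentLift x₀ k u ⬝ᵥ normalLift N₀ u = 0 := by
  simp [tangentLift, normalLift, sumElim_dotProduct_sumElim, dotProduct_comm _ (N₀ u),
    dualFrame_dot_eq_zero (hN.normal u hu)]

include hN hu in
theorem normalLift_dot_normalLift : normalLift N₀ u ⬝ᵥ normalLift N₀ u = 1 := by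
  simp [normalLift, sumElim_dotProduct_sumElim, hN.unit u hu]

theorem basisLift_dot (k : Fin n) (v : Fin (n + 1) → ℂ) (w : Fin n → ℂ) :
    basisLift k ⬝ᵥ Sum.elim v w = w k := by
  simp [basisLift]

theorem dot_basisLift (k : Fin n) (v : Fin (n + 1) → ℂ) (w : Fin n → ℂ) :
    Sum.elim v w ⬝ᵥ basisLift k = w k := by
  rw [dotProduct_comm, basisLift_dot]

theorem ratioVec_dot_ratioVec (ha : IsSolution x₀ N₀ U a) (hu : u ∈ U) :
    ratioVec x₀ N₀ a u ⬝ᵥ ratioVec x₀ N₀ a u = -1 := by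
  rw [← eq_neg_of_add_eq_zero_left (ha.sum_eq u hu)]
  simp [ratioVec, dotProduct, ← pow_two, div_pow]

end Dot

section Flat

variable (hU : IsOpen U) (hx₀ : IsConjugateNet x₀ U) (hN : IsUnitNormal x₀ N₀ U)
  (hΓ : ∀ u ∈ U, ∀ j k l : Fin n, j ≠ k → j ≠ l → k ≠ l → christoffel x₀ l j k u = 0)
  (hh : ∀ u ∈ U, ∀ j, h₀ x₀ N₀ j u ≠ 0) (ha : IsSolution x₀ N₀ U a)
include hU hx₀ hN ha

omit hN ha in
theorem contDiffOn_tangentLift (k : Fin n) : ContDiffOn ℂ ∞ (tangentLift x₀ k) U :=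
  contDiffOn_sumElim (contDiffOn_dualFrame hU hx₀ k) contDiffOn_const

omit hU hx₀ ha in
theorem contDiffOn_normalLift : ContDiffOn ℂ ∞ (normalLift N₀) U :=
  contDiffOn_sumElim hN.holo contDiffOn_const

theorem contDiffOn_ratioVec : ContDiffOn ℂ ∞ (ratioVec x₀ N₀ a) U :=
  contDiffOn_sumElim contDiffOn_const <| contDiffOn_pi.mpr fun j =>
    (contDiffOn_h₀ hU hx₀ hN j).div (ha.holo j) (ha.ne_zero j)

omit hN in
theorem contDiffOn_rotVec (k : Fin n) : ContDiffOn ℂ ∞ (rotVec x₀ a k) U := by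
  refine contDiffOn_sumElim contDiffOn_const <| contDiffOn_pi.mpr fun j => ?_
  split_ifs
  · exact contDiffOn_const
  · exact ((contDiffOn_christoffel hU hx₀.holo hx₀.regular k j j).mul (ha.holo k)).div (ha.holo j)
      (ha.ne_zero j)

theorem contDiffOn_curvVec (k : Fin n) : ContDiffOn ℂ ∞ (curvVec x₀ N₀ a k) U :=
  ((ha.holo k).smul contDiffOn_const).add
    ((contDiffOn_h₀ hU hx₀ hN k).smul (contDiffOn_ratioVec hU hx₀ hN ha))

theorem contDiffOn_shiftVec (k : Fin n) : ContDiffOn ℂ ∞ (shiftVec x₀ N₀ a k) U :=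
  (((ha.holo k).smul contDiffOn_const).add
    ((contDiffOn_h₀ hU hx₀ hN k).smul (contDiffOn_ratioVec hU hx₀ hN ha))).sub
    ((contDiffOn_h₀ hU hx₀ hN k).smul (contDiffOn_normalLift hN))

theorem contDiffOn_rollingConn (k : Fin n) : ContDiffOn ℂ ∞ (rollingConn x₀ N₀ a k) U :=
  ((contDiffOn_tangentLift hU hx₀ k).wedge (contDiffOn_shiftVec hU hx₀ hN ha k)).add
    (contDiffOn_const.wedge (contDiffOn_rotVec hU hx₀ ha k))

omit hU hx₀ hN in
theorem pd_solution {j k : Fin n} (hjk : j ≠ k) {u : Fin n → ℂ} (hu : u ∈ U) :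
    pd k (a j) u = christoffel x₀ j j k u * a j u := by
  rw [← ha.log_deriv u hu j k hjk, div_mul_cancel₀ _ (ha.ne_zero j u hu)]

omit ha in
theorem pd_normalLift (k : Fin n) {u : Fin n → ℂ} (hu : u ∈ U) :
    pd k (normalLift N₀) u = -(h₀ x₀ N₀ k u • tangentLift x₀ k u) := by
  have h1 := pd_sumElim (g := fun _ => (0 : Fin n → ℂ)) (hN.holo.differentiableAt_of_isOpen hU hu)
    (differentiableAt_const _) k
  rw [pd_const, pd_unitNormal hU hx₀ hN hu] at h1
  unfold normalLift
  rw [h1]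
  ext (i | i) <;> simp [tangentLift]

include hΓ in
omit ha in
theorem pd_tangentLift {k l : Fin n} (hkl : k ≠ l) {u : Fin n → ℂ} (hu : u ∈ U) :
    pd k (tangentLift x₀ l) u = -(christoffel x₀ l l k u • tangentLift x₀ l u)
      - christoffel x₀ l k k u • tangentLift x₀ k u
      + (h₀ x₀ N₀ k u * (metric x₀ u)⁻¹ k l) • normalLift N₀ u := by
  have h1 := pd_sumElim (g := fun _ => (0 : Fin n → ℂ))
    ((contDiffOn_dualFrame hU hx₀ l).differentiableAt_of_isOpen hU hu) (differentiableAt_const _) k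
  rw [pd_const, pd_dualFrame hU hx₀ hN hΓ hu hkl] at h1
  unfold tangentLift
  rw [h1]
  ext (i | i) <;> simp [normalLift]

include hh in
-- For j ≠ k the component follows from Codazzi for h_j^0 and the system for a_j. The component k is
-- accessible only through ν · ∂_k ν = 0, and solving for it requires h_k^0 ≠ 0.
theorem pd_ratioVec (k : Fin n) {u : Fin n → ℂ} (hu : u ∈ U) :
    pd k (ratioVec x₀ N₀ a) u = wedge (basisLift k) (rotVec x₀ a k u) (ratioVec x₀ N₀ a u) := by
  have hd := (contDiffOn_ratioVec hU hx₀ hN ha).differentiableAt_of_isOpen hU hu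
  have hda := fun j => (ha.holo j).differentiableAt_of_isOpen hU hu
  have hdh := fun j => (contDiffOn_h₀ hU hx₀ hN j).differentiableAt_of_isOpen hU hu
  have hne := fun j => ha.ne_zero j u hu
  have comp : ∀ j, pd k (ratioVec x₀ N₀ a) u (Sum.inr j)
      = (pd k (h₀ x₀ N₀ j) u * a j u - h₀ x₀ N₀ j u * pd k (a j) u) / a j u ^ 2 := fun j => by
    rw [← pd_apply hd]
    exact pd_div (hdh j) (hda j) (hne j) k
  have off : ∀ j, j ≠ k → pd k (ratioVec x₀ N₀ a) u (Sum.inr j)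
      = -(christoffel x₀ k j j u * h₀ x₀ N₀ k u / a j u) := fun j hj => by
    rw [comp, pd_h₀ hU hx₀ hN hj hu, pd_solution ha hj hu]
    have := hne j
    field_simp
    ring
  have hz : ∀ i, pd k (ratioVec x₀ N₀ a) u (Sum.inl i) = 0 := fun i => by
    rw [← pd_apply hd]
    change pd k (fun _ => (0 : ℂ)) u = 0
    rw [pd_const]
  have hsum : ∑ j, h₀ x₀ N₀ j u / a j u * pd k (ratioVec x₀ N₀ a) u (Sum.inr j) = 0 := by
    have h1 := pd_dot hd hd k
    rw [pd_congr hU (fun v hv => ratioVec_dot_ratioVec ha hv) hu, pd_const,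
      dotProduct_comm (pd k (ratioVec x₀ N₀ a) u)] at h1
    have h2 : ratioVec x₀ N₀ a u ⬝ᵥ pd k (ratioVec x₀ N₀ a) u = 0 := by linear_combination -h1 / 2
    rw [dotProduct, Fintype.sum_sum_type] at h2
    simpa [ratioVec, hz] using h2
  ext (i | j)
  · rw [hz, wedge_apply]
    simp [basisLift, rotVec]
  · rw [wedge_apply, ratioVec, basisLift_dot, rotVec, sumElim_dotProduct_sumElim]
    by_cases hj : j = k
    · subst hj
      rw [← Finset.add_sum_erase _ _ (Finset.mem_univ j)] at hsum
      have h3 := hh u hu j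
      have h4 := hne j
      have e : (fun i => if i = j then 0 else christoffel x₀ j i i u * a j u / a i u) ⬝ᵥ
          (fun i => h₀ x₀ N₀ i u / a i u)
          = -(a j u / h₀ x₀ N₀ j u) * ∑ x ∈ Finset.univ.erase j,
            h₀ x₀ N₀ x u / a x u * pd j (ratioVec x₀ N₀ a) u (Sum.inr x) := by
        rw [dotProduct, ← Finset.add_sum_erase _ _ (Finset.mem_univ j), Finset.mul_sum, if_pos rfl,
          zero_mul, zero_add]
        refine Finset.sum_congr rfl fun i hi => ?_
        have hij := (Finset.mem_erase.mp hi).1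
        rw [off i hij, if_neg hij]
        field_simp
      rw [e, ← neg_eq_of_add_eq_zero_right hsum]
      simp [basisLift]
      field_simp
    · rw [off j hj]
      simp [basisLift, hj]
      have h4 := hne j
      have h5 := hne k
      field_simp

include hh in
-- The first wedge kills ν: it is orthogonal to X^k, and a_k e_k · ν = h_k^0 cancels h_k^0 ν · ν =
-- -h_k^0.
theorem ratioVec_parallel (k : Fin n) {u : Fin n → ℂ} (hu : u ∈ U) :
    pd k (ratioVec x₀ N₀ a) u = rollingConn x₀ N₀ a k u (ratioVec x₀ N₀ a u) := by
  have h1 : tangentLift x₀ k u ⬝ᵥ ratioVec x₀ N₀ a u = 0 := tangentLift_dot_sumElim_zero _ _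
  have h2 : shiftVec x₀ N₀ a k u ⬝ᵥ ratioVec x₀ N₀ a u = 0 := by
    have h3 : normalLift N₀ u ⬝ᵥ ratioVec x₀ N₀ a u = 0 := normalLift_dot_sumElim_zero _
    rw [shiftVec, sub_dotProduct, add_dotProduct, smul_dotProduct, smul_dotProduct,
      smul_dotProduct, ratioVec_dot_ratioVec ha hu, h3, ratioVec, basisLift_dot, smul_eq_mul,
      mul_div_cancel₀ _ (ha.ne_zero k u hu)]
    simp
  rw [pd_ratioVec hU hx₀ hN hh ha k hu, rollingConn, _root_.add_apply,
    wedge_apply (tangentLift x₀ k u), h1, h2]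
  simp

include hh in
theorem pd_curvVec {k l : Fin n} (hkl : k ≠ l) {u : Fin n → ℂ} (hu : u ∈ U) :
    pd k (curvVec x₀ N₀ a l) u = christoffel x₀ l l k u • curvVec x₀ N₀ a l u
      - christoffel x₀ k l l u • curvVec x₀ N₀ a k u
      + wedge (basisLift k) (rotVec x₀ a k u) (curvVec x₀ N₀ a l u) := by
  have hd := (contDiffOn_ratioVec hU hx₀ hN ha).differentiableAt_of_isOpen hU hu
  have hda := (ha.holo l).differentiableAt_of_isOpen hU hu
  have hdh := (contDiffOn_h₀ hU hx₀ hN l).differentiableAt_of_isOpen hU hu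
  have hde : DifferentiableAt ℂ (fun _ : Fin n → ℂ => (basisLift l : Fin (n + 1) ⊕ Fin n → ℂ)) u :=
    differentiableAt_const _
  have h1 : wedge (basisLift k) (rotVec x₀ a k u) (basisLift l)
      = (christoffel x₀ k l l u * a k u / a l u) • basisLift k := by
    rw [wedge_apply, rotVec, dot_basisLift, if_neg hkl.symm, basisLift.eq_1 l, basisLift_dot]
    simp [hkl]
  unfold curvVec
  rw [pd_add (hda.fun_smul hde) (hdh.fun_smul hd), pd_smul hda hde, pd_smul hdh hd, pd_const,
    pd_ratioVec hU hx₀ hN hh ha k hu, pd_solution ha hkl.symm hu, pd_h₀ hU hx₀ hN hkl.symm hu,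
    map_add, map_smul, map_smul, h1, smul_smul, mul_div_cancel₀ _ (ha.ne_zero l u hu)]
  module

include hh in
theorem pd_shiftVec {k l : Fin n} (hkl : k ≠ l) {u : Fin n → ℂ} (hu : u ∈ U) :
    pd k (shiftVec x₀ N₀ a l) u = christoffel x₀ l l k u • curvVec x₀ N₀ a l u
      - christoffel x₀ k l l u • curvVec x₀ N₀ a k u
      + wedge (basisLift k) (rotVec x₀ a k u) (curvVec x₀ N₀ a l u)
      - (christoffel x₀ l l k u * h₀ x₀ N₀ l u - christoffel x₀ k l l u * h₀ x₀ N₀ k u) •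
        normalLift N₀ u
      + (h₀ x₀ N₀ l u * h₀ x₀ N₀ k u) • tangentLift x₀ k u := by
  have hd := (contDiffOn_curvVec hU hx₀ hN ha l).differentiableAt_of_isOpen hU hu
  have hdh := (contDiffOn_h₀ hU hx₀ hN l).differentiableAt_of_isOpen hU hu
  have hdN := (contDiffOn_normalLift hN).differentiableAt_of_isOpen hU hu
  have e : shiftVec x₀ N₀ a l = fun v => curvVec x₀ N₀ a l v - h₀ x₀ N₀ l v • normalLift N₀ v := rfl
  rw [e, pd_sub hd (hdh.fun_smul hdN), pd_smul hdh hdN, pd_curvVec hU hx₀ hN hh ha hkl hu,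
    pd_h₀ hU hx₀ hN hkl.symm hu, pd_normalLift hU hx₀ hN k hu]
  module

include hΓ in
-- The components off e_k and e_l are given by the Gauss equation `pd_christoffel`. The remaining
-- two stay as unknowns p and q; only p enters the curvature.
theorem exists_pd_rotVec {k l : Fin n} (hkl : k ≠ l) {u : Fin n → ℂ} (hu : u ∈ U) :
    ∃ p q : ℂ, pd l (rotVec x₀ a k) u = p • basisLift l + q • basisLift k
      + ((metric x₀ u)⁻¹ l k * a k u * h₀ x₀ N₀ l u) • ratioVec x₀ N₀ a u
      - (rotVec x₀ a k u ⬝ᵥ basisLift l) • rotVec x₀ a l u := by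
  have hd := (contDiffOn_rotVec hU hx₀ ha k).differentiableAt_of_isOpen hU hu
  set T := pd l (rotVec x₀ a k) u
    - ((metric x₀ u)⁻¹ l k * a k u * h₀ x₀ N₀ l u) • ratioVec x₀ N₀ a u
    + (rotVec x₀ a k u ⬝ᵥ basisLift l) • rotVec x₀ a l u with hT
  have hz : ∀ i, T (Sum.inl i) = 0 := fun i => by
    have : pd l (rotVec x₀ a k) u (Sum.inl i) = 0 := by
      rw [← pd_apply hd]
      change pd l (fun _ => (0 : ℂ)) u = 0
      rw [pd_const]
    simp [hT, this, ratioVec, rotVec]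
  have hoff : ∀ j, j ≠ k → j ≠ l → T (Sum.inr j) = 0 := fun j hjk hjl => by
    have hda := fun j => (ha.holo j).differentiableAt_of_isOpen hU hu
    have hdΓ := (contDiffOn_christoffel hU hx₀.holo hx₀.regular k j j).differentiableAt_of_isOpen hU hu
    have h1 : pd l (rotVec x₀ a k) u (Sum.inr j)
        = ((pd l (christoffel x₀ k j j) u * a k u + christoffel x₀ k j j u * pd l (a k) u) * a j u
          - christoffel x₀ k j j u * a k u * pd l (a j) u) / a j u ^ 2 := by
      rw [← pd_apply hd, ← pd_mul hdΓ (hda k)]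
      simp only [rotVec, Sum.elim_inr, if_neg hjk]
      exact pd_div (hdΓ.fun_mul (hda k)) (hda j) (ha.ne_zero j u hu) l
    have h2 : rotVec x₀ a k u ⬝ᵥ basisLift l = christoffel x₀ k l l u * a k u / a l u := by
      rw [rotVec, dot_basisLift, if_neg hkl.symm]
    simp only [hT, Pi.add_apply, Pi.sub_apply, Pi.smul_apply, smul_eq_mul, h1, h2]
    simp only [ratioVec, rotVec, Sum.elim_inr, if_neg hjl]
    rw [pd_christoffel hU hx₀ hN hΓ hu hjl hjk hkl.symm, pd_solution ha hkl hu,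
      pd_solution ha hjl hu]
    have h3 := ha.ne_zero j u hu
    have h4 := ha.ne_zero l u hu
    field_simp
    ring
  refine ⟨T (Sum.inr l), T (Sum.inr k), ?_⟩
  have hTe : T = T (Sum.inr l) • basisLift l + T (Sum.inr k) • basisLift k := by
    ext (i | j)
    · rw [hz]; simp [basisLift]
    · by_cases hjk : j = k
      · subst hjk; simp [basisLift, hkl]
      · by_cases hjl : j = l
        · subst hjl; simp [basisLift, hjk]
        · rw [hoff j hjk hjl]; simp [basisLift, hjk, hjl]
  rw [← hTe, hT]
  abel

include hh hΓ in
/-- The connection is flat. -/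
theorem rollingConn_flat {u : Fin n → ℂ} (hu : u ∈ U) (k l : Fin n)
    (s : Fin (n + 1) ⊕ Fin n → ℂ) :
    pd l (fun v => rollingConn x₀ N₀ a k v s) u
        + rollingConn x₀ N₀ a k u (rollingConn x₀ N₀ a l u s)
      = pd k (fun v => rollingConn x₀ N₀ a l v s) u
        + rollingConn x₀ N₀ a l u (rollingConn x₀ N₀ a k u s) := by
  rcases eq_or_ne k l with rfl | hkl
  · rfl
  have hdX := fun k => (contDiffOn_tangentLift hU hx₀ k).differentiableAt_of_isOpen hU hu
  have hdP := fun k => (contDiffOn_shiftVec hU hx₀ hN ha k).differentiableAt_of_isOpen hU hu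
  have hdβ := fun k => (contDiffOn_rotVec hU hx₀ ha k).differentiableAt_of_isOpen hU hu
  have hdL := fun k => (contDiffOn_rollingConn hU hx₀ hN ha k).differentiableAt_of_isOpen hU hu
  have hds := (contDiffOn_ratioVec hU hx₀ hN ha).differentiableAt_of_isOpen hU hu
  have hpd : ∀ k l s, pd l (fun v => rollingConn x₀ N₀ a k v s) u
      = wedge (pd l (tangentLift x₀ k) u) (shiftVec x₀ N₀ a k u) s
        + wedge (tangentLift x₀ k u) (pd l (shiftVec x₀ N₀ a k) u) s
        + wedge (basisLift k) (pd l (rotVec x₀ a k) u) s := by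
    intro k l s
    have hde : DifferentiableAt ℂ (fun _ : Fin n → ℂ => (basisLift k : Fin (n + 1) ⊕ Fin n → ℂ)) u :=
      differentiableAt_const _
    have h1 : DifferentiableAt ℂ (fun v => wedge (tangentLift x₀ k v) (shiftVec x₀ N₀ a k v) s) u :=
      (((contDiffOn_tangentLift hU hx₀ k).wedge
        (contDiffOn_shiftVec hU hx₀ hN ha k)).differentiableAt_of_isOpen hU hu).clm_apply
        (differentiableAt_const _)
    have h2 : DifferentiableAt ℂ (fun v => wedge (basisLift k) (rotVec x₀ a k v) s) u :=
      ((contDiffOn_const.wedge (contDiffOn_rotVec hU hx₀ ha k)).differentiableAt_of_isOpen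
        hU hu).clm_apply (differentiableAt_const _)
    simp only [rollingConn, _root_.add_apply]
    rw [pd_add h1 h2, pd_wedge (hdX k) (hdP k), pd_wedge hde (hdβ k), pd_const]
    simp [wedge_apply]
  obtain ⟨p, q, hb⟩ := exists_pd_rotVec hU hx₀ hN hΓ ha hkl hu
  obtain ⟨r, t, hc⟩ := exists_pd_rotVec hU hx₀ hN hΓ ha hkl.symm hu
  have hg := metric_inv_symm (x := x₀) u k l
  have hcv : ∀ k, curvVec x₀ N₀ a k u
      = shiftVec x₀ N₀ a k u + h₀ x₀ N₀ k u • normalLift N₀ u := fun k => by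
    rw [curvVec, shiftVec]; abel
  have hν : ∀ k, a k u * (ratioVec x₀ N₀ a u ⬝ᵥ basisLift k) = h₀ x₀ N₀ k u := fun k => by
    rw [ratioVec, dot_basisLift, mul_div_cancel₀ _ (ha.ne_zero k u hu)]
  obtain ⟨C, hC⟩ := exists_curvature_eq (X := tangentLift x₀ k u) (Y := tangentLift x₀ l u)
    (N := normalLift N₀ u) (e := basisLift k) (f := basisLift l) (b := rotVec x₀ a k u)
    (c := rotVec x₀ a l u) (ν := ratioVec x₀ N₀ a u) (P := shiftVec x₀ N₀ a k u)
    (Q := shiftVec x₀ N₀ a l u) (dX := pd l (tangentLift x₀ k) u) (dY := pd k (tangentLift x₀ l) u)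
    (dP := pd l (shiftVec x₀ N₀ a k) u) (dQ := pd k (shiftVec x₀ N₀ a l) u)
    (db := pd l (rotVec x₀ a k) u) (dc := pd k (rotVec x₀ a l) u)
    (α := a k u) (β := a l u) (h := h₀ x₀ N₀ k u) (l := h₀ x₀ N₀ l u) (g := (metric x₀ u)⁻¹ l k)
    (G₁ := christoffel x₀ k k l u) (G₂ := christoffel x₀ l l k u) (G₃ := christoffel x₀ k l l u)
    (G₄ := christoffel x₀ l k k u) (p := p) (q := q) (r := r) (t := t) rfl rfl
    (pd_tangentLift hU hx₀ hN hΓ hkl.symm hu)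
    ((pd_tangentLift hU hx₀ hN hΓ hkl hu).trans (by rw [hg]))
    ((pd_shiftVec hU hx₀ hN hh ha hkl.symm hu).trans (by rw [hcv, hcv]))
    ((pd_shiftVec hU hx₀ hN hh ha hkl hu).trans (by rw [hcv, hcv, mul_comm (h₀ x₀ N₀ l u)]))
    hb (hc.trans (by rw [hg]))
    (tangentLift_dot_tangentLift hx₀ hu k l) (tangentLift_dot_normalLift hN hu k)
    (tangentLift_dot_normalLift hN hu l) (tangentLift_dot_sumElim_zero _ _)
    (tangentLift_dot_sumElim_zero _ _) (tangentLift_dot_sumElim_zero _ _)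
    (tangentLift_dot_sumElim_zero _ _) (tangentLift_dot_sumElim_zero _ _)
    (tangentLift_dot_sumElim_zero _ _) (normalLift_dot_normalLift hN hu)
    (normalLift_dot_sumElim_zero _) (normalLift_dot_sumElim_zero _)
    (normalLift_dot_sumElim_zero _) (normalLift_dot_sumElim_zero _)
    (normalLift_dot_sumElim_zero _) (by rw [basisLift.eq_1 l, basisLift_dot]; simp [hkl])
    (ratioVec_dot_ratioVec ha hu) (hν k) (hν l)
  have hflat : ∀ s, pd l (fun v => rollingConn x₀ N₀ a k v s) u
        + rollingConn x₀ N₀ a k u (rollingConn x₀ N₀ a l u s)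
      - (pd k (fun v => rollingConn x₀ N₀ a l v s) u
        + rollingConn x₀ N₀ a l u (rollingConn x₀ N₀ a k u s))
      = C • wedge (basisLift k) (basisLift l) s := fun s => by
    rw [hpd, hpd]
    exact hC s
  -- the curvature annihilates the parallel section `ν`
  have hpar := fun v hv k => ratioVec_parallel hU hx₀ hN hh ha k (u := v) hv
  have hC0 : C = 0 := by
    have h1 := pd_comm hU (contDiffOn_ratioVec hU hx₀ hN ha) hu k l
    rw [pd_congr hU (fun v hv => hpar v hv l) hu, pd_congr hU (fun v hv => hpar v hv k) hu,
      pd_clm_apply (hdL l) hds, pd_clm_apply (hdL k) hds, hpar u hu, hpar u hu] at h1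
    have h2 := hflat (ratioVec x₀ N₀ a u)
    rw [← h1, sub_self, wedge_apply] at h2
    have h3 := congrFun h2 (Sum.inr k)
    have h4 : basisLift l ⬝ᵥ ratioVec x₀ N₀ a u ≠ 0 := by
      rw [ratioVec, basisLift_dot]
      exact div_ne_zero (hh u hu l) (ha.ne_zero l u hu)
    have h5 : (0 : ℂ) = C * basisLift l ⬝ᵥ ratioVec x₀ N₀ a u := by
      simpa [basisLift, hkl] using h3
    rcases mul_eq_zero.mp h5.symm with h6 | h6
    · exact h6
    · exact absurd h6 h4
  rw [← sub_eq_zero, hflat, hC0, zero_smul]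

end Flat

end Realization

/-! ### Integration of the flat connection to a deformation -/

section Realization

variable {n : ℕ} {U : Set (Fin n → ℂ)} {x₀ N₀ : (Fin n → ℂ) → (Fin (n + 1) → ℂ)}
  {a : Fin n → (Fin n → ℂ) → ℂ}

/-- A closed system of partial derivatives on a convex open set has a primitive. -/
theorem exists_primitive (hU : IsOpen U) (hc : Convex ℝ U) {f : Fin n → (Fin n → ℂ) → ℂ}
    (hf : ∀ j, ContDiffOn ℂ ∞ (f j) U) (hsymm : ∀ u ∈ U, ∀ j k, pd k (f j) u = pd j (f k) u) :
    ∃ ξ : (Fin n → ℂ) → ℂ, ContDiffOn ℂ ∞ ξ U ∧ ∀ u ∈ U, ∀ j, pd j ξ u = f j u := by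
  set Ω : (Fin n → ℂ) → (Fin n → ℂ) →L[ℂ] ℂ := fun u =>
    ∑ k, f k u • ContinuousLinearMap.proj (R := ℂ) (φ := fun _ : Fin n => ℂ) k with hΩd
  have hΩa : ∀ u w, Ω u w = ∑ k, f k u * w k := fun u w => by simp [hΩd]
  have hΩ : ContDiffOn ℂ ∞ Ω U := ContDiffOn.sum fun k _ => (hf k).smul contDiffOn_const
  have hd : ∀ u ∈ U, ∀ v w, fderiv ℂ Ω u v w = ∑ l, v l * ∑ k, pd l (f k) u * w k := by
    intro u hu v w
    have hdΩ := hΩ.differentiableAt_of_isOpen hU hu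
    have h1 : fderiv ℂ (fun v => Ω v w) u v = fderiv ℂ Ω u v w := by
      rw [(hdΩ.hasFDerivAt.clm_apply (hasFDerivAt_const w u)).fderiv]
      simp
    rw [← h1, fderiv_apply_eq_sum_pd]
    refine Finset.sum_congr rfl fun l _ => ?_
    rw [smul_eq_mul]
    congr 1
    simp only [hΩa]
    have hdk : ∀ k, DifferentiableAt ℂ (f k) u := fun k => (hf k).differentiableAt_of_isOpen hU hu
    rw [pd_sum _ (fun k _ => (hdk k).fun_mul (differentiableAt_const _))]
    refine Finset.sum_congr rfl fun k _ => ?_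
    rw [pd_mul (hdk k) (differentiableAt_const _), pd_const, mul_zero, add_zero]
  obtain ⟨ξ, hξ⟩ := hc.exists_forall_hasFDerivAt_of_fderiv_symmetric (𝕜 := ℂ) hU
    (show DifferentiableOn ℝ Ω U from (hΩ.differentiableOn (by simp)).restrictScalars ℝ) (fun u hu v w => by
      rw [(hΩ.differentiableAt_of_isOpen hU hu).fderiv_restrictScalars ℝ]
      change fderiv ℂ Ω u v w = fderiv ℂ Ω u w v
      rw [hd u hu, hd u hu]
      simp only [Finset.mul_sum]
      rw [Finset.sum_comm]
      refine Finset.sum_congr rfl fun k _ => Finset.sum_congr rfl fun l _ => ?_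
      rw [hsymm u hu]
      ring)
  have hpd : ∀ u ∈ U, ∀ j, pd j ξ u = f j u := fun u hu j => by
    rw [pd, (hξ u hu).fderiv, hΩa]
    simp [Pi.single_apply]
  refine ⟨ξ, ?_, hpd⟩
  rw [contDiffOn_infty_iff_fderiv_of_isOpen hU]
  exact ⟨fun u hu => (hξ u hu).differentiableAt.differentiableWithinAt,
    hΩ.congr fun u hu => (hξ u hu).fderiv⟩

theorem rollingConn_dot (k : Fin n) (u : Fin n → ℂ) (s t : Fin (n + 1) ⊕ Fin n → ℂ) :
    rollingConn x₀ N₀ a k u s ⬝ᵥ t = -(s ⬝ᵥ rollingConn x₀ N₀ a k u t) := by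
  simp only [rollingConn, _root_.add_apply, add_dotProduct, dotProduct_add, wedge_dot]
  ring

/-- The coordinate vectors of a hypersurface in `ℂ^{n+1} ⊕ ℂ^n`. -/
noncomputable def coordLift (x₀ : (Fin n → ℂ) → (Fin (n + 1) → ℂ)) (j : Fin n)
    (u : Fin n → ℂ) : Fin (n + 1) ⊕ Fin n → ℂ := Sum.elim (pd j x₀ u) 0

section Rolling

variable (hU : IsOpen U) (hx₀ : IsConjugateNet x₀ U) (hN : IsUnitNormal x₀ N₀ U)
  (hΓ : ∀ u ∈ U, ∀ j k l : Fin n, j ≠ k → j ≠ l → k ≠ l → christoffel x₀ l j k u = 0)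
  (hh : ∀ u ∈ U, ∀ j, h₀ x₀ N₀ j u ≠ 0) (ha : IsSolution x₀ N₀ U a)

theorem normalLift_parallel (hU : IsOpen U) (hx₀ : IsConjugateNet x₀ U) (hN : IsUnitNormal x₀ N₀ U)
    (k : Fin n) {u : Fin n → ℂ} (hu : u ∈ U) :
    pd k (normalLift N₀) u = rollingConn x₀ N₀ a k u (normalLift N₀ u) := by
  have h1 : tangentLift x₀ k u ⬝ᵥ normalLift N₀ u = 0 := tangentLift_dot_normalLift hN hu k
  have h2 : shiftVec x₀ N₀ a k u ⬝ᵥ normalLift N₀ u = -h₀ x₀ N₀ k u := by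
    simp [shiftVec, sub_dotProduct, add_dotProduct, smul_dotProduct,
      ratioVec, basisLift, normalLift, sumElim_dotProduct_sumElim,
      hN.unit u hu]
  have h3 : rotVec x₀ a k u ⬝ᵥ normalLift N₀ u = 0 := by
    simp [rotVec, normalLift, sumElim_dotProduct_sumElim]
  have h4 : basisLift k ⬝ᵥ normalLift N₀ u = 0 := by
    rw [normalLift, basisLift_dot]; rfl
  rw [pd_normalLift hU hx₀ hN k hu, rollingConn, _root_.add_apply, wedge_apply, wedge_apply, h1,
    h2, h3, h4]
  simp

include hx₀ hN in
-- The X^k are dual to the coordinate vectors, and every other product of a coordinate vector with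
-- the constituents of the connection vanishes.
theorem rollingConn_coordLift (j k : Fin n) {u : Fin n → ℂ} (hu : u ∈ U) :
    rollingConn x₀ N₀ a k u (coordLift x₀ j u)
      = -((if j = k then 1 else 0 : ℂ) • shiftVec x₀ N₀ a k u) := by
  have h1 : tangentLift x₀ k u ⬝ᵥ coordLift x₀ j u = if j = k then 1 else 0 := by
    simp [tangentLift, coordLift, sumElim_dotProduct_sumElim, dualFrame_dot_pd hx₀.regular hu,
      eq_comm]
  have h2 : shiftVec x₀ N₀ a k u ⬝ᵥ coordLift x₀ j u = 0 := by
    simp [shiftVec, sub_dotProduct, add_dotProduct, smul_dotProduct, coordLift, ratioVec, basisLift,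
      normalLift, sumElim_dotProduct_sumElim, hN.normal u hu]
  have h3 : rotVec x₀ a k u ⬝ᵥ coordLift x₀ j u = 0 := by
    simp [rotVec, coordLift, sumElim_dotProduct_sumElim]
  have h4 : basisLift k ⬝ᵥ coordLift x₀ j u = 0 := by
    rw [coordLift, basisLift_dot]; rfl
  rw [rollingConn, _root_.add_apply, wedge_apply, wedge_apply, h1, h2, h3, h4]
  simp

include hU hx₀ hN in
/-- The derivatives of the products of the coordinate vectors with a parallel section. -/
theorem pd_coordLift_dot {y : (Fin n → ℂ) → (Fin (n + 1) ⊕ Fin n → ℂ)} {u : Fin n → ℂ}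
    (hu : u ∈ U) (hy : DifferentiableAt ℂ y u)
    (hpar : ∀ k, pd k y u = rollingConn x₀ N₀ a k u (y u)) (j k : Fin n) :
    pd k (fun v => coordLift x₀ j v ⬝ᵥ y v) u
      = ∑ l, christoffel x₀ l j k u * (coordLift x₀ l u ⬝ᵥ y u)
        + (if j = k then 1 else 0) * (curvVec x₀ N₀ a k u ⬝ᵥ y u) := by
  have hdj := (contDiffOn_pd hU hx₀.holo j).differentiableAt_of_isOpen hU hu
  have hd : DifferentiableAt ℂ (coordLift x₀ j) u :=
    (contDiffOn_sumElim (contDiffOn_pd hU hx₀.holo j) contDiffOn_const).differentiableAt_of_isOpen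
      hU hu
  have h1 : pd k (coordLift x₀ j) u = ∑ l, christoffel x₀ l j k u • coordLift x₀ l u
      + (if j = k then h₀ x₀ N₀ k u else 0) • normalLift N₀ u := by
    have h2 := pd_sumElim (g := fun _ => (0 : Fin n → ℂ)) hdj (differentiableAt_const _) k
    rw [pd_const, pd_pd_hypersurface hU hx₀ hN hu] at h2
    unfold coordLift
    rw [h2]
    ext (i | i) <;> split_ifs <;> simp [normalLift, Finset.sum_apply]
  -- Moving the skew connection from y to the coordinate vector adds P_k when j = k. This replaces
  -- the normal part h_k^0 N₀ by a_k e_k + h_k^0 ν, the future second form.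
  have h3 : curvVec x₀ N₀ a k u = shiftVec x₀ N₀ a k u + h₀ x₀ N₀ k u • normalLift N₀ u := by
    rw [curvVec, shiftVec]; abel
  have h4 := rollingConn_dot (x₀ := x₀) (N₀ := N₀) (a := a) k u (coordLift x₀ j u) (y u)
  rw [rollingConn_coordLift hx₀ hN j k hu] at h4
  rw [pd_dot hd hy, hpar, h1, h3, add_dotProduct, sum_dotProduct, ← neg_eq_iff_eq_neg.mpr h4]
  simp only [smul_dotProduct, neg_dotProduct, add_dotProduct, smul_eq_mul, neg_neg]
  split_ifs <;> ring

include hU hx₀ hN hΓ hh ha in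
/-- A solution `(𝐚_j)` is realized by a deformation. -/
theorem IsSolution.exists_isDeformation (hc : Convex ℝ U) (hn : 0 < n) :
    ∃ x, IsDeformation x₀ U x ∧ ∀ u ∈ U, ∀ j, a j u ^ 2 = joinedSq x₀ N₀ x j u := by
  rcases U.eq_empty_or_nonempty with rfl | ⟨u₀, hu₀⟩
  · exact ⟨0, ⟨contDiffOn_const, by simp, fun u hu => hu.elim, fun u hu => hu.elim⟩, by simp⟩
  set p₀ : Fin n := ⟨0, hn⟩
  -- a parallel orthonormal frame
  obtain ⟨Q₁, hQ₁, hQ₁r⟩ := exists_orthogonal_row (0 : Fin (n + 1)) (hN.unit u₀ hu₀)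
  obtain ⟨Q₂, hQ₂, hQ₂r⟩ := exists_orthogonal_row p₀
    (v := fun j => Complex.I * (h₀ x₀ N₀ j u₀ / a j u₀)) (by
      have := ratioVec_dot_ratioVec ha hu₀
      simp only [ratioVec, sumElim_dotProduct_sumElim, zero_dotProduct, zero_add] at this
      have e : (fun j => Complex.I * (h₀ x₀ N₀ j u₀ / a j u₀))
        = Complex.I • fun j => h₀ x₀ N₀ j u₀ / a j u₀ := rfl
      rw [e, smul_dotProduct, dotProduct_smul, this, smul_eq_mul, smul_eq_mul, ← mul_assoc,
        Complex.I_mul_I]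
      ring)
  -- Initial values for the parallel frame. Two of its rows are N₀ and iν, a unit vector because ν ·
  -- ν = -1; both are already parallel.
  set O : Matrix (Fin (n + 1) ⊕ Fin n) (Fin (n + 1) ⊕ Fin n) ℂ := Matrix.fromBlocks Q₁ 0 0 Q₂
    with hO
  have hOO : ∀ b c, O b ⬝ᵥ O c = if b = c then 1 else 0 := by
    have h1 : O * Oᵀ = 1 := by
      rw [hO, Matrix.fromBlocks_transpose, Matrix.fromBlocks_multiply, hQ₁, hQ₂]
      simp
    intro b c
    have h2 := congrFun (congrFun h1 b) c
    rw [Matrix.one_apply] at h2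
    exact h2
  have hON : O (Sum.inl 0) = normalLift N₀ u₀ := by
    ext (i | i)
    · exact congrFun hQ₁r i
    · rfl
  have hOν : O (Sum.inr p₀) = Complex.I • ratioVec x₀ N₀ a u₀ := by
    ext (i | i)
    · simp [hO, ratioVec]
    · exact congrFun hQ₂r i
  have hex := fun b => exists_parallel hU hc hu₀ (contDiffOn_rollingConn hU hx₀ hN ha)
    (fun u hu k l s => rollingConn_flat hU hx₀ hN hΓ hh ha hu k l s) (O b)
  choose y hy hy₀ hyp using hex
  have hconst : ∀ f g : (Fin n → ℂ) → (Fin (n + 1) ⊕ Fin n → ℂ), ContDiffOn ℂ ∞ f U →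
      ContDiffOn ℂ ∞ g U → (∀ u ∈ U, ∀ k, pd k f u = rollingConn x₀ N₀ a k u (f u)) →
      (∀ u ∈ U, ∀ k, pd k g u = rollingConn x₀ N₀ a k u (g u)) →
      ∀ u ∈ U, f u ⬝ᵥ g u = f u₀ ⬝ᵥ g u₀ := by
    intro f g hf hg hfp hgp u hu
    refine eq_of_pd_eq_zero hU hc (hf.dotProduct hg) (fun v hv k => ?_) hu hu₀
    rw [pd_dot (hf.differentiableAt_of_isOpen hU hv) (hg.differentiableAt_of_isOpen hU hv),
      hfp v hv, hgp v hv, rollingConn_dot]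
    ring
  have hyy : ∀ u ∈ U, ∀ b c, y b u ⬝ᵥ y c u = if b = c then 1 else 0 := fun u hu b c => by
    rw [hconst _ _ (hy b) (hy c) (hyp b) (hyp c) u hu, hy₀, hy₀, hOO]
  have hyN : ∀ u ∈ U, ∀ b, y b u ⬝ᵥ normalLift N₀ u = if b = Sum.inl 0 then 1 else 0 :=
    fun u hu b => by
      rw [hconst _ _ (hy b) (contDiffOn_normalLift hN) (hyp b)
        (fun v hv k => normalLift_parallel hU hx₀ hN k hv) u hu, hy₀, ← hON, hOO]
  have hyν : ∀ u ∈ U, ∀ b, y b u ⬝ᵥ (Complex.I • ratioVec x₀ N₀ a u)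
      = if b = Sum.inr p₀ then 1 else 0 := fun u hu b => by
    rw [dotProduct_smul, hconst _ _ (hy b) (contDiffOn_ratioVec hU hx₀ hN ha) (hyp b)
        (fun v hv k => ratioVec_parallel hU hx₀ hN hh ha k hv) u hu, hy₀, ← dotProduct_smul,
        ← hOν, hOO]
  have hcompl : ∀ u ∈ U, ∀ v w, ∑ b, (v ⬝ᵥ y b u) * (w ⬝ᵥ y b u) = v ⬝ᵥ w := by
    intro u hu v w
    set Y : Matrix (Fin (n + 1) ⊕ Fin n) (Fin (n + 1) ⊕ Fin n) ℂ := Matrix.of fun b => y b u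
      with hY
    have h1 : Y * Yᵀ = 1 := by
      ext b c
      rw [Matrix.one_apply]
      exact hyy u hu b c
    have h2 : Yᵀ * Y = 1 := mul_eq_one_comm.mp h1
    calc ∑ b, (v ⬝ᵥ y b u) * (w ⬝ᵥ y b u) = (Y *ᵥ v) ⬝ᵥ (Y *ᵥ w) :=
          Finset.sum_congr rfl fun b _ => by
            rw [dotProduct_comm v, dotProduct_comm w]; rfl
      _ = v ⬝ᵥ w := by
        rw [Matrix.dotProduct_mulVec, Matrix.vecMul_mulVec, ← Matrix.mulVec_transpose,
          Matrix.transpose_mul, Matrix.transpose_transpose, h2, Matrix.one_mulVec]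
  have hext : ∀ u ∈ U, ∀ v w : Fin (n + 1) ⊕ Fin n → ℂ, (∀ b, y b u ⬝ᵥ v = y b u ⬝ᵥ w) → v = w := by
    intro u hu v w h
    rw [← sub_eq_zero]
    refine dotProduct_eq_zero _ fun z => ?_
    rw [← hcompl u hu]
    refine Finset.sum_eq_zero fun b _ => ?_
    rw [dotProduct_comm, dotProduct_sub, h, sub_self, zero_mul]
  -- Products of parallel sections are constant, so a frame member that starts as N₀, or as iν,
  -- remains equal to it.
  have hyNe : ∀ u ∈ U, y (Sum.inl 0) u = normalLift N₀ u := fun u hu =>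
    hext u hu _ _ fun b => by rw [hyy u hu, hyN u hu]
  have hyνe : ∀ u ∈ U, y (Sum.inr p₀) u = Complex.I • ratioVec x₀ N₀ a u := fun u hu =>
    hext u hu _ _ fun b => by rw [hyy u hu, hyν u hu]
  -- the normal directions of the deformation
  set I := {b : Fin (n + 1) ⊕ Fin n // ¬(b = Sum.inl 0 ∨ b = Sum.inr p₀)} with hI
  have hcard : Fintype.card I = 2 * n - 1 := by
    rw [Fintype.card_subtype_compl, Fintype.card_subtype_or_disjoint, Fintype.card_subtype_eq,
      Fintype.card_subtype_eq, Fintype.card_sum, Fintype.card_fin, Fintype.card_fin]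
    · omega
    · rw [Pi.disjoint_iff]
      intro b
      simp only [Prop.disjoint_iff]
      rintro ⟨rfl, h⟩
      cases h
  set σ : I ≃ Fin (2 * n - 1) := Fintype.equivFinOfCardEq hcard
  -- Discarding the coordinates along N₀ and iν leaves 2n - 1 of them and does not change a product
  -- in which one factor is orthogonal to both.
  have hsum : ∀ u ∈ U, ∀ v w : Fin (n + 1) ⊕ Fin n → ℂ, v ⬝ᵥ normalLift N₀ u = 0 →
      v ⬝ᵥ ratioVec x₀ N₀ a u = 0 →
      (fun i => v ⬝ᵥ y (σ.symm i).1 u) ⬝ᵥ (fun i => w ⬝ᵥ y (σ.symm i).1 u) = v ⬝ᵥ w := by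
    intro u hu v w h1 h2
    have h3 : ∀ b, b = Sum.inl 0 ∨ b = Sum.inr p₀ → v ⬝ᵥ y b u = 0 := by
      rintro b (rfl | rfl)
      · rw [hyNe u hu, h1]
      · rw [hyνe u hu, dotProduct_smul, h2, smul_zero]
    rw [← hcompl u hu, dotProduct, σ.symm.sum_comp (fun b : I => (v ⬝ᵥ y b.1 u) * (w ⬝ᵥ y b.1 u)),
      ← Fintype.sum_subtype_add_sum_subtype (fun b => b = Sum.inl 0 ∨ b = Sum.inr p₀)
        (fun b => (v ⬝ᵥ y b u) * (w ⬝ᵥ y b u)),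
      Finset.sum_eq_zero (s := Finset.univ) (fun (b : {b // b = Sum.inl 0 ∨ b = Sum.inr p₀}) _ => by
        rw [h3 b.1 b.2, zero_mul]), zero_add]
  -- integration
  have hcs : ∀ j, ContDiffOn ℂ ∞ (coordLift x₀ j) U := fun j =>
    contDiffOn_sumElim (contDiffOn_pd hU hx₀.holo j) contDiffOn_const
  have hpd : ∀ b, ∀ u ∈ U, ∀ j k, pd k (fun v => coordLift x₀ j v ⬝ᵥ y b v) u
      = ∑ l, christoffel x₀ l j k u * (coordLift x₀ l u ⬝ᵥ y b u)
        + (if j = k then 1 else 0) * (curvVec x₀ N₀ a k u ⬝ᵥ y b u) := fun b u hu j k =>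
    pd_coordLift_dot hU hx₀ hN hu ((hy b).differentiableAt_of_isOpen hU hu) (hyp b u hu) j k
  have hprim := fun b => exists_primitive hU hc (fun j => (hcs j).dotProduct (hy b))
    (fun u hu j k => by
      rw [hpd b u hu, hpd b u hu]
      congr 1
      · simp only [christoffel_comm hU hx₀.holo hu _ j k]
      · by_cases hjk : j = k
        · rw [hjk]
        · rw [if_neg hjk, if_neg (Ne.symm hjk)]; simp)
  choose ξ hξ hξd using hprim
  -- The coordinates are primitives of the forms ∑ (∂_j x₀ · y_b) du^j. These are closed because Γ
  -- is symmetric and the additional term is diagonal.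
  set x : (Fin n → ℂ) → (Fin (2 * n - 1) → ℂ) := fun u i => ξ (σ.symm i).1 u with hx
  have hxs : ContDiffOn ℂ ∞ x U := contDiffOn_pi.mpr fun i => hξ _
  have hxd : ∀ u ∈ U, ∀ j, pd j x u = fun i => coordLift x₀ j u ⬝ᵥ y (σ.symm i).1 u := by
    intro u hu j
    ext i
    rw [← pd_apply (hxs.differentiableAt_of_isOpen hU hu)]
    exact hξd _ u hu j
  have hcN : ∀ u ∈ U, ∀ j, coordLift x₀ j u ⬝ᵥ normalLift N₀ u = 0 := fun u hu j => by
    simp [coordLift, normalLift, sumElim_dotProduct_sumElim, dotProduct_comm _ (N₀ u),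
      hN.normal u hu]
  have hcν : ∀ u ∈ U, ∀ j, coordLift x₀ j u ⬝ᵥ ratioVec x₀ N₀ a u = 0 := fun u hu j => by
    simp [coordLift, ratioVec, sumElim_dotProduct_sumElim]
  have hkN : ∀ u ∈ U, ∀ j, curvVec x₀ N₀ a j u ⬝ᵥ normalLift N₀ u = 0 := fun u hu j => by
    simp [curvVec, normalLift, ratioVec, basisLift, sumElim_dotProduct_sumElim]
  have hνe : ∀ u ∈ U, ∀ j, a j u * (ratioVec x₀ N₀ a u ⬝ᵥ basisLift j) = h₀ x₀ N₀ j u :=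
    fun u hu j => by
      rw [ratioVec, dot_basisLift, mul_div_cancel₀ _ (ha.ne_zero j u hu)]
  -- Orthogonality to N₀ and ν lets `hsum` compute the products of the second forms of `x` from
  -- those of the vectors a_j e_j + h_j^0 ν, namely δ_{jk} a_j² + h_j^0 h_k^0.
  have hkν : ∀ u ∈ U, ∀ j, curvVec x₀ N₀ a j u ⬝ᵥ ratioVec x₀ N₀ a u = 0 := fun u hu j => by
    have := hνe u hu j
    rw [dotProduct_comm] at this
    rw [curvVec, add_dotProduct, smul_dotProduct, smul_dotProduct, ratioVec_dot_ratioVec ha hu,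
      smul_eq_mul, this]
    simp
  have hkk : ∀ u ∈ U, ∀ j k, curvVec x₀ N₀ a j u ⬝ᵥ curvVec x₀ N₀ a k u
      = (if j = k then a j u ^ 2 else 0) + h₀ x₀ N₀ j u * h₀ x₀ N₀ k u := fun u hu j k => by
    have h1 := hkν u hu j
    rw [curvVec.eq_1 _ _ _ k, dotProduct_add, dotProduct_smul, dotProduct_smul, h1, curvVec,
      add_dotProduct, smul_dotProduct, smul_dotProduct, basisLift.eq_1 j, dot_basisLift]
    simp only [smul_eq_mul]
    have h2 := hνe u hu k
    split_ifs with hjk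
    · subst hjk
      simp only [Pi.single_eq_same]
      linear_combination h₀ x₀ N₀ j u * h2
    · simp only [Pi.single_eq_of_ne (Ne.symm hjk)]
      linear_combination h₀ x₀ N₀ j u * h2
  have hck : ∀ u ∈ U, ∀ j k, curvVec x₀ N₀ a k u ⬝ᵥ coordLift x₀ j u = 0 := fun u hu j k => by
    simp [curvVec, coordLift, ratioVec, basisLift, sumElim_dotProduct_sumElim]
  have hmet : ∀ u ∈ U, metric x u = metric x₀ u := fun u hu => by
    ext j k
    rw [metric_apply, hxd u hu, hxd u hu, hsum u hu _ _ (hcN u hu j) (hcν u hu j)]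
    simp [coordLift, sumElim_dotProduct_sumElim, metric_apply]
  have hreg : IsRegular x U := fun u hu => by rw [hmet u hu]; exact hx₀.regular u hu
  have hII : ∀ u ∈ U, ∀ j k, secondForm x j k u
      = (if j = k then 1 else 0 : ℂ) • fun i => curvVec x₀ N₀ a k u ⬝ᵥ y (σ.symm i).1 u := by
    intro u hu j k
    refine (christoffel_secondForm_unique hU hxs hreg hu (c := fun l => christoffel x₀ l j k u)
      ?_ fun p => ?_).2
    · ext i
      rw [pd_congr hU (fun v hv => hxd v hv j) hu]
      have hd : DifferentiableAt ℂ (fun v i => coordLift x₀ j v ⬝ᵥ y (σ.symm i).1 v) u :=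
        differentiableAt_pi.mpr fun i =>
          ((hcs j).dotProduct (hy _)).differentiableAt_of_isOpen hU hu
      rw [← pd_apply hd, hpd _ u hu]
      simp [hxd u hu]
      split_ifs <;> rfl
    · rw [smul_dotProduct, hxd u hu, hsum u hu _ _ (hkN u hu k) (hkν u hu k), hck u hu, smul_zero]
  have hIIdot : ∀ u ∈ U, ∀ j k, secondForm x j j u ⬝ᵥ secondForm x k k u
      = (if j = k then a j u ^ 2 else 0) + h₀ x₀ N₀ j u * h₀ x₀ N₀ k u := fun u hu j k => by
    rw [hII u hu, hII u hu, if_pos rfl, if_pos rfl, one_smul, one_smul,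
      hsum u hu _ _ (hkN u hu j) (hkν u hu j), hkk u hu]
  refine ⟨x, ⟨hxs, hmet, fun u hu j k hjk => ?_, fun u hu => ?_⟩, fun u hu j => ?_⟩
  · rw [hII u hu, if_neg hjk, zero_smul]
  · rw [Fintype.linearIndependent_iff]
    intro c hcz k
    rw [← Prod.mk_zero_zero] at hcz
    have h1 := congrArg Prod.fst hcz
    have h2 := congrArg Prod.snd hcz
    simp only [Prod.fst_sum, Prod.snd_sum, Prod.smul_fst, Prod.smul_snd] at h1 h2
    have h3 : ∑ j, c j * h₀ x₀ N₀ j u = 0 := by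
      have := congrArg (fun v => v ⬝ᵥ N₀ u) h1
      simpa [sum_dotProduct, ← h₀_eq_secondForm_dot hN hu] using this
    have h4 := congrArg (fun v => v ⬝ᵥ secondForm x k k u) h2
    simp only [sum_dotProduct, smul_dotProduct, hIIdot u hu, zero_dotProduct, smul_eq_mul, mul_add,
      Finset.sum_add_distrib, ← mul_assoc, ← Finset.sum_mul, h3, zero_mul, add_zero] at h4
    simp at h4
    exact h4.resolve_right (ha.ne_zero k u hu)
  · rw [joinedSq, hIIdot u hu, if_pos rfl]
    ring

end Rolling

end Realization

/-! ### Quadrics -/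

section Quadric

theorem dotProduct_mulVec_comm {ι : Type} [Fintype ι] {M : Matrix ι ι ℂ} (hM : M.IsSymm)
    (v w : ι → ℂ) : v ⬝ᵥ (M *ᵥ w) = w ⬝ᵥ (M *ᵥ v) := by
  rw [Matrix.dotProduct_mulVec, ← Matrix.mulVec_transpose, hM.eq, dotProduct_comm]

variable {n : ℕ} {U : Set (Fin n → ℂ)}

theorem pd_dotProduct_mulVec {m : ℕ} {f g : (Fin n → ℂ) → (Fin m → ℂ)} {u : Fin n → ℂ}
    (hf : DifferentiableAt ℂ f u) (hg : DifferentiableAt ℂ g u) (M : Matrix (Fin m) (Fin m) ℂ)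
    (k : Fin n) : pd k (fun v => f v ⬝ᵥ (M *ᵥ g v)) u
      = pd k f u ⬝ᵥ (M *ᵥ g u) + f u ⬝ᵥ (M *ᵥ pd k g u) := by
  have hMg : DifferentiableAt ℂ (fun v => M *ᵥ g v) u :=
    (LinearMap.toContinuousLinearMap (Matrix.mulVecLin M)).differentiableAt.comp u hg
  rw [pd_dot hf hMg, pd_mulVec hg]

theorem differentiableAt_vecCons {m : ℕ} {f : (Fin n → ℂ) → (Fin m → ℂ)} {u : Fin n → ℂ}
    (hf : DifferentiableAt ℂ f u) (c : ℂ) :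
    DifferentiableAt ℂ (fun v => (Matrix.vecCons c (f v) : Fin (m + 1) → ℂ)) u := by
  rw [differentiableAt_pi]
  intro i
  refine Fin.cases ?_ (fun i => ?_) i
  · exact differentiableAt_const _
  · exact differentiableAt_pi.mp hf i

theorem pd_vecCons {m : ℕ} {f : (Fin n → ℂ) → (Fin m → ℂ)} {u : Fin n → ℂ}
    (hf : DifferentiableAt ℂ f u) (c : ℂ) (k : Fin n) :
    pd k (fun v => (Matrix.vecCons c (f v) : Fin (m + 1) → ℂ)) u
      = Matrix.vecCons 0 (pd k f u) := by
  have hd := differentiableAt_vecCons hf c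
  ext i
  rw [← pd_apply hd]
  refine Fin.cases ?_ (fun i => ?_) i
  · exact pd_const k c u
  · exact pd_apply hf k i

variable {x₀ N₀ : (Fin n → ℂ) → (Fin (n + 1) → ℂ)}

theorem vecCons_zero_sum (u : Fin n → ℂ) (c : Fin n → ℂ) (d : ℂ) :
    (Matrix.vecCons 0 (∑ l, c l • pd l x₀ u + d • N₀ u) : Fin (n + 1 + 1) → ℂ)
      = ∑ l, c l • (Matrix.vecCons 0 (pd l x₀ u) : Fin (n + 1 + 1) → ℂ)
        + d • Matrix.vecCons 0 (N₀ u) := by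
  ext i
  refine Fin.cases ?_ (fun i => ?_) i <;> simp [Finset.sum_apply]

variable {M : Matrix (Fin (n + 1 + 1)) (Fin (n + 1 + 1)) ℂ}
  (hU : IsOpen U) (hx₀ : IsConjugateNet x₀ U) (hN : IsUnitNormal x₀ N₀ U) (hM : M.IsSymm)
  (hMx : ∀ u ∈ U, Matrix.vecCons 1 (x₀ u) ⬝ᵥ (M *ᵥ Matrix.vecCons 1 (x₀ u)) = 0)
include hU hx₀ hM hMx

theorem pd_dot_mulVec_eq_zero {u : Fin n → ℂ} (hu : u ∈ U) (j : Fin n) :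
    Matrix.vecCons 0 (pd j x₀ u) ⬝ᵥ (M *ᵥ Matrix.vecCons 1 (x₀ u)) = 0 := by
  have hd := hx₀.holo.differentiableAt_of_isOpen hU hu
  have h1 := pd_dotProduct_mulVec (differentiableAt_vecCons hd 1) (differentiableAt_vecCons hd 1) M j
  rw [pd_congr hU hMx hu, pd_const, pd_vecCons hd,
    dotProduct_mulVec_comm hM (Matrix.vecCons 1 (x₀ u))] at h1
  linear_combination -h1 / 2

include hN

/-- The derivative of the tangency relation. It says that a conjugate system consists of directions
that are mutually polar with respect to the quadric. -/
theorem pd_dot_mulVec_pd {u : Fin n → ℂ} (hu : u ∈ U) (j k : Fin n) :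
    Matrix.vecCons 0 (pd j x₀ u) ⬝ᵥ (M *ᵥ Matrix.vecCons 0 (pd k x₀ u))
      = if j = k then
          -(h₀ x₀ N₀ k u * (Matrix.vecCons 0 (N₀ u) ⬝ᵥ (M *ᵥ Matrix.vecCons 1 (x₀ u)))) else 0 := by
  have hd := hx₀.holo.differentiableAt_of_isOpen hU hu
  have hdj := (contDiffOn_pd hU hx₀.holo j).differentiableAt_of_isOpen hU hu
  have h1 := pd_dotProduct_mulVec (differentiableAt_vecCons hdj 0) (differentiableAt_vecCons hd 1) M k
  rw [pd_congr hU (fun v hv => pd_dot_mulVec_eq_zero hU hx₀ hM hMx hv j) hu, pd_const,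
    pd_vecCons hd, pd_vecCons hdj, pd_pd_hypersurface hU hx₀ hN hu, vecCons_zero_sum,
    add_dotProduct, sum_dotProduct] at h1
  simp only [smul_dotProduct, pd_dot_mulVec_eq_zero hU hx₀ hM hMx hu,
    Finset.sum_const_zero, zero_add, smul_eq_mul, mul_zero] at h1
  split_ifs at h1 ⊢ with h
  · linear_combination -h1
  · simp only [zero_add, zero_mul] at h1
    exact h1.symm

variable (hdet : M.det ≠ 0)
include hdet

/-- If h_j^0 = 0, then subtracting a multiple of the point from the tangent vector ∂_j x₀, both in
homogeneous coordinates, gives a vector in the kernel of M. Its first coordinate shows that the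
multiple is zero, so ∂_j x₀ = 0, against regularity. -/
theorem h₀_ne_zero_of_quadric {u : Fin n → ℂ} (hu : u ∈ U) (j : Fin n) : h₀ x₀ N₀ j u ≠ 0 := by
  set X : Fin (n + 1 + 1) → ℂ := Matrix.vecCons 1 (x₀ u) with hX
  set N : Fin (n + 1 + 1) → ℂ := Matrix.vecCons 0 (N₀ u) with hNd
  set T : Fin n → Fin (n + 1 + 1) → ℂ := fun k => Matrix.vecCons 0 (pd k x₀ u) with hT
  have key : ∀ w : Fin (n + 1 + 1) → ℂ, X ⬝ᵥ (M *ᵥ w) = 0 → (∀ k, T k ⬝ᵥ (M *ᵥ w) = 0) →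
      N ⬝ᵥ (M *ᵥ w) = 0 → w = 0 := by
    intro w h1 h2 h3
    have h4 : M *ᵥ w = 0 := by
      set v := M *ᵥ w
      have hv : v = Matrix.vecCons (v 0) (fun i => v i.succ) := by
        ext i
        refine Fin.cases ?_ (fun i => ?_) i <;> rfl
      rw [hv] at h1 h2 h3
      simp only [hX, hT, hNd, Matrix.cons_dotProduct_cons, zero_mul, zero_add, one_mul] at h1 h2 h3
      have h5 : (fun i => v (Fin.succ i)) = 0 := eq_of_dot_eq hx₀ hN hu
        (fun p => by rw [dotProduct_comm, h2, zero_dotProduct])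
        (by rw [dotProduct_comm, h3, zero_dotProduct])
      rw [h5, dotProduct_zero, add_zero] at h1
      rw [hv, h5, h1]
      ext i
      refine Fin.cases ?_ (fun i => ?_) i <;> rfl
    by_contra hw
    exact hdet (Matrix.exists_mulVec_eq_zero_iff.mp ⟨w, hw, h4⟩)
  -- Otherwise X itself would lie in the kernel of M, while its first coordinate is 1.
  have hμ : N ⬝ᵥ (M *ᵥ X) ≠ 0 := fun h => by
    have := congrFun (key X (hMx u hu) (pd_dot_mulVec_eq_zero hU hx₀ hM hMx hu) h) 0
    simp [hX] at this
  intro hj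
  set t := N ⬝ᵥ (M *ᵥ T j) / N ⬝ᵥ (M *ᵥ X) with ht
  have hw : T j - t • X = 0 := by
    refine key _ ?_ (fun k => ?_) ?_
    · rw [Matrix.mulVec_sub, Matrix.mulVec_smul, dotProduct_sub, dotProduct_smul, hMx u hu,
        dotProduct_mulVec_comm hM, pd_dot_mulVec_eq_zero hU hx₀ hM hMx hu]
      simp
    · rw [Matrix.mulVec_sub, Matrix.mulVec_smul, dotProduct_sub, dotProduct_smul,
        pd_dot_mulVec_eq_zero hU hx₀ hM hMx hu, pd_dot_mulVec_pd hU hx₀ hN hM hMx hu]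
      split_ifs
      · simp [hj]
      · simp
    · rw [Matrix.mulVec_sub, Matrix.mulVec_smul, dotProduct_sub, dotProduct_smul, smul_eq_mul, ht,
        div_mul_cancel₀ _ hμ, sub_self]
  have ht0 : t = 0 := by
    have := congrFun hw 0
    simpa [hT, hX] using this
  have hTj : pd j x₀ u = 0 := by
    ext i
    have := congrFun hw i.succ
    simpa [hT, ht0] using this
  have := dualFrame_dot_pd hx₀.regular hu j j
  rw [hTj, if_pos rfl, dotProduct_zero] at this
  exact zero_ne_one this

/-- Needed because realizing a solution cannot presuppose a deformation. Differentiating polarity of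
∂_j and ∂_k in the direction l relates two symbols; the three relations have only the zero solution.
-/
theorem christoffel_eq_zero_of_quadric {u : Fin n → ℂ} (hu : u ∈ U) {j k l : Fin n} (hjk : j ≠ k)
    (hjl : j ≠ l) (hkl : k ≠ l) : christoffel x₀ l j k u = 0 := by
  set B : Fin n → ℂ := fun k => Matrix.vecCons 0 (pd k x₀ u) ⬝ᵥ (M *ᵥ Matrix.vecCons 0 (pd k x₀ u))
    with hB
  have hB0 : ∀ k, B k ≠ 0 := fun k h => by
    have h1 := h₀_ne_zero_of_quadric hU hx₀ hN hM hMx hdet hu k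
    rw [hB] at h
    simp only [pd_dot_mulVec_pd hU hx₀ hN hM hMx hu, if_true, neg_eq_zero, mul_eq_zero, h1,
      false_or] at h
    have hz : Matrix.vecCons 1 (x₀ u) = 0 := by
      by_contra hw
      refine hdet (Matrix.exists_mulVec_eq_zero_iff.mp ⟨_, hw, ?_⟩)
      set v := M *ᵥ Matrix.vecCons 1 (x₀ u)
      have hv : v = Matrix.vecCons (v 0) (fun i => v i.succ) := by
        ext i
        refine Fin.cases ?_ (fun i => ?_) i <;> rfl
      have e1 : Matrix.vecCons 1 (x₀ u) ⬝ᵥ v = 0 := hMx u hu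
      have e2 := fun p => pd_dot_mulVec_eq_zero hU hx₀ hM hMx hu p
      change ∀ p, Matrix.vecCons 0 (pd p x₀ u) ⬝ᵥ v = 0 at e2
      rw [hv] at e1 e2 h
      simp only [Matrix.cons_dotProduct_cons, zero_mul, zero_add, one_mul] at e1 e2 h
      have h5 : (fun i => v (Fin.succ i)) = 0 := eq_of_dot_eq hx₀ hN hu
        (fun p => by rw [dotProduct_comm, e2, zero_dotProduct])
        (by rw [dotProduct_comm, h, zero_dotProduct])
      rw [h5, dotProduct_zero, add_zero] at e1
      rw [hv, h5, e1]
      ext i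
      refine Fin.cases ?_ (fun i => ?_) i <;> rfl
    simpa using congrFun hz 0
  have key : ∀ j k l : Fin n, j ≠ k → j ≠ l → k ≠ l →
      christoffel x₀ k j l u * B k + christoffel x₀ j k l u * B j = 0 := by
    intro j k l hjk hjl hkl
    have hdj := (contDiffOn_pd hU hx₀.holo j).differentiableAt_of_isOpen hU hu
    have hdk := (contDiffOn_pd hU hx₀.holo k).differentiableAt_of_isOpen hU hu
    have h1 := pd_dotProduct_mulVec (differentiableAt_vecCons hdj 0)
      (differentiableAt_vecCons hdk 0) M l
    rw [pd_congr hU (fun v hv => (pd_dot_mulVec_pd hU hx₀ hN hM hMx hv j k).trans (if_neg hjk)) hu,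
      pd_const, pd_vecCons hdj, pd_vecCons hdk, dotProduct_mulVec_comm hM (Matrix.vecCons 0 (pd j x₀ u)),
      pd_pd_hypersurface hU hx₀ hN hu, pd_pd_hypersurface hU hx₀ hN hu, if_neg hjl, if_neg hkl,
      vecCons_zero_sum, vecCons_zero_sum, zero_smul, add_zero, add_zero, sum_dotProduct,
      sum_dotProduct] at h1
    have e : ∀ (c : Fin n → ℂ) (i : Fin n), ∑ p, (c p • (Matrix.vecCons 0 (pd p x₀ u) :
        Fin (n + 1 + 1) → ℂ)) ⬝ᵥ (M *ᵥ Matrix.vecCons 0 (pd i x₀ u)) = c i * B i := fun c i => by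
      rw [Finset.sum_eq_single i]
      · rw [smul_dotProduct, smul_eq_mul]
      · intro p _ hp
        rw [smul_dotProduct, pd_dot_mulVec_pd hU hx₀ hN hM hMx hu, if_neg hp, smul_zero]
      · simp
    rw [e, e] at h1
    exact h1.symm
  have e1 := key l j k hjl.symm hkl.symm hjk
  have e2 := key j k l hjk hjl hkl
  have e3 := key k l j hkl hjk.symm hjl.symm
  have hs := fun i p q => christoffel_comm hU hx₀.holo hu i p q
  rw [hs j l k] at e1
  rw [hs l k j, hs k l j] at e3
  -- The three quantities Γ^l_{jk} B_l, Γ^k_{jl} B_k and Γ^j_{kl} B_j have pairwise sums zero.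
  have : christoffel x₀ l j k u * B l = 0 := by linear_combination (e1 - e2 + e3) / 2
  exact (mul_eq_zero.mp this).resolve_right (hB0 l)

end Quadric

/-! ### The bijection between deformations and solutions -/

section Bijection

variable {n : ℕ} {U : Set (Fin n → ℂ)} {x₀ N₀ : (Fin n → ℂ) → (Fin (n + 1) → ℂ)}

/-- The quotient has square 1, so its derivatives vanish and it is constant on a convex set. -/
theorem exists_sign_of_sq_eq (hU : IsOpen U) (hc : Convex ℝ U) {f g : (Fin n → ℂ) → ℂ}
    (hf : ContDiffOn ℂ ∞ f U) (hg : ContDiffOn ℂ ∞ g U) (h0 : ∀ u ∈ U, f u ≠ 0)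
    (h : ∀ u ∈ U, g u ^ 2 = f u ^ 2) :
    ∃ ε : ℂ, (ε = 1 ∨ ε = -1) ∧ ∀ u ∈ U, g u = ε * f u := by
  rcases U.eq_empty_or_nonempty with rfl | ⟨u₀, hu₀⟩
  · exact ⟨1, Or.inl rfl, by simp⟩
  have hr : ContDiffOn ℂ ∞ (fun v => g v / f v) U := hg.div hf h0
  have hsq : ∀ u ∈ U, (g u / f u) ^ 2 = 1 := fun u hu => by
    rw [div_pow, h u hu, div_self (pow_ne_zero 2 (h0 u hu))]
  have hconst : ∀ u ∈ U, g u / f u = g u₀ / f u₀ := fun u hu => by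
    refine eq_of_pd_eq_zero hU hc hr (fun v hv k => ?_) hu hu₀
    have h1 := pd_sq (hr.differentiableAt_of_isOpen hU hv) k
    rw [pd_congr hU hsq hv, pd_const] at h1
    have h2 : g v / f v ≠ 0 := fun h3 => by
      have := hsq v hv
      rw [h3] at this
      norm_num at this
    exact (mul_eq_zero.mp h1.symm).resolve_left (mul_ne_zero two_ne_zero h2)
  refine ⟨g u₀ / f u₀, sq_eq_one_iff.mp (hsq u₀ hu₀), fun u hu => ?_⟩
  rw [← hconst u hu, div_mul_cancel₀ _ (h0 u hu)]

/-- Well defined because rigid motions preserve |h_j|² and holomorphic roots are unique up to sign.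
Injectivity is `IsDeformation.congruent`, surjectivity `IsSolution.exists_isDeformation`. -/
theorem IsConjugateQuadric.exists_equiv (hn : 0 < n) (hU : IsOpen U) (hc : Convex ℝ U)
    (hq : IsConjugateQuadric x₀ U) (hN : IsUnitNormal x₀ N₀ U) :
    ∃ Φ : Quotient (deformationSetoid x₀ U) ≃ Quotient (solutionSetoid x₀ N₀ U),
      ∀ (x : {x // IsDeformation x₀ U x}) (a : {a // IsSolution x₀ N₀ U a}),
        Φ (Quotient.mk _ x) = Quotient.mk _ a ↔
          ∀ u ∈ U, ∀ j, a.1 j u ^ 2 = joinedSq x₀ N₀ x.1 j u := by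
  have hx₀ := hq.isConjugateNet
  obtain ⟨M, hM, hdet, hMx⟩ := hq.quadric
  have hs : ∀ x : {x // IsDeformation x₀ U x}, ∃ a : {a // IsSolution x₀ N₀ U a},
      ∀ u ∈ U, ∀ j, a.1 j u ^ 2 = joinedSq x₀ N₀ x.1 j u := fun x => by
    obtain ⟨a, ha, h⟩ := x.2.exists_isSolution hU hx₀ hN hc hn
    exact ⟨⟨a, ha⟩, h⟩
  choose s hs using hs
  have hsign : ∀ a b : {a // IsSolution x₀ N₀ U a},
      (∀ u ∈ U, ∀ j, b.1 j u ^ 2 = a.1 j u ^ 2) → SameUpToSigns U a.1 b.1 := fun a b h => by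
    have := fun j => exists_sign_of_sq_eq hU hc (a.2.holo j) (b.2.holo j) (a.2.ne_zero j)
      (fun u hu => h u hu j)
    choose ε hε hab using this
    exact ⟨ε, hε, hab⟩
  have hsq : ∀ a b : {a // IsSolution x₀ N₀ U a}, SameUpToSigns U a.1 b.1 →
      ∀ u ∈ U, ∀ j, b.1 j u ^ 2 = a.1 j u ^ 2 := by
    rintro a b ⟨ε, hε, h⟩ u hu j
    rw [h j u hu, mul_pow]
    rcases hε j with h1 | h1 <;> rw [h1] <;> ring
  let φ : Quotient (deformationSetoid x₀ U) → Quotient (solutionSetoid x₀ N₀ U) :=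
    Quotient.lift (fun x => Quotient.mk _ (s x)) fun x y hxy => Quotient.sound <|
      hsign _ _ fun u hu j => by
        rw [hs x u hu, hs y u hu]
        exact Congruent.joinedSq_eq hU x.2.holo hxy hu j
  have hφ : ∀ (x : {x // IsDeformation x₀ U x}) (a : {a // IsSolution x₀ N₀ U a}),
      φ (Quotient.mk _ x) = Quotient.mk _ a ↔
        ∀ u ∈ U, ∀ j, a.1 j u ^ 2 = joinedSq x₀ N₀ x.1 j u := fun x a => by
    constructor
    · intro h u hu j
      rw [hsq _ _ (Quotient.exact h) u hu j, hs x u hu]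
    · intro h
      refine Quotient.sound (hsign _ _ fun u hu j => ?_)
      rw [h u hu, hs x u hu]
  refine ⟨Equiv.ofBijective φ ⟨?_, ?_⟩, hφ⟩
  · intro p q
    induction p using Quotient.inductionOn with | h x => ?_
    induction q using Quotient.inductionOn with | h y => ?_
    intro h
    have h1 := (hφ x (s y)).mp h
    exact Quotient.sound (IsDeformation.congruent hU hx₀ hN hc hn x.2 y.2 fun u hu j => by
      rw [← h1 u hu, hs y u hu])
  · intro q
    induction q using Quotient.inductionOn with | h a => ?_
    obtain ⟨x, hx, h⟩ := a.2.exists_isDeformation hU hx₀ hN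
      (fun u hu j k l hjk hjl hkl =>
        christoffel_eq_zero_of_quadric hU hx₀ hN hM hMx hdet hu hjk hjl hkl)
      (fun u hu j => h₀_ne_zero_of_quadric hU hx₀ hN hM hMx hdet hu j) hc hn
    exact ⟨Quotient.mk _ ⟨x, hx⟩, (hφ ⟨x, hx⟩ a).mpr h⟩

end Bijection

/-! ### Iterated cones -/

section Line

variable {n : ℕ} {E : Type} [NormedAddCommGroup E] [NormedSpace ℂ E]

theorem pd_eq_of_hasDerivAt {f : (Fin n → ℂ) → E} {u : Fin n → ℂ} (hf : DifferentiableAt ℂ f u)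
    (j : Fin n) {f' : E} (h : HasDerivAt (fun t => f (Function.update u j t)) f' (u j)) :
    pd j f u = f' := by
  have h1 : HasDerivAt (fun t : ℂ => Function.update u j t) (Pi.single j 1) (u j) :=
    hasDerivAt_update u j (u j)
  have h2 : HasFDerivAt f (fderiv ℂ f u) (Function.update u j (u j)) := by
    rw [Function.update_eq_self]; exact hf.hasFDerivAt
  exact (h2.comp_hasDerivAt (u j) h1).unique h

end Line

section Cosines

variable {n : ℕ}

theorem bigC_castSucc (i : Fin n) (u : Fin n → ℂ) :
    bigC i.val u = Complex.cos (u i) * bigC (i.val + 1) u := by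
  unfold bigC
  have h : Finset.univ.filter (fun l : Fin n => i.val ≤ l.val)
      = insert i (Finset.univ.filter (fun l : Fin n => i.val + 1 ≤ l.val)) := by
    ext l
    simp only [Finset.mem_filter, Finset.mem_univ, true_and, Finset.mem_insert, Fin.ext_iff]
    omega
  rw [h, Finset.prod_insert (by simp)]

theorem bigC_self (u : Fin n → ℂ) : bigC n u = 1 := by
  unfold bigC
  rw [Finset.filter_false_of_mem, Finset.prod_empty]
  intro i _
  omega

theorem contDiff_bigC (k : ℕ) : ContDiff ℂ ∞ (bigC (n := n) k) := by
  unfold bigC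
  exact contDiff_prod fun i _ => Complex.contDiff_cos.comp (contDiff_apply ℂ ℂ i)

theorem bigC_update_of_lt {k : ℕ} {i : Fin n} (h : i.val < k) (u : Fin n → ℂ) (t : ℂ) :
    bigC k (Function.update u i t) = bigC k u := by
  unfold bigC
  refine Finset.prod_congr rfl fun l hl => ?_
  rw [Finset.mem_filter] at hl
  rw [Function.update_of_ne (fun h' => by rw [h'] at hl; omega)]

theorem exists_bigC_update {k : ℕ} {i : Fin n} (h : k ≤ i.val) (u : Fin n → ℂ) :
    ∃ R : ℂ, ∀ t, bigC k (Function.update u i t) = Complex.cos t * R := by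
  unfold bigC
  refine ⟨∏ l ∈ (Finset.univ.filter (fun l : Fin n => k ≤ l.val)).erase i, Complex.cos (u l),
    fun t => ?_⟩
  rw [← Finset.mul_prod_erase _ _ (show i ∈ Finset.univ.filter (fun l : Fin n => k ≤ l.val) by
    simpa using h), Function.update_self]
  congr 1
  exact Finset.prod_congr rfl fun l hl => by rw [Function.update_of_ne (Finset.mem_erase.mp hl).1]

theorem bigC_ne_zero {u : Fin n → ℂ} {k : ℕ} (h : ∀ i : Fin n, k ≤ i.val → Complex.cos (u i) ≠ 0) :
    bigC k u ≠ 0 :=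
  Finset.prod_ne_zero_iff.mpr fun i hi => h i (Finset.mem_filter.mp hi).2

end Cosines

section Cone

variable {n : ℕ} {E : Type} [NormedAddCommGroup E] [NormedSpace ℂ E]

/-- The iterated cones `S_0 = v`, `S_{m+1} = cos (u^m) S_m + φ_m(u^m)`. -/
noncomputable def cone (v : E) (φ : Fin n → ℂ → E) : ℕ → (Fin n → ℂ) → E
  | 0 => fun _ => v
  | m + 1 => fun u => if h : m < n then
      Complex.cos (u ⟨m, h⟩) • cone v φ m u + φ ⟨m, h⟩ (u ⟨m, h⟩) else cone v φ m u

theorem cone_succ (v : E) (φ : Fin n → ℂ → E) (i : Fin n) (u : Fin n → ℂ) :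
    cone v φ (i.val + 1) u = Complex.cos (u i) • cone v φ i.val u + φ i (u i) :=
  dif_pos i.isLt

theorem cone_update_of_le (v : E) (φ : Fin n → ℂ → E) {m : ℕ} {i : Fin n} (h : m ≤ i.val)
    (u : Fin n → ℂ) (t : ℂ) : cone v φ m (Function.update u i t) = cone v φ m u := by
  induction m with
  | zero => rfl
  | succ m ih =>
    have hm : m < n := by omega
    have hne : (⟨m, hm⟩ : Fin n) ≠ i := fun h' => by rw [← h'] at h; simp at h
    have := cone_succ v φ ⟨m, hm⟩
    rw [this, this, ih (by omega), Function.update_of_ne hne]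

theorem cone_eq_sum (v : E) (φ : Fin n → ℂ → E) {m : ℕ} (hm : m ≤ n) (u : Fin n → ℂ) :
    bigC m u • cone v φ m u = bigC 0 u • v
      + ∑ i ∈ Finset.univ.filter (fun i : Fin n => i.val < m), bigC (i.val + 1) u • φ i (u i) := by
  induction m with
  | zero => simp [cone]
  | succ m ih =>
    have := cone_succ v φ ⟨m, hm⟩ u
    have h := bigC_castSucc (⟨m, hm⟩ : Fin n) u
    simp only at this h
    rw [this, smul_add, smul_smul, mul_comm, ← h, ih (by omega)]
    have hset : Finset.univ.filter (fun i : Fin n => i.val < m + 1)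
        = insert ⟨m, hm⟩ (Finset.univ.filter (fun i : Fin n => i.val < m)) := by
      ext l
      simp only [Finset.mem_filter, Finset.mem_univ, true_and, Finset.mem_insert, Fin.ext_iff]
      omega
    rw [hset, Finset.sum_insert (by simp)]
    abel

theorem cone_self_eq_sum (v : E) (φ : Fin n → ℂ → E) (u : Fin n → ℂ) :
    cone v φ n u = bigC 0 u • v + ∑ i : Fin n, bigC (i.val + 1) u • φ i (u i) := by
  have := cone_eq_sum v φ le_rfl u
  rw [bigC_self, one_smul] at this
  rw [this, Finset.filter_true_of_mem fun i _ => i.isLt]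

variable [CompleteSpace E] {U : Set (Fin n → ℂ)} {v : E} {φ : Fin n → ℂ → E}

theorem isOpen_coordImage (hU : IsOpen U) (i : Fin n) : IsOpen ((fun u : Fin n → ℂ => u i) '' U) :=
  isOpenMap_eval i U hU

theorem contDiffOn_comp_coord (hU : IsOpen U) {i : Fin n} {ψ : ℂ → E}
    (hψ : ∀ t ∈ (fun u : Fin n → ℂ => u i) '' U, DifferentiableAt ℂ ψ t) :
    ContDiffOn ℂ ∞ (fun u => ψ (u i)) U := by
  have h1 : ContDiffOn ℂ ∞ ψ ((fun u : Fin n → ℂ => u i) '' U) :=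
    DifferentiableOn.contDiffOn (fun t ht => (hψ t ht).differentiableWithinAt)
      (isOpen_coordImage hU i)
  exact h1.comp (contDiff_apply ℂ ℂ i).contDiffOn (Set.mapsTo_image _ _)

variable (hU : IsOpen U)
  (hφ : ∀ i, ∀ t ∈ (fun u : Fin n → ℂ => u i) '' U, DifferentiableAt ℂ (φ i) t)
include hU hφ

theorem contDiffOn_cone (m : ℕ) : ContDiffOn ℂ ∞ (cone v φ m) U := by
  induction m with
  | zero => exact contDiffOn_const
  | succ m ih =>
    by_cases h : m < n
    · have e : cone v φ (m + 1) = fun u => Complex.cos (u ⟨m, h⟩) • cone v φ m u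
          + φ ⟨m, h⟩ (u ⟨m, h⟩) := by
        ext u; exact cone_succ v φ ⟨m, h⟩ u
      rw [e]
      exact ((Complex.contDiff_cos.comp (contDiff_apply ℂ ℂ _)).contDiffOn.smul ih).add
        (contDiffOn_comp_coord hU (hφ _))
    · have e : cone v φ (m + 1) = cone v φ m := by
        ext u; exact dif_neg h
      rw [e]
      exact ih

omit [CompleteSpace E] hU in
theorem differentiableAt_coord {u : Fin n → ℂ} (hu : u ∈ U) (i : Fin n) :
    DifferentiableAt ℂ (φ i) (u i) := hφ i _ ⟨u, hu, rfl⟩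

/-- The cone is 𝐂_{j+1} S_{j+1} plus the terms of index above j. Neither 𝐂_{j+1} nor those terms
involve u^j, so only the recursion for S_{j+1} is differentiated. -/
theorem pd_cone {u : Fin n → ℂ} (hu : u ∈ U) (j : Fin n) :
    pd j (cone v φ n) u = bigC (j.val + 1) u •
      (deriv (φ j) (u j) - Complex.sin (u j) • cone v φ j.val u) := by
  refine pd_eq_of_hasDerivAt ((contDiffOn_cone hU hφ n).differentiableAt_of_isOpen hU hu) j ?_
  set r : E := ∑ i ∈ Finset.univ.filter (fun i : Fin n => ¬ i.val < j.val + 1),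
    bigC (i.val + 1) u • φ i (u i) with hr
  have e : (fun t => cone v φ n (Function.update u j t))
      = fun t => bigC (j.val + 1) u • (Complex.cos t • cone v φ j.val u + φ j t) + r := by
    ext t
    rw [cone_self_eq_sum, ← Finset.sum_filter_add_sum_filter_not _ (fun i : Fin n => i.val < j.val + 1),
      ← add_assoc, ← cone_eq_sum v φ (by omega), bigC_update_of_lt (by omega), cone_succ,
      cone_update_of_le v φ le_rfl, Function.update_self]
    congr 1
    refine Finset.sum_congr rfl fun i hi => ?_
    have hij := (Finset.mem_filter.mp hi).2
    rw [bigC_update_of_lt (by omega), Function.update_of_ne (fun h => by rw [h] at hij; omega)]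
  rw [e]
  have h1 : HasDerivAt (fun t => Complex.cos t • cone v φ j.val u + φ j t)
      (-Complex.sin (u j) • cone v φ j.val u + deriv (φ j) (u j)) (u j) :=
    ((Complex.hasDerivAt_cos (u j)).smul_const _).add
      (differentiableAt_coord hφ hu j).hasDerivAt
  have h2 := (h1.const_smul (bigC (j.val + 1) u)).add_const r
  rw [show deriv (φ j) (u j) - Complex.sin (u j) • cone v φ j.val u
    = -Complex.sin (u j) • cone v φ j.val u + deriv (φ j) (u j) by rw [neg_smul]; abel]
  exact h2

theorem pd_pd_cone_self {u : Fin n → ℂ} (hu : u ∈ U) (j : Fin n) :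
    pd j (pd j (cone v φ n)) u = bigC (j.val + 1) u •
      (deriv (deriv (φ j)) (u j) - Complex.cos (u j) • cone v φ j.val u) := by
  rw [pd_congr hU (fun w hw => pd_cone hU hφ hw j) hu]
  have hφ' : ∀ t ∈ (fun u : Fin n → ℂ => u j) '' U, DifferentiableAt ℂ (deriv (φ j)) t := fun t ht =>
    (DifferentiableOn.deriv (fun t ht => (hφ j t ht).differentiableWithinAt)
      (isOpen_coordImage hU j)).differentiableAt ((isOpen_coordImage hU j).mem_nhds ht)
  have hd : DifferentiableAt ℂ (fun w : Fin n → ℂ => bigC (j.val + 1) w •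
      (deriv (φ j) (w j) - Complex.sin (w j) • cone v φ j.val w)) u := by
    refine ContDiffOn.differentiableAt_of_isOpen (U := U) ?_ hU hu
    exact (contDiff_bigC _).contDiffOn.smul ((contDiffOn_comp_coord hU hφ').sub
      ((Complex.contDiff_sin.comp (contDiff_apply ℂ ℂ _)).contDiffOn.smul (contDiffOn_cone hU hφ _)))
  refine pd_eq_of_hasDerivAt hd j ?_
  simp only [bigC_update_of_lt (Nat.lt_succ_self j.val), Function.update_self,
    cone_update_of_le v φ (le_refl j.val)]
  have h1 : HasDerivAt (fun t => deriv (φ j) t - Complex.sin t • cone v φ j.val u)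
      (deriv (deriv (φ j)) (u j) - Complex.cos (u j) • cone v φ j.val u) (u j) :=
    (hφ' _ ⟨u, hu, rfl⟩).hasDerivAt.sub ((Complex.hasDerivAt_sin (u j)).smul_const _)
  exact h1.const_smul _

/-- The mixed derivatives of an iterated cone. -/
theorem pd_pd_cone_of_lt {u : Fin n → ℂ} (hu : u ∈ U) {j m : Fin n} (hjm : j < m)
    (hcos : Complex.cos (u m) ≠ 0) :
    pd m (pd j (cone v φ n)) u = -Complex.tan (u m) • pd j (cone v φ n) u := by
  have hlt : j.val < m.val := hjm
  have hd := (contDiffOn_pd hU (contDiffOn_cone (v := v) hU hφ n) j).differentiableAt_of_isOpen hU hu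
  -- For j < m the derivative ∂_j depends on u^m only through the factor cos u^m of 𝐂_{j+1}; this is
  -- why the coordinates are conjugate.
  obtain ⟨R, hR⟩ := exists_bigC_update (k := j.val + 1) (i := m) hlt u
  have hdd : DifferentiableAt ℂ (fun w : Fin n → ℂ => bigC (j.val + 1) w •
      (deriv (φ j) (w j) - Complex.sin (w j) • cone v φ j.val w)) u :=
    hd.congr_of_eventuallyEq (Filter.mem_of_superset (hU.mem_nhds hu)
      fun w hw => (pd_cone hU hφ hw j).symm)
  rw [pd_congr hU (fun w hw => pd_cone hU hφ hw j) hu]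
  refine pd_eq_of_hasDerivAt hdd m ?_
  simp only [hR, Function.update_of_ne hjm.ne, cone_update_of_le v φ hlt.le]
  have h0 := hR (u m)
  rw [Function.update_eq_self] at h0
  rw [pd_cone hU hφ hu, h0]
  have h1 := ((Complex.hasDerivAt_cos (u m)).mul_const R).smul_const
    (deriv (φ j) (u j) - Complex.sin (u j) • cone v φ j.val u)
  convert h1 using 1
  rw [smul_smul, Complex.tan_eq_sin_div_cos]
  congr 1
  field_simp

end Cone

/-! ### Spherical coordinates on a quadric -/

section Spherical

variable {n : ℕ}

theorem cpow_half_sq (z : ℂ) : (z ^ (1 / 2 : ℂ)) ^ 2 = z := by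
  rw [← Complex.cpow_nat_mul]
  norm_num

/-- The directrices of the quadric in spherical coordinates, as an iterated cone. -/
noncomputable def sphericalDirectrix (a : Fin (n + 1) → ℂ) (i : Fin n) (t : ℂ) :
    Fin (n + 1) → ℂ := Pi.single i.succ (a i.succ ^ (1 / 2 : ℂ) * Complex.sin t)

/-- The vertex of the iterated cone. -/
noncomputable def sphericalVertex (a : Fin (n + 1) → ℂ) : Fin (n + 1) → ℂ :=
  Pi.single 0 (a 0 ^ (1 / 2 : ℂ))

theorem spherical_eq_cone (a : Fin (n + 1) → ℂ) :
    spherical a = cone (sphericalVertex a) (sphericalDirectrix a) n := by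
  ext u p
  rw [cone_self_eq_sum]
  refine Fin.cases ?_ (fun i => ?_) p
  · simp [spherical, sphericalVertex, sphericalDirectrix, Finset.sum_apply, mul_comm]
  · simp only [spherical, sphericalVertex, sphericalDirectrix, Finset.sum_apply, Pi.add_apply,
      Pi.smul_apply, Pi.single_apply, Fin.cons_succ, Fin.succ_ne_zero, if_false, smul_eq_mul,
      mul_zero, zero_add, Fin.succ_inj, mul_ite]
    simp
    ring

theorem hasDerivAt_sphericalDirectrix (a : Fin (n + 1) → ℂ) (i : Fin n) (t : ℂ) :
    HasDerivAt (sphericalDirectrix a i)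
      (Pi.single i.succ (a i.succ ^ (1 / 2 : ℂ) * Complex.cos t)) t := by
  rw [hasDerivAt_pi]
  intro p
  by_cases hp : p = i.succ
  · subst hp
    simp only [sphericalDirectrix, Pi.single_eq_same]
    exact (Complex.hasDerivAt_sin t).const_mul _
  · simp only [sphericalDirectrix, Pi.single_eq_of_ne hp]
    exact hasDerivAt_const t _

theorem deriv_sphericalDirectrix (a : Fin (n + 1) → ℂ) (i : Fin n) : deriv (sphericalDirectrix a i)
    = fun t => Pi.single i.succ (a i.succ ^ (1 / 2 : ℂ) * Complex.cos t) :=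
  funext fun t => (hasDerivAt_sphericalDirectrix a i t).deriv

theorem deriv_deriv_sphericalDirectrix (a : Fin (n + 1) → ℂ) (i : Fin n) :
    deriv (deriv (sphericalDirectrix a i)) = fun t => -sphericalDirectrix a i t := by
  rw [deriv_sphericalDirectrix]
  ext1 t
  refine HasDerivAt.deriv ?_
  rw [hasDerivAt_pi]
  intro p
  by_cases hp : p = i.succ
  · subst hp
    simp only [sphericalDirectrix, Pi.single_eq_same, Pi.neg_apply]
    rw [← mul_neg]
    exact (Complex.hasDerivAt_cos t).const_mul (a i.succ ^ (1 / 2 : ℂ))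
  · simp only [sphericalDirectrix, Pi.single_eq_of_ne hp, Pi.neg_apply, neg_zero]
    exact hasDerivAt_const t _

theorem differentiableAt_sphericalDirectrix (a : Fin (n + 1) → ℂ) (U : Set (Fin n → ℂ)) (i : Fin n) :
    ∀ t ∈ (fun u : Fin n → ℂ => u i) '' U, DifferentiableAt ℂ (sphericalDirectrix a i) t :=
  fun t _ => (hasDerivAt_sphericalDirectrix a i t).differentiableAt

theorem cone_spherical_eq_zero (a : Fin (n + 1) → ℂ) {m : ℕ} {i : Fin n} (h : m ≤ i.val)
    (u : Fin n → ℂ) : cone (sphericalVertex a) (sphericalDirectrix a) m u i.succ = 0 := by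
  induction m with
  | zero => simp [cone, sphericalVertex]
  | succ m ih =>
    have hm : m < n := by omega
    have e := cone_succ (sphericalVertex a) (sphericalDirectrix a) ⟨m, hm⟩ u
    simp only at e
    have hne : i ≠ ⟨m, hm⟩ := fun h' => by rw [h'] at h; simp at h
    rw [e, Pi.add_apply, Pi.smul_apply, ih (by omega), sphericalDirectrix, Pi.single_apply,
      if_neg (fun h' => hne (Fin.succ_inj.mp h'))]
    simp

variable {a : Fin (n + 1) → ℂ} (ha : ∀ j, a j ≠ 0)
include ha

/-- Applied with (c, s) = (cos, sin) for the points of the cone and with (-sin, cos) for its tangent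
directions. -/
theorem sum_sq_single_sub_smul {i : Fin n} {c s : ℂ} {v : Fin (n + 1) → ℂ} (hv : v i.succ = 0)
    (hvv : ∑ p, v p ^ 2 / a p = 1) :
    ∑ p, ((Pi.single i.succ (a i.succ ^ (1 / 2 : ℂ) * s) : Fin (n + 1) → ℂ) p + c * v p) ^ 2 / a p
      = s ^ 2 + c ^ 2 := by
  have e : ∀ p, ((Pi.single i.succ (a i.succ ^ (1 / 2 : ℂ) * s) : Fin (n + 1) → ℂ) p + c * v p) ^ 2
      / a p = (if p = i.succ then s ^ 2 else 0) + c ^ 2 * (v p ^ 2 / a p) := by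
    intro p
    have := ha p
    by_cases hp : p = i.succ
    · subst hp
      rw [Pi.single_eq_same, hv, if_pos rfl, mul_zero, add_zero, mul_pow, cpow_half_sq]
      field_simp
      simp
    · rw [Pi.single_eq_of_ne hp, if_neg hp]
      field_simp
      ring
  simp only [e, Finset.sum_add_distrib, ← Finset.mul_sum, hvv]
  simp

theorem sum_sq_cone_spherical {m : ℕ} (hm : m ≤ n) (u : Fin n → ℂ) :
    ∑ p, cone (sphericalVertex a) (sphericalDirectrix a) m u p ^ 2 / a p = 1 := by
  induction m with
  | zero =>
    rw [Finset.sum_eq_single 0]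
    · simp only [cone, sphericalVertex, Pi.single_eq_same, cpow_half_sq]
      exact div_self (ha 0)
    · intro p _ hp
      simp [cone, sphericalVertex, hp]
    · simp
  | succ m ih =>
    have e := cone_succ (sphericalVertex a) (sphericalDirectrix a) ⟨m, hm⟩ u
    simp only at e
    rw [e]
    have h := sum_sq_single_sub_smul ha (c := Complex.cos (u ⟨m, hm⟩))
      (s := Complex.sin (u ⟨m, hm⟩)) (cone_spherical_eq_zero a (i := ⟨m, hm⟩) le_rfl u)
      (ih (by omega))
    rw [Complex.sin_sq_add_cos_sq] at h
    rw [← h]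
    refine Finset.sum_congr rfl fun p _ => ?_
    rw [Pi.add_apply, Pi.smul_apply, sphericalDirectrix, smul_eq_mul, add_comm]

theorem sum_sq_spherical (u : Fin n → ℂ) : ∑ p, spherical a u p ^ 2 / a p = 1 := by
  rw [spherical_eq_cone]
  exact sum_sq_cone_spherical ha le_rfl u

omit ha in
theorem pd_spherical (j : Fin n) (u : Fin n → ℂ) : pd j (spherical a) u = bigC (j.val + 1) u •
    (Pi.single j.succ (a j.succ ^ (1 / 2 : ℂ) * Complex.cos (u j))
      - Complex.sin (u j) • cone (sphericalVertex a) (sphericalDirectrix a) j.val u) := by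
  rw [spherical_eq_cone, pd_cone isOpen_univ (differentiableAt_sphericalDirectrix a Set.univ)
    (Set.mem_univ u), deriv_sphericalDirectrix]

theorem sum_sq_pd_spherical (j : Fin n) (u : Fin n → ℂ) :
    ∑ p, pd j (spherical a) u p ^ 2 / a p = bigC (j.val + 1) u ^ 2 := by
  have h := sum_sq_single_sub_smul ha (c := -Complex.sin (u j)) (s := Complex.cos (u j))
      (cone_spherical_eq_zero a (i := j) le_rfl u) (sum_sq_cone_spherical ha (Nat.le_of_lt j.isLt) u)
  rw [neg_sq, Complex.cos_sq_add_sin_sq] at h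
  rw [← mul_one (bigC (j.val + 1) u ^ 2), ← h, Finset.mul_sum]
  refine Finset.sum_congr rfl fun p _ => ?_
  rw [pd_spherical, Pi.smul_apply, Pi.sub_apply, Pi.smul_apply, smul_eq_mul, smul_eq_mul]
  ring

omit ha in
theorem contDiffOn_spherical (U : Set (Fin n → ℂ)) : ContDiffOn ℂ ∞ (spherical a) U := by
  rw [spherical_eq_cone]
  exact (contDiffOn_cone isOpen_univ (differentiableAt_sphericalDirectrix a Set.univ) n).mono
    (Set.subset_univ U)

/-- The square length of the gradient of the equation of the quadric, up to a factor. -/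
noncomputable def gradSq (a : Fin (n + 1) → ℂ) (u : Fin n → ℂ) : ℂ :=
  ∑ p, (spherical a u p / a p) ^ 2

theorem gradSq_eq (u : Fin n → ℂ) : gradSq a u
    = bigC 0 u ^ 2 / a 0 + ∑ i : Fin n, bigC (i.val + 1) u ^ 2 * (Complex.sin (u i) ^ 2 / a i.succ) := by
  rw [gradSq, Fin.sum_univ_succ]
  congr 1
  · have h1 := ha 0
    simp only [spherical, Fin.cons_zero, div_pow, mul_pow, cpow_half_sq]
    field_simp
  · refine Finset.sum_congr rfl fun i _ => ?_
    have h1 := ha i.succ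
    simp only [spherical, Fin.cons_succ, div_pow, mul_pow, cpow_half_sq]
    field_simp

variable {U : Set (Fin n → ℂ)} (hr : IsRegular (spherical a) U)
include hr

omit ha in
-- If cos u^i vanished, so would 𝐂_i and with it the tangent vector of index i - 1. The first
-- coordinate is exempt, as its cosine occurs only in 𝐂_0.
theorem cos_ne_zero_of_isRegular {u : Fin n → ℂ} (hu : u ∈ U) {i : Fin n} (hi : 0 < i.val) :
    Complex.cos (u i) ≠ 0 := by
  intro h
  have hlt : i.val - 1 < n := by omega
  refine hr u hu (Matrix.det_eq_zero_of_row_eq_zero ⟨i.val - 1, hlt⟩ fun k => ?_)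
  rw [metric_apply, pd_spherical]
  have : bigC (i.val - 1 + 1) u = 0 := by
    rw [Nat.sub_add_cancel hi, bigC_castSucc, h, zero_mul]
  simp [this]

omit ha in
theorem bigC_succ_ne_zero {u : Fin n → ℂ} (hu : u ∈ U) (k : ℕ) : bigC (k + 1) u ≠ 0 :=
  bigC_ne_zero fun _ hi => cos_ne_zero_of_isRegular hr hu (by omega)

variable (hU : IsOpen U)
include hU

omit ha in
theorem pd_pd_spherical_of_lt {u : Fin n → ℂ} (hu : u ∈ U) {j m : Fin n} (hjm : j < m) :
    pd m (pd j (spherical a)) u = -Complex.tan (u m) • pd j (spherical a) u := by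
  have hlt : j.val < m.val := hjm
  rw [spherical_eq_cone]
  exact pd_pd_cone_of_lt hU (differentiableAt_sphericalDirectrix a U) hu hjm
    (cos_ne_zero_of_isRegular hr hu (by omega))

omit ha in
theorem christoffel_spherical_of_lt {u : Fin n → ℂ} (hu : u ∈ U) {j m : Fin n} (hjm : j < m)
    (l : Fin n) : christoffel (spherical a) l j m u = if l = j then -Complex.tan (u m) else 0 := by
  have h := (christoffel_secondForm_unique hU (contDiffOn_spherical U) hr hu (j := j) (k := m)
    (c := Pi.single j (-Complex.tan (u m))) (ν := 0) (by
      rw [pd_pd_spherical_of_lt hr hU hu hjm]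
      simp [Pi.single_apply]) (by simp)).1 l
  rw [h, Pi.single_apply]

omit ha in
theorem isConjugateNet_spherical : IsConjugateNet (spherical a) U := by
  refine ⟨contDiffOn_spherical U, hr, fun u hu j k hjk => ?_⟩
  have key : ∀ j m : Fin n, j < m → secondForm (spherical a) j m u = 0 := fun j m hjm =>
    (christoffel_secondForm_unique hU (contDiffOn_spherical U) hr hu (j := j) (k := m)
      (c := Pi.single j (-Complex.tan (u m))) (ν := 0) (by
        rw [pd_pd_spherical_of_lt hr hU hu hjm]
        simp [Pi.single_apply]) (by simp)).2
  rcases lt_or_gt_of_ne hjk with h | h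
  · exact key j k h
  · rw [secondForm_comm hU (contDiffOn_spherical U) hu]
    exact key k j h

omit hr in
theorem grad_dot_pd {u : Fin n → ℂ} (hu : u ∈ U) (j : Fin n) :
    (fun p => spherical a u p / a p) ⬝ᵥ pd j (spherical a) u = 0 := by
  have hd := (contDiffOn_spherical (a := a) U).differentiableAt_of_isOpen hU hu
  have hdn : DifferentiableAt ℂ (fun v p => spherical a v p / a p) u :=
    by
    refine differentiableAt_pi.mpr fun p => ?_
    have h := differentiableAt_pi.mp hd p
    simpa only [div_eq_mul_inv] using h.mul_const (a p)⁻¹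
  have h1 := pd_dot hdn hd j
  have e : ∀ v ∈ U, (fun p => spherical a v p / a p) ⬝ᵥ spherical a v = 1 := fun v _ => by
    rw [← sum_sq_spherical ha v, dotProduct]
    exact Finset.sum_congr rfl fun p _ => by ring
  have e2 : pd j (fun v p => spherical a v p / a p) u = fun p => pd j (spherical a) u p / a p := by
    ext p
    rw [← pd_apply hdn, pd_div (differentiableAt_pi.mp hd p) (differentiableAt_const _) (ha p),
      pd_const, pd_apply hd]
    have := ha p
    field_simp
    ring
  rw [pd_congr hU e hu, pd_const, e2] at h1
  have e3 : (fun p => pd j (spherical a) u p / a p) ⬝ᵥ spherical a u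
      = (fun p => spherical a u p / a p) ⬝ᵥ pd j (spherical a) u := by
    rw [dotProduct, dotProduct]
    exact Finset.sum_congr rfl fun p _ => by ring
  rw [e3] at h1
  linear_combination -h1 / 2

/-- The gradient is orthogonal to the tangent vectors. Were it isotropic, it would be orthogonal to
a basis of ℂ^{n+1}, whereas its product with the position vector is 1. -/
theorem gradSq_ne_zero {u : Fin n → ℂ} (hu : u ∈ U) : gradSq a u ≠ 0 := by
  intro h0
  set ν : Fin (n + 1) → ℂ := fun p => spherical a u p / a p with hν
  have hνν : ν ⬝ᵥ ν = 0 := by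
    rw [← h0, gradSq, dotProduct]
    exact Finset.sum_congr rfl fun p _ => by rw [sq]
  have hνx : ν ⬝ᵥ spherical a u = 1 := by
    rw [← sum_sq_spherical ha u, dotProduct]
    exact Finset.sum_congr rfl fun p _ => by rw [hν]; ring
  have hνd := grad_dot_pd ha hU hu
  have hli : LinearIndependent ℂ
      (Sum.elim (fun _ : Unit => ν) fun j => pd j (spherical a) u) := by
    rw [Fintype.linearIndependent_iff]
    intro c hc
    rw [Fintype.sum_sum_type] at hc
    simp only [Sum.elim_inl, Sum.elim_inr, Finset.univ_unique, Finset.sum_singleton] at hc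
    have h1 : (fun j => c (Sum.inr j)) = 0 := eq_zero_of_tangent (hr u hu) fun q => by
      have := congrArg (fun w => w ⬝ᵥ pd q (spherical a) u) hc
      simpa [add_dotProduct, smul_dotProduct, hν, hνd] using this
    rintro (b | j)
    · have h2 : ∀ j, c (Sum.inr j) = 0 := fun j => congrFun h1 j
      simp only [h2, zero_smul, Finset.sum_const_zero, add_zero] at hc
      have := congrArg (fun w => w ⬝ᵥ spherical a u) hc
      simpa [smul_dotProduct, hνx] using this
    · exact congrFun h1 j
  have htop := hli.span_eq_top_of_card_eq_finrank' (by simp [add_comm])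
  have hz : ∀ w, ν ⬝ᵥ w = 0 := by
    intro w
    have hw : w ∈ Submodule.span ℂ (Set.range
        (Sum.elim (fun _ : Unit => ν) fun j => pd j (spherical a) u)) := by
      rw [htop]; trivial
    induction hw using Submodule.span_induction with
    | mem w hw =>
      obtain ⟨b | j, rfl⟩ := hw
      · exact hνν
      · exact hνd j
    | zero => simp
    | add w w' _ _ h h' => rw [dotProduct_add, h, h', add_zero]
    | smul c w _ h => rw [dotProduct_smul, h, smul_zero]
  rw [hz] at hνx
  exact zero_ne_one hνx

omit ha hr hU in
theorem contDiffOn_gradSq : ContDiffOn ℂ ∞ (gradSq a) U :=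
  ContDiffOn.sum fun p _ => ((contDiffOn_pi.mp (contDiffOn_spherical U) p).div_const _).pow 2

/-- The unit normal of the quadric, and its second fundamental form. -/
theorem exists_isUnitNormal_spherical (hc : Convex ℝ U) :
    ∃ N₀, IsUnitNormal (spherical a) N₀ U ∧ ∀ u ∈ U, ∀ j,
      h₀ (spherical a) N₀ j u ^ 2 = bigC (j.val + 1) u ^ 4 / gradSq a u := by
  obtain ⟨r, hrs, hr2⟩ := exists_sqrt hU hc (contDiffOn_gradSq)
    fun u hu => gradSq_ne_zero ha hr hU hu
  have hr0 : ∀ u ∈ U, r u ≠ 0 := fun u hu h => gradSq_ne_zero ha hr hU hu (by rw [← hr2 u hu, h]; ring)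
  have hN : IsUnitNormal (spherical a) (fun u p => spherical a u p / a p / r u) U := by
    refine ⟨contDiffOn_pi.mpr fun p => ((contDiffOn_pi.mp (contDiffOn_spherical U) p).div_const
      _).div hrs hr0, fun u hu => ?_, fun u hu j => ?_⟩
    · have h1 : ∑ p, spherical a u p / a p / r u * (spherical a u p / a p / r u)
          = gradSq a u / r u ^ 2 := by
        rw [gradSq, Finset.sum_div]
        exact Finset.sum_congr rfl fun p _ => by ring
      rw [dotProduct, h1, hr2 u hu]
      exact div_self (gradSq_ne_zero ha hr hU hu)
    · have h1 : (fun p => spherical a u p / a p / r u)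
          = (r u)⁻¹ • fun p => spherical a u p / a p := by
        ext p; simp only [Pi.smul_apply, smul_eq_mul]; ring
      rw [h1, smul_dotProduct, grad_dot_pd ha hU hu, smul_zero]
  refine ⟨_, hN, fun u hu j => ?_⟩
  have hd := (contDiffOn_spherical (a := a) U).differentiableAt_of_isOpen hU hu
  have hdj := (contDiffOn_pd hU (contDiffOn_spherical (a := a) U) j).differentiableAt_of_isOpen hU hu
  have hdn : DifferentiableAt ℂ (fun v p => spherical a v p / a p) u :=
    by
    refine differentiableAt_pi.mpr fun p => ?_
    have h := differentiableAt_pi.mp hd p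
    simpa only [div_eq_mul_inv] using h.mul_const (a p)⁻¹
  have h1 := pd_dot hdn hdj j
  have e2 : pd j (fun v p => spherical a v p / a p) u = fun p => pd j (spherical a) u p / a p := by
    ext p
    rw [← pd_apply hdn, pd_div (differentiableAt_pi.mp hd p) (differentiableAt_const _) (ha p),
      pd_const, pd_apply hd]
    have := ha p
    field_simp
    ring
  have e3 : (fun p => pd j (spherical a) u p / a p) ⬝ᵥ pd j (spherical a) u
      = bigC (j.val + 1) u ^ 2 := by
    rw [← sum_sq_pd_spherical ha, dotProduct]
    exact Finset.sum_congr rfl fun p _ => by ring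
  rw [pd_congr hU (fun v hv => grad_dot_pd ha hU hv j) hu, pd_const, e2, e3] at h1
  -- Differentiating the orthogonality of gradient and tangent gives ∇ · ∂_j² x = -∑ (∂_j x_p)² /
  -- a_p = -𝐂_{j+1}².
  have e4 : h₀ (spherical a) (fun u p => spherical a u p / a p / r u) j u
      = -(bigC (j.val + 1) u ^ 2) / r u := by
    have h5 : (fun p => spherical a u p / a p / r u)
        = (r u)⁻¹ • fun p => spherical a u p / a p := by
      ext p; simp only [Pi.smul_apply, smul_eq_mul]; ring
    rw [h₀, h5, smul_dotProduct, smul_eq_mul]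
    linear_combination -(r u)⁻¹ * h1
  rw [e4, div_pow, hr2 u hu]
  ring

end Spherical

/-! ### The invariants of the deformations of a quadric in spherical coordinates -/

section Invariants

variable {n : ℕ}

/-- The differences of the squares of the second fundamental forms of `x` and of the quadric. -/
noncomputable def curvSq (a : Fin (n + 1) → ℂ) (x : (Fin n → ℂ) → (Fin (2 * n - 1) → ℂ)) (j : Fin n)
    (u : Fin n → ℂ) : ℂ :=
  secondForm x j j u ⬝ᵥ secondForm x j j u
    - secondForm (spherical a) j j u ⬝ᵥ secondForm (spherical a) j j u

/-- The quantities `W_0 = 1 / a_0`,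
`W_{m+1} = 𝐂_{m+1}² / J_m + sin² (u^m) / a_{m+1} + cos² (u^m) W_m`. -/
noncomputable def ladder (a : Fin (n + 1) → ℂ) (J : Fin n → (Fin n → ℂ) → ℂ) : ℕ → (Fin n → ℂ) → ℂ
  | 0 => fun _ => (a 0)⁻¹
  | m + 1 => fun u => if h : m < n then
      bigC (m + 1) u ^ 2 / J ⟨m, h⟩ u + Complex.sin (u ⟨m, h⟩) ^ 2 / a (Fin.succ ⟨m, h⟩)
        + Complex.cos (u ⟨m, h⟩) ^ 2 * ladder a J m u
      else ladder a J m u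

theorem ladder_zero (a : Fin (n + 1) → ℂ) (J : Fin n → (Fin n → ℂ) → ℂ) (u : Fin n → ℂ) :
    ladder a J 0 u = (a 0)⁻¹ := rfl

theorem ladder_succ (a : Fin (n + 1) → ℂ) (J : Fin n → (Fin n → ℂ) → ℂ) (i : Fin n)
    (u : Fin n → ℂ) : ladder a J (i.val + 1) u
      = bigC (i.val + 1) u ^ 2 / J i u + Complex.sin (u i) ^ 2 / a i.succ
        + Complex.cos (u i) ^ 2 * ladder a J i.val u :=
  dif_pos i.isLt

/-- The ladder is Horner's scheme for this sum: since 𝐂_m = cos(u^m) 𝐂_{m+1}, the factor cos² in the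
recursion restores the power of 𝐂. -/
theorem bigC_sq_mul_ladder (a : Fin (n + 1) → ℂ) (J : Fin n → (Fin n → ℂ) → ℂ) {m : ℕ} (hm : m ≤ n)
    (u : Fin n → ℂ) : bigC m u ^ 2 * ladder a J m u = bigC 0 u ^ 2 / a 0
      + ∑ i ∈ Finset.univ.filter (fun i : Fin n => i.val < m), bigC (i.val + 1) u ^ 2 *
        (bigC (i.val + 1) u ^ 2 / J i u + Complex.sin (u i) ^ 2 / a i.succ) := by
  induction m with
  | zero => simp [ladder_zero, div_eq_mul_inv]
  | succ m ih =>
    have e := ladder_succ a J ⟨m, hm⟩ u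
    have h := bigC_castSucc (⟨m, hm⟩ : Fin n) u
    have ih := ih (by omega)
    simp only at e h
    have hset : Finset.univ.filter (fun i : Fin n => i.val < m + 1)
        = insert ⟨m, hm⟩ (Finset.univ.filter (fun i : Fin n => i.val < m)) := by
      ext l
      simp only [Finset.mem_filter, Finset.mem_univ, true_and, Finset.mem_insert, Fin.ext_iff]
      omega
    rw [hset, Finset.sum_insert (by simp)]
    rw [h] at ih
    rw [e]
    linear_combination ih

theorem ladder_congr {a : Fin (n + 1) → ℂ} {J J' : Fin n → (Fin n → ℂ) → ℂ} {u : Fin n → ℂ}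
    (h : ∀ j, J j u = J' j u) (m : ℕ) : ladder a J m u = ladder a J' m u := by
  induction m with
  | zero => rfl
  | succ m ih =>
    by_cases hm : m < n
    · have e := ladder_succ a J ⟨m, hm⟩ u
      have e' := ladder_succ a J' ⟨m, hm⟩ u
      simp only at e e'
      rw [e, e', ih, h]
    · have e : ∀ J, ladder a J (m + 1) u = ladder a J m u := fun J => dif_neg hm
      rw [e, e, ih]

theorem pd_comp_coord_of_ne {f : ℂ → ℂ} {u : Fin n → ℂ} {i k : Fin n} (hik : i ≠ k)
    (hf : DifferentiableAt ℂ f (u i)) : pd k (fun v : Fin n → ℂ => f (v i)) u = 0 := by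
  refine pd_eq_of_hasDerivAt (f := fun v : Fin n → ℂ => f (v i))
    (DifferentiableAt.comp u hf (differentiableAt_apply i u)) k ?_
  simp only [Function.update_of_ne hik]
  exact hasDerivAt_const _ _

theorem pd_bigC_of_lt {k : ℕ} {i : Fin n} (h : i.val < k) (u : Fin n → ℂ) :
    pd i (bigC k) u = 0 := by
  refine pd_eq_of_hasDerivAt ((contDiff_bigC k).differentiable (by simp)).differentiableAt i ?_
  simp only [bigC_update_of_lt h]
  exact hasDerivAt_const _ _

theorem pd_bigC_of_le {k : ℕ} {i : Fin n} (h : k ≤ i.val) {u : Fin n → ℂ}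
    (hcos : Complex.cos (u i) ≠ 0) : pd i (bigC k) u = -Complex.tan (u i) * bigC k u := by
  refine pd_eq_of_hasDerivAt ((contDiff_bigC k).differentiable (by simp)).differentiableAt i ?_
  obtain ⟨R, hR⟩ := exists_bigC_update h u
  simp only [hR]
  have h0 := hR (u i)
  rw [Function.update_eq_self] at h0
  rw [h0, Complex.tan_eq_sin_div_cos]
  have h1 := (Complex.hasDerivAt_cos (u i)).mul_const R
  have e : -(Complex.sin (u i) / Complex.cos (u i)) * (Complex.cos (u i) * R)
      = -Complex.sin (u i) * R := by field_simp
  rw [e]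
  exact h1

variable {a : Fin (n + 1) → ℂ} {U : Set (Fin n → ℂ)} {x x' : (Fin n → ℂ) → (Fin (2 * n - 1) → ℂ)}
variable (ha : ∀ j, a j ≠ 0) (hU : IsOpen U) (hr : IsRegular (spherical a) U)
include hU hr

theorem contDiffOn_curvSq (hx : IsDeformation (spherical a) U x) (j : Fin n) :
    ContDiffOn ℂ ∞ (curvSq a x j) U := by
  have hx₀ := isConjugateNet_spherical hr hU
  have h := hx.isConjugateNet hx₀
  have h1 := contDiffOn_secondForm hU h.holo h.regular j j
  have h2 := contDiffOn_secondForm hU hx₀.holo hx₀.regular j j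
  exact (h1.dotProduct h1).sub (h2.dotProduct h2)

theorem joinedSq_eq_curvSq {N₀ : (Fin n → ℂ) → (Fin (n + 1) → ℂ)}
    (hN : IsUnitNormal (spherical a) N₀ U) {u : Fin n → ℂ} (hu : u ∈ U) (j : Fin n) :
    joinedSq (spherical a) N₀ x j u = curvSq a x j u := by
  rw [joinedSq, curvSq, secondForm_dot_secondForm hU (isConjugateNet_spherical hr hU) hN hu]
  ring

include ha

theorem curvSq_ne_zero (hc : Convex ℝ U) (hx : IsDeformation (spherical a) U x)
    {u : Fin n → ℂ} (hu : u ∈ U) (j : Fin n) : curvSq a x j u ≠ 0 := by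
  obtain ⟨N₀, hN, -⟩ := exists_isUnitNormal_spherical ha hr hU hc
  rw [← joinedSq_eq_curvSq hU hr hN hu]
  exact joinedSq_ne_zero hU (isConjugateNet_spherical hr hU) hN hx hu j

/-- Numerator and denominator have the same logarithmic derivative in u^k: -2 tan u^k for k above j,
and 0 for k below j. Hence the quotient is a function of u^j alone. -/
theorem pd_bigC_sq_div_curvSq (hc : Convex ℝ U) (hx : IsDeformation (spherical a) U x)
    {u : Fin n → ℂ} (hu : u ∈ U) {j k : Fin n} (hjk : j ≠ k) :
    pd k (fun v => bigC (j.val + 1) v ^ 2 / curvSq a x j v) u = 0 := by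
  obtain ⟨N₀, hN, -⟩ := exists_isUnitNormal_spherical ha hr hU hc
  have hx₀ := isConjugateNet_spherical hr hU
  have h0 := curvSq_ne_zero ha hU hr hc hx hu j
  have hd : DifferentiableAt ℂ (bigC (n := n) (j.val + 1)) u :=
    ((contDiff_bigC _).differentiable (by simp)).differentiableAt
  have h1 := pd_joinedSq hU hx₀ hN hx hjk hu
  rw [pd_congr hU (fun v hv => joinedSq_eq_curvSq hU hr hN hv j) hu,
    joinedSq_eq_curvSq hU hr hN hu] at h1
  rw [pd_div (hd.fun_pow 2) ((contDiffOn_curvSq hU hr hx j).differentiableAt_of_isOpen hU hu) h0,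
    pd_sq hd, h1]
  rcases lt_or_gt_of_ne hjk with h | h
  · rw [christoffel_spherical_of_lt hr hU hu h, if_pos rfl,
      pd_bigC_of_le h (cos_ne_zero_of_isRegular hr hu (lt_of_le_of_lt (Nat.zero_le _) h))]
    ring
  · rw [christoffel_comm hU hx₀.holo hu, christoffel_spherical_of_lt hr hU hu h, if_neg hjk,
      pd_bigC_of_lt (Nat.lt_succ_of_lt h)]
    ring

theorem contDiffOn_ladder (hc : Convex ℝ U) (hx : IsDeformation (spherical a) U x) (m : ℕ) :
    ContDiffOn ℂ ∞ (ladder a (curvSq a x) m) U := by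
  induction m with
  | zero => exact contDiffOn_const
  | succ m ih =>
    by_cases hm : m < n
    · have e : ladder a (curvSq a x) (m + 1) = fun u =>
          bigC (m + 1) u ^ 2 / curvSq a x ⟨m, hm⟩ u
            + Complex.sin (u ⟨m, hm⟩) ^ 2 / a (Fin.succ ⟨m, hm⟩)
            + Complex.cos (u ⟨m, hm⟩) ^ 2 * ladder a (curvSq a x) m u := by
        ext u; exact ladder_succ a _ ⟨m, hm⟩ u
      rw [e]
      exact ((((contDiff_bigC _).contDiffOn.pow 2).div (contDiffOn_curvSq hU hr hx _)
        fun u hu => curvSq_ne_zero ha hU hr hc hx hu _).add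
        (((Complex.contDiff_sin.comp (contDiff_apply ℂ ℂ _)).contDiffOn.pow 2).div_const _)).add
        (((Complex.contDiff_cos.comp (contDiff_apply ℂ ℂ _)).contDiffOn.pow 2).mul ih)
    · have e : ladder a (curvSq a x) (m + 1) = ladder a (curvSq a x) m := by
        ext u; exact dif_neg hm
      rw [e]; exact ih

/-- The algebraic equation for the a_j, multiplied by `gradSq`, since (h_j^0)² = 𝐂_{j+1}⁴ /
`gradSq`. -/
theorem ladder_self_eq_zero (hc : Convex ℝ U) (hn : 0 < n) (hx : IsDeformation (spherical a) U x)
    {u : Fin n → ℂ} (hu : u ∈ U) : ladder a (curvSq a x) n u = 0 := by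
  obtain ⟨N₀, hN, hh⟩ := exists_isUnitNormal_spherical ha hr hU hc
  have hx₀ := isConjugateNet_spherical hr hU
  have h1 := bigC_sq_mul_ladder a (curvSq a x) le_rfl u
  have h2 := sum_sq_div_joinedSq hU hx₀ hN hn hx hu
  have h3 := gradSq_ne_zero ha hr hU hu
  rw [bigC_self, one_pow, one_mul, Finset.filter_true_of_mem fun i _ => i.isLt] at h1
  simp only [mul_add, Finset.sum_add_distrib] at h1
  have h4 := gradSq_eq ha u
  have h5 : ∑ i : Fin n, bigC (i.val + 1) u ^ 2 * (bigC (i.val + 1) u ^ 2 / curvSq a x i u)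
      = gradSq a u * ∑ j, h₀ (spherical a) N₀ j u ^ 2 / joinedSq (spherical a) N₀ x j u := by
    rw [Finset.mul_sum]
    refine Finset.sum_congr rfl fun i _ => ?_
    rw [hh u hu, joinedSq_eq_curvSq hU hr hN hu]
    have := curvSq_ne_zero ha hU hr hc hx hu i
    field_simp
  rw [h1, h5, eq_neg_of_add_eq_zero_left h2, h4]
  ring

theorem pd_ladder_succ (hc : Convex ℝ U) (hx : IsDeformation (spherical a) U x) {u : Fin n → ℂ}
    (hu : u ∈ U) {i k : Fin n} (hik : i ≠ k) : pd k (ladder a (curvSq a x) (i.val + 1)) u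
      = Complex.cos (u i) ^ 2 * pd k (ladder a (curvSq a x) i.val) u := by
  have d1 : DifferentiableAt ℂ (fun v => bigC (i.val + 1) v ^ 2 / curvSq a x i v) u :=
    ((((contDiff_bigC _).contDiffOn.pow 2).div (contDiffOn_curvSq hU hr hx i) fun v hv =>
      curvSq_ne_zero ha hU hr hc hx hv i) : ContDiffOn ℂ ∞ _ U).differentiableAt_of_isOpen hU hu
  have ds : DifferentiableAt ℂ (fun t => Complex.sin t ^ 2 / a i.succ) (u i) := by fun_prop
  have dc : DifferentiableAt ℂ (fun t => Complex.cos t ^ 2) (u i) := by fun_prop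
  have d2 : DifferentiableAt ℂ (fun v : Fin n → ℂ => Complex.sin (v i) ^ 2 / a i.succ) u := by
    fun_prop
  have d3 : DifferentiableAt ℂ (fun v : Fin n → ℂ => Complex.cos (v i) ^ 2) u := by
    fun_prop
  have d4 := (contDiffOn_ladder ha hU hr hc hx i.val).differentiableAt_of_isOpen hU hu
  rw [pd_congr hU (fun v _ => ladder_succ a (curvSq a x) i v) hu,
    pd_add (d1.fun_add d2) (d3.fun_mul d4), pd_add d1 d2, pd_mul d3 d4,
    pd_bigC_sq_div_curvSq ha hU hr hc hx hu hik, pd_comp_coord_of_ne hik ds,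
    pd_comp_coord_of_ne hik dc]
  ring

theorem pd_ladder_of_le (hc : Convex ℝ U) (hx : IsDeformation (spherical a) U x) {u : Fin n → ℂ}
    (hu : u ∈ U) {m : ℕ} {k : Fin n} (hmk : m ≤ k.val) : pd k (ladder a (curvSq a x) m) u = 0 := by
  induction m with
  | zero => exact pd_const k _ u
  | succ m ih =>
    have hm : m < n := by omega
    have := pd_ladder_succ ha hU hr hc hx hu (i := ⟨m, hm⟩) (k := k)
      (fun h => by rw [← h] at hmk; simp at hmk)
    simp only at this
    rw [this, ih (by omega), mul_zero]

/-- The quantities `W_m` are constants. -/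
theorem pd_ladder_eq_zero (hc : Convex ℝ U) (hn : 0 < n) (hx : IsDeformation (spherical a) U x)
    {m : ℕ} (hm : m ≤ n) : ∀ u ∈ U, ∀ k, pd k (ladder a (curvSq a x) m) u = 0 := by
  -- By construction W_m involves only the first m coordinates. In those, constancy descends from
  -- W_n = 0 through ∂_k W_{m+1} = cos²(u^m) ∂_k W_m, where the cosine is nonzero because m > k ≥ 0.
  induction hm using Nat.decreasingInduction with
  | self =>
    intro u hu k
    rw [pd_congr hU (fun v hv => ladder_self_eq_zero ha hU hr hc hn hx hv) hu, pd_const]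
  | of_succ m hm ih =>
    intro u hu k
    replace hm : m < n := hm
    rcases le_or_gt m k.val with h | h
    · exact pd_ladder_of_le ha hU hr hc hx hu h
    · have h1 := pd_ladder_succ ha hU hr hc hx hu (i := ⟨m, hm⟩) (k := k)
        (fun h' => by rw [← h'] at h; simp at h)
      simp only at h1
      rw [ih u hu k] at h1
      have h2 : Complex.cos (u ⟨m, hm⟩) ≠ 0 :=
        cos_ne_zero_of_isRegular hr hu (lt_of_le_of_lt (Nat.zero_le _) h)
      exact (mul_eq_zero.mp h1.symm).resolve_left (pow_ne_zero 2 h2)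

theorem ladder_eq (hc : Convex ℝ U) (hn : 0 < n) (hx : IsDeformation (spherical a) U x)
    {m : ℕ} (hm : m ≤ n) {u v : Fin n → ℂ} (hu : u ∈ U) (hv : v ∈ U) :
    ladder a (curvSq a x) m u = ladder a (curvSq a x) m v :=
  eq_of_pd_eq_zero hU hc (contDiffOn_ladder ha hU hr hc hx m)
    (pd_ladder_eq_zero ha hU hr hc hn hx hm) hu hv

/-- The constants `W_1, …, W_{n-1}` determine a deformation up to rigid motions. -/
theorem congruent_of_ladder_eq (hc : Convex ℝ U) (hn : 0 < n) (hx : IsDeformation (spherical a) U x)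
    (hx' : IsDeformation (spherical a) U x') {u₀ : Fin n → ℂ} (hu₀ : u₀ ∈ U)
    (h : ∀ m, 0 < m → m < n → ladder a (curvSq a x) m u₀ = ladder a (curvSq a x') m u₀) :
    Congruent U x x' := by
  obtain ⟨N₀, hN, -⟩ := exists_isUnitNormal_spherical ha hr hU hc
  have hL : ∀ u ∈ U, ∀ m, m ≤ n → ladder a (curvSq a x) m u = ladder a (curvSq a x') m u := by
    intro u hu m hm
    rcases Nat.eq_zero_or_pos m with rfl | h0
    · rw [ladder_zero, ladder_zero]
    · rcases hm.lt_or_eq with h1 | h1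
      · rw [ladder_eq ha hU hr hc hn hx hm hu hu₀, ladder_eq ha hU hr hc hn hx' hm hu hu₀, h m h0 h1]
      · rw [h1, ladder_self_eq_zero ha hU hr hc hn hx hu, ladder_self_eq_zero ha hU hr hc hn hx' hu]
  refine IsDeformation.congruent hU (isConjugateNet_spherical hr hU) hN hc hn hx hx' fun u hu j => ?_
  rw [joinedSq_eq_curvSq hU hr hN hu, joinedSq_eq_curvSq hU hr hN hu]
  -- Two consecutive W recover 𝐂_{j+1}² / J_j, hence J_j.
  have e := hL u hu (j.val + 1) j.isLt
  rw [ladder_succ, ladder_succ, hL u hu j.val j.isLt.le] at e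
  have e1 : bigC (j.val + 1) u ^ 2 / curvSq a x j u = bigC (j.val + 1) u ^ 2 / curvSq a x' j u := by
    linear_combination e
  have hb := pow_ne_zero 2 (bigC_succ_ne_zero hr hu j.val)
  have := congrArg (fun t => bigC (j.val + 1) u ^ 2 / t) e1
  simpa [div_div_cancel₀, hb] using this

omit ha hr in
theorem Congruent.ladder_eq (hx : ContDiffOn ℂ ∞ x U) (h : Congruent U x x')
    {u : Fin n → ℂ} (hu : u ∈ U) (m : ℕ) :
    ladder a (curvSq a x') m u = ladder a (curvSq a x) m u :=
  ladder_congr (fun j => by rw [curvSq, curvSq, h.secondForm_dot hU hx hu]) m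

end Invariants

/-! ### Isometric iterated cones -/

section Curves

variable {p : ℕ}

theorem hasDerivAt_dot {φ ψ : ℂ → Fin p → ℂ} {φ' ψ' : Fin p → ℂ} {t : ℂ} (hφ : HasDerivAt φ φ' t)
    (hψ : HasDerivAt ψ ψ' t) :
    HasDerivAt (fun s => φ s ⬝ᵥ ψ s) (φ' ⬝ᵥ ψ t + φ t ⬝ᵥ ψ') t := by
  have h := HasDerivAt.fun_sum (u := Finset.univ) fun q _ =>
    (hasDerivAt_pi.mp hφ q).fun_mul (hasDerivAt_pi.mp hψ q)
  rw [Finset.sum_add_distrib] at h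
  exact h

theorem differentiableAt_deriv {E : Type} [NormedAddCommGroup E] [NormedSpace ℂ E] [CompleteSpace E]
    {I : Set ℂ} (hI : IsOpen I) {φ : ℂ → E} (hφ : ∀ t ∈ I, DifferentiableAt ℂ φ t) :
    ∀ t ∈ I, DifferentiableAt ℂ (deriv φ) t := fun _ ht =>
  (DifferentiableOn.deriv (fun t ht => (hφ t ht).differentiableWithinAt) hI).differentiableAt
    (hI.mem_nhds ht)

theorem differentiableAt_iterate_deriv {E : Type} [NormedAddCommGroup E] [NormedSpace ℂ E]
    [CompleteSpace E] {I : Set ℂ} (hI : IsOpen I) {φ : ℂ → E}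
    (hφ : ∀ t ∈ I, DifferentiableAt ℂ φ t) (r : ℕ) :
    ∀ t ∈ I, DifferentiableAt ℂ (deriv^[r] φ) t := by
  induction r with
  | zero => exact hφ
  | succ r ih =>
    rw [Function.iterate_succ_apply']
    exact differentiableAt_deriv hI ih

theorem dot_iterate_deriv_eq_zero {I : Set ℂ} (hI : IsOpen I) {φ : ℂ → Fin p → ℂ}
    (hφ : ∀ t ∈ I, DifferentiableAt ℂ φ t) {w : Fin p → ℂ} (h : ∀ t ∈ I, w ⬝ᵥ φ t = 0) (r : ℕ) :
    ∀ t ∈ I, w ⬝ᵥ (deriv^[r] φ) t = 0 := by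
  induction r with
  | zero => exact h
  | succ r ih =>
    intro t ht
    rw [Function.iterate_succ_apply']
    have h1 := hasDerivAt_dot (hasDerivAt_const t w)
      (differentiableAt_iterate_deriv hI hφ r t ht).hasDerivAt
    have h2 : HasDerivAt (fun s => w ⬝ᵥ (deriv^[r] φ) s) 0 t :=
      (hasDerivAt_const t (0 : ℂ)).congr_of_eventuallyEq
        (Filter.mem_of_superset (hI.mem_nhds ht) ih)
    have := h1.unique h2
    simpa using this

end Curves

/-- The directrices and the vertex of an iterated cone lie in mutually orthogonal subspaces. -/
structure IsSplit {n p : ℕ} (v : Fin p → ℂ) (φ : Fin n → ℂ → Fin p → ℂ) (U : Set (Fin n → ℂ)) :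
    Prop where
  diff : ∀ i, ∀ t ∈ (fun u : Fin n → ℂ => u i) '' U, DifferentiableAt ℂ (φ i) t
  vertex : ∀ i t, v ⬝ᵥ φ i t = 0
  split : ∀ i j, i ≠ j → ∀ s t, φ i s ⬝ᵥ φ j t = 0

section Split

variable {n p : ℕ} {v : Fin p → ℂ} {φ : Fin n → ℂ → Fin p → ℂ} {U : Set (Fin n → ℂ)}

theorem IsSplit.iterate_dot_iterate (h : IsSplit v φ U) (hU : IsOpen U) {u : Fin n → ℂ} (hu : u ∈ U)
    {i j : Fin n} (hij : i ≠ j) (r s : ℕ) :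
    (deriv^[r] (φ i)) (u i) ⬝ᵥ (deriv^[s] (φ j)) (u j) = 0 := by
  have h1 : ∀ t ∈ (fun u : Fin n → ℂ => u j) '' U, (deriv^[r] (φ i)) (u i) ⬝ᵥ φ j t = 0 := by
    intro t _
    rw [dotProduct_comm]
    exact dot_iterate_deriv_eq_zero (isOpen_coordImage hU i) (h.diff i)
      (fun s _ => h.split j i hij.symm t s) r _ ⟨u, hu, rfl⟩
  exact dot_iterate_deriv_eq_zero (isOpen_coordImage hU j) (h.diff j) h1 s _ ⟨u, hu, rfl⟩

theorem IsSplit.cone_dot_iterate (h : IsSplit v φ U) (hU : IsOpen U) {u : Fin n → ℂ} (hu : u ∈ U)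
    {i : Fin n} (r : ℕ) {m : ℕ} (hm : m ≤ i.val) :
    cone v φ m u ⬝ᵥ (deriv^[r] (φ i)) (u i) = 0 := by
  induction m with
  | zero =>
    exact dot_iterate_deriv_eq_zero (isOpen_coordImage hU i) (h.diff i)
      (fun t _ => h.vertex i t) r _ ⟨u, hu, rfl⟩
  | succ m ih =>
    have hmn : m < n := by omega
    have e := cone_succ v φ ⟨m, hmn⟩ u
    have h1 := h.iterate_dot_iterate hU hu (i := ⟨m, hmn⟩) (j := i)
      (fun h' => by rw [← h'] at hm; simp at hm) 0 r
    simp only [Function.iterate_zero, id] at e h1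
    rw [e, add_dotProduct, smul_dotProduct, ih (by omega), h1]
    simp

theorem IsSplit.cone_dot_cone (h : IsSplit v φ U) (hU : IsOpen U) {u : Fin n → ℂ} (hu : u ∈ U)
    (i : Fin n) : cone v φ (i.val + 1) u ⬝ᵥ cone v φ (i.val + 1) u
      = Complex.cos (u i) ^ 2 * (cone v φ i.val u ⬝ᵥ cone v φ i.val u) + φ i (u i) ⬝ᵥ φ i (u i) := by
  have h1 : cone v φ i.val u ⬝ᵥ φ i (u i) = 0 := h.cone_dot_iterate hU hu 0 le_rfl
  have h2 := h1
  rw [dotProduct_comm] at h2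
  simp only [cone_succ, add_dotProduct, dotProduct_add, smul_dotProduct, dotProduct_smul, h1, h2,
    smul_eq_mul]
  ring

/-- The direction of the derivative of an iterated cone. -/
noncomputable def coneTangent (v : Fin p → ℂ) (φ : Fin n → ℂ → Fin p → ℂ) (j : Fin n)
    (u : Fin n → ℂ) : Fin p → ℂ := deriv (φ j) (u j) - Complex.sin (u j) • cone v φ j.val u

theorem IsSplit.coneTangent_dot_self (h : IsSplit v φ U) (hU : IsOpen U) {u : Fin n → ℂ}
    (hu : u ∈ U) (j : Fin n) : coneTangent v φ j u ⬝ᵥ coneTangent v φ j u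
      = deriv (φ j) (u j) ⬝ᵥ deriv (φ j) (u j)
        + Complex.sin (u j) ^ 2 * (cone v φ j.val u ⬝ᵥ cone v φ j.val u) := by
  have h1 : cone v φ j.val u ⬝ᵥ deriv (φ j) (u j) = 0 := h.cone_dot_iterate hU hu 1 le_rfl
  have h2 := h1
  rw [dotProduct_comm] at h2
  simp only [coneTangent, sub_dotProduct, dotProduct_sub, smul_dotProduct, dotProduct_smul, h1, h2,
    smul_eq_mul]
  ring

theorem IsSplit.coneTangent_dot_cone_succ (h : IsSplit v φ U) (hU : IsOpen U) {u : Fin n → ℂ}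
    (hu : u ∈ U) (j : Fin n) : coneTangent v φ j u ⬝ᵥ cone v φ (j.val + 1) u
      = deriv (φ j) (u j) ⬝ᵥ φ j (u j) - Complex.sin (u j) * Complex.cos (u j)
        * (cone v φ j.val u ⬝ᵥ cone v φ j.val u) := by
  have h1 : cone v φ j.val u ⬝ᵥ φ j (u j) = 0 := h.cone_dot_iterate hU hu 0 le_rfl
  have h2 : cone v φ j.val u ⬝ᵥ deriv (φ j) (u j) = 0 := h.cone_dot_iterate hU hu 1 le_rfl
  rw [dotProduct_comm] at h2
  simp only [coneTangent, cone_succ, sub_dotProduct, dotProduct_add, smul_dotProduct,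
    dotProduct_smul, h1, h2, smul_eq_mul]
  ring

theorem IsSplit.coneTangent_dot_iterate (h : IsSplit v φ U) (hU : IsOpen U) {u : Fin n → ℂ}
    (hu : u ∈ U) {j k : Fin n} (hjk : j < k) (r : ℕ) :
    coneTangent v φ j u ⬝ᵥ (deriv^[r] (φ k)) (u k) = 0 := by
  have h1 : deriv (φ j) (u j) ⬝ᵥ (deriv^[r] (φ k)) (u k) = 0 :=
    h.iterate_dot_iterate hU hu hjk.ne 1 r
  have h2 := h.cone_dot_iterate hU hu r (i := k) (m := j.val) (le_of_lt hjk)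
  simp only [coneTangent, sub_dotProduct, smul_dotProduct, h1, h2]
  simp

theorem IsSplit.coneTangent_dot_of_lt (h : IsSplit v φ U) (hU : IsOpen U) {u : Fin n → ℂ}
    (hu : u ∈ U) {j k : Fin n} (hjk : j < k) : coneTangent v φ j u ⬝ᵥ coneTangent v φ k u
      = -Complex.sin (u k) * (coneTangent v φ j u ⬝ᵥ cone v φ k.val u) := by
  have h1 : coneTangent v φ j u ⬝ᵥ deriv (φ k) (u k) = 0 := h.coneTangent_dot_iterate hU hu hjk 1
  conv_lhs => rw [coneTangent.eq_1 v φ k, dotProduct_sub, dotProduct_smul, h1]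
  simp

theorem IsSplit.pd_pd_dot_self (h : IsSplit v φ U) (hU : IsOpen U) {u : Fin n → ℂ} (hu : u ∈ U)
    (j : Fin n) : pd j (pd j (cone v φ n)) u ⬝ᵥ pd j (pd j (cone v φ n)) u
      = bigC (j.val + 1) u ^ 2 * (deriv (deriv (φ j)) (u j) ⬝ᵥ deriv (deriv (φ j)) (u j)
        + Complex.cos (u j) ^ 2 * (cone v φ j.val u ⬝ᵥ cone v φ j.val u)) := by
  have h1 : cone v φ j.val u ⬝ᵥ deriv (deriv (φ j)) (u j) = 0 := h.cone_dot_iterate hU hu 2 le_rfl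
  have h2 := h1
  rw [dotProduct_comm] at h2
  rw [pd_pd_cone_self hU h.diff hu]
  simp only [sub_dotProduct, dotProduct_sub, smul_dotProduct, dotProduct_smul, h1, h2, smul_eq_mul]
  ring

variable {p' : ℕ} {v' : Fin p' → ℂ} {φ' : Fin n → ℂ → Fin p' → ℂ}

/-- A criterion for two iterated cones to be isometric. -/
theorem metric_cone_eq (h : IsSplit v φ U) (h' : IsSplit v' φ' U) (hU : IsOpen U) {u : Fin n → ℂ}
    (hu : u ∈ U)
    (ht : ∀ j, coneTangent v φ j u ⬝ᵥ coneTangent v φ j u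
      = coneTangent v' φ' j u ⬝ᵥ coneTangent v' φ' j u)
    (hs : ∀ j : Fin n, j.val + 1 < n → coneTangent v φ j u ⬝ᵥ cone v φ (j.val + 1) u
      = coneTangent v' φ' j u ⬝ᵥ cone v' φ' (j.val + 1) u) :
    metric (cone v φ n) u = metric (cone v' φ' n) u := by
  -- The direction T_j is orthogonal to φ_m for m > j, so passing from S_m to S_{m+1} multiplies T_j
  -- · S_m by cos u^m. Only S_m with m < n occur in the metric, which is why the hypothesis omits
  -- the last index.
  have key : ∀ (j : Fin n) (m : ℕ), j.val + 1 ≤ m → m < n →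
      coneTangent v φ j u ⬝ᵥ cone v φ m u = coneTangent v' φ' j u ⬝ᵥ cone v' φ' m u := by
    intro j m hm
    induction m, hm using Nat.le_induction with
    | base => exact hs j
    | succ m hm ih =>
      intro hmn
      have hlt : j < (⟨m, by omega⟩ : Fin n) := hm
      have e := cone_succ v φ ⟨m, by omega⟩ u
      have e' := cone_succ v' φ' ⟨m, by omega⟩ u
      have d : coneTangent v φ j u ⬝ᵥ φ ⟨m, by omega⟩ (u ⟨m, by omega⟩) = 0 :=
        h.coneTangent_dot_iterate hU hu hlt 0
      have d' : coneTangent v' φ' j u ⬝ᵥ φ' ⟨m, by omega⟩ (u ⟨m, by omega⟩) = 0 :=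
        h'.coneTangent_dot_iterate hU hu hlt 0
      simp only at e e'
      rw [e, e', dotProduct_add, dotProduct_add, d, d', dotProduct_smul, dotProduct_smul,
        ih (by omega)]
  have key2 : ∀ j k : Fin n, j < k → coneTangent v φ j u ⬝ᵥ coneTangent v φ k u
      = coneTangent v' φ' j u ⬝ᵥ coneTangent v' φ' k u := fun j k hjk => by
    rw [h.coneTangent_dot_of_lt hU hu hjk, h'.coneTangent_dot_of_lt hU hu hjk, key j k hjk k.isLt]
  have key3 : ∀ j k : Fin n, coneTangent v φ j u ⬝ᵥ coneTangent v φ k u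
      = coneTangent v' φ' j u ⬝ᵥ coneTangent v' φ' k u := fun j k => by
    rcases lt_trichotomy j k with hjk | rfl | hjk
    · exact key2 j k hjk
    · exact ht j
    · rw [dotProduct_comm, key2 k j hjk, dotProduct_comm]
  ext j k
  rw [metric_apply, metric_apply, pd_cone hU h.diff hu, pd_cone hU h.diff hu, pd_cone hU h'.diff hu,
    pd_cone hU h'.diff hu, smul_dotProduct, smul_dotProduct, dotProduct_smul, dotProduct_smul]
  exact congrArg (fun s => bigC (j.val + 1) u • bigC (k.val + 1) u • s) (key3 j k)

end Split

/-! ### A criterion for deformations of the spherical quadric -/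

section Criterion

variable {n : ℕ} {a : Fin (n + 1) → ℂ} {U : Set (Fin n → ℂ)}
  {x : (Fin n → ℂ) → (Fin (2 * n - 1) → ℂ)}

/-- Isometric maps have equal tangential contributions to |∂_j² x|², so the invariant is computed
without splitting off normal parts. -/
theorem curvSq_eq_pd_pd (hU : IsOpen U) (hr : IsRegular (spherical a) U) (hx : ContDiffOn ℂ ∞ x U)
    (hm : ∀ u ∈ U, metric x u = metric (spherical a) u) {u : Fin n → ℂ} (hu : u ∈ U) (j : Fin n) :
    curvSq a x j u = pd j (pd j x) u ⬝ᵥ pd j (pd j x) u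
      - pd j (pd j (spherical a)) u ⬝ᵥ pd j (pd j (spherical a)) u := by
  have hrx : IsRegular x U := fun v hv => by rw [hm v hv]; exact hr v hv
  rw [pd_pd_dot_pd_pd hU hx hrx hu, pd_pd_dot_pd_pd hU (contDiffOn_spherical U) hr hu]
  simp only [christoffel_congr hU hm hu, hm u hu, curvSq]
  ring

/-- The mixed derivatives are tangent, so the coordinates are conjugate. By Gauss the products of
the second forms of `x` minus those of the quadric form the diagonal matrix of the J_k, which tests
the joined forms for independence. -/
theorem isDeformation_spherical (hU : IsOpen U) (hr : IsRegular (spherical a) U)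
    (hx : ContDiffOn ℂ ∞ x U) (hm : ∀ u ∈ U, metric x u = metric (spherical a) u)
    (hd : ∀ u ∈ U, ∀ j m : Fin n, j < m → pd m (pd j x) u = -Complex.tan (u m) • pd j x u)
    (hJ : ∀ u ∈ U, ∀ j, curvSq a x j u ≠ 0) : IsDeformation (spherical a) U x := by
  have hrx : IsRegular x U := fun v hv => by rw [hm v hv]; exact hr v hv
  have hcx : IsConjugate x U := by
    have key : ∀ u ∈ U, ∀ j m : Fin n, j < m → secondForm x j m u = 0 := fun u hu j m hjm =>
      (christoffel_secondForm_unique hU hx hrx hu (j := j) (k := m)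
        (c := Pi.single j (-Complex.tan (u m))) (ν := 0) (by
          rw [hd u hu j m hjm]
          simp [Pi.single_apply]) (by simp)).2
    intro u hu j k hjk
    rcases lt_or_gt_of_ne hjk with h | h
    · exact key u hu j k h
    · rw [secondForm_comm hU hx hu]
      exact key u hu k j h
  have hx₀ := isConjugateNet_spherical hr hU
  refine ⟨hx, hm, hcx, fun u hu => ?_⟩
  rw [Fintype.linearIndependent_iff]
  intro c hc k
  have h1 := congrArg Prod.fst hc
  have h2 := congrArg Prod.snd hc
  simp only [Prod.fst_sum, Prod.snd_sum, Prod.smul_fst, Prod.smul_snd, Prod.fst_zero,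
    Prod.snd_zero] at h1 h2
  have h3 := congrArg (fun w => w ⬝ᵥ secondForm (spherical a) k k u) h1
  have h4 := congrArg (fun w => w ⬝ᵥ secondForm x k k u) h2
  simp only [sum_dotProduct, smul_dotProduct, zero_dotProduct] at h3 h4
  have h5 : ∑ j, c j • (secondForm x j j u ⬝ᵥ secondForm x k k u
      - secondForm (spherical a) j j u ⬝ᵥ secondForm (spherical a) k k u) = 0 := by
    simp only [smul_sub, Finset.sum_sub_distrib, h3, h4, sub_zero]
  rw [Finset.sum_eq_single k (fun j _ hjk => by
    rw [secondForm_dot_eq hU hx₀.holo hx₀.regular hx₀.conjugate hx hcx hm hjk hu, sub_self,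
      smul_zero]) (fun h => absurd (Finset.mem_univ k) h)] at h5
  exact (mul_eq_zero.mp h5).resolve_right (hJ u hu k)

end Criterion

/-! ### Peterson's deformations -/

section Planar

variable {p : ℕ} {e₁ e₂ : Fin p → ℂ} (h₁₁ : e₁ ⬝ᵥ e₁ = 1) (h₁₂ : e₁ ⬝ᵥ e₂ = 0) (h₂₂ : e₂ ⬝ᵥ e₂ = 1)
  {I : Set ℂ} (hI : IsOpen I) {X Y : ℂ → ℂ} (hX : ∀ t ∈ I, DifferentiableAt ℂ X t)
  (hY : ∀ t ∈ I, DifferentiableAt ℂ Y t)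

include hX hY in
theorem hasDerivAt_planar {t : ℂ} (ht : t ∈ I) :
    HasDerivAt (fun s => X s • e₁ + Y s • e₂) (deriv X t • e₁ + deriv Y t • e₂) t :=
  ((hX t ht).hasDerivAt.smul_const e₁).fun_add ((hY t ht).hasDerivAt.smul_const e₂)

include hI hX hY in
theorem deriv_deriv_planar {t : ℂ} (ht : t ∈ I) : deriv (deriv fun s => X s • e₁ + Y s • e₂) t
    = deriv (deriv X) t • e₁ + deriv (deriv Y) t • e₂ := by
  have h : deriv (fun s => X s • e₁ + Y s • e₂)
      =ᶠ[nhds t] fun s => deriv X s • e₁ + deriv Y s • e₂ :=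
    Filter.mem_of_superset (hI.mem_nhds ht) fun s hs => (hasDerivAt_planar hX hY hs).deriv
  rw [h.deriv_eq]
  exact (hasDerivAt_planar (differentiableAt_deriv hI hX) (differentiableAt_deriv hI hY) ht).deriv

include h₁₁ h₁₂ h₂₂

theorem planar_dot (x y x' y' : ℂ) :
    (x • e₁ + y • e₂) ⬝ᵥ (x' • e₁ + y' • e₂) = x * x' + y * y' := by
  have h₂₁ := h₁₂
  rw [dotProduct_comm] at h₂₁
  simp only [add_dotProduct, dotProduct_add, smul_dotProduct, dotProduct_smul, h₁₁, h₁₂, h₂₁, h₂₂,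
    smul_eq_mul]
  ring

/-- The 3 × 3 Gram determinant of three vectors in a plane vanishes; expanded, it yields the square
of the third vector from the other products. -/
theorem planar_gram {a b w : Fin p → ℂ} (ha : ∃ x y : ℂ, a = x • e₁ + y • e₂)
    (hb : ∃ x y : ℂ, b = x • e₁ + y • e₂) (hw : ∃ x y : ℂ, w = x • e₁ + y • e₂) :
    (a ⬝ᵥ a * (b ⬝ᵥ b) - (a ⬝ᵥ b) ^ 2) * (w ⬝ᵥ w)
      = a ⬝ᵥ a * (w ⬝ᵥ b) ^ 2 - 2 * (a ⬝ᵥ b) * (w ⬝ᵥ a) * (w ⬝ᵥ b) + b ⬝ᵥ b * (w ⬝ᵥ a) ^ 2 := by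
  obtain ⟨x, y, rfl⟩ := ha
  obtain ⟨x', y', rfl⟩ := hb
  obtain ⟨x'', y'', rfl⟩ := hw
  simp only [planar_dot h₁₁ h₁₂ h₂₂]
  ring

end Planar

section Derivatives

variable {p : ℕ} {I : Set ℂ} (hI : IsOpen I) {φ : ℂ → Fin p → ℂ}
  (hφ : ∀ t ∈ I, DifferentiableAt ℂ φ t)
include hI hφ

theorem deriv_dot_self {F F' : ℂ → ℂ} (h : ∀ t ∈ I, φ t ⬝ᵥ φ t = F t)
    (hF : ∀ t ∈ I, HasDerivAt F (F' t) t) : ∀ t ∈ I, 2 * (deriv φ t ⬝ᵥ φ t) = F' t := by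
  intro t ht
  have h1 := hasDerivAt_dot (hφ t ht).hasDerivAt (hφ t ht).hasDerivAt
  have h2 := (hF t ht).congr_of_eventuallyEq (Filter.mem_of_superset (hI.mem_nhds ht) h)
  have h3 := h1.unique h2
  rw [dotProduct_comm (φ t)] at h3
  linear_combination h3

theorem deriv_deriv_dot {F F' : ℂ → ℂ} (h : ∀ t ∈ I, deriv φ t ⬝ᵥ φ t = F t)
    (hF : ∀ t ∈ I, HasDerivAt F (F' t) t) :
    ∀ t ∈ I, deriv (deriv φ) t ⬝ᵥ φ t + deriv φ t ⬝ᵥ deriv φ t = F' t := by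
  intro t ht
  have h1 := hasDerivAt_dot (differentiableAt_deriv hI hφ t ht).hasDerivAt (hφ t ht).hasDerivAt
  exact h1.unique ((hF t ht).congr_of_eventuallyEq (Filter.mem_of_superset (hI.mem_nhds ht) h))

end Derivatives

/-- The numbers `1 = z_0, z_1, …, z_{n-1}, 0, …`. -/
noncomputable def zSeq {n : ℕ} (z : Fin (n - 1) → ℂ) (m : ℕ) : ℂ :=
  if h : m < n - 1 + 1 then zExt z ⟨m, h⟩ else 0

theorem hasDerivAt_add_mul_sin_sq (b d t : ℂ) :
    HasDerivAt (fun s => b + d * Complex.sin s ^ 2) (2 * (d * (Complex.sin t * Complex.cos t))) t := by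
  have h := (((Complex.hasDerivAt_sin t).fun_pow 2).const_mul d).const_add b
  have e : 2 * (d * (Complex.sin t * Complex.cos t))
      = d * ((2 : ℕ) * Complex.sin t ^ (2 - 1) * Complex.cos t) := by
    push_cast; ring
  rw [e]; exact h

theorem hasDerivAt_mul_sin_mul_cos (d t : ℂ) :
    HasDerivAt (fun s => d * (Complex.sin s * Complex.cos s))
      (d * (1 - 2 * Complex.sin t ^ 2)) t := by
  have h := ((Complex.hasDerivAt_sin t).fun_mul (Complex.hasDerivAt_cos t)).const_mul d
  have e : d * (1 - 2 * Complex.sin t ^ 2) = d * (Complex.cos t * Complex.cos t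
      + Complex.sin t * -Complex.sin t) := by
    linear_combination -d * Complex.sin_sq_add_cos_sq t
  rw [e]; exact h

section Directrix

variable {p : ℕ} {e₁ e₂ : Fin p → ℂ} (h₁₁ : e₁ ⬝ᵥ e₁ = 1) (h₁₂ : e₁ ⬝ᵥ e₂ = 0) (h₂₂ : e₂ ⬝ᵥ e₂ = 1)
  {I : Set ℂ} (hI : IsOpen I) {a₀ A z z' : ℂ} (ha₀ : a₀ ≠ 0) (hA : A ≠ 0) (hz : z ≠ 0)
include h₁₁ h₁₂ h₂₂ hI ha₀ hA hz

/-- The geometry of the directrix `f (cos g, sin g)`. -/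
theorem directrix_dot {f g : ℂ → ℂ} (hz' : z' ≠ 0) (hf : ∀ t ∈ I, DifferentiableAt ℂ f t)
    (hg : ∀ t ∈ I, DifferentiableAt ℂ g t) (hf0 : ∀ t ∈ I, f t ≠ 0) (hg0 : ∀ t ∈ I, deriv g t ≠ 0)
    (hF : ∀ t ∈ I, f t ^ 2 = (z - z') * a₀ + (A - z * a₀) * Complex.sin t ^ 2)
    (hG : ∀ t ∈ I, (deriv g t * ((z - z') * a₀ + (A - z * a₀) * Complex.sin t ^ 2)) ^ 2
      = (z - z') * a₀ * A + (A - z * a₀) * z' * a₀ * Complex.sin t ^ 2)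
    {φ : ℂ → Fin p → ℂ}
    (hφ : φ = fun t => (f t * Complex.cos (g t)) • e₁ + (f t * Complex.sin (g t)) • e₂) :
    ∀ t ∈ I, φ t ⬝ᵥ φ t = (z - z') * a₀ + (A - z * a₀) * Complex.sin t ^ 2 ∧
      deriv φ t ⬝ᵥ φ t = (A - z * a₀) * (Complex.sin t * Complex.cos t) ∧
      deriv φ t ⬝ᵥ deriv φ t = A + (z * a₀ - A) * Complex.sin t ^ 2 ∧
      deriv (deriv φ) t ⬝ᵥ deriv (deriv φ) t - A * Complex.sin t ^ 2
        - z * a₀ * Complex.cos t ^ 2 ≠ 0 ∧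
      (deriv (deriv φ) t ⬝ᵥ deriv (deriv φ) t - A * Complex.sin t ^ 2
        - z * a₀ * Complex.cos t ^ 2)⁻¹
        = (a₀ * z')⁻¹ - Complex.cos t ^ 2 * (a₀ * z)⁻¹ - Complex.sin t ^ 2 / A := by
  have hX : ∀ t ∈ I, DifferentiableAt ℂ (fun t => f t * Complex.cos (g t)) t := fun t ht =>
    (hf t ht).fun_mul (hg t ht).ccos
  have hY : ∀ t ∈ I, DifferentiableAt ℂ (fun t => f t * Complex.sin (g t)) t := fun t ht =>
    (hf t ht).fun_mul (hg t ht).csin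
  have hφd : ∀ t ∈ I, DifferentiableAt ℂ φ t := fun t ht => by
    rw [hφ]; exact (hasDerivAt_planar hX hY ht).differentiableAt
  have k0 : ∀ t ∈ I, φ t ⬝ᵥ φ t = (z - z') * a₀ + (A - z * a₀) * Complex.sin t ^ 2 := by
    intro t ht
    rw [hφ, planar_dot h₁₁ h₁₂ h₂₂, ← hF t ht]
    linear_combination f t ^ 2 * Complex.sin_sq_add_cos_sq (g t)
  have k1 : ∀ t ∈ I, deriv φ t ⬝ᵥ φ t = (A - z * a₀) * (Complex.sin t * Complex.cos t) :=
    fun t ht => mul_left_cancel₀ two_ne_zero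
      (deriv_dot_self hI hφd k0 (fun t _ => hasDerivAt_add_mul_sin_sq _ _ t) t ht)
  have k2 : ∀ t ∈ I, deriv φ t ⬝ᵥ deriv φ t = A + (z * a₀ - A) * Complex.sin t ^ 2 := by
    intro t ht
    have d1 : deriv (fun t => f t * Complex.cos (g t)) t
        = deriv f t * Complex.cos (g t) + f t * (-Complex.sin (g t) * deriv g t) :=
      ((hf t ht).hasDerivAt.fun_mul (hg t ht).hasDerivAt.ccos).deriv
    have d2 : deriv (fun t => f t * Complex.sin (g t)) t
        = deriv f t * Complex.sin (g t) + f t * (Complex.cos (g t) * deriv g t) :=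
      ((hf t ht).hasDerivAt.fun_mul (hg t ht).hasDerivAt.csin).deriv
    have d3 : f t * deriv f t = (A - z * a₀) * (Complex.sin t * Complex.cos t) := by
      rw [← k1 t ht, hφ, (hasDerivAt_planar hX hY ht).deriv, planar_dot h₁₁ h₁₂ h₂₂, d1, d2]
      linear_combination -f t * deriv f t * Complex.sin_sq_add_cos_sq (g t)
    have d4 : f t ^ 2 * (deriv φ t ⬝ᵥ deriv φ t)
        = f t ^ 2 * (A + (z * a₀ - A) * Complex.sin t ^ 2) := by
      have d5 : f t ^ 2 * (deriv φ t ⬝ᵥ deriv φ t)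
          = (f t * deriv f t) ^ 2 + (deriv g t * f t ^ 2) ^ 2 := by
        rw [hφ, (hasDerivAt_planar hX hY ht).deriv, planar_dot h₁₁ h₁₂ h₂₂, d1, d2]
        linear_combination (f t ^ 2 * (deriv f t ^ 2 + f t ^ 2 * deriv g t ^ 2))
          * Complex.sin_sq_add_cos_sq (g t)
      rw [d5, d3, hF t ht, hG t ht, mul_pow, mul_pow, Complex.cos_sq']
      ring
    exact mul_left_cancel₀ (pow_ne_zero 2 (hf0 t ht)) d4
  intro t ht
  refine ⟨k0 t ht, k1 t ht, k2 t ht, ?_⟩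
  have k3 := deriv_deriv_dot hI hφd k1 (fun t _ => hasDerivAt_mul_sin_mul_cos _ t) t ht
  have k4 := deriv_dot_self hI (differentiableAt_deriv hI hφd) k2
    (fun t _ => hasDerivAt_add_mul_sin_sq _ _ t) t ht
  -- Products of φ'' with φ and φ' come from differentiating the known products. The planarity of
  -- the directrix then yields |φ''|².
  have hpl := planar_gram h₁₁ h₁₂ h₂₂ (a := φ t) (b := deriv φ t) (w := deriv (deriv φ) t)
    ⟨_, _, by rw [hφ]⟩ ⟨_, _, by rw [hφ]; exact (hasDerivAt_planar hX hY ht).deriv⟩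
    ⟨_, _, by rw [hφ]; exact deriv_deriv_planar hI hX hY ht⟩
  have k3' : deriv (deriv φ) t ⬝ᵥ φ t
      = -(A * Complex.sin t ^ 2 + z * a₀ * (1 - Complex.sin t ^ 2)) := by
    rw [k2 t ht] at k3
    linear_combination k3
  have k4' : deriv (deriv φ) t ⬝ᵥ deriv φ t
      = (z * a₀ - A) * (Complex.sin t * Complex.cos t) := mul_left_cancel₀ two_ne_zero k4
  rw [dotProduct_comm (φ t) (deriv φ t), k0 t ht, k1 t ht, k2 t ht, k3', k4'] at hpl
  simp only [mul_pow, Complex.cos_sq'] at hpl ⊢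
  set S := Complex.sin t ^ 2
  set w := deriv (deriv φ) t ⬝ᵥ deriv (deriv φ) t
  set c := Complex.sin t * Complex.cos t with hc
  have hc2 : c ^ 2 = S * (1 - S) := by rw [hc, mul_pow, Complex.cos_sq']
  have hF0 : (z - z') * a₀ + (A - z * a₀) * S ≠ 0 := by
    rw [← hF t ht]; exact pow_ne_zero 2 (hf0 t ht)
  have hG0 : (z - z') * a₀ * A + (A - z * a₀) * z' * a₀ * S ≠ 0 := by
    rw [← hG t ht]; exact pow_ne_zero 2 (mul_ne_zero (hg0 t ht) hF0)
  -- The first factor is the radicand belonging to g', and it equals the Gram determinant |φ|²|φ'|²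
  -- - (φ · φ')² of φ and φ'. The right side is constant, so the inverse of the other factor is
  -- affine in sin².
  have key : ((z - z') * a₀ * A + (A - z * a₀) * z' * a₀ * S) * (w - A * S - z * a₀ * (1 - S))
      = A * a₀ ^ 2 * z * z' := by
    linear_combination hpl + 2 * (A - z * a₀) * (A * S + z * a₀ * (1 - S)) * (z * a₀ - A) * hc2
  have hne : w - A * S - z * a₀ * (1 - S) ≠ 0 := by
    intro h0
    rw [h0, mul_zero] at key
    exact (mul_ne_zero (mul_ne_zero (mul_ne_zero hA (pow_ne_zero 2 ha₀)) hz) hz') key.symm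
  refine ⟨hne, ?_⟩
  rw [inv_eq_iff_eq_inv, ← mul_right_inj' hG0, key]
  have h7 : (a₀ * z')⁻¹ - (1 - S) * (a₀ * z)⁻¹ - S / A
      = ((z - z') * a₀ * A + (A - z * a₀) * z' * a₀ * S) / (A * a₀ ^ 2 * z * z') := by
    field_simp
    ring
  rw [h7, inv_div, mul_div_cancel₀ _ hG0]

omit h₁₂ h₂₂ in
/-- The geometry of the last directrix. -/
theorem last_directrix_dot {h : ℂ → ℂ} (hh : ∀ t ∈ I, DifferentiableAt ℂ h t)
    (hh0 : ∀ t ∈ I, deriv h t ≠ 0)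
    (hH : ∀ t ∈ I, deriv h t ^ 2 = A - (A - z * a₀) * Complex.sin t ^ 2)
    {φ : ℂ → Fin p → ℂ} (hφ : φ = fun t => h t • e₁) :
    ∀ t ∈ I, deriv φ t ⬝ᵥ deriv φ t = A + (z * a₀ - A) * Complex.sin t ^ 2 ∧
      deriv (deriv φ) t ⬝ᵥ deriv (deriv φ) t - A * Complex.sin t ^ 2
        - z * a₀ * Complex.cos t ^ 2 ≠ 0 ∧
      (deriv (deriv φ) t ⬝ᵥ deriv (deriv φ) t - A * Complex.sin t ^ 2
        - z * a₀ * Complex.cos t ^ 2)⁻¹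
        = - (Complex.cos t ^ 2 * (a₀ * z)⁻¹) - Complex.sin t ^ 2 / A := by
  have hφ' : ∀ t ∈ I, HasDerivAt φ (deriv h t • e₁) t := fun t ht => by
    rw [hφ]; exact (hh t ht).hasDerivAt.smul_const e₁
  have hφd : ∀ t ∈ I, DifferentiableAt ℂ φ t := fun t ht => (hφ' t ht).differentiableAt
  have k2 : ∀ t ∈ I, deriv φ t ⬝ᵥ deriv φ t = A + (z * a₀ - A) * Complex.sin t ^ 2 := by
    intro t ht
    rw [(hφ' t ht).deriv, smul_dotProduct, dotProduct_smul, h₁₁]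
    simp only [smul_eq_mul]
    linear_combination hH t ht
  intro t ht
  refine ⟨k2 t ht, ?_⟩
  have k4 := deriv_dot_self hI (differentiableAt_deriv hI hφd) k2
    (fun t _ => hasDerivAt_add_mul_sin_sq _ _ t) t ht
  have k4' : deriv (deriv φ) t ⬝ᵥ deriv φ t
      = (z * a₀ - A) * (Complex.sin t * Complex.cos t) := mul_left_cancel₀ two_ne_zero k4
  have e : deriv (deriv φ) t = deriv (deriv h) t • e₁ := by
    have h1 : deriv φ =ᶠ[nhds t] fun s => deriv h s • e₁ :=
      Filter.mem_of_superset (hI.mem_nhds ht) fun s hs => (hφ' s hs).deriv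
    rw [h1.deriv_eq]
    exact ((differentiableAt_deriv hI hh t ht).hasDerivAt.smul_const e₁).deriv
  have hpl : deriv h t ^ 2 * (deriv (deriv φ) t ⬝ᵥ deriv (deriv φ) t)
      = (deriv (deriv φ) t ⬝ᵥ deriv φ t) ^ 2 := by
    rw [e, (hφ' t ht).deriv]
    simp only [smul_dotProduct, dotProduct_smul, h₁₁, smul_eq_mul]
    ring
  rw [k4', hH t ht] at hpl
  have hH0 : A - (A - z * a₀) * Complex.sin t ^ 2 ≠ 0 := by
    rw [← hH t ht]; exact pow_ne_zero 2 (hh0 t ht)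
  simp only [mul_pow, Complex.cos_sq'] at hpl ⊢
  set S := Complex.sin t ^ 2
  set w := deriv (deriv φ) t ⬝ᵥ deriv (deriv φ) t
  have key : (A - (A - z * a₀) * S) * (w - A * S - z * a₀ * (1 - S)) = -(A * z * a₀) := by
    linear_combination hpl
  have hne : w - A * S - z * a₀ * (1 - S) ≠ 0 := by
    intro h0
    rw [h0, mul_zero] at key
    exact (neg_ne_zero.mpr (mul_ne_zero (mul_ne_zero hA hz) ha₀)) key.symm
  refine ⟨hne, ?_⟩
  rw [inv_eq_iff_eq_inv, ← mul_right_inj' hH0, key]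
  have h7 : -((1 - S) * (a₀ * z)⁻¹) - S / A = -((A - (A - z * a₀) * S) / (A * z * a₀)) := by
    field_simp
    ring
  rw [h7, inv_neg, inv_div, mul_neg, mul_div_cancel₀ _ hH0]

end Directrix

section SphericalSplit

variable {n : ℕ} (a : Fin (n + 1) → ℂ)

theorem isSplit_spherical (U : Set (Fin n → ℂ)) :
    IsSplit (sphericalVertex a) (sphericalDirectrix a) U where
  diff := differentiableAt_sphericalDirectrix a U
  vertex i t := by simp [sphericalVertex, sphericalDirectrix]
  split i j hij s t := by
    simp only [sphericalDirectrix, single_dotProduct]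
    rw [Pi.single_eq_of_ne (fun h => hij (Fin.succ_injective _ h)), mul_zero]

theorem sphericalDirectrix_dot_self (i : Fin n) (t : ℂ) :
    sphericalDirectrix a i t ⬝ᵥ sphericalDirectrix a i t = a i.succ * Complex.sin t ^ 2 := by
  simp only [sphericalDirectrix, single_dotProduct, Pi.single_eq_same]
  linear_combination Complex.sin t ^ 2 * cpow_half_sq (a i.succ)

theorem deriv_sphericalDirectrix_dot (i : Fin n) (t : ℂ) :
    deriv (sphericalDirectrix a i) t ⬝ᵥ sphericalDirectrix a i t
      = a i.succ * (Complex.sin t * Complex.cos t) := by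
  simp only [deriv_sphericalDirectrix, sphericalDirectrix, single_dotProduct, Pi.single_eq_same]
  linear_combination Complex.sin t * Complex.cos t * cpow_half_sq (a i.succ)

theorem deriv_sphericalDirectrix_dot_self (i : Fin n) (t : ℂ) :
    deriv (sphericalDirectrix a i) t ⬝ᵥ deriv (sphericalDirectrix a i) t
      = a i.succ * Complex.cos t ^ 2 := by
  simp only [deriv_sphericalDirectrix, single_dotProduct, Pi.single_eq_same]
  linear_combination Complex.cos t ^ 2 * cpow_half_sq (a i.succ)

theorem deriv_deriv_sphericalDirectrix_dot_self (i : Fin n) (t : ℂ) :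
    deriv (deriv (sphericalDirectrix a i)) t ⬝ᵥ deriv (deriv (sphericalDirectrix a i)) t
      = a i.succ * Complex.sin t ^ 2 := by
  rw [deriv_deriv_sphericalDirectrix, neg_dotProduct, dotProduct_neg, neg_neg,
    sphericalDirectrix_dot_self]

end SphericalSplit

section Sequence

variable {n : ℕ}

theorem zSeq_zero (z : Fin (n - 1) → ℂ) : zSeq z 0 = 1 := dif_pos (Nat.succ_pos _)

theorem zSeq_succ (z : Fin (n - 1) → ℂ) (k : Fin (n - 1)) : zSeq z (k.val + 1) = z k :=
  dif_pos (Nat.succ_lt_succ k.isLt)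

/-- This value, with the convention 0⁻¹ = 0, makes (a_0 z_m)⁻¹ equal to W_m also at m = n, where W_n
= 0. -/
theorem zSeq_self (hn : 0 < n) (z : Fin (n - 1) → ℂ) : zSeq z n = 0 := dif_neg (by omega)

theorem zSeq_ne_zero {z : Fin (n - 1) → ℂ} (hz : ∀ k, z k ≠ 0) {m : ℕ} (hm : m < n) :
    zSeq z m ≠ 0 := by
  cases m with
  | zero => rw [zSeq_zero]; exact one_ne_zero
  | succ m =>
    have := zSeq_succ z ⟨m, by omega⟩
    simp only at this
    rw [this]; exact hz _

theorem radF_eq (a : Fin (n + 1) → ℂ) (z : Fin (n - 1) → ℂ) (i : Fin n) (hi : i.val < n - 1) (t : ℂ) :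
    radF a z ⟨i.val, hi⟩ t = (zSeq z i.val - zSeq z (i.val + 1)) * a 0
      + (a i.succ - zSeq z i.val * a 0) * Complex.sin t ^ 2 := by
  rw [zSeq, zSeq, dif_pos (by omega), dif_pos (by omega)]
  rfl

theorem radG_eq (a : Fin (n + 1) → ℂ) (z : Fin (n - 1) → ℂ) (i : Fin n) (hi : i.val < n - 1) (t : ℂ) :
    radG a z ⟨i.val, hi⟩ t = (zSeq z i.val - zSeq z (i.val + 1)) * a 0 * a i.succ
      + (a i.succ - zSeq z i.val * a 0) * zSeq z (i.val + 1) * a 0 * Complex.sin t ^ 2 := by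
  rw [zSeq, zSeq, dif_pos (by omega), dif_pos (by omega)]
  rfl

theorem radH_eq (a : Fin (n + 1) → ℂ) (z : Fin (n - 1) → ℂ) (i : Fin n) (hi : i.val + 1 = n) (t : ℂ) :
    radH a z t = a i.succ - (a i.succ - zSeq z i.val * a 0) * Complex.sin t ^ 2 := by
  have e : Fin.last n = i.succ := Fin.ext (by simp [hi])
  have e' : zExt z (Fin.last (n - 1)) = zSeq z i.val := by
    rw [zSeq, dif_pos (by omega)]
    congr 1
    exact Fin.ext (by simp; omega)
  rw [radH, e, e']

end Sequence

/-- The directrices of Peterson's deformations, seen as iterated cones with vertex `0`. -/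
noncomputable def petersonDirectrix {n : ℕ} (f g : Fin (n - 1) → ℂ → ℂ) (h : ℂ → ℂ) (i : Fin n)
    (t : ℂ) : Fin (2 * n - 1) → ℂ := fun p =>
  if p.val / 2 = i.val then
    (if hi : i.val < n - 1 then f ⟨i.val, hi⟩ t *
      (if p.val % 2 = 0 then Complex.cos (g ⟨i.val, hi⟩ t) else Complex.sin (g ⟨i.val, hi⟩ t))
    else h t) else 0

section PetersonDirectrix

variable {n : ℕ} (f g : Fin (n - 1) → ℂ → ℂ) (h : ℂ → ℂ)

theorem petersonMap_eq_cone : petersonMap f g h = cone 0 (petersonDirectrix f g h) n := by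
  ext u p
  have hp : p.val / 2 < n := by omega
  rw [cone_self_eq_sum, Pi.add_apply, Finset.sum_apply,
    Finset.sum_eq_single (⟨p.val / 2, hp⟩ : Fin n)]
  · simp only [Pi.zero_apply, Pi.smul_apply, smul_eq_mul, petersonDirectrix,
      if_true, petersonMap]
    split_ifs with h1 h2
    · ring
    · ring
    · have e : p.val / 2 + 1 = n := by omega
      have e' : (⟨p.val / 2, hp⟩ : Fin n) = ⟨n - 1, by omega⟩ := Fin.ext (by simp; omega)
      rw [e, bigC_self, one_mul, e', mul_zero, zero_add]
  · intro i _ hi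
    have : p.val / 2 ≠ i.val := fun h' => hi (Fin.ext h'.symm)
    simp [petersonDirectrix, this]
  · intro h'; exact absurd (Finset.mem_univ _) h'

theorem petersonDirectrix_eq_of_lt {i : Fin n} (hi : i.val < n - 1) :
    petersonDirectrix f g h i = fun t =>
      (f ⟨i.val, hi⟩ t * Complex.cos (g ⟨i.val, hi⟩ t))
        • (Pi.single ⟨2 * i.val, by omega⟩ 1 : Fin (2 * n - 1) → ℂ)
      + (f ⟨i.val, hi⟩ t * Complex.sin (g ⟨i.val, hi⟩ t))
        • (Pi.single ⟨2 * i.val + 1, by omega⟩ 1 : Fin (2 * n - 1) → ℂ) := by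
  ext t p
  simp only [petersonDirectrix, dif_pos hi, Pi.add_apply, Pi.smul_apply, Pi.single_apply, Fin.ext_iff,
    smul_eq_mul]
  by_cases h1 : p.val / 2 = i.val
  · rcases Nat.mod_two_eq_zero_or_one p.val with h2 | h2
    · rw [if_pos h1, if_pos h2, if_pos (by omega), if_neg (by omega)]; ring
    · rw [if_pos h1, if_neg (by omega), if_neg (by omega), if_pos (by omega)]; ring
  · rw [if_neg h1, if_neg (by omega), if_neg (by omega)]; ring

theorem petersonDirectrix_eq_of_succ_eq {i : Fin n} (hi : i.val + 1 = n) :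
    petersonDirectrix f g h i = fun t =>
      h t • (Pi.single ⟨2 * i.val, by omega⟩ 1 : Fin (2 * n - 1) → ℂ) := by
  ext t p
  have hi' : ¬ i.val < n - 1 := by omega
  simp only [petersonDirectrix, dif_neg hi', Pi.smul_apply, Pi.single_apply, Fin.ext_iff,
    smul_eq_mul]
  by_cases h1 : p.val / 2 = i.val
  · rw [if_pos h1, if_pos (by omega)]; ring
  · rw [if_neg h1, if_neg (by omega)]; ring

end PetersonDirectrix

/-- The geometric content of the formulas of Peterson's deformations. -/
structure IsPetersonCone {n : ℕ} (a : Fin (n + 1) → ℂ) (z : Fin (n - 1) → ℂ) (U : Set (Fin n → ℂ))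
    (φ : Fin n → ℂ → Fin (2 * n - 1) → ℂ) : Prop where
  split : IsSplit 0 φ U
  dot : ∀ u ∈ U, ∀ i : Fin n, i.val + 1 < n → φ i (u i) ⬝ᵥ φ i (u i)
    = (zSeq z i.val - zSeq z (i.val + 1)) * a 0
      + (a i.succ - zSeq z i.val * a 0) * Complex.sin (u i) ^ 2
  deriv_dot : ∀ u ∈ U, ∀ i : Fin n, i.val + 1 < n → deriv (φ i) (u i) ⬝ᵥ φ i (u i)
    = (a i.succ - zSeq z i.val * a 0) * (Complex.sin (u i) * Complex.cos (u i))
  deriv_dot_deriv : ∀ u ∈ U, ∀ i : Fin n, deriv (φ i) (u i) ⬝ᵥ deriv (φ i) (u i)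
    = a i.succ + (zSeq z i.val * a 0 - a i.succ) * Complex.sin (u i) ^ 2
  ne_zero : ∀ u ∈ U, ∀ i : Fin n, deriv (deriv (φ i)) (u i) ⬝ᵥ deriv (deriv (φ i)) (u i)
    - a i.succ * Complex.sin (u i) ^ 2 - zSeq z i.val * a 0 * Complex.cos (u i) ^ 2 ≠ 0
  inv_eq : ∀ u ∈ U, ∀ i : Fin n, (deriv (deriv (φ i)) (u i) ⬝ᵥ deriv (deriv (φ i)) (u i)
    - a i.succ * Complex.sin (u i) ^ 2 - zSeq z i.val * a 0 * Complex.cos (u i) ^ 2)⁻¹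
    = (a 0 * zSeq z (i.val + 1))⁻¹ - Complex.cos (u i) ^ 2 * (a 0 * zSeq z i.val)⁻¹
      - Complex.sin (u i) ^ 2 / a i.succ

section Peterson

variable {n : ℕ} {a : Fin (n + 1) → ℂ} {z : Fin (n - 1) → ℂ} {U : Set (Fin n → ℂ)}

theorem IsPeterson.exists_cone (hn : 0 < n) (ha : ∀ j, a j ≠ 0) (hz : ∀ k, z k ≠ 0) (hU : IsOpen U)
    {X : (Fin n → ℂ) → (Fin (2 * n - 1) → ℂ)} (hX : IsPeterson a z U X) :
    ∃ φ, IsPetersonCone a z U φ ∧ ∀ u ∈ U, X u = cone 0 φ n u := by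
  obtain ⟨f, g, h, hfg, hh, hX⟩ := hX
  have A1 : ∀ i : Fin n, i.val < n - 1 → ∀ t ∈ (fun u : Fin n → ℂ => u i) '' U, _ :=
    fun i hi t ht => directrix_dot
      (e₁ := (Pi.single ⟨2 * i.val, by omega⟩ 1 : Fin (2 * n - 1) → ℂ))
      (e₂ := (Pi.single ⟨2 * i.val + 1, by omega⟩ 1 : Fin (2 * n - 1) → ℂ))
      (by simp) (by simp) (by simp) (isOpen_coordImage hU i) (ha 0) (ha i.succ)
      (zSeq_ne_zero hz i.isLt) (zSeq_ne_zero hz (m := i.val + 1) (by omega))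
      (fun t ht => (hfg ⟨i.val, hi⟩ t ht).1) (fun t ht => (hfg ⟨i.val, hi⟩ t ht).2.1)
      (fun t ht => (hfg ⟨i.val, hi⟩ t ht).2.2.1) (fun t ht => (hfg ⟨i.val, hi⟩ t ht).2.2.2.2.1)
      (fun t ht => by rw [← radF_eq a z i hi]; exact (hfg ⟨i.val, hi⟩ t ht).2.2.2.1)
      (fun t ht => by
        rw [← radF_eq a z i hi, ← radG_eq a z i hi]; exact (hfg ⟨i.val, hi⟩ t ht).2.2.2.2.2)
      (petersonDirectrix_eq_of_lt f g h hi) t ht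
  have A2 : ∀ i : Fin n, i.val + 1 = n → ∀ t ∈ (fun u : Fin n → ℂ => u i) '' U, _ :=
    fun i hi t ht => last_directrix_dot
      (e₁ := (Pi.single ⟨2 * i.val, by omega⟩ 1 : Fin (2 * n - 1) → ℂ))
      (by simp) (isOpen_coordImage hU i) (ha 0) (ha i.succ)
      (zSeq_ne_zero hz i.isLt)
      (fun t ht => (hh i hi t ht).1) (fun t ht => (hh i hi t ht).2.1)
      (fun t ht => by rw [← radH_eq a z i hi]; exact (hh i hi t ht).2.2)
      (petersonDirectrix_eq_of_succ_eq f g h hi) t ht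
  have hlast : ∀ i : Fin n, ¬ i.val < n - 1 → i.val + 1 = n := fun i hi => by omega
  refine ⟨petersonDirectrix f g h, ⟨⟨fun i t ht => ?_, fun i t => zero_dotProduct _,
    fun i j hij s t => ?_⟩, fun u hu i hi => (A1 i (by omega) _ ⟨u, hu, rfl⟩).1,
    fun u hu i hi => (A1 i (by omega) _ ⟨u, hu, rfl⟩).2.1, fun u hu i => ?_, fun u hu i => ?_,
    fun u hu i => ?_⟩, fun u hu => by rw [hX u hu, petersonMap_eq_cone]⟩
  · by_cases hi : i.val < n - 1
    · rw [petersonDirectrix_eq_of_lt f g h hi]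
      have h1 := hfg ⟨i.val, hi⟩ t ht
      exact ((h1.1.fun_mul h1.2.1.ccos).smul_const _).fun_add
        ((h1.1.fun_mul h1.2.1.csin).smul_const _)
    · rw [petersonDirectrix_eq_of_succ_eq f g h (hlast i hi)]
      exact (hh i (hlast i hi) t ht).1.smul_const _
  · refine Finset.sum_eq_zero fun p _ => ?_
    by_cases h1 : p.val / 2 = i.val
    · have h2 : p.val / 2 ≠ j.val := fun h2 => hij (Fin.ext (h1.symm.trans h2))
      simp only [petersonDirectrix, if_neg h2, mul_zero]
    · simp only [petersonDirectrix, if_neg h1, zero_mul]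
  · by_cases hi : i.val < n - 1
    · exact (A1 i hi _ ⟨u, hu, rfl⟩).2.2.1
    · exact (A2 i (hlast i hi) _ ⟨u, hu, rfl⟩).1
  · by_cases hi : i.val < n - 1
    · exact (A1 i hi _ ⟨u, hu, rfl⟩).2.2.2.1
    · exact (A2 i (hlast i hi) _ ⟨u, hu, rfl⟩).2.1
  · by_cases hi : i.val < n - 1
    · exact (A1 i hi _ ⟨u, hu, rfl⟩).2.2.2.2
    -- The last directrix fits the general formula because its first term is a junk inverse equal to
    -- 0.
    · rw [hlast i hi, zSeq_self hn, mul_zero, inv_zero, zero_sub]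
      exact (A2 i (hlast i hi) _ ⟨u, hu, rfl⟩).2.2

variable {φ : Fin n → ℂ → Fin (2 * n - 1) → ℂ}

/-- At each step the factor cos² multiplies the discrepancy z_m a_0, and F_{m+1} is chosen so that
adding |φ_m|² turns it into z_{m+1} a_0. The initial discrepancy a_0 comes from the vertices 0 and
√a_0 e_0. -/
theorem IsPetersonCone.cone_dot_cone (h : IsPetersonCone a z U φ) (hU : IsOpen U) {u : Fin n → ℂ}
    (hu : u ∈ U) {m : ℕ} (hm : m < n) : cone 0 φ m u ⬝ᵥ cone 0 φ m u
      = cone (sphericalVertex a) (sphericalDirectrix a) m u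
        ⬝ᵥ cone (sphericalVertex a) (sphericalDirectrix a) m u - zSeq z m * a 0 := by
  induction m with
  | zero =>
    simp only [cone, zSeq_zero, zero_dotProduct, sphericalVertex, single_dotProduct,
      Pi.single_eq_same]
    linear_combination -cpow_half_sq (a 0)
  | succ m ih =>
    have e := h.split.cone_dot_cone hU hu ⟨m, by omega⟩
    have e' := (isSplit_spherical a U).cone_dot_cone hU hu ⟨m, by omega⟩
    have e2 := h.dot u hu ⟨m, by omega⟩ hm
    simp only [sphericalDirectrix_dot_self] at e e' e2
    rw [e, e', e2, ih (by omega), Complex.cos_sq']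
    ring

/-- The discrepancies z_j a_0 of the square lengths are compensated by those of the products of φ_j
and its derivative. -/
theorem IsPetersonCone.metric_eq (h : IsPetersonCone a z U φ) (hU : IsOpen U) {u : Fin n → ℂ}
    (hu : u ∈ U) : metric (cone 0 φ n) u = metric (spherical a) u := by
  rw [spherical_eq_cone]
  refine metric_cone_eq h.split (isSplit_spherical a U) hU hu (fun j => ?_) fun j hj => ?_
  · rw [h.split.coneTangent_dot_self hU hu, (isSplit_spherical a U).coneTangent_dot_self hU hu,
      h.cone_dot_cone hU hu j.isLt, h.deriv_dot_deriv u hu, deriv_sphericalDirectrix_dot_self,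
      Complex.cos_sq']
    ring
  · rw [h.split.coneTangent_dot_cone_succ hU hu,
      (isSplit_spherical a U).coneTangent_dot_cone_succ hU hu,
      h.cone_dot_cone hU hu j.isLt, h.deriv_dot u hu j hj, deriv_sphericalDirectrix_dot]
    ring

theorem IsPetersonCone.curvSq_eq (h : IsPetersonCone a z U φ) (hU : IsOpen U)
    (hr : IsRegular (spherical a) U) {u : Fin n → ℂ} (hu : u ∈ U) (j : Fin n) :
    curvSq a (cone 0 φ n) j u = bigC (j.val + 1) u ^ 2 *
      (deriv (deriv (φ j)) (u j) ⬝ᵥ deriv (deriv (φ j)) (u j)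
        - a j.succ * Complex.sin (u j) ^ 2 - zSeq z j.val * a 0 * Complex.cos (u j) ^ 2) := by
  rw [curvSq_eq_pd_pd hU hr (contDiffOn_cone hU h.split.diff n) (fun v hv => h.metric_eq hU hv) hu,
    spherical_eq_cone, h.split.pd_pd_dot_self hU hu, (isSplit_spherical a U).pd_pd_dot_self hU hu,
    h.cone_dot_cone hU hu j.isLt, deriv_deriv_sphericalDirectrix_dot_self]
  ring

theorem IsPetersonCone.isDeformation (h : IsPetersonCone a z U φ) (hU : IsOpen U)
    (hr : IsRegular (spherical a) U) : IsDeformation (spherical a) U (cone 0 φ n) := by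
  refine isDeformation_spherical hU hr (contDiffOn_cone hU h.split.diff n)
    (fun u hu => h.metric_eq hU hu) (fun u hu j m hjm => ?_) fun u hu j => ?_
  · exact pd_pd_cone_of_lt hU h.split.diff hu hjm
      (cos_ne_zero_of_isRegular hr hu (lt_of_le_of_lt (Nat.zero_le _) hjm))
  · rw [h.curvSq_eq hU hr hu]
    exact mul_ne_zero (pow_ne_zero 2 (bigC_succ_ne_zero hr hu _)) (h.ne_zero u hu j)

/-- Up to 𝐂_{j+1}², the inverse of J_j is 1/(a_0 z_{j+1}) - cos²/(a_0 z_j) - sin²/a_{j+1}, which is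
exactly what the recursion of the ladder needs to advance by one. -/
theorem IsPetersonCone.ladder_eq (h : IsPetersonCone a z U φ) (hU : IsOpen U)
    (hr : IsRegular (spherical a) U) {u : Fin n → ℂ} (hu : u ∈ U) {m : ℕ} (hm : m ≤ n) :
    ladder a (curvSq a (cone 0 φ n)) m u = (a 0 * zSeq z m)⁻¹ := by
  induction m with
  | zero => rw [ladder_zero, zSeq_zero, mul_one]
  | succ m ih =>
    have e := ladder_succ a (curvSq a (cone 0 φ n)) ⟨m, hm⟩ u
    have e2 := h.inv_eq u hu ⟨m, hm⟩
    rw [h.curvSq_eq hU hr hu, ← div_div,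
      div_self (pow_ne_zero 2 (bigC_succ_ne_zero hr hu _)), one_div, e2] at e
    simp only at e
    rw [e, ih (by omega)]
    ring

end Peterson

/-! ### Restriction and change of representative -/

section Locality

variable {n : ℕ} {U : Set (Fin n → ℂ)} {x₀ : (Fin n → ℂ) → (Fin (n + 1) → ℂ)}
  {x x' : (Fin n → ℂ) → (Fin (2 * n - 1) → ℂ)}

theorem IsDeformation.mono {V : Set (Fin n → ℂ)} (h : IsDeformation x₀ U x) (hV : V ⊆ U) :
    IsDeformation x₀ V x :=
  ⟨h.holo.mono hV, fun u hu => h.isometric u (hV hu), fun u hu => h.conjugate u (hV hu),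
    fun u hu => h.nondegenerate u (hV hu)⟩

theorem secondForm_congr {p : ℕ} {y y' : (Fin n → ℂ) → (Fin p → ℂ)} (hU : IsOpen U)
    (h : ∀ u ∈ U, y u = y' u) {u : Fin n → ℂ} (hu : u ∈ U) (j k : Fin n) :
    secondForm y j k u = secondForm y' j k u := by
  have h1 : ∀ v ∈ U, ∀ l, pd l y v = pd l y' v := fun v hv l => pd_congr hU h hv l
  have hm : ∀ v ∈ U, metric y v = metric y' v := fun v hv => by
    ext i l; rw [metric_apply, metric_apply, h1 v hv, h1 v hv]
  simp only [secondForm, christoffel_congr hU hm hu, h1 u hu]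
  rw [pd_congr hU (fun v hv => h1 v hv j) hu]

theorem IsDeformation.congr (hU : IsOpen U) (h : IsDeformation x₀ U x) (he : ∀ u ∈ U, x' u = x u) :
    IsDeformation x₀ U x' := by
  have h1 : ∀ v ∈ U, ∀ l, pd l x' v = pd l x v := fun v hv l => pd_congr hU he hv l
  have h2 := fun u (hu : u ∈ U) j k => secondForm_congr hU he hu j k
  refine ⟨h.holo.congr he, fun u hu => ?_, fun u hu j k hjk => ?_, fun u hu => ?_⟩
  · rw [← h.isometric u hu]
    ext j k
    rw [metric_apply, metric_apply, h1 u hu, h1 u hu]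
  · rw [h2 u hu]; exact h.conjugate u hu j k hjk
  · simp only [h2 u hu]; exact h.nondegenerate u hu

end Locality

/-! ### Peterson's maps as deformations, and their invariants -/

section PetersonMain

variable {n : ℕ} {a : Fin (n + 1) → ℂ} {z z' : Fin (n - 1) → ℂ} {U : Set (Fin n → ℂ)}
  {X X' : (Fin n → ℂ) → (Fin (2 * n - 1) → ℂ)}
  (hn : 0 < n) (ha : ∀ j, a j ≠ 0) (hU : IsOpen U) (hr : IsRegular (spherical a) U)

include hn ha hU hr

theorem IsPeterson.isDeformation (hX : IsPeterson a z U X) (hz : ∀ k, z k ≠ 0) :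
    IsDeformation (spherical a) U X := by
  obtain ⟨φ, hφ, he⟩ := hX.exists_cone hn ha hz hU
  exact (hφ.isDeformation hU hr).congr hU he

theorem IsPeterson.ladder_eq (hX : IsPeterson a z U X) (hz : ∀ k, z k ≠ 0) {u : Fin n → ℂ}
    (hu : u ∈ U) {m : ℕ} (hm : m ≤ n) : ladder a (curvSq a X) m u = (a 0 * zSeq z m)⁻¹ := by
  obtain ⟨φ, hφ, he⟩ := hX.exists_cone hn ha hz hU
  rw [← hφ.ladder_eq hU hr hu hm]
  exact ladder_congr (fun j => by rw [curvSq, curvSq, secondForm_congr hU he hu]) m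

theorem IsPeterson.congruent_iff (hc : Convex ℝ U) (hne : U.Nonempty) (hX : IsPeterson a z U X)
    (hX' : IsPeterson a z' U X') (hz : ∀ k, z k ≠ 0) (hz' : ∀ k, z' k ≠ 0) :
    Congruent U X X' ↔ z = z' := by
  obtain ⟨u, hu⟩ := hne
  have hd := hX.isDeformation hn ha hU hr hz
  have hd' := hX'.isDeformation hn ha hU hr hz'
  constructor
  · intro h
    ext k
    have h1 := h.ladder_eq (a := a) hU hd.holo hu (k.val + 1)
    rw [hX.ladder_eq hn ha hU hr hz hu (by omega), hX'.ladder_eq hn ha hU hr hz' hu (by omega),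
      zSeq_succ, zSeq_succ, inv_inj] at h1
    exact (mul_left_cancel₀ (ha 0) h1).symm
  · rintro rfl
    exact congruent_of_ladder_eq ha hU hr hc hn hd hd' hu fun m _ hm => by
      rw [hX.ladder_eq hn ha hU hr hz hu hm.le, hX'.ladder_eq hn ha hU hr hz' hu hm.le]

end PetersonMain

/-! ### Injective holomorphic maps do not lower the dimension -/

section Dimension

/-- The map Φ that replaces the coordinate of index q by g has invertible derivative at w₀. Its
local inverse, restricted to the slice where that coordinate equals g(w₀), parametrizes the level
set. -/
theorem exists_level_section {m : ℕ} {W : Set (Fin (m + 1) → ℂ)} (hW : IsOpen W)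
    {g : (Fin (m + 1) → ℂ) → ℂ} (hg : ContDiffOn ℂ 1 g W) {w₀ : Fin (m + 1) → ℂ} (hw₀ : w₀ ∈ W)
    {q : Fin (m + 1)} (hq : pd q g w₀ ≠ 0) :
    ∃ (S : Set (Fin m → ℂ)) (ψ : (Fin m → ℂ) → (Fin (m + 1) → ℂ)), IsOpen S ∧ S.Nonempty ∧
      ContDiffOn ℂ 1 ψ S ∧ Set.MapsTo ψ S W ∧ Set.InjOn ψ S ∧ ∀ s ∈ S, g (ψ s) = g w₀ := by
  have hgat : ContDiffAt ℂ 1 g w₀ := hg.contDiffAt (hW.mem_nhds hw₀)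
  set Φ : (Fin (m + 1) → ℂ) → (Fin (m + 1) → ℂ) := fun w => w + (g w - w q) • Pi.single q 1 with hΦ
  have hΦat : ContDiffAt ℂ 1 Φ w₀ :=
    contDiffAt_id.add ((hgat.sub (contDiff_apply ℂ ℂ q).contDiffAt).smul contDiffAt_const)
  set L : (Fin (m + 1) → ℂ) →L[ℂ] (Fin (m + 1) → ℂ) := ContinuousLinearMap.id ℂ _
    + (fderiv ℂ g w₀ - ContinuousLinearMap.proj q).smulRight (Pi.single q 1) with hL
  have hder : HasFDerivAt Φ L w₀ :=
    (hasFDerivAt_id w₀).add (((hgat.differentiableAt one_ne_zero).hasFDerivAt.sub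
      (hasFDerivAt_apply q w₀)).smul_const _)
  have hLinj : Function.Injective L := by
    rw [injective_iff_map_eq_zero]
    intro v hv
    have hLv : L v = v + (fderiv ℂ g w₀ v - v q) • Pi.single q 1 := rfl
    rw [hLv] at hv
    have h1 : v = v q • Pi.single q 1 := by
      ext i
      by_cases hi : i = q
      · subst hi; simp
      · have := congrFun hv i
        simp only [Pi.add_apply, Pi.smul_apply, Pi.single_eq_of_ne hi, smul_zero, add_zero,
          Pi.zero_apply] at this
        simp [this, Pi.single_eq_of_ne hi]
    have h2 := congrFun hv q
    simp only [Pi.add_apply, Pi.smul_apply, Pi.single_eq_same, smul_eq_mul, mul_one,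
      Pi.zero_apply, add_sub_cancel] at h2
    rw [h1, map_smul, smul_eq_mul] at h2
    rw [h1, (mul_eq_zero.mp h2).resolve_right hq, zero_smul]
  set Le : (Fin (m + 1) → ℂ) ≃L[ℂ] (Fin (m + 1) → ℂ) :=
    (LinearEquiv.ofInjectiveEndo (L : (Fin (m + 1) → ℂ) →ₗ[ℂ] (Fin (m + 1) → ℂ))
      hLinj).toContinuousLinearEquiv with hLe
  have hLeL : (Le : (Fin (m + 1) → ℂ) →L[ℂ] (Fin (m + 1) → ℂ)) = L := by
    ext1 v; rfl
  rw [← hLeL] at hder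
  set e := hΦat.toOpenPartialHomeomorph Φ hder one_ne_zero with he
  have hecoe : ∀ w, e w = Φ w := fun w => rfl
  have hsymm : ContDiffAt ℂ 1 e.symm (Φ w₀) := hΦat.to_localInverse hder one_ne_zero
  set ι : (Fin m → ℂ) → (Fin (m + 1) → ℂ) := fun s => q.insertNth (g w₀) s with hι
  have hιc : ContDiff ℂ 1 ι := by
    rw [contDiff_pi]
    intro i
    refine Fin.succAboveCases q ?_ (fun l => ?_) i
    · simp only [hι, Fin.insertNth_apply_same]; exact contDiff_const
    · simp only [hι, Fin.insertNth_apply_succAbove]; exact contDiff_apply ℂ ℂ l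
  have hΦq : ∀ w, Φ w q = g w := fun w => by simp [hΦ]
  have hι0 : ι (fun i => w₀ (q.succAbove i)) = Φ w₀ := by
    ext i
    refine Fin.succAboveCases q ?_ (fun l => ?_) i
    · simp only [hι, Fin.insertNth_apply_same, hΦq]
    · simp [hι, hΦ]
  have hmem : Φ w₀ ∈ e.target := hΦat.image_mem_toOpenPartialHomeomorph_target hder one_ne_zero
  have hsrc : w₀ ∈ e.source := hΦat.mem_toOpenPartialHomeomorph_source hder one_ne_zero
  have hback : e.symm (Φ w₀) = w₀ := e.left_inv hsrc
  have hev : ∀ᶠ y in nhds (Φ w₀), y ∈ e.target ∧ ContDiffAt ℂ 1 e.symm y ∧ e.symm y ∈ W := by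
    refine (e.open_target.eventually_mem hmem).and ((hsymm.eventually (by simp)).and ?_)
    refine hsymm.continuousAt.eventually_mem ?_
    rw [hback]
    exact hW.mem_nhds hw₀
  rw [← hι0] at hev
  have hev' := hιc.continuous.continuousAt.eventually hev
  obtain ⟨S, hS, hSo, hs₀⟩ := eventually_nhds_iff.mp hev'
  have hgr : ∀ s ∈ S, Φ (e.symm (ι s)) = ι s := fun s hs => e.right_inv (hS s hs).1
  refine ⟨S, fun s => e.symm (ι s), hSo, ⟨_, hs₀⟩, fun s hs => ?_, fun s hs => (hS s hs).2.2,
    fun s hs s' hs' h => ?_, fun s hs => ?_⟩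
  · exact ((hS s hs).2.1.comp s hιc.contDiffAt).contDiffWithinAt
  · have h1 : ι s = ι s' := by rw [← hgr s hs, ← hgr s' hs']; exact congrArg Φ h
    ext i
    have := congrFun h1 (q.succAbove i)
    simpa [hι] using this
  · rw [← hΦq, hgr s hs]
    simp [hι]

/-- Induction on the target dimension. If the first component has zero derivative it is constant on
a ball and can be dropped; otherwise restriction to one of its level sets lowers both dimensions by
one. -/
theorem le_of_injOn {p : ℕ} : ∀ {m : ℕ} {W : Set (Fin m → ℂ)}, IsOpen W → W.Nonempty →
    ∀ {f : (Fin m → ℂ) → (Fin p → ℂ)}, ContDiffOn ℂ 1 f W → Set.InjOn f W → m ≤ p := by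
  induction p with
  | zero =>
    intro m W hW hne f _ hinj
    by_contra hm
    have hsub : W.Subsingleton := fun x hx y hy => hinj hx hy (Subsingleton.elim _ _)
    obtain ⟨w, hw⟩ := hne
    have : NeZero m := ⟨by omega⟩
    have : Nontrivial (Fin m → ℂ) := Pi.nontrivial
    exact not_isOpen_singleton w (hsub.eq_singleton_of_mem hw ▸ hW)
  | succ p ih =>
    intro m W hW hne f hf hinj
    have hg : ContDiffOn ℂ 1 (fun w => f w 0) W := contDiffOn_pi.mp hf 0
    by_cases hA : ∀ w ∈ W, ∀ q, pd q (fun w => f w 0) w = 0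
    · obtain ⟨w, hw⟩ := hne
      obtain ⟨ε, hε, hB⟩ := Metric.isOpen_iff.mp hW w hw
      have hconst : ∀ x ∈ Metric.ball w ε, ∀ y ∈ Metric.ball w ε, f x 0 = f y 0 :=
        fun x hx y hy => Metric.isOpen_ball.is_const_of_fderiv_eq_zero
          (convex_ball w ε).isPreconnected ((hg.mono hB).differentiableOn one_ne_zero)
          (fun v hv => fderiv_eq_zero_of_pd fun k => hA v (hB hv) k) hx hy
      refine Nat.le_succ_of_le (ih (f := fun w => Fin.tail (f w)) Metric.isOpen_ball
        ⟨w, Metric.mem_ball_self hε⟩ ?_ fun x hx y hy h => hinj (hB hx) (hB hy) ?_)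
      · exact contDiffOn_pi.mpr fun i => contDiffOn_pi.mp (hf.mono hB) i.succ
      · rw [← Fin.cons_self_tail (f x), ← Fin.cons_self_tail (f y), hconst x hx y hy]
        exact congrArg _ h
    · push Not at hA
      obtain ⟨w, hw, q, hq⟩ := hA
      obtain ⟨m, rfl⟩ : ∃ m', m = m' + 1 := ⟨m - 1, by have := q.isLt; omega⟩
      obtain ⟨S, ψ, hSo, hSn, hψ, hψW, hψi, hψg⟩ := exists_level_section hW hg hw hq
      refine Nat.succ_le_succ (ih (f := fun s => Fin.tail (f (ψ s))) hSo hSn ?_ fun x hx y hy h =>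
        hψi hx hy (hinj (hψW hx) (hψW hy) ?_))
      · have h1 := hf.comp hψ hψW
        exact contDiffOn_pi.mpr fun i => contDiffOn_pi.mp h1 i.succ
      · rw [← Fin.cons_self_tail (f (ψ x)), ← Fin.cons_self_tail (f (ψ y)), hψg x hx, hψg y hy]
        exact congrArg _ h

/-- The components of an injective holomorphic map between spaces of equal dimension avoid
given values somewhere. -/
theorem exists_apply_ne_of_injOn {m : ℕ} {W : Set (Fin m → ℂ)} (hW : IsOpen W) (hne : W.Nonempty)
    {f : (Fin m → ℂ) → (Fin m → ℂ)} (hf : ContDiffOn ℂ 1 f W) (hinj : Set.InjOn f W) (k : Fin m)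
    (c : ℂ) : ∃ w ∈ W, f w k ≠ c := by
  by_contra! h
  obtain ⟨m, rfl⟩ : ∃ m', m = m' + 1 := ⟨m - 1, by have := k.isLt; omega⟩
  have := le_of_injOn (p := m) hW hne (f := fun w i => f w (k.succAbove i))
    (contDiffOn_pi.mpr fun i => contDiffOn_pi.mp hf _) fun x hx y hy hxy => hinj hx hy (by
      ext i
      refine Fin.succAboveCases k ?_ (fun l => ?_) i
      · rw [h x hx, h y hy]
      · exact congrFun hxy l)
  omega

/-- A component constant on an open set would leave an injective map into one dimension less. Hence
each excluded set has dense complement, and finitely many dense open sets meet densely. -/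
theorem dense_apply_ne_of_injOn {m : ℕ} {W : Set (Fin m → ℂ)} (hW : IsOpen W)
    {f : (Fin m → ℂ) → (Fin m → ℂ)} (hf : ContDiffOn ℂ 1 f W) (hinj : Set.InjOn f W)
    {ι : Type} [Finite ι] (k : ι → Fin m) (c : ι → ℂ) :
    W ⊆ closure {w ∈ W | ∀ i, f w (k i) ≠ c i} := by
  -- Adjoining the exterior of W makes the set dense in the whole space, so that a Baire type
  -- intersection lemma applies.
  set S : ι → Set (Fin m → ℂ) := fun i => {w ∈ W | f w (k i) ≠ c i} ∪ (closure W)ᶜ with hS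
  have ho : ∀ i, IsOpen (S i) := fun i => by
    refine IsOpen.union ?_ isClosed_closure.isOpen_compl
    have h1 : ContinuousOn (fun w => f w (k i)) W := (contDiffOn_pi.mp hf (k i)).continuousOn
    exact h1.isOpen_inter_preimage hW isOpen_compl_singleton
  have hd : ∀ i, Dense (S i) := fun i => by
    rw [dense_iff_inter_open]
    intro O hO hne
    by_cases h : (O ∩ W).Nonempty
    · obtain ⟨w, hw, hwk⟩ := exists_apply_ne_of_injOn (hO.inter hW) h
        (hf.mono Set.inter_subset_right) (hinj.mono Set.inter_subset_right) (k i) (c i)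
      exact ⟨w, hw.1, Or.inl ⟨hw.2, hwk⟩⟩
    · obtain ⟨w, hw⟩ := hne
      refine ⟨w, hw, Or.inr fun hc => h ?_⟩
      exact mem_closure_iff.mp hc O hO hw
  have hD := dense_iInter_of_isOpen ho hd
  intro w hw
  rw [mem_closure_iff]
  intro O hO hwO
  obtain ⟨v, hv, hvS⟩ := dense_iff_inter_open.mp hD (O ∩ W) (hO.inter hW) ⟨w, hwO, hw⟩
  refine ⟨v, hv.1, hv.2, fun i => ?_⟩
  rcases Set.mem_iInter.mp hvS i with h | h
  · exact h.2
  · exact absurd (subset_closure hv.2) h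

end Dimension

/-! ### Families of deformations -/

section Family

variable {m n : ℕ} {E : Type} [NormedAddCommGroup E] [NormedSpace ℂ E]

theorem contDiffOn_pd_family {W : Set (Fin m → ℂ)} {U : Set (Fin n → ℂ)} (hW : IsOpen W)
    (hU : IsOpen U) {Y : (Fin m → ℂ) → (Fin n → ℂ) → E}
    (hY : ContDiffOn ℂ ∞ (fun q : (Fin m → ℂ) × (Fin n → ℂ) => Y q.1 q.2) (W ×ˢ U)) (j : Fin n) :
    ContDiffOn ℂ ∞ (fun q : (Fin m → ℂ) × (Fin n → ℂ) => pd j (Y q.1) q.2) (W ×ˢ U) := by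
  have h1 := contDiffOn_fderiv_of_isOpen hY (hW.prod hU)
  refine (h1.clm_apply (contDiffOn_const (c := ((0 : Fin m → ℂ), Pi.single j 1)))).congr ?_
  rintro ⟨w, u⟩ hq
  have h2 : HasFDerivAt (Y w) _ u :=
    (hY.differentiableAt_of_isOpen (hW.prod hU) hq).hasFDerivAt.comp u
      (hasFDerivAt_prodMk_right w u)
  rw [pd, h2.fderiv]
  rfl

variable {a : Fin (n + 1) → ℂ} {U : Set (Fin n → ℂ)} {W : Set (Fin m → ℂ)}
  {Y : (Fin m → ℂ) → (Fin n → ℂ) → (Fin (2 * n - 1) → ℂ)}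
  (ha : ∀ j, a j ≠ 0) (hU : IsOpen U) (hr : IsRegular (spherical a) U) (hc : Convex ℝ U)
  (hY : IsFamily (spherical a) U W Y) {u : Fin n → ℂ} (hu : u ∈ U)
include ha hU hr hc hY hu

theorem IsFamily.contDiffOn_ladder (k : ℕ) :
    ContDiffOn ℂ ∞ (fun w => ladder a (curvSq a (Y w)) k u) W := by
  have hJ : ∀ j, ContDiffOn ℂ ∞ (fun w => curvSq a (Y w) j u) W := fun j => by
    have h1 := contDiffOn_pd_family (Y := fun w => pd j (Y w)) hY.isOpen hU
      (contDiffOn_pd_family hY.isOpen hU hY.holo j) j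
    have h2 : ContDiffOn ℂ ∞ (fun w => pd j (pd j (Y w)) u) W :=
      h1.comp (contDiff_prodMk_left u).contDiffOn fun w hw => ⟨hw, hu⟩
    refine ((h2.dotProduct h2).sub (contDiffOn_const (c :=
      pd j (pd j (spherical a)) u ⬝ᵥ pd j (pd j (spherical a)) u))).congr fun w hw => ?_
    exact curvSq_eq_pd_pd hU hr (hY.deformation w hw).holo
      (fun v hv => (hY.deformation w hw).isometric v hv) hu j
  induction k with
  | zero => exact contDiffOn_const
  | succ k ih =>
    by_cases hk : k < n
    · have e : (fun w => ladder a (curvSq a (Y w)) (k + 1) u) = fun w =>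
          bigC (k + 1) u ^ 2 / curvSq a (Y w) ⟨k, hk⟩ u
            + Complex.sin (u ⟨k, hk⟩) ^ 2 / a (Fin.succ ⟨k, hk⟩)
            + Complex.cos (u ⟨k, hk⟩) ^ 2 * ladder a (curvSq a (Y w)) k u := by
        ext w; exact ladder_succ a _ ⟨k, hk⟩ u
      rw [e]
      exact ((contDiffOn_const.div (hJ _) fun w hw =>
        curvSq_ne_zero ha hU hr hc (hY.deformation w hw) hu _).add contDiffOn_const).add
        (contDiffOn_const.mul ih)
    · have e : (fun w => ladder a (curvSq a (Y w)) (k + 1) u)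
          = fun w => ladder a (curvSq a (Y w)) k u := by
        ext w; exact dif_neg hk
      rw [e]; exact ih

/-- Completeness of the invariants: equal W_1, …, W_{n-1} mean congruent deformations, hence equal
parameters. -/
theorem IsEssential.injOn_ladder (hn : 0 < n) (hess : IsEssential U W Y) :
    Set.InjOn (fun w (k : Fin (n - 1)) => ladder a (curvSq a (Y w)) (k.val + 1) u) W := by
  intro w hw w' hw' h
  refine hess w hw w' hw' (congruent_of_ladder_eq ha hU hr hc hn (hY.deformation w hw)
    (hY.deformation w' hw') hu fun k h0 hk => ?_)
  have h1 := congrFun h ⟨k - 1, by omega⟩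
  simp only [Nat.sub_add_cancel h0] at h1
  exact h1

/-- A family of deformations has at most `n - 1` essential parameters. -/
theorem IsEssential.parameters_le (hn : 0 < n) (hess : IsEssential U W Y) (hne : W.Nonempty) :
    m ≤ n - 1 :=
  le_of_injOn hY.isOpen hne
    (contDiffOn_pi.mpr fun k => (hY.contDiffOn_ladder ha hU hr hc hu (k.val + 1)).of_le (by simp))
    (hess.injOn_ladder ha hU hr hc hY hu hn)

end Family

/-! ### Existence and maximality of Peterson's family -/

/-- The several variable root, transported along the identification of ℂ with `Fin 1 → ℂ`. -/
theorem exists_sqrt_on_ball {c : ℂ} {ε : ℝ} {F : ℂ → ℂ} (hF : DifferentiableOn ℂ F (Metric.ball c ε))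
    (h0 : ∀ t ∈ Metric.ball c ε, F t ≠ 0) :
    ∃ f : ℂ → ℂ, DifferentiableOn ℂ f (Metric.ball c ε) ∧ ∀ t ∈ Metric.ball c ε, f t ^ 2 = F t := by
  set U : Set (Fin 1 → ℂ) := (fun w => w 0) ⁻¹' Metric.ball c ε with hU
  have hUo : IsOpen U := Metric.isOpen_ball.preimage (continuous_apply 0)
  have hUc : Convex ℝ U :=
    (convex_ball c ε).linear_preimage (LinearMap.proj (R := ℝ) (φ := fun _ : Fin 1 => ℂ) 0)
  obtain ⟨r, hr, hr2⟩ := exists_sqrt hUo hUc (f := fun w => F (w 0))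
    ((hF.contDiffOn Metric.isOpen_ball).comp (contDiff_apply ℂ ℂ 0).contDiffOn fun w hw => hw)
    fun w hw => h0 _ hw
  have hd : Differentiable ℂ fun t : ℂ => (fun _ => t : Fin 1 → ℂ) :=
    differentiable_pi.mpr fun _ => differentiable_id
  exact ⟨fun t => r fun _ => t, (hr.differentiableOn (by simp)).comp hd.differentiableOn
    fun t ht => ht, fun t ht => hr2 _ ht⟩

/-- The conditions under which `𝒳_𝐳` exists near `u`. -/
structure IsAdmissible {n : ℕ} (a : Fin (n + 1) → ℂ) (z : Fin (n - 1) → ℂ) (u : Fin n → ℂ) :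
    Prop where
  ne_zero : ∀ k, z k ≠ 0
  radF_ne : ∀ i : Fin (n - 1), radF a z i (u ⟨i.val, by omega⟩) ≠ 0
  radG_ne : ∀ i : Fin (n - 1), radG a z i (u ⟨i.val, by omega⟩) ≠ 0
  radH_ne : ∀ i : Fin n, i.val + 1 = n → radH a z (u i) ≠ 0

section Admissible

variable {n : ℕ} {a : Fin (n + 1) → ℂ}

theorem continuous_zExt {m : ℕ} (j : Fin (m + 1)) : Continuous fun z : Fin m → ℂ => zExt z j := by
  refine Fin.cases ?_ (fun k => ?_) j
  · simp only [zExt, Fin.cons_zero]; exact continuous_const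
  · simp only [zExt, Fin.cons_succ]; exact continuous_apply k

/-- Openness jointly in parameter and point gives one neighbourhood of u that serves all nearby
parameters. -/
theorem isOpen_isAdmissible :
    IsOpen {q : (Fin (n - 1) → ℂ) × (Fin n → ℂ) | IsAdmissible a q.1 q.2} := by
  have e : {q : (Fin (n - 1) → ℂ) × (Fin n → ℂ) | IsAdmissible a q.1 q.2}
      = (⋂ k, {q | q.1 k ≠ 0}) ∩ ((⋂ i : Fin (n - 1), {q | radF a q.1 i (q.2 ⟨i.val, by omega⟩) ≠ 0})
        ∩ ((⋂ i : Fin (n - 1), {q | radG a q.1 i (q.2 ⟨i.val, by omega⟩) ≠ 0})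
        ∩ ⋂ i : Fin n, ⋂ _ : i.val + 1 = n, {q | radH a q.1 (q.2 i) ≠ 0})) := by
    ext q
    simp only [Set.mem_ofPred_eq, Set.mem_inter_iff, Set.mem_iInter]
    exact ⟨fun h => ⟨h.1, h.2, h.3, h.4⟩, fun h => ⟨h.1, h.2.1, h.2.2.1, h.2.2.2⟩⟩
  have hz : ∀ j : Fin (n - 1 + 1),
      Continuous fun q : (Fin (n - 1) → ℂ) × (Fin n → ℂ) => zExt q.1 j :=
    fun j => (continuous_zExt j).comp continuous_fst
  have hs : ∀ j : Fin n, Continuous fun q : (Fin (n - 1) → ℂ) × (Fin n → ℂ) => Complex.sin (q.2 j) :=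
    fun j => Complex.continuous_sin.comp ((continuous_apply j).comp continuous_snd)
  rw [e]
  refine (isOpen_iInter_of_finite fun k => ?_).inter ((isOpen_iInter_of_finite fun i => ?_).inter
    ((isOpen_iInter_of_finite fun i => ?_).inter (isOpen_iInter_of_finite fun i =>
      isOpen_iInter_of_finite fun _ => ?_)))
  · exact isOpen_ne_fun ((continuous_apply k).comp continuous_fst) continuous_const
  · refine isOpen_ne_fun ?_ continuous_const
    have h1 := hz i.castSucc
    have h2 := hz i.succ
    have h3 := hs ⟨i.val, by omega⟩
    unfold radF
    fun_prop
  · refine isOpen_ne_fun ?_ continuous_const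
    have h1 := hz i.castSucc
    have h2 := hz i.succ
    have h3 := hs ⟨i.val, by omega⟩
    unfold radG
    fun_prop
  · refine isOpen_ne_fun ?_ continuous_const
    have h1 := hz (Fin.last (n - 1))
    have h3 := hs i
    unfold radH
    fun_prop

/-- The coordinates of points of V range over discs on which the radicands have no zeros; there
roots exist, and holomorphic functions have primitives. -/
theorem exists_isPeterson_of_ball (hn : 0 < n) {z : Fin (n - 1) → ℂ} {u : Fin n → ℂ} {ε : ℝ}
    {V : Set (Fin n → ℂ)}
    (himg : ∀ i : Fin n, ∀ t ∈ (fun v : Fin n → ℂ => v i) '' V, t ∈ Metric.ball (u i) ε)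
    (hF0 : ∀ i : Fin (n - 1), ∀ t ∈ Metric.ball (u ⟨i.val, by omega⟩) ε, radF a z i t ≠ 0)
    (hG0 : ∀ i : Fin (n - 1), ∀ t ∈ Metric.ball (u ⟨i.val, by omega⟩) ε, radG a z i t ≠ 0)
    (hH0 : ∀ t ∈ Metric.ball (u ⟨n - 1, by omega⟩) ε, radH a z t ≠ 0) :
    ∃ X, IsPeterson a z V X := by
  have hFd : ∀ i, Differentiable ℂ (radF a z i) := fun i => by unfold radF; fun_prop
  have hGd : ∀ i, Differentiable ℂ (radG a z i) := fun i => by unfold radG; fun_prop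
  have hHd : Differentiable ℂ (radH a z) := by unfold radH; fun_prop
  choose f hf hf2 using fun i => exists_sqrt_on_ball (hFd i).differentiableOn (hF0 i)
  choose s hs hs2 using fun i => exists_sqrt_on_ball (hGd i).differentiableOn (hG0 i)
  obtain ⟨r, hr, hr2⟩ := exists_sqrt_on_ball hHd.differentiableOn hH0
  choose g hg using fun i => ((hs i).fun_div (hFd i).differentiableOn (hF0 i)).isExactOn_ball
  obtain ⟨k, hk⟩ := hr.isExactOn_ball
  refine ⟨petersonMap f g k, f, g, k, fun i t ht => ?_, fun i hi t ht => ?_, fun _ _ => rfl⟩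
  · have ht := himg ⟨i.val, by omega⟩ t ht
    have hs0 : s i t ≠ 0 := fun h0 => hG0 i t ht (by rw [← hs2 i t ht, h0]; ring)
    refine ⟨(hf i).differentiableAt (Metric.isOpen_ball.mem_nhds ht), (hg i t ht).differentiableAt,
      fun h0 => hF0 i t ht (by rw [← hf2 i t ht, h0]; ring), hf2 i t ht, ?_, ?_⟩
    · rw [(hg i t ht).deriv]
      exact div_ne_zero hs0 (hF0 i t ht)
    · rw [(hg i t ht).deriv, div_mul_cancel₀ _ (hF0 i t ht), hs2 i t ht]
  · have ht := himg i t ht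
    rw [show i = ⟨n - 1, Nat.sub_lt hn Nat.one_pos⟩ from Fin.ext (by simp; omega)] at ht
    refine ⟨(hk t ht).differentiableAt, ?_, ?_⟩
    · rw [(hk t ht).deriv]
      exact fun h0 => hH0 t ht (by rw [← hr2 t ht, h0]; ring)
    · rw [(hk t ht).deriv, hr2 t ht]

theorem IsAdmissible.exists_ball {z : Fin (n - 1) → ℂ} {u : Fin n → ℂ} (h : IsAdmissible a z u)
    {U : Set (Fin n → ℂ)} (hU : IsOpen U) (hu : u ∈ U) : ∃ ε > 0, Metric.ball u ε ⊆ U ∧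
      ∀ z' ∈ Metric.ball z ε, ∀ v ∈ Metric.ball u ε, IsAdmissible a z' v := by
  obtain ⟨δ, hδ, hδU⟩ := Metric.isOpen_iff.mp hU u hu
  obtain ⟨ε, hε, hB⟩ := Metric.isOpen_iff.mp isOpen_isAdmissible (z, u) h
  refine ⟨min δ ε, lt_min hδ hε, (Metric.ball_subset_ball (min_le_left _ _)).trans hδU,
    fun z' hz' v hv => ?_⟩
  have h1 : (z', v) ∈ Metric.ball (z, u) ε := by
    rw [← ball_prod_same]
    exact ⟨Metric.ball_subset_ball (min_le_right _ _) hz',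
      Metric.ball_subset_ball (min_le_right _ _) hv⟩
  exact hB h1

theorem mem_ball_of_mem_image {u : Fin n → ℂ} {ε : ℝ} (i : Fin n) (t : ℂ)
    (ht : t ∈ (fun v : Fin n → ℂ => v i) '' Metric.ball u ε) : t ∈ Metric.ball (u i) ε := by
  obtain ⟨v, hv, rfl⟩ := ht
  exact lt_of_le_of_lt (dist_le_pi_dist v u i) hv

theorem update_mem_ball {u : Fin n → ℂ} {ε : ℝ} (hε : 0 < ε) {i : Fin n} {t : ℂ}
    (ht : t ∈ Metric.ball (u i) ε) : Function.update u i t ∈ Metric.ball u ε := by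
  rw [Metric.mem_ball, dist_pi_lt_iff hε]
  intro l
  by_cases hl : l = i
  · subst hl; rw [Function.update_self]; exact ht
  · rw [Function.update_of_ne hl, dist_self]; exact hε

/-- Peterson's deformations exist near the admissible points, for all nearby parameters. -/
theorem IsAdmissible.exists_isPeterson (hn : 0 < n) {z : Fin (n - 1) → ℂ} {u : Fin n → ℂ}
    (h : IsAdmissible a z u) {U : Set (Fin n → ℂ)} (hU : IsOpen U) (hu : u ∈ U) :
    ∃ V, IsOpen V ∧ Convex ℝ V ∧ u ∈ V ∧ V ⊆ U ∧
      ∀ᶠ z' in nhds z, (∀ k, z' k ≠ 0) ∧ ∃ X, IsPeterson a z' V X := by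
  obtain ⟨ε, hε, hB, hadm⟩ := h.exists_ball hU hu
  refine ⟨Metric.ball u ε, Metric.isOpen_ball, convex_ball u ε, Metric.mem_ball_self hε, hB,
    Filter.mem_of_superset (Metric.ball_mem_nhds z hε) fun z' hz' =>
      ⟨(hadm z' hz' u (Metric.mem_ball_self hε)).ne_zero,
        exists_isPeterson_of_ball hn mem_ball_of_mem_image (fun i t ht => ?_) (fun i t ht => ?_)
          fun t ht => ?_⟩⟩
  · have := (hadm z' hz' _ (update_mem_ball hε ht)).radF_ne i
    rwa [Function.update_self] at this
  · have := (hadm z' hz' _ (update_mem_ball hε ht)).radG_ne i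
    rwa [Function.update_self] at this
  · have := (hadm z' hz' _ (update_mem_ball hε ht)).radH_ne ⟨n - 1, by omega⟩
      (Nat.sub_add_cancel hn)
    rwa [Function.update_self] at this

/-- A nonzero affine function of one coordinate has at most one zero. All admissibility conditions
are affine in a suitable single z_k, so this gives their density. -/
theorem exists_update_affine_ne_zero {m : ℕ} {O : Set (Fin m → ℂ)} (hO : IsOpen O) {z : Fin m → ℂ}
    (hz : z ∈ O) (k : Fin m) {α β : ℂ} (h : α ≠ 0 ∨ β ≠ 0) :
    ∃ t, Function.update z k t ∈ O ∧ α + β * t ≠ 0 := by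
  by_contra! hcon
  set T : Set ℂ := (fun t => Function.update z k t) ⁻¹' O with hT
  have hTo : IsOpen T := hO.preimage (continuous_const.update k continuous_id)
  have hzT : z k ∈ T := by simpa [hT] using hz
  have hβ : β ≠ 0 := fun hβ => by
    have h1 := hcon _ hzT
    rw [hβ, zero_mul, add_zero] at h1
    exact h.elim (fun h => h h1) (fun h => h hβ)
  have hsub : T.Subsingleton := fun x hx y hy =>
    mul_left_cancel₀ hβ (by linear_combination hcon x hx - hcon y hy)
  exact not_isOpen_singleton (z k) (hsub.eq_singleton_of_mem hzT ▸ hTo)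

theorem zSeq_update_self (z : Fin (n - 1) → ℂ) (k : Fin (n - 1)) (t : ℂ) :
    zSeq (Function.update z k t) (k.val + 1) = t := by
  rw [zSeq_succ, Function.update_self]

theorem zSeq_update_of_ne (z : Fin (n - 1) → ℂ) (k : Fin (n - 1)) (t : ℂ) {m : ℕ}
    (hm : m ≠ k.val + 1) : zSeq (Function.update z k t) m = zSeq z m := by
  cases m with
  | zero => rw [zSeq_zero, zSeq_zero]
  | succ m =>
    by_cases h : m < n - 1
    · have e := zSeq_succ (Function.update z k t) ⟨m, h⟩
      have e' := zSeq_succ z ⟨m, h⟩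
      simp only at e e'
      rw [e, e', Function.update_of_ne fun h' => hm (by rw [← h'])]
    · rw [zSeq, zSeq, dif_neg (by omega), dif_neg (by omega)]

theorem dense_ne_zero (m : ℕ) : Dense {z : Fin m → ℂ | ∀ k, z k ≠ 0} := by
  have e : {z : Fin m → ℂ | ∀ k, z k ≠ 0} = ⋂ k, {z | z k ≠ 0} := by ext; simp
  rw [e]
  refine dense_iInter_of_isOpen (fun k => isOpen_ne_fun (continuous_apply k) continuous_const)
    fun k => ?_
  rw [dense_iff_inter_open]
  rintro O hO ⟨z, hz⟩
  obtain ⟨t, ht, h0⟩ := exists_update_affine_ne_zero hO hz k (α := 0) (β := 1) (Or.inr one_ne_zero)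
  exact ⟨_, ht, by simpa using h0⟩

theorem isOpen_ne_zero (m : ℕ) : IsOpen {z : Fin m → ℂ | ∀ k, z k ≠ 0} := by
  simp only [Set.ofPred_forall]
  exact isOpen_iInter_of_finite fun k => isOpen_ne_fun (continuous_apply k) continuous_const

/-- The admissible parameters are dense. -/
theorem dense_isAdmissible (hn : 2 ≤ n) (ha : ∀ j, a j ≠ 0) (u : Fin n → ℂ) :
    Dense {z | IsAdmissible a z u} := by
  have hzc := fun j => continuous_zExt (m := n - 1) j
  have hF : Dense (⋂ i : Fin (n - 1), {z | radF a z i (u ⟨i.val, by omega⟩) ≠ 0}) := by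
    refine dense_iInter_of_isOpen (fun i => ?_) fun i => ?_
    · refine isOpen_ne_fun ?_ continuous_const
      have h1 := hzc i.castSucc
      have h2 := hzc i.succ
      unfold radF
      fun_prop
    · rw [dense_iff_inter_open]
      rintro O hO ⟨z, hz⟩
      obtain ⟨t, ht, h0⟩ := exists_update_affine_ne_zero hO hz i
        (α := zSeq z i.val * a 0 + (a (Fin.succ ⟨i.val, by omega⟩) - zSeq z i.val * a 0)
          * Complex.sin (u ⟨i.val, by omega⟩) ^ 2) (β := -a 0) (Or.inr (neg_ne_zero.mpr (ha 0)))
      refine ⟨_, ht, ?_⟩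
      rw [Set.mem_ofPred_eq, radF_eq a _ ⟨i.val, by omega⟩ i.isLt, zSeq_update_self,
        zSeq_update_of_ne _ _ _ (by simp)]
      convert h0 using 1
      ring
  have hG : Dense (⋂ i : Fin (n - 1), {z | radG a z i (u ⟨i.val, by omega⟩) ≠ 0}) := by
    refine dense_iInter_of_isOpen (fun i => ?_) fun i => ?_
    · refine isOpen_ne_fun ?_ continuous_const
      have h1 := hzc i.castSucc
      have h2 := hzc i.succ
      unfold radG
      fun_prop
    · rw [dense_iff_inter_open]
      intro O hO hne
      obtain ⟨z, hz, hz0⟩ := dense_iff_inter_open.mp (dense_ne_zero (n - 1)) O hO hne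
      obtain ⟨t, ht, h0⟩ := exists_update_affine_ne_zero hO hz i
        (α := zSeq z i.val * a 0 * a (Fin.succ ⟨i.val, by omega⟩))
        (β := -(a 0 * a (Fin.succ ⟨i.val, by omega⟩))
          + (a (Fin.succ ⟨i.val, by omega⟩) - zSeq z i.val * a 0) * a 0
          * Complex.sin (u ⟨i.val, by omega⟩) ^ 2)
        -- The constant coefficient contains the preceding member of the sequence 1, z_1, …, which
        -- is why the point was first moved off the coordinate hyperplanes.
        (Or.inl (mul_ne_zero (mul_ne_zero (zSeq_ne_zero hz0 (by omega)) (ha 0)) (ha _)))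
      refine ⟨_, ht, ?_⟩
      rw [Set.mem_ofPred_eq, radG_eq a _ ⟨i.val, by omega⟩ i.isLt, zSeq_update_self,
        zSeq_update_of_ne _ _ _ (by simp)]
      convert h0 using 1
      ring
  have hH : Dense {z : Fin (n - 1) → ℂ | radH a z (u ⟨n - 1, by omega⟩) ≠ 0} := by
    rw [dense_iff_inter_open]
    rintro O hO ⟨z, hz⟩
    have hi : n - 1 + 1 = n := by omega
    have hi' : n - 1 = n - 2 + 1 := by omega
    have hor : ∀ A S : ℂ, A ≠ 0 → A - A * S ≠ 0 ∨ a 0 * S ≠ 0 := fun A S hA => by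
      by_contra! h
      have hS := (mul_eq_zero.mp h.2).resolve_left (ha 0)
      exact hA (by simpa [hS] using h.1)
    -- The condition is affine in z_{n-1}, whose index is n - 2; for n ≥ 2 it is a true parameter
    -- and not z_0 = 1. Its coefficients A(1 - sin²) and a_0 sin² cannot both vanish.
    obtain ⟨t, ht, h0⟩ := exists_update_affine_ne_zero hO hz ⟨n - 2, by omega⟩
      (hor (a (Fin.succ ⟨n - 1, by omega⟩)) (Complex.sin (u ⟨n - 1, by omega⟩) ^ 2) (ha _))
    refine ⟨_, ht, ?_⟩
    have e := zSeq_update_self z ⟨n - 2, by omega⟩ t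
    simp only [← hi'] at e
    rw [Set.mem_ofPred_eq, radH_eq a _ ⟨n - 1, by omega⟩ hi]
    simp only [e]
    convert h0 using 1
    ring
  have hHo : IsOpen {z : Fin (n - 1) → ℂ | radH a z (u ⟨n - 1, by omega⟩) ≠ 0} := by
    refine isOpen_ne_fun ?_ continuous_const
    have h1 := hzc (Fin.last (n - 1))
    unfold radH
    fun_prop
  have hGo : IsOpen (⋂ i : Fin (n - 1), {z | radG a z i (u ⟨i.val, by omega⟩) ≠ 0}) := by
    refine isOpen_iInter_of_finite fun i => isOpen_ne_fun ?_ continuous_const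
    have h1 := hzc i.castSucc
    have h2 := hzc i.succ
    unfold radG
    fun_prop
  refine (((hF.inter_of_isOpen_right hG hGo).inter_of_isOpen_right hH hHo).inter_of_isOpen_right
    (dense_ne_zero _) (isOpen_ne_zero _)).mono ?_
  rintro z ⟨⟨⟨h1, h2⟩, h3⟩, h4⟩
  refine ⟨h4, Set.mem_iInter.mp h1, Set.mem_iInter.mp h2, fun i hi => ?_⟩
  have hi' : i = ⟨n - 1, Nat.sub_lt (by omega) Nat.one_pos⟩ := Fin.ext (by simp; omega)
  rw [hi']
  exact h3

/-- If the function vanished on a disc, two derivatives would give sin c cos c = 0 and 1 - 2 sin² c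
= 0 at the centre, which is impossible. -/
theorem exists_add_mul_sin_sq_ne_zero {b d c : ℂ} (hd : d ≠ 0) {ε : ℝ} (hε : 0 < ε) :
    ∃ t ∈ Metric.ball c ε, b + d * Complex.sin t ^ 2 ≠ 0 := by
  by_contra! h
  have key : ∀ {F F' : ℂ → ℂ}, (∀ t ∈ Metric.ball c ε, F t = 0) → (∀ t, HasDerivAt F (F' t) t) →
      ∀ t ∈ Metric.ball c ε, F' t = 0 := fun hF hF' t ht =>
    (hF' t).unique ((hasDerivAt_const t (0 : ℂ)).congr_of_eventuallyEq
      (Filter.mem_of_superset (Metric.isOpen_ball.mem_nhds ht) hF))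
  have h1 := key h (hasDerivAt_add_mul_sin_sq b d)
  have h1' : ∀ t ∈ Metric.ball c ε, d * (Complex.sin t * Complex.cos t) = 0 := fun t ht =>
    (mul_eq_zero.mp (h1 t ht)).resolve_left two_ne_zero
  have hc := Metric.mem_ball_self (x := c) hε
  have h2 := (mul_eq_zero.mp (key h1' (hasDerivAt_mul_sin_mul_cos d) c hc)).resolve_left hd
  have h3 := (mul_eq_zero.mp (h1' c hc)).resolve_left hd
  have h4 : (Complex.sin c * Complex.cos c) ^ 2 = Complex.sin c ^ 2 * (1 - Complex.sin c ^ 2) := by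
    rw [mul_pow, Complex.cos_sq']
  rw [h3] at h4
  have h5 : (1 : ℂ) = 0 := by
    linear_combination -4 * h4 + (1 - 2 * Complex.sin c ^ 2) * h2
  exact one_ne_zero h5

variable {U : Set (Fin n → ℂ)} {x : (Fin n → ℂ) → (Fin (2 * n - 1) → ℂ)}

theorem inv_mul_zSeq_eq_ladder (hn : 0 < n) (ha : a 0 ≠ 0) {J : Fin n → (Fin n → ℂ) → ℂ}
    {u : Fin n → ℂ} (hlast : ladder a J n u = 0) {z : Fin (n - 1) → ℂ}
    (hz : ∀ k : Fin (n - 1), z k = (a 0 * ladder a J (k.val + 1) u)⁻¹) {m : ℕ} (hm : m ≤ n) :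
    (a 0 * zSeq z m)⁻¹ = ladder a J m u := by
  rcases hm.lt_or_eq with h | h
  · cases m with
    | zero => rw [zSeq_zero, ladder_zero, mul_one]
    | succ m =>
      have e := zSeq_succ z ⟨m, by omega⟩
      simp only at e
      rw [e, hz, mul_inv, inv_inv, inv_mul_cancel_left₀ ha]
  · rw [h, zSeq_self hn, mul_zero, inv_zero, hlast]

theorem isPetersonUpToMotion_of_ladder (hn : 0 < n) (ha : ∀ j, a j ≠ 0) (hU : IsOpen U)
    (hr : IsRegular (spherical a) U) (hc : Convex ℝ U) (hx : IsDeformation (spherical a) U x)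
    {z : Fin (n - 1) → ℂ} (hz : ∀ k, z k ≠ 0) {X : (Fin n → ℂ) → (Fin (2 * n - 1) → ℂ)}
    (hX : IsPeterson a z U X) {u : Fin n → ℂ} (hu : u ∈ U)
    (h : ∀ m, m ≤ n → (a 0 * zSeq z m)⁻¹ = ladder a (curvSq a x) m u) :
    IsPetersonUpToMotion a U x :=
  ⟨z, hz, X, hX, congruent_of_ladder_eq ha hU hr hc hn hx (hX.isDeformation hn ha hU hr hz) hu
    fun m _ hm => by rw [hX.ladder_eq hn ha hU hr hz hu hm.le, h m hm.le]⟩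

/-- A deformation whose constants `W_m` are in general position is locally one of Peterson's. -/
theorem exists_isPetersonUpToMotion (hn : 0 < n) (ha : ∀ j, a j ≠ 0) (hinj : Function.Injective a)
    (hU : IsOpen U) (hr : IsRegular (spherical a) U) (hc : Convex ℝ U)
    (hx : IsDeformation (spherical a) U x) {u₀ : Fin n → ℂ} (hu₀ : u₀ ∈ U)
    (h0 : ∀ k : Fin (n - 1), ladder a (curvSq a x) (k.val + 1) u₀ ≠ 0)
    (h1 : ∀ k : Fin (n - 1), ladder a (curvSq a x) (k.val + 1) u₀
      ≠ (a (Fin.succ ⟨k.val + 1, by omega⟩))⁻¹) :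
    ∃ V, IsOpen V ∧ Convex ℝ V ∧ V.Nonempty ∧ V ⊆ U ∧ IsPetersonUpToMotion a V x := by
  -- The only possible parameters, since a Peterson deformation has W_m = 1 / (a_0 z_m).
  set z : Fin (n - 1) → ℂ := fun k => (a 0 * ladder a (curvSq a x) (k.val + 1) u₀)⁻¹ with hzdef
  have hz : ∀ k, z k ≠ 0 := fun k => inv_ne_zero (mul_ne_zero (ha 0) (h0 k))
  have hW : ∀ u ∈ U, ∀ m, m ≤ n → (a 0 * zSeq z m)⁻¹ = ladder a (curvSq a x) m u :=
    fun u hu m hm => by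
      rw [inv_mul_zSeq_eq_ladder hn (ha 0) (ladder_self_eq_zero ha hU hr hc hn hx hu₀)
        (fun k => rfl) hm, ladder_eq ha hU hr hc hn hx hm hu hu₀]
  -- The coefficient of sin² in F vanishes exactly when W_i = 1 / a_{i+1}. For i = 0 this is
  -- excluded by a_0 ≠ a_1, for larger i by `h1`. Hence F is not identically zero and the base point
  -- can be moved off its zeros.
  have hd : ∀ i : Fin n, i.val < n - 1 → a i.succ - zSeq z i.val * a 0 ≠ 0 := by
    intro i hi hzero
    have e : a i.succ = a 0 * zSeq z i.val := by linear_combination hzero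
    have e2 := hW u₀ hu₀ i.val i.isLt.le
    rw [← e] at e2
    obtain ⟨i, hin⟩ := i
    cases i with
    | zero =>
      simp only at e2
      rw [ladder_zero, inv_inj] at e2
      exact Fin.succ_ne_zero _ (hinj e2)
    | succ k => exact h1 ⟨k, by simp at hi; omega⟩ e2.symm
  obtain ⟨ε, hε, hB⟩ := Metric.isOpen_iff.mp hU u₀ hu₀
  have hpick : ∀ i : Fin n, ∃ t ∈ Metric.ball (u₀ i) ε, i.val < n - 1 →
      (zSeq z i.val - zSeq z (i.val + 1)) * a 0
        + (a i.succ - zSeq z i.val * a 0) * Complex.sin t ^ 2 ≠ 0 := fun i => by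
    by_cases hi : i.val < n - 1
    · obtain ⟨t, ht, h⟩ := exists_add_mul_sin_sq_ne_zero (c := u₀ i)
        (b := (zSeq z i.val - zSeq z (i.val + 1)) * a 0) (hd i hi) hε
      exact ⟨t, ht, fun _ => h⟩
    · exact ⟨u₀ i, Metric.mem_ball_self hε, fun h => absurd h hi⟩
  choose u hub huF using hpick
  have hu : u ∈ U := hB (by rw [Metric.mem_ball, dist_pi_lt_iff hε]; exact hub)
  -- By the recursion this expression is 𝐂_{i+1}² / J_i, which never vanishes. Up to nonzero factors
  -- it is the radicand for g' or, at the last index, for h', so these need no further condition.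
  have hne : ∀ i : Fin n, (a 0 * zSeq z (i.val + 1))⁻¹ - Complex.sin (u i) ^ 2 / a i.succ
      - Complex.cos (u i) ^ 2 * (a 0 * zSeq z i.val)⁻¹ ≠ 0 := fun i => by
    rw [hW u hu _ i.isLt, hW u hu _ i.isLt.le, ladder_succ]
    have := div_ne_zero (pow_ne_zero 2 (bigC_succ_ne_zero hr hu i.val))
      (curvSq_ne_zero ha hU hr hc hx hu i)
    intro h
    exact this (by linear_combination h)
  have hadm : IsAdmissible a z u := by
    refine ⟨hz, fun i => ?_, fun i => ?_, fun i hi => ?_⟩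
    · rw [radF_eq a z ⟨i.val, by omega⟩ i.isLt]
      exact huF ⟨i.val, by omega⟩ i.isLt
    · rw [radG_eq a z ⟨i.val, by omega⟩ i.isLt]
      intro h
      refine hne ⟨i.val, by omega⟩ ?_
      have z1 := zSeq_ne_zero hz (m := i.val) (by omega)
      have z2 := zSeq_ne_zero hz (m := i.val + 1) (by omega)
      have a0 := ha 0
      have a1 := ha (Fin.succ ⟨i.val, by omega⟩)
      rw [Complex.cos_sq']
      field_simp
      refine mul_left_cancel₀ a0 ?_
      linear_combination h
    · rw [radH_eq a z i hi]
      intro h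
      refine hne i ?_
      have z1 := zSeq_ne_zero hz i.isLt
      have a0 := ha 0
      have a1 := ha i.succ
      rw [hi, zSeq_self hn, Complex.cos_sq']
      field_simp
      linear_combination -h
  obtain ⟨V, hV, hVc, huV, hVU, hev⟩ := hadm.exists_isPeterson hn hU hu
  obtain ⟨-, X, hX⟩ := hev.self_of_nhds
  exact ⟨V, hV, hVc, ⟨u, huV⟩, hVU, isPetersonUpToMotion_of_ladder hn ha hV
    (fun v hv => hr v (hVU hv)) hVc (hx.mono hVU) hz hX huV (hW u hu)⟩

end Admissible

/-! ### Maximality of Peterson's family -/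

section Maximality

variable {n : ℕ} {a : Fin (n + 1) → ℂ} {U : Set (Fin n → ℂ)}

/-- The required absence of zeros of f_k, g_k' and h' is equivalent to that of the radicands, so
existence at a point is as strong as admissibility there. -/
theorem IsPeterson.isAdmissible {z : Fin (n - 1) → ℂ} {X : (Fin n → ℂ) → (Fin (2 * n - 1) → ℂ)}
    (hX : IsPeterson a z U X) (hz : ∀ k, z k ≠ 0) {u : Fin n → ℂ} (hu : u ∈ U) :
    IsAdmissible a z u := by
  obtain ⟨f, g, h, hfg, hh, -⟩ := hX
  have hF : ∀ i : Fin (n - 1), radF a z i (u ⟨i.val, by omega⟩) ≠ 0 := fun i => by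
    have h1 := hfg i _ ⟨u, hu, rfl⟩
    rw [← h1.2.2.2.1]; exact pow_ne_zero 2 h1.2.2.1
  refine ⟨hz, hF, fun i => ?_, fun i hi => ?_⟩
  · have h1 := hfg i _ ⟨u, hu, rfl⟩
    rw [← h1.2.2.2.2.2]; exact pow_ne_zero 2 (mul_ne_zero h1.2.2.2.2.1 (hF i))
  · have h1 := hh i hi _ ⟨u, hu, rfl⟩
    rw [← h1.2.2]; exact pow_ne_zero 2 h1.2.1

/-- The parameters read off from the invariants of `Y w` depend continuously on w and equal those of
the given member at w₀. They therefore stay admissible, and the invariants identify `Y w` with the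
corresponding Peterson deformation. -/
theorem IsFamily.eventually_isPetersonUpToMotion (hn : 0 < n) (ha : ∀ j, a j ≠ 0) (hU : IsOpen U)
    (hc : Convex ℝ U) (hr : IsRegular (spherical a) U) {m : ℕ} {W : Set (Fin m → ℂ)}
    {Y : (Fin m → ℂ) → (Fin n → ℂ) → (Fin (2 * n - 1) → ℂ)} (hY : IsFamily (spherical a) U W Y)
    {w₀ : Fin m → ℂ} (hw₀ : w₀ ∈ W) (h : IsPetersonUpToMotion a U (Y w₀)) {u : Fin n → ℂ}
    (hu : u ∈ U) : ∃ V, IsOpen V ∧ Convex ℝ V ∧ u ∈ V ∧ V ⊆ U ∧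
      ∀ᶠ w in nhds w₀, IsPetersonUpToMotion a V (Y w) := by
  obtain ⟨z₀, hz₀, X₀, hX₀, hcong⟩ := h
  obtain ⟨V, hV, hVc, huV, hVU, hev⟩ := (hX₀.isAdmissible hz₀ hu).exists_isPeterson hn hU hu
  refine ⟨V, hV, hVc, huV, hVU, ?_⟩
  set ζ : (Fin m → ℂ) → Fin (n - 1) → ℂ :=
    fun w k => (a 0 * ladder a (curvSq a (Y w)) (k.val + 1) u)⁻¹ with hζ
  have hL : ∀ k, k ≤ n → ladder a (curvSq a (Y w₀)) k u = (a 0 * zSeq z₀ k)⁻¹ := fun k hk => by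
    rw [← hX₀.ladder_eq hn ha hU hr hz₀ hu hk,
      hcong.ladder_eq hU (hY.deformation w₀ hw₀).holo hu]
  have hLk : ∀ k : Fin (n - 1), ladder a (curvSq a (Y w₀)) (k.val + 1) u = (a 0 * z₀ k)⁻¹ :=
    fun k => by rw [hL _ (by omega), zSeq_succ]
  have hζ0 : ζ w₀ = z₀ := by
    ext k
    simp only [hζ, hLk]
    rw [mul_inv, inv_inv, inv_mul_cancel_left₀ (ha 0)]
  have hζc : ContinuousAt ζ w₀ := by
    rw [continuousAt_pi]
    intro k
    have h1 := ((hY.contDiffOn_ladder ha hU hr hc hu (k.val + 1)).continuousOn.continuousAt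
      (hY.isOpen.mem_nhds hw₀)).const_mul (a 0)
    refine h1.inv₀ ?_
    simp only [hLk]
    exact mul_ne_zero (ha 0) (inv_ne_zero (mul_ne_zero (ha 0) (hz₀ k)))
  rw [← hζ0] at hev
  filter_upwards [hζc.eventually hev, hY.isOpen.mem_nhds hw₀] with w hw hwW
  obtain ⟨hz, X, hX⟩ := hw
  have hd := hY.deformation w hwW
  exact isPetersonUpToMotion_of_ladder hn ha hV (fun v hv => hr v (hVU hv)) hVc (hd.mono hVU) hz hX
    huV fun k hk => inv_mul_zSeq_eq_ladder hn (ha 0) (ladder_self_eq_zero ha hU hr hc hn hd hu)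
      (fun k => rfl) hk

theorem petersonFamilyIsMaximal (hn : 2 ≤ n) (hU : IsOpen U) (hc : Convex ℝ U) (hne : U.Nonempty)
    (ha : ∀ j, a j ≠ 0) (hinj : Function.Injective a) (hr : IsRegular (spherical a) U) :
    PetersonFamilyIsMaximal a U where
  deformation z hz X hX := hX.isDeformation (by omega) ha hU hr hz
  congruent_iff z z' hz hz' X X' hX hX' := hX.congruent_iff (by omega) ha hU hr hc hne hX' hz hz'
  exist u hu O hO hOne := by
    obtain ⟨z, hzO, hz⟩ := dense_iff_inter_open.mp (dense_isAdmissible hn ha u) O hO hOne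
    obtain ⟨V, hV, hVc, huV, hVU, hev⟩ := hz.exists_isPeterson (by omega) hU hu
    obtain ⟨Z, hZ, hZo, hzZ⟩ := eventually_nhds_iff.mp hev
    exact ⟨V, hV, hVc, huV, hVU, Z ∩ O, hZo.inter hO, ⟨z, hzZ, hzO⟩, Set.inter_subset_right,
      fun z' hz' => hZ z' hz'.1⟩
  parameters_le m W Y hW hY hess := by
    obtain ⟨u, hu⟩ := hne
    exact hess.parameters_le ha hU hr hc hY hu (by omega) hW
  generic W Y hY hess := by
    obtain ⟨u, hu⟩ := hne
    have hs : ContDiffOn ℂ 1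
        (fun w (k : Fin (n - 1)) => ladder a (curvSq a (Y w)) (k.val + 1) u) W :=
      contDiffOn_pi.mpr fun k => (hY.contDiffOn_ladder ha hU hr hc hu (k.val + 1)).of_le (by simp)
    -- The values to avoid are W = 0, which would make z infinite, and W = 1 / a_{k+2} for the
    -- component W_{k+1}, at which F may degenerate.
    refine (dense_apply_ne_of_injOn hY.isOpen hs (hess.injOn_ladder ha hU hr hc hY hu (by omega))
      (ι := Fin (n - 1) ⊕ Fin (n - 1)) (Sum.elim id id)
      (Sum.elim (fun _ => 0) fun k => (a (Fin.succ ⟨k.val + 1, by omega⟩))⁻¹)).trans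
      (closure_mono fun w hw => ⟨hw.1, ?_⟩)
    exact exists_isPetersonUpToMotion (by omega) ha hinj hU hr hc (hY.deformation w hw.1) hu
      (fun k => hw.2 (Sum.inl k)) fun k => hw.2 (Sum.inr k)
  isolated m W Y hY w₀ hw₀ h u hu :=
    hY.eventually_isPetersonUpToMotion (by omega) ha hU hc hr hw₀ h hu

end Maximality

end QuadricDeformation

open QuadricDeformation in
theorem theorem2 (n : ℕ) (hn : 3 ≤ n) :
    -- the Christoffel symbols with three distinct indices vanish
    (∀ (U : Set (Fin n → ℂ)) (x₀ : (Fin n → ℂ) → (Fin (n + 1) → ℂ))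
        (x : (Fin n → ℂ) → (Fin (2 * n - 1) → ℂ)),
      IsOpen U → IsConjugateQuadric x₀ U → IsDeformation x₀ U x →
      ∀ u ∈ U, ∀ j k l : Fin n, j ≠ k → j ≠ l → k ≠ l → christoffel x₀ l j k u = 0) ∧
    -- deformations up to rigid motions correspond bijectively to solutions up to signs,
    -- the correspondence being given by `𝐚_j² = |h_j|²`
    (∀ (U : Set (Fin n → ℂ)) (x₀ N₀ : (Fin n → ℂ) → (Fin (n + 1) → ℂ)),
      IsOpen U → Convex ℝ U → IsConjugateQuadric x₀ U → IsUnitNormal x₀ N₀ U →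
      ∃ Φ : Quotient (deformationSetoid x₀ U) ≃ Quotient (solutionSetoid x₀ N₀ U),
        ∀ (x : {x // IsDeformation x₀ U x}) (a : {a // IsSolution x₀ N₀ U a}),
          Φ (Quotient.mk _ x) = Quotient.mk _ a ↔
            ∀ u ∈ U, ∀ j, a.1 j u ^ 2 = joinedSq x₀ N₀ x.1 j u) ∧
    -- maximality of Peterson's family
    (∀ (U : Set (Fin n → ℂ)) (a : Fin (n + 1) → ℂ),
      IsOpen U → Convex ℝ U → U.Nonempty → (∀ j, a j ≠ 0) → Function.Injective a →
      IsRegular (spherical a) U → PetersonFamilyIsMaximal a U) := by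
  refine ⟨fun U x₀ x hU hq h u hu j k l hjk hjl hkl =>
      h.christoffel_eq_zero hq.isConjugateNet hU hu hjk hjl hkl,
    fun U x₀ N₀ hU hc hq hN => hq.exists_equiv (by omega) hU hc hN, fun U a hU hc hne ha hinj hr => ?_⟩
  exact petersonFamilyIsMaximal (by omega) hU hc hne ha hinj hr
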